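/- **Conventions.** Let $\mathbb F$ be a field. "Graded" means $\mathbb Z$-graded, and all complexes are chain complexes of graded bimodules with differentials of degree $0$; for a graded bimodule $M$ put $(M\langle k\rangle)_j=M_{k+j}$. Tensor products of complexes are total complexes with $d(x\otimes y)=dx\otimes y+(-1)^{p}x\otimes dy$ for $x$ in homological degree $p$. **Hypotheses.** Let $\Lambda=\bigoplus_{n\ge 0}\Lambda_n$ be a graded $\mathbb F$-algebra with $\Lambda_1$ finite-dimensional. * $\Lambda$ is *Koszul*: $\Lambda_0$ is semisimple; for all $n\ge 2$, $\Lambda_n$ is spanned by the products of $n$ elements of $\Lambda_1$; and $\Lambda_0=\Lambda/\Lambda_{>0}$ has a resolution $\cdots\to P_1\to P_0\to\Lambda_0\to 0$ by graded projective $\Lambda$-modules, with maps of degree $0$, such that $P_i$ is generated in degree $i$. * $\Lambda$ is *acyclic* with ordering $e_1<\dots<e_r$: the $e_i\in\Lambda_0$ form a complete set of primitive orthogonal idempotents of $\Lambda$, $e_j\Lambda e_i=0$ for $i<j$, and $e_i\Lambda e_i=\mathbb F e_i$ for all $i$. (It follows that $\Lambda_0=S:=\bigoplus_i\mathbb F e_i$.)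 * $d\ge 0$ is an integer with $\operatorname{gldim}\Lambda\le d$. **Quadratic duals.** For a graded algebra $B$ with a complete set of orthogonal idempotents $e_1,\dots,e_r\in B_0$ and with $B_1$ finite-dimensional, let $S=\bigoplus_i\mathbb Fe_i$, let $V=B_1$, regarded as an $S$-$S$-bimodule, and let $R=\ker(V\otimes_SV\to B)$. Put $V^*=\operatorname{Hom}_{\mathbb F}(V,\mathbb F)$ with $(sft)(x)=f(txs)$ and identify $V^*\otimes_SV^*=(V\otimes_SV)^*$ via $\langle f\otimes g,x\otimes y\rangle=\sum_k g(xe_k)f(e_ky)$. Then $B^!=\operatorname{Tens}_S(V^*)/(R^\perp)$, with $V^*$ in degree $1$. **The zigzag algebra.** Let $A=Z_{d+1}(\Lambda)$ be the $(d+1)$-trivial extension of $\Lambda^!$: the graded vector space $\Lambda^!\oplus(\Lambda^!)^*\langle -d-1\rangle$ (so $((\Lambda^!)_i)^*$ lies in degree $d+1-i$) with multiplication $(a,f)(b,g)=(ab,\,fb+(-1)^{di}ag)$ for $a\in(\Lambda^!)_i$, where $(fb)(x)=f(bx)$ and $(ag)(x)=g(xa)$. For $d=\operatorname{gldim}\Lambda$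 this is $Z(\Lambda)$. The $e_i$ are regarded as idempotents of $\Lambda^!\subset A$. **Twists.** Let $X_i$ be the complex $Ae_i\otimes_{\mathbb F}e_iA\to A$ given by multiplication, with $A$ in degree $0$. **The complex $Q_A(\Lambda)$.** Let $\theta:A^!\to\Lambda$ be the homomorphism of graded algebras that is the identity on $S$ and is, in degree $1$, the transpose $A_1^*\to\Lambda_1$ of the inclusion $\Lambda_1^*=(\Lambda^!)_1\subset A_1$. Through $\theta$, regard $\Lambda$ as a graded $A^!$-$A^!$-bimodule. Let $(v_\beta)$ be a basis of $A_1$ with dual basis $(v_\beta^*)$ of $A_1^*=(A^!)_1$. Then $Q_A(\Lambda)$ is the complex with terms $Q_n=A\otimes_S(\Lambda_n)^*\otimes_SA\langle -n\rangle$ for $n\ge0$, where $(sxt)(m)=x(tms)$ for $x\in(\Lambda_n)^*$, and with differential $Q_{n+1}\to Q_n$ $$a\otimes x\otimes b\;\mapsto\;\sum_\beta av_\beta\otimes x(-\cdot v_\beta^*)\otimes b\;+\;(-1)^{n+1}\sum_\beta a\otimes x(v_\beta^*\cdot -)\otimes v_\beta b .$$ Let $m:Q_A(\Lambda)\to A$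 be the chain map given in degree $0$ by $m(a\otimes x\otimes b)=\sum_k x(e_k)\,ae_kb$. Its cone has $A$ in degree $0$ and $Q_n$ in degree $n+1$, with differential $m$ on $Q_0$ and $-d$ elsewhere. **Proposition.** Under these hypotheses there is a homotopy equivalence of complexes of graded $A$-$A$-bimodules $$X_r\otimes_A\cdots\otimes_AX_2\otimes_AX_1\;\simeq\;\operatorname{cone}\bigl(Q_A(\Lambda)\xrightarrow{\,m\,}A\bigr).$$ -/

import Mathlib

open CategoryTheory
open scoped TensorProduct

universe u

noncomputable section

namespace HigherZigzag

/-! ## Gradings -/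

section Gradings

variable {F : Type u} [Field F]

/-- A criterion for a family of subspaces to be a direct sum decomposition. -/
theorem isInternal_of_proj {M : Type u} [AddCommGroup M] [Module F M] {ι : Type} [DecidableEq ι]
    {gr : ι → Submodule F M} (p : ι → M →ₗ[F] M) (hp : ∀ i, ∀ x ∈ gr i, p i x = x)
    (hp' : ∀ i j, i ≠ j → ∀ x ∈ gr j, p i x = 0) (hs : ⨆ i, gr i = ⊤) :
    DirectSum.IsInternal gr := by
  refine DirectSum.isInternal_submodule_of_iSupIndep_of_iSup_eq_top ?_ hs
  rw [iSupIndep_def]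
  intro i
  rw [Submodule.disjoint_def]
  intro x hx hx'
  have hle : (⨆ j, ⨆ (_ : j ≠ i), gr j) ≤ LinearMap.ker (p i) :=
    iSup₂_le fun j hj y hy => hp' i j hj.symm y hy
  rw [← hp i x hx]
  exact hle hx'

/-- The projection of a graded space onto its component of degree `n`. -/
def component {M : Type u} [AddCommGroup M] [Module F M] {gr : ℤ → Submodule F M}
    (h : DirectSum.IsInternal gr) (n : ℤ) : M →ₗ[F] gr n :=
  letI := h.chooseDecomposition
  DirectSum.component F ℤ (fun i => gr i) n ∘ₗ (DirectSum.decomposeLinearEquiv gr).toLinearMap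

theorem component_of_mem {M : Type u} [AddCommGroup M] [Module F M] {gr : ℤ → Submodule F M}
    (h : DirectSum.IsInternal gr) {n : ℤ} {x : M} (hx : x ∈ gr n) :
    component h n x = ⟨x, hx⟩ := by
  let := h.chooseDecomposition
  apply Subtype.ext
  exact DirectSum.decompose_of_mem_same gr hx

theorem component_of_mem_ne {M : Type u} [AddCommGroup M] [Module F M] {gr : ℤ → Submodule F M}
    (h : DirectSum.IsInternal gr) {m n : ℤ} (hmn : m ≠ n) {x : M} (hx : x ∈ gr m) :
    component h n x = 0 := by
  let := h.chooseDecomposition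
  apply Subtype.ext
  exact DirectSum.decompose_of_mem_ne gr hx hmn

@[elab_as_elim]
theorem homogeneous_induction {M : Type u} [AddCommGroup M] [Module F M]
    {gr : ℤ → Submodule F M} (h : DirectSum.IsInternal gr) {P : M → Prop}
    (mem : ∀ i, ∀ x ∈ gr i, P x) (zero : P 0) (add : ∀ x y, P x → P y → P (x + y)) (x : M) :
    P x := by
  have hx : x ∈ ⨆ i, gr i := by rw [h.submodule_iSup_eq_top]; trivial
  exact Submodule.iSup_induction gr (motive := P) hx mem zero add

/-- Build a graded algebra structure from a direct sum decomposition. -/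
abbrev gradedAlgebraOfInternal {B : Type u} [Ring B] [Algebra F B] {ι : Type} [DecidableEq ι]
    [AddMonoid ι] (gr : ι → Submodule F B) (h1 : (1 : B) ∈ gr 0)
    (hmul : ∀ i j (a b : B), a ∈ gr i → b ∈ gr j → a * b ∈ gr (i + j))
    (h : DirectSum.IsInternal gr) : GradedAlgebra gr :=
  { one_mem := h1
    mul_mem := fun {i j a b} ha hb => hmul i j a b ha hb
    toDecomposition := h.chooseDecomposition }

/-- A nonnegative grading, regarded as a grading by the integers. -/
def zgr {M : Type u} [AddCommGroup M] [Module F M] (g : ℕ → Submodule F M) : ℤ → Submodule F M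
  | Int.ofNat n => g n
  | Int.negSucc _ => ⊥

theorem zgr_internal {M : Type u} [AddCommGroup M] [Module F M] {g : ℕ → Submodule F M}
    (h : DirectSum.IsInternal g) : DirectSum.IsInternal (zgr g) := by
  let := h.chooseDecomposition
  refine isInternal_of_proj (fun n => match n with
    | Int.ofNat n => (g n).subtype ∘ₗ DirectSum.component F ℕ (fun i => g i) n ∘ₗ
        (DirectSum.decomposeLinearEquiv g).toLinearMap
    | Int.negSucc _ => 0) ?_ ?_ ?_
  · rintro (n | n) x hx
    · exact DirectSum.decompose_of_mem_same g hx
    · exact ((Submodule.mem_bot F).1 hx).symm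
  · rintro (n | n) (m | m) hnm x hx
    · exact DirectSum.decompose_of_mem_ne g hx (fun h => hnm (by rw [h]))
    · rw [(Submodule.mem_bot F).1 hx, map_zero]
    · rfl
    · rfl
  · rw [eq_top_iff, ← h.submodule_iSup_eq_top]
    exact iSup_le fun n => le_iSup (zgr g) (Int.ofNat n)

instance {B : Type u} [Ring B] [Algebra F B] (g : ℕ → Submodule F B) [GradedAlgebra g] :
    GradedAlgebra (zgr g) :=
  gradedAlgebraOfInternal (zgr g) (SetLike.GradedOne.one_mem (A := g))
    (by
      rintro (i | i) (j | j) a b ha hb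
      · exact SetLike.GradedMul.mul_mem (A := g) ha hb
      · rw [(Submodule.mem_bot F).1 hb, mul_zero]; exact zero_mem _
      · rw [(Submodule.mem_bot F).1 ha, zero_mul]; exact zero_mem _
      · rw [(Submodule.mem_bot F).1 ha, zero_mul]; exact zero_mem _)
    (zgr_internal (DirectSum.Decomposition.isInternal g))

/-- The grading concentrated in the single degree `n`. -/
def conc (F : Type u) [Field F] (M : Type u) [AddCommGroup M] [Module F M] (n : ℤ) :
    ℤ → Submodule F M :=
  fun k => if k = n then ⊤ else ⊥

theorem mem_conc {M : Type u} [AddCommGroup M] [Module F M] {n k : ℤ} {x : M} :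
    x ∈ conc F M n k ↔ (k = n ∨ x = 0) := by
  unfold conc
  split_ifs with h <;> simp [h]

theorem conc_internal (M : Type u) [AddCommGroup M] [Module F M] (n : ℤ) :
    DirectSum.IsInternal (conc F M n) := by
  refine isInternal_of_proj (fun k => if k = n then LinearMap.id else 0) ?_ ?_ ?_
  · intro k x hx
    rcases mem_conc.1 hx with rfl | rfl <;> simp
  · intro k j hkj x hx
    rcases mem_conc.1 hx with rfl | rfl <;> simp [hkj]
  · rw [eq_top_iff]
    refine le_trans ?_ (le_iSup (conc F M n) n)
    simp [conc]

instance (B : Type u) [Ring B] [Algebra F B] : GradedAlgebra (conc F B 0) :=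
  gradedAlgebraOfInternal _ (mem_conc.2 (Or.inl rfl))
    (by
      intro i j a b ha hb
      rcases mem_conc.1 ha with rfl | rfl
      · rcases mem_conc.1 hb with rfl | rfl
        · exact mem_conc.2 (Or.inl rfl)
        · simp
      · simp)
    (conc_internal B 0)

end Gradings

/-! ## Graded bimodules -/

section Bimodules

variable {F : Type u} [Field F] {A B C : Type u} [Ring A] [Algebra F A] [Ring B] [Algebra F B]
  [Ring C] [Algebra F C]

/-- A graded `A`-`B`-bimodule over the field `F` (which acts centrally): the left action is the
algebra map `L`, the right action is the algebra map `R`, and the homogeneous components are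
the subspaces `gr n`. -/
structure GrBimod (𝒜 : ℤ → Submodule F A) (ℬ : ℤ → Submodule F B) where
  carrier : Type u
  [grp : AddCommGroup carrier]
  [mod : Module F carrier]
  L : A →ₐ[F] Module.End F carrier
  R : Bᵐᵒᵖ →ₐ[F] Module.End F carrier
  comm : ∀ a b x, L a (R b x) = R b (L a x)
  gr : ℤ → Submodule F carrier
  internal : DirectSum.IsInternal gr
  L_mem : ∀ {i j : ℤ} {a : A} {x : carrier}, a ∈ 𝒜 i → x ∈ gr j → L a x ∈ gr (i + j)
  R_mem : ∀ {i j : ℤ} {b : B} {x : carrier}, b ∈ ℬ i → x ∈ gr j →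
    R (MulOpposite.op b) x ∈ gr (j + i)

attribute [instance] GrBimod.grp GrBimod.mod

namespace GrBimod

variable {𝒜 : ℤ → Submodule F A} {ℬ : ℤ → Submodule F B} {𝒞 : ℤ → Submodule F C}

/-- Homomorphisms of graded bimodules (of degree `0`). -/
@[ext]
structure Hom (M N : GrBimod 𝒜 ℬ) where
  toLin : M.carrier →ₗ[F] N.carrier
  map_L : ∀ a x, toLin (M.L a x) = N.L a (toLin x)
  map_R : ∀ b x, toLin (M.R b x) = N.R b (toLin x)
  map_mem : ∀ n, ∀ x ∈ M.gr n, toLin x ∈ N.gr n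

instance : Category (GrBimod 𝒜 ℬ) where
  Hom M N := Hom M N
  id M := ⟨LinearMap.id, fun _ _ => rfl, fun _ _ => rfl, fun _ _ h => h⟩
  comp f g := ⟨g.toLin ∘ₗ f.toLin, fun a x => by simp [f.map_L, g.map_L],
    fun b x => by simp [f.map_R, g.map_R], fun n x h => g.map_mem n _ (f.map_mem n x h)⟩

@[ext]
theorem hom_ext {M N : GrBimod 𝒜 ℬ} {f g : M ⟶ N} (h : f.toLin = g.toLin) : f = g :=
  Hom.ext h

@[simp]
theorem id_toLin (M : GrBimod 𝒜 ℬ) : Hom.toLin (𝟙 M) = LinearMap.id := rfl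

@[simp]
theorem comp_toLin {M N P : GrBimod 𝒜 ℬ} (f : M ⟶ N) (g : N ⟶ P) :
    Hom.toLin (f ≫ g) = Hom.toLin g ∘ₗ Hom.toLin f := rfl

instance (M N : GrBimod 𝒜 ℬ) : Zero (M ⟶ N) :=
  ⟨⟨0, fun _ _ => by simp, fun _ _ => by simp, fun _ _ _ => by simp⟩⟩

instance (M N : GrBimod 𝒜 ℬ) : Add (M ⟶ N) :=
  ⟨fun f g => ⟨f.toLin + g.toLin, fun a x => by simp [f.map_L, g.map_L],
    fun b x => by simp [f.map_R, g.map_R],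
    fun n x h => add_mem (f.map_mem n x h) (g.map_mem n x h)⟩⟩

instance (M N : GrBimod 𝒜 ℬ) : Neg (M ⟶ N) :=
  ⟨fun f => ⟨-f.toLin, fun a x => by simp [f.map_L], fun b x => by simp [f.map_R],
    fun n x h => neg_mem (f.map_mem n x h)⟩⟩

@[simp]
theorem zero_toLin (M N : GrBimod 𝒜 ℬ) : Hom.toLin (0 : M ⟶ N) = 0 := rfl

@[simp]
theorem add_toLin {M N : GrBimod 𝒜 ℬ} (f g : M ⟶ N) :
    Hom.toLin (f + g) = Hom.toLin f + Hom.toLin g := rfl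

@[simp]
theorem neg_toLin {M N : GrBimod 𝒜 ℬ} (f : M ⟶ N) : Hom.toLin (-f) = -Hom.toLin f := rfl

instance (M N : GrBimod 𝒜 ℬ) : AddCommGroup (M ⟶ N) where
  add_assoc f g h := by ext1; simp [add_assoc]
  zero_add f := by ext1; simp
  add_zero f := by ext1; simp
  add_comm f g := by ext1; simp [add_comm]
  neg_add_cancel f := by ext1; simp
  nsmul := nsmulRec
  zsmul := zsmulRec

instance : Preadditive (GrBimod 𝒜 ℬ) where
  add_comp _ _ _ f g h := by ext1; simp [LinearMap.comp_add]
  comp_add _ _ _ f g h := by ext1; simp [LinearMap.add_comp]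

/-- The zero bimodule. -/
def zero (𝒜 : ℤ → Submodule F A) (ℬ : ℤ → Submodule F B) : GrBimod 𝒜 ℬ where
  carrier := PUnit
  L := { toFun := fun _ => 0, map_one' := Subsingleton.elim _ _, map_mul' := fun _ _ => by simp,
         map_zero' := rfl, map_add' := fun _ _ => by simp,
         commutes' := fun _ => Subsingleton.elim _ _ }
  R := { toFun := fun _ => 0, map_one' := Subsingleton.elim _ _, map_mul' := fun _ _ => by simp,
         map_zero' := rfl, map_add' := fun _ _ => by simp,
         commutes' := fun _ => Subsingleton.elim _ _ }
  comm _ _ _ := rfl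
  gr := conc F PUnit 0
  internal := conc_internal PUnit 0
  L_mem _ _ := zero_mem _
  R_mem _ _ := zero_mem _

/-- The regular bimodule of a graded algebra. -/
def regular (𝒜 : ℤ → Submodule F A) [GradedAlgebra 𝒜] : GrBimod 𝒜 𝒜 where
  carrier := A
  L := Algebra.lmul F A
  R := { toFun := fun b => LinearMap.mulRight F b.unop
         map_one' := by ext; simp
         map_mul' := fun a b => by ext; simp [mul_assoc]
         map_zero' := by ext; simp
         map_add' := fun a b => by ext; simp [mul_add]
         commutes' := fun c => by
           ext x
           simp [Algebra.algebraMap_eq_smul_one] }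
  comm a b x := by simp [mul_assoc]
  gr := 𝒜
  internal := DirectSum.Decomposition.isInternal 𝒜
  L_mem ha hx := SetLike.GradedMul.mul_mem ha hx
  R_mem hb hx := SetLike.GradedMul.mul_mem hx hb

/-- Restriction of the two actions along homomorphisms of graded algebras. -/
def restrict {A' B' : Type u} [Ring A'] [Algebra F A'] [Ring B'] [Algebra F B']
    {𝒜' : ℤ → Submodule F A'} {ℬ' : ℤ → Submodule F B'} (φ : A' →ₐ[F] A)
    (hφ : ∀ n, ∀ a ∈ 𝒜' n, φ a ∈ 𝒜 n) (ψ : B' →ₐ[F] B) (hψ : ∀ n, ∀ b ∈ ℬ' n, ψ b ∈ ℬ n)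
    (M : GrBimod 𝒜 ℬ) : GrBimod 𝒜' ℬ' where
  carrier := M.carrier
  L := M.L.comp φ
  R := M.R.comp (AlgHom.op ψ)
  comm _ _ _ := M.comm _ _ _
  gr := M.gr
  internal := M.internal
  L_mem ha hx := M.L_mem (hφ _ _ ha) hx
  R_mem hb hx := M.R_mem (hψ _ _ hb) hx

/-- Finite direct sums of graded bimodules. -/
def pi {ι : Type} [Fintype ι] [DecidableEq ι] (M : ι → GrBimod 𝒜 ℬ) : GrBimod 𝒜 ℬ where
  carrier := ∀ k, (M k).carrier
  L := { toFun := fun a => LinearMap.pi fun k => (M k).L a ∘ₗ LinearMap.proj k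
         map_one' := by ext; simp
         map_mul' := fun a b => by ext; simp
         map_zero' := by ext; simp
         map_add' := fun a b => by ext; simp
         commutes' := fun c => by ext; simp }
  R := { toFun := fun a => LinearMap.pi fun k => (M k).R a ∘ₗ LinearMap.proj k
         map_one' := by ext; simp
         map_mul' := fun a b => by ext; simp
         map_zero' := by ext; simp
         map_add' := fun a b => by ext; simp
         commutes' := fun c => LinearMap.ext fun x => funext fun k => by
           change (M k).R (algebraMap F Bᵐᵒᵖ c) (x k) = c • x k
           rw [AlgHom.commutes]; rfl }
  comm a b x := by ext k; simp [(M k).comm]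
  gr n := Submodule.pi Set.univ fun k => (M k).gr n
  internal := by
    refine isInternal_of_proj (fun n => LinearMap.pi fun k =>
      ((M k).gr n).subtype ∘ₗ component (M k).internal n ∘ₗ LinearMap.proj k) ?_ ?_ ?_
    · intro n x hx
      ext k
      simp [component_of_mem (M k).internal (hx k trivial)]
    · intro n m hnm x hx
      ext k
      simp [component_of_mem_ne (M k).internal (Ne.symm hnm) (hx k trivial)]
    · rw [eq_top_iff]
      intro x _
      rw [← Finset.univ_sum_single x]
      refine sum_mem fun k _ => ?_
      refine homogeneous_induction (M k).internal
        (P := fun y => Pi.single k y ∈ ⨆ n, Submodule.pi Set.univ fun k => (M k).gr n)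
        ?_ ?_ ?_ (x k)
      · intro n y hy
        refine Submodule.mem_iSup_of_mem n fun j _ => ?_
        by_cases hj : j = k
        · subst hj; simpa using hy
        · simp [Pi.single_eq_of_ne hj]
      · simp
      · intro y z hy hz
        rw [Pi.single_add]
        exact add_mem hy hz
  L_mem ha hx k hk := (M k).L_mem ha (hx k hk)
  R_mem hb hx k hk := (M k).R_mem hb (hx k hk)

end GrBimod

end Bimodules

/-! ## Tensor products of graded bimodules and of complexes of graded bimodules -/

section Tensor

variable {F : Type u} [Field F] {A B C : Type u} [Ring A] [Algebra F A] [Ring B] [Algebra F B]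
  [Ring C] [Algebra F C] {𝒜 : ℤ → Submodule F A} {ℬ : ℤ → Submodule F B}
  {𝒞 : ℤ → Submodule F C}

namespace GrBimod

/-- The relations `m b ⊗ n = m ⊗ b n` defining `M ⊗_B N` as a quotient of `M ⊗_F N`. -/
def tensorRel (M : GrBimod 𝒜 ℬ) (N : GrBimod ℬ 𝒞) : Submodule F (M.carrier ⊗[F] N.carrier) :=
  Submodule.span F {t | ∃ m b n, t = M.R (MulOpposite.op b) m ⊗ₜ[F] n - m ⊗ₜ[F] N.L b n}

/-- The underlying space of `M ⊗_B N`. -/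
abbrev TensorCarrier (M : GrBimod 𝒜 ℬ) (N : GrBimod ℬ 𝒞) : Type u :=
  (M.carrier ⊗[F] N.carrier) ⧸ tensorRel M N

/-- The canonical bilinear map `M × N → M ⊗_B N`. -/
def tmk (M : GrBimod 𝒜 ℬ) (N : GrBimod ℬ 𝒞) :
    M.carrier →ₗ[F] N.carrier →ₗ[F] TensorCarrier M N :=
  (TensorProduct.mk F M.carrier N.carrier).compr₂ (tensorRel M N).mkQ

theorem tmk_balanced (M : GrBimod 𝒜 ℬ) (N : GrBimod ℬ 𝒞) (m : M.carrier) (b : B)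
    (n : N.carrier) : tmk M N (M.R (MulOpposite.op b) m) n = tmk M N m (N.L b n) := by
  rw [← sub_eq_zero]
  change (tensorRel M N).mkQ (M.R (MulOpposite.op b) m ⊗ₜ[F] n - m ⊗ₜ[F] N.L b n) = 0
  rw [Submodule.mkQ_apply, Submodule.Quotient.mk_eq_zero]
  exact Submodule.subset_span ⟨m, b, n, rfl⟩

/-- The universal property of `M ⊗_B N`. -/
def tlift {P : Type u} [AddCommGroup P] [Module F P] (M : GrBimod 𝒜 ℬ) (N : GrBimod ℬ 𝒞)
    (f : M.carrier →ₗ[F] N.carrier →ₗ[F] P)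
    (hf : ∀ m b n, f (M.R (MulOpposite.op b) m) n = f m (N.L b n)) :
    TensorCarrier M N →ₗ[F] P :=
  (tensorRel M N).liftQ (TensorProduct.lift f) (by
    refine Submodule.span_le.2 ?_
    rintro _ ⟨m, b, n, rfl⟩
    simp [hf])

@[simp]
theorem tlift_tmk {P : Type u} [AddCommGroup P] [Module F P] (M : GrBimod 𝒜 ℬ)
    (N : GrBimod ℬ 𝒞) (f : M.carrier →ₗ[F] N.carrier →ₗ[F] P)
    (hf : ∀ m b n, f (M.R (MulOpposite.op b) m) n = f m (N.L b n)) (m : M.carrier)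
    (n : N.carrier) : tlift M N f hf (tmk M N m n) = f m n := by
  change (tensorRel M N).liftQ _ _ ((tensorRel M N).mkQ (m ⊗ₜ[F] n)) = _
  exact TensorProduct.lift.tmul m n

theorem tensor_ext {P : Type u} [AddCommGroup P] [Module F P] {M : GrBimod 𝒜 ℬ}
    {N : GrBimod ℬ 𝒞} {f g : TensorCarrier M N →ₗ[F] P}
    (h : ∀ m n, f (tmk M N m n) = g (tmk M N m n)) : f = g := by
  apply Submodule.linearMap_qext
  apply TensorProduct.ext'
  exact h

@[elab_as_elim]
theorem tensor_induction {M : GrBimod 𝒜 ℬ} {N : GrBimod ℬ 𝒞} {P : TensorCarrier M N → Prop}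
    (mk : ∀ m n, P (tmk M N m n)) (zero : P 0) (add : ∀ x y, P x → P y → P (x + y))
    (x : TensorCarrier M N) : P x := by
  obtain ⟨t, rfl⟩ := (tensorRel M N).mkQ_surjective x
  induction t using TensorProduct.induction_on with
  | zero => simpa using zero
  | tmul m n => exact mk m n
  | add x y hx hy => rw [map_add]; exact add _ _ hx hy

/-- The degree `n` component of `M ⊗_B N`, spanned by all `x ⊗ y` with `x`, `y` homogeneous
and `deg x + deg y = n`. -/
def tensorGr (M : GrBimod 𝒜 ℬ) (N : GrBimod ℬ 𝒞) (n : ℤ) : Submodule F (TensorCarrier M N) :=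
  Submodule.span F {t | ∃ i j : ℤ, i + j = n ∧ ∃ x ∈ M.gr i, ∃ y ∈ N.gr j, t = tmk M N x y}

theorem tmk_mem (M : GrBimod 𝒜 ℬ) (N : GrBimod ℬ 𝒞) {i j : ℤ} {x : M.carrier} {y : N.carrier}
    (hx : x ∈ M.gr i) (hy : y ∈ N.gr j) : tmk M N x y ∈ tensorGr M N (i + j) :=
  Submodule.subset_span ⟨i, j, rfl, x, hx, y, hy, rfl⟩

/-- The projection of a graded bimodule to its degree `n` component, as an endomorphism. -/
def prj (M : GrBimod 𝒜 ℬ) (n : ℤ) : M.carrier →ₗ[F] M.carrier :=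
  (M.gr n).subtype ∘ₗ component M.internal n

theorem prj_of_mem (M : GrBimod 𝒜 ℬ) {n : ℤ} {x : M.carrier} (hx : x ∈ M.gr n) :
    M.prj n x = x := by
  simp [prj, component_of_mem M.internal hx]

theorem prj_of_mem_ne (M : GrBimod 𝒜 ℬ) {m n : ℤ} (h : m ≠ n) {x : M.carrier}
    (hx : x ∈ M.gr m) : M.prj n x = 0 := by
  simp [prj, component_of_mem_ne M.internal h hx]

theorem prj_L (M : GrBimod 𝒜 ℬ) {k : ℤ} (n : ℤ) {a : A} (ha : a ∈ 𝒜 k) (x : M.carrier) :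
    M.prj n (M.L a x) = M.L a (M.prj (n - k) x) := by
  refine homogeneous_induction M.internal ?_ ?_ ?_ x
  · intro i x hx
    by_cases h : k + i = n
    · have h' : i = n - k := by omega
      subst h'
      rw [prj_of_mem M hx, prj_of_mem M (h ▸ M.L_mem ha hx)]
    · rw [prj_of_mem_ne M h (M.L_mem ha hx), prj_of_mem_ne M (by omega) hx, map_zero]
  · simp
  · intro x y hx hy
    simp only [map_add, hx, hy]

/-- The operator `m ⊗ n ↦ ∑ i, m_i ⊗ n_{k-i}` on `M ⊗_F N`, before passing to the quotient. -/
def tensorPrjAux (M : GrBimod 𝒜 ℬ) (N : GrBimod ℬ 𝒞) (k : ℤ) :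
    M.carrier →ₗ[F] N.carrier →ₗ[F] TensorCarrier M N :=
  letI := M.internal.chooseDecomposition
  DirectSum.toModule F ℤ (N.carrier →ₗ[F] TensorCarrier M N)
      (fun i => ((tmk M N).compl₂ (N.prj (k - i))) ∘ₗ (M.gr i).subtype) ∘ₗ
    (DirectSum.decomposeLinearEquiv M.gr).toLinearMap

theorem tensorPrjAux_of_mem (M : GrBimod 𝒜 ℬ) (N : GrBimod ℬ 𝒞) (k : ℤ) {i : ℤ}
    {m : M.carrier} (hm : m ∈ M.gr i) (n : N.carrier) :
    tensorPrjAux M N k m n = tmk M N m (N.prj (k - i) n) := by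
  let := M.internal.chooseDecomposition
  simp only [tensorPrjAux, LinearMap.comp_apply, LinearEquiv.coe_coe,
    DirectSum.decomposeLinearEquiv_apply]
  rw [DirectSum.decompose_of_mem M.gr hm]
  erw [DirectSum.toModule_lof F i]
  rfl

theorem tensorPrjAux_balanced [GradedAlgebra ℬ] (M : GrBimod 𝒜 ℬ) (N : GrBimod ℬ 𝒞) (k : ℤ) (m : M.carrier)
    (b : B) (n : N.carrier) :
    tensorPrjAux M N k (M.R (MulOpposite.op b) m) n = tensorPrjAux M N k m (N.L b n) := by
  refine homogeneous_induction M.internal ?_ ?_ ?_ m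
  · intro i m hm
    refine homogeneous_induction (DirectSum.Decomposition.isInternal ℬ) ?_ ?_ ?_ b
    · intro j b hb
      rw [tensorPrjAux_of_mem M N k (M.R_mem hb hm), tensorPrjAux_of_mem M N k hm,
        prj_L N _ hb, tmk_balanced, sub_sub]
    · simp
    · intro b b' hb hb'
      simp only [MulOpposite.op_add, map_add, LinearMap.add_apply, hb, hb']
  · simp
  · intro m m' hm hm'
    simp only [map_add, LinearMap.add_apply, hm, hm']

theorem tensor_internal [GradedAlgebra ℬ] (M : GrBimod 𝒜 ℬ) (N : GrBimod ℬ 𝒞) :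
    DirectSum.IsInternal (tensorGr M N) := by
  refine isInternal_of_proj
    (fun k => tlift M N (tensorPrjAux M N k) (tensorPrjAux_balanced M N k)) ?_ ?_ ?_
  · intro k x hx
    refine Submodule.span_induction (p := fun x _ => tlift M N (tensorPrjAux M N k)
      (tensorPrjAux_balanced M N k) x = x) ?_ ?_ ?_ ?_ hx
    · rintro _ ⟨i, j, hij, x, hx, y, hy, rfl⟩
      have : k - i = j := by omega
      rw [tlift_tmk, tensorPrjAux_of_mem M N k hx, this, prj_of_mem N hy]
    · simp
    · intro x y _ _ hx hy
      rw [map_add, hx, hy]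
    · intro c x _ hx
      rw [map_smul, hx]
  · intro k l hkl x hx
    refine Submodule.span_induction (p := fun x _ => tlift M N (tensorPrjAux M N k)
      (tensorPrjAux_balanced M N k) x = 0) ?_ ?_ ?_ ?_ hx
    · rintro _ ⟨i, j, hij, x, hx, y, hy, rfl⟩
      rw [tlift_tmk, tensorPrjAux_of_mem M N k hx, prj_of_mem_ne N (by omega) hy, map_zero]
    · simp
    · intro x y _ _ hx hy
      rw [map_add, hx, hy, add_zero]
    · intro c x _ hx
      rw [map_smul, hx, smul_zero]
  · rw [eq_top_iff]
    intro x _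
    refine tensor_induction (P := fun x => x ∈ ⨆ k, tensorGr M N k) ?_ (zero_mem _)
      (fun _ _ => add_mem) x
    intro m n
    refine homogeneous_induction M.internal ?_ (by simp)
      (fun x y hx hy => by rw [map_add]; exact add_mem hx hy) m
    intro i m hm
    refine homogeneous_induction N.internal ?_ (by simp)
      (fun x y hx hy => by rw [map_add]; exact add_mem hx hy) n
    intro j n hn
    exact Submodule.mem_iSup_of_mem (i + j) (tmk_mem M N hm hn)

/-- The left action on `M ⊗_B N`. -/
def tensorL (M : GrBimod 𝒜 ℬ) (N : GrBimod ℬ 𝒞) (a : A) :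
    TensorCarrier M N →ₗ[F] TensorCarrier M N :=
  tlift M N ((tmk M N) ∘ₗ M.L a) (fun m b n => by
    simp only [LinearMap.comp_apply, M.comm, tmk_balanced])

/-- The right action on `M ⊗_B N`. -/
def tensorR (M : GrBimod 𝒜 ℬ) (N : GrBimod ℬ 𝒞) (c : Cᵐᵒᵖ) :
    TensorCarrier M N →ₗ[F] TensorCarrier M N :=
  tlift M N ((tmk M N).compl₂ (N.R c)) (fun m b n => by
    simp only [LinearMap.compl₂_apply, ← N.comm, tmk_balanced])

@[simp]
theorem tensorL_tmk (M : GrBimod 𝒜 ℬ) (N : GrBimod ℬ 𝒞) (a : A) (m : M.carrier)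
    (n : N.carrier) : tensorL M N a (tmk M N m n) = tmk M N (M.L a m) n :=
  tlift_tmk M N ((tmk M N) ∘ₗ M.L a) _ m n

@[simp]
theorem tensorR_tmk (M : GrBimod 𝒜 ℬ) (N : GrBimod ℬ 𝒞) (c : Cᵐᵒᵖ) (m : M.carrier)
    (n : N.carrier) : tensorR M N c (tmk M N m n) = tmk M N m (N.R c n) :=
  tlift_tmk M N ((tmk M N).compl₂ (N.R c)) _ m n

theorem tensorL_mem (M : GrBimod 𝒜 ℬ) (N : GrBimod ℬ 𝒞) {i j : ℤ} {a : A}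
    {x : TensorCarrier M N} (ha : a ∈ 𝒜 i) (hx : x ∈ tensorGr M N j) :
    tensorL M N a x ∈ tensorGr M N (i + j) := by
  refine Submodule.span_induction (p := fun x _ => tensorL M N a x ∈ tensorGr M N (i + j))
    ?_ ?_ ?_ ?_ hx
  · rintro _ ⟨k, l, hkl, x, hx, y, hy, rfl⟩
    have := tmk_mem M N (M.L_mem ha hx) hy
    rw [add_assoc, hkl] at this
    simpa using this
  · simp
  · intro x y _ _ hx hy
    rw [map_add]; exact add_mem hx hy
  · intro c x _ hx
    rw [map_smul]; exact Submodule.smul_mem _ _ hx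

theorem tensorR_mem (M : GrBimod 𝒜 ℬ) (N : GrBimod ℬ 𝒞) {i j : ℤ} {c : C}
    {x : TensorCarrier M N} (hc : c ∈ 𝒞 i) (hx : x ∈ tensorGr M N j) :
    tensorR M N (MulOpposite.op c) x ∈ tensorGr M N (j + i) := by
  refine Submodule.span_induction
    (p := fun x _ => tensorR M N (MulOpposite.op c) x ∈ tensorGr M N (j + i)) ?_ ?_ ?_ ?_ hx
  · rintro _ ⟨k, l, hkl, x, hx, y, hy, rfl⟩
    have := tmk_mem M N hx (N.R_mem hc hy)
    rw [← add_assoc, hkl] at this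
    simpa using this
  · simp
  · intro x y _ _ hx hy
    rw [map_add]; exact add_mem hx hy
  · intro c x _ hx
    rw [map_smul]; exact Submodule.smul_mem _ _ hx

/-- The graded bimodule `M ⊗_B N`. -/
def tensor [GradedAlgebra ℬ] (M : GrBimod 𝒜 ℬ) (N : GrBimod ℬ 𝒞) : GrBimod 𝒜 𝒞 where
  carrier := TensorCarrier M N
  L :=
    { toFun := tensorL M N
      map_one' := tensor_ext fun m n => by simp
      map_mul' := fun a b => tensor_ext fun m n => by simp
      map_zero' := tensor_ext fun m n => by simp
      map_add' := fun a b => tensor_ext fun m n => by simp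
      commutes' := fun c => tensor_ext fun m n => by simp }
  R :=
    { toFun := tensorR M N
      map_one' := tensor_ext fun m n => by simp
      map_mul' := fun a b => tensor_ext fun m n => by simp
      map_zero' := tensor_ext fun m n => by simp
      map_add' := fun a b => tensor_ext fun m n => by simp
      commutes' := fun c => tensor_ext fun m n => by
        rw [tensorR_tmk, AlgHom.commutes]
        simp }
  comm a c x := by
    change tensorL M N a (tensorR M N c x) = tensorR M N c (tensorL M N a x)
    refine tensor_induction (fun m n => ?_) (by simp)
      (fun x y hx hy => by simp only [map_add, hx, hy]) x
    simp
  gr := tensorGr M N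
  internal := tensor_internal M N
  L_mem ha hx := tensorL_mem M N ha hx
  R_mem hc hx := tensorR_mem M N hc hx

variable [GradedAlgebra ℬ]

/-- The canonical bilinear map `(x, y) ↦ x ⊗ y` from `M × N` to `M ⊗_B N`. -/
def tmul (M : GrBimod 𝒜 ℬ) (N : GrBimod ℬ 𝒞) :
    M.carrier →ₗ[F] N.carrier →ₗ[F] (tensor M N).carrier :=
  tmk M N

theorem tmul_balanced (M : GrBimod 𝒜 ℬ) (N : GrBimod ℬ 𝒞) (m : M.carrier) (b : B)
    (n : N.carrier) : tmul M N (M.R (MulOpposite.op b) m) n = tmul M N m (N.L b n) :=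
  tmk_balanced M N m b n

theorem tmul_mem (M : GrBimod 𝒜 ℬ) (N : GrBimod ℬ 𝒞) {i j : ℤ} {x : M.carrier}
    {y : N.carrier} (hx : x ∈ M.gr i) (hy : y ∈ N.gr j) :
    tmul M N x y ∈ (tensor M N).gr (i + j) :=
  tmk_mem M N hx hy

@[simp]
theorem tensor_L (M : GrBimod 𝒜 ℬ) (N : GrBimod ℬ 𝒞) (a : A) (m : M.carrier)
    (n : N.carrier) : (tensor M N).L a (tmul M N m n) = tmul M N (M.L a m) n :=
  tensorL_tmk M N a m n

@[simp]
theorem tensor_R (M : GrBimod 𝒜 ℬ) (N : GrBimod ℬ 𝒞) (c : Cᵐᵒᵖ) (m : M.carrier)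
    (n : N.carrier) : (tensor M N).R c (tmul M N m n) = tmul M N m (N.R c n) :=
  tensorR_tmk M N c m n

/-- The universal property of `M ⊗_B N`. -/
def tdesc {P : Type u} [AddCommGroup P] [Module F P] (M : GrBimod 𝒜 ℬ) (N : GrBimod ℬ 𝒞)
    (f : M.carrier →ₗ[F] N.carrier →ₗ[F] P)
    (hf : ∀ m b n, f (M.R (MulOpposite.op b) m) n = f m (N.L b n)) :
    (tensor M N).carrier →ₗ[F] P :=
  tlift M N f hf

@[simp]
theorem tdesc_tmul {P : Type u} [AddCommGroup P] [Module F P] (M : GrBimod 𝒜 ℬ)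
    (N : GrBimod ℬ 𝒞) (f : M.carrier →ₗ[F] N.carrier →ₗ[F] P)
    (hf : ∀ m b n, f (M.R (MulOpposite.op b) m) n = f m (N.L b n)) (m : M.carrier)
    (n : N.carrier) : tdesc M N f hf (tmul M N m n) = f m n :=
  tlift_tmk M N f hf m n

theorem tdesc_ext {P : Type u} [AddCommGroup P] [Module F P] {M : GrBimod 𝒜 ℬ}
    {N : GrBimod ℬ 𝒞} {f g : (tensor M N).carrier →ₗ[F] P}
    (h : ∀ m n, f (tmul M N m n) = g (tmul M N m n)) : f = g :=
  tensor_ext h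

@[elab_as_elim]
theorem tmul_induction {M : GrBimod 𝒜 ℬ} {N : GrBimod ℬ 𝒞}
    {P : (tensor M N).carrier → Prop} (mk : ∀ m n, P (tmul M N m n)) (zero : P 0)
    (add : ∀ x y, P x → P y → P (x + y)) (x : (tensor M N).carrier) : P x :=
  tensor_induction (P := P) mk zero add x

/-- Build a homomorphism out of `M ⊗_B N` from a balanced bilinear map. -/
def homOfTensor {M : GrBimod 𝒜 ℬ} {N : GrBimod ℬ 𝒞} {P : GrBimod 𝒜 𝒞}
    (f : M.carrier →ₗ[F] N.carrier →ₗ[F] P.carrier)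
    (hf : ∀ m b n, f (M.R (MulOpposite.op b) m) n = f m (N.L b n))
    (hL : ∀ a m n, f (M.L a m) n = P.L a (f m n))
    (hR : ∀ c m n, f m (N.R c n) = P.R c (f m n))
    (hmem : ∀ i j, ∀ m ∈ M.gr i, ∀ n ∈ N.gr j, f m n ∈ P.gr (i + j)) :
    tensor M N ⟶ P where
  toLin := tdesc M N f hf
  map_L a x := by
    refine tmul_induction (fun m n => ?_) (by simp)
      (fun x y hx hy => by simp only [map_add, hx, hy]) x
    rw [tensor_L, tdesc_tmul, tdesc_tmul, hL]
  map_R c x := by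
    refine tmul_induction (fun m n => ?_) (by simp)
      (fun x y hx hy => by simp only [map_add, hx, hy]) x
    rw [tensor_R, tdesc_tmul, tdesc_tmul, hR]
  map_mem n x hx := by
    refine Submodule.span_induction (p := fun x _ => tdesc M N f hf x ∈ P.gr n)
      ?_ ?_ ?_ ?_ hx
    · rintro _ ⟨k, l, rfl, x, hx, y, hy, rfl⟩
      have := hmem k l x hx y hy
      rwa [← tdesc_tmul M N f hf] at this
    · rw [map_zero]; exact zero_mem _
    · intro x y _ _ hx hy
      rw [map_add]; exact add_mem hx hy
    · intro c x _ hx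
      rw [map_smul]; exact Submodule.smul_mem _ _ hx

@[simp]
theorem homOfTensor_tmul {M : GrBimod 𝒜 ℬ} {N : GrBimod ℬ 𝒞} {P : GrBimod 𝒜 𝒞}
    (f : M.carrier →ₗ[F] N.carrier →ₗ[F] P.carrier) (hf) (hL) (hR) (hmem) (m : M.carrier)
    (n : N.carrier) :
    Hom.toLin (homOfTensor (P := P) f hf hL hR hmem) (tmul M N m n) = f m n :=
  tdesc_tmul M N f hf m n

theorem tensor_hom_ext {M : GrBimod 𝒜 ℬ} {N : GrBimod ℬ 𝒞} {P : GrBimod 𝒜 𝒞}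
    {f g : tensor M N ⟶ P}
    (h : ∀ m n, Hom.toLin f (tmul M N m n) = Hom.toLin g (tmul M N m n)) : f = g :=
  hom_ext (tdesc_ext h)

/-- The homomorphism `f ⊗ g`. -/
def tensorMap {M M' : GrBimod 𝒜 ℬ} {N N' : GrBimod ℬ 𝒞} (f : M ⟶ M') (g : N ⟶ N') :
    tensor M N ⟶ tensor M' N' :=
  homOfTensor (P := tensor M' N') ((tmul M' N').compl₁₂ (Hom.toLin f) (Hom.toLin g))
    (fun m b n => by simp [Hom.map_R, Hom.map_L, tmul_balanced])
    (fun a m n => by simp [Hom.map_L])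
    (fun c m n => by simp [Hom.map_R])
    (fun i j m hm n hn => tmul_mem M' N' (Hom.map_mem f i m hm) (Hom.map_mem g j n hn))

@[simp]
theorem tensorMap_tmul {M M' : GrBimod 𝒜 ℬ} {N N' : GrBimod ℬ 𝒞} (f : M ⟶ M') (g : N ⟶ N')
    (m : M.carrier) (n : N.carrier) :
    Hom.toLin (tensorMap f g) (tmul M N m n) = tmul M' N' (Hom.toLin f m) (Hom.toLin g n) :=
  homOfTensor_tmul _ _ _ _ _ m n

theorem tensorMap_comp {M M' M'' : GrBimod 𝒜 ℬ} {N N' N'' : GrBimod ℬ 𝒞} (f : M ⟶ M')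
    (g : N ⟶ N') (f' : M' ⟶ M'') (g' : N' ⟶ N'') :
    tensorMap f g ≫ tensorMap f' g' = tensorMap (f ≫ f') (g ≫ g') :=
  tensor_hom_ext fun m n => by simp

theorem tensorMap_zero_left {M M' : GrBimod 𝒜 ℬ} {N N' : GrBimod ℬ 𝒞} (g : N ⟶ N') :
    tensorMap (0 : M ⟶ M') g = 0 :=
  tensor_hom_ext fun m n => by simp

theorem tensorMap_zero_right {M M' : GrBimod 𝒜 ℬ} {N N' : GrBimod ℬ 𝒞} (f : M ⟶ M') :
    tensorMap f (0 : N ⟶ N') = 0 :=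
  tensor_hom_ext fun m n => by simp

/-! ### The total tensor product of two complexes -/

/-- The term of degree `n` of `X ⊗_B Y`, the direct sum of all `X_p ⊗_B Y_q` with
`p + q = n`. -/
def totalX (X : ChainComplex (GrBimod 𝒜 ℬ) ℕ) (Y : ChainComplex (GrBimod ℬ 𝒞) ℕ) (n : ℕ) :
    GrBimod 𝒜 𝒞 :=
  GrBimod.pi fun pq : {pq : ℕ × ℕ // pq ∈ Finset.HasAntidiagonal.antidiagonal n} =>
    tensor (X.X pq.1.1) (Y.X pq.1.2)

/-- The `(p, q)`-component of an element of the term of degree `n` of `X ⊗_B Y`. -/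
def totalProj (X : ChainComplex (GrBimod 𝒜 ℬ) ℕ) (Y : ChainComplex (GrBimod ℬ 𝒞) ℕ)
    {n : ℕ} (p q : ℕ) (h : p + q = n) : totalX X Y n ⟶ tensor (X.X p) (Y.X q) where
  toLin := LinearMap.proj (R := F)
    (φ := fun pq : {pq : ℕ × ℕ // pq ∈ Finset.HasAntidiagonal.antidiagonal n} =>
      (tensor (X.X pq.1.1) (Y.X pq.1.2)).carrier)
    ⟨(p, q), Finset.HasAntidiagonal.mem_antidiagonal.2 h⟩
  map_L _ _ := rfl
  map_R _ _ := rfl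
  map_mem _ _ hx := hx ⟨(p, q), Finset.HasAntidiagonal.mem_antidiagonal.2 h⟩ trivial

/-- The homomorphism to the term of degree `n` of `X ⊗_B Y` with prescribed components. -/
def totalLift (X : ChainComplex (GrBimod 𝒜 ℬ) ℕ) (Y : ChainComplex (GrBimod ℬ 𝒞) ℕ)
    {n : ℕ} {P : GrBimod 𝒜 𝒞} (f : ∀ p q : ℕ, p + q = n → (P ⟶ tensor (X.X p) (Y.X q))) :
    P ⟶ totalX X Y n where
  toLin := LinearMap.pi fun pq : {pq : ℕ × ℕ // pq ∈ Finset.HasAntidiagonal.antidiagonal n} =>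
    Hom.toLin (f pq.1.1 pq.1.2 (Finset.HasAntidiagonal.mem_antidiagonal.1 pq.2))
  map_L a x := funext fun pq => Hom.map_L (f pq.1.1 pq.1.2 _) a x
  map_R a x := funext fun pq => Hom.map_R (f pq.1.1 pq.1.2 _) a x
  map_mem n x hx := fun pq _ => Hom.map_mem (f pq.1.1 pq.1.2 _) n x hx

@[simp]
theorem totalLift_totalProj (X : ChainComplex (GrBimod 𝒜 ℬ) ℕ)
    (Y : ChainComplex (GrBimod ℬ 𝒞) ℕ) {n : ℕ} {P : GrBimod 𝒜 𝒞}
    (f : ∀ p q : ℕ, p + q = n → (P ⟶ tensor (X.X p) (Y.X q))) (p q : ℕ) (h : p + q = n) :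
    totalLift X Y f ≫ totalProj X Y p q h = f p q h := rfl

theorem total_hom_ext {X : ChainComplex (GrBimod 𝒜 ℬ) ℕ} {Y : ChainComplex (GrBimod ℬ 𝒞) ℕ}
    {n : ℕ} {P : GrBimod 𝒜 𝒞} {f g : P ⟶ totalX X Y n}
    (h : ∀ p q (hpq : p + q = n), f ≫ totalProj X Y p q hpq = g ≫ totalProj X Y p q hpq) :
    f = g :=
  hom_ext <| LinearMap.ext fun x => funext fun pq =>
    LinearMap.congr_fun (congrArg Hom.toLin
      (h pq.1.1 pq.1.2 (Finset.HasAntidiagonal.mem_antidiagonal.1 pq.2))) x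

/-- The differential `d (x ⊗ y) = d x ⊗ y + (-1) ^ p x ⊗ d y`, for `x` in `X_p`, of the
complex `X ⊗_B Y`, described through its components: the `(p, q)`-component of `d z` is the sum of
the contributions of the `(p + 1, q)`-component and of the `(p, q + 1)`-component of `z`. -/
def totalD (X : ChainComplex (GrBimod 𝒜 ℬ) ℕ) (Y : ChainComplex (GrBimod ℬ 𝒞) ℕ) (n : ℕ) :
    totalX X Y (n + 1) ⟶ totalX X Y n :=
  totalLift X Y fun p q h =>
    totalProj X Y (p + 1) q (by omega) ≫ tensorMap (X.d (p + 1) p) (𝟙 (Y.X q)) +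
      (-1 : ℤ) ^ p • (totalProj X Y p (q + 1) (by omega) ≫
        tensorMap (𝟙 (X.X p)) (Y.d (q + 1) q))

/-- The tensor product over `B` of two complexes of graded bimodules. -/
def tensorComplex (X : ChainComplex (GrBimod 𝒜 ℬ) ℕ) (Y : ChainComplex (GrBimod ℬ 𝒞) ℕ) :
    ChainComplex (GrBimod 𝒜 𝒞) ℕ :=
  ChainComplex.of (totalX X Y) (totalD X Y) (fun n => total_hom_ext fun p q h => by
    simp only [Category.assoc, totalD, totalLift_totalProj, Preadditive.comp_add,
      Preadditive.comp_zsmul, Limits.zero_comp]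
    simp only [← Category.assoc, totalLift_totalProj, Preadditive.add_comp,
      Preadditive.zsmul_comp]
    simp [tensorMap_comp, tensorMap_zero_left, tensorMap_zero_right, pow_succ])

end GrBimod

end Tensor

/-! ## Cones and spherical twists -/

section Twists

variable {F : Type u} [Field F] {A : Type u} [Ring A] [Algebra F A]

namespace GrBimod

/-- The terms of the cone below. -/
def coneX {B : Type u} [Ring B] [Algebra F B] {𝒜 : ℤ → Submodule F A} {ℬ : ℤ → Submodule F B}
    (Q : ChainComplex (GrBimod 𝒜 ℬ) ℕ) (M : GrBimod 𝒜 ℬ) : ℕ → GrBimod 𝒜 ℬ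
  | 0 => M
  | n + 1 => Q.X n

/-- The differentials of the cone below. -/
def coneD {B : Type u} [Ring B] [Algebra F B] {𝒜 : ℤ → Submodule F A} {ℬ : ℤ → Submodule F B}
    (Q : ChainComplex (GrBimod 𝒜 ℬ) ℕ) (M : GrBimod 𝒜 ℬ) (m : Q.X 0 ⟶ M) :
    ∀ n, coneX Q M (n + 1) ⟶ coneX Q M n
  | 0 => m
  | n + 1 => -Q.d (n + 1) n

/-- The cone of a chain map `m : Q → M`, where `M` is a bimodule regarded as a complex
concentrated in degree `0` (so that `m` is a homomorphism `Q_0 → M` with `d ≫ m = 0`): its term of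
degree `0` is `M`, its term of degree `n + 1` is `Q_n`, and its differential is `m` on `Q_0` and
`-d` on the other terms. -/
def coneTo {B : Type u} [Ring B] [Algebra F B] {𝒜 : ℤ → Submodule F A} {ℬ : ℤ → Submodule F B}
    (Q : ChainComplex (GrBimod 𝒜 ℬ) ℕ) (M : GrBimod 𝒜 ℬ) (m : Q.X 0 ⟶ M)
    (w : Q.d 1 0 ≫ m = 0) : ChainComplex (GrBimod 𝒜 ℬ) ℕ :=
  ChainComplex.of (coneX Q M) (coneD Q M m) (fun n => match n with
    | 0 => (Preadditive.neg_comp _ _).trans ((congrArg Neg.neg w).trans neg_zero)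
    | n + 1 => (Preadditive.neg_comp_neg _ _).trans (Q.d_comp_d _ _ _))

/-- The terms of a complex concentrated in degree `0`. -/
def singleX {B : Type u} [Ring B] [Algebra F B] {𝒜 : ℤ → Submodule F A}
    {ℬ : ℤ → Submodule F B} (M : GrBimod 𝒜 ℬ) : ℕ → GrBimod 𝒜 ℬ
  | 0 => M
  | _ + 1 => GrBimod.zero 𝒜 ℬ

/-- A bimodule regarded as a complex concentrated in degree `0`. -/
def single {B : Type u} [Ring B] [Algebra F B] {𝒜 : ℤ → Submodule F A} {ℬ : ℤ → Submodule F B}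
    (M : GrBimod 𝒜 ℬ) : ChainComplex (GrBimod 𝒜 ℬ) ℕ :=
  ChainComplex.of (singleX M) (fun _ => 0) (fun _ => Limits.zero_comp)

theorem single_d_comp {B : Type u} [Ring B] [Algebra F B] {𝒜 : ℤ → Submodule F A}
    {ℬ : ℤ → Submodule F B} (M N : GrBimod 𝒜 ℬ) (m : (single M).X 0 ⟶ N) :
    (single M).d 1 0 ≫ m = 0 := by
  have : (single M).d 1 0 = 0 := ChainComplex.of_d (singleX M) (fun _ => 0) 0
  rw [this, Limits.zero_comp]

end GrBimod

/-- A complete family `e_1, …, e_r` of orthogonal idempotents of degree `0` in a graded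
algebra. -/
structure VertexIdem (𝒜 : ℤ → Submodule F A) (r : ℕ) where
  e : Fin r → A
  complete : CompleteOrthogonalIdempotents e
  mem : ∀ i, e i ∈ 𝒜 0

/-- The action of the field on a vector space, as a right action. -/
def scalarR (F : Type u) [Field F] (M : Type u) [AddCommGroup M] [Module F M] :
    Fᵐᵒᵖ →ₐ[F] Module.End F M :=
  (Algebra.ofId F (Module.End F M)).comp (AlgEquiv.toOpposite F F).symm.toAlgHom

theorem scalarR_op {M : Type u} [AddCommGroup M] [Module F M] (c : F) (x : M) :
    scalarR F M (MulOpposite.op c) x = c • x := rfl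

variable {𝒜 : ℤ → Submodule F A} [GradedAlgebra 𝒜]

theorem component_eq_decompose (n : ℤ) (x : A) :
    component (DirectSum.Decomposition.isInternal 𝒜) n x = DirectSum.decompose 𝒜 x n := by
  unfold component
  rw [Subsingleton.elim (DirectSum.IsInternal.chooseDecomposition 𝒜
    (DirectSum.Decomposition.isInternal 𝒜)) _]
  rfl

theorem gmul_mem {i j : ℤ} {a b : A} (ha : a ∈ 𝒜 i) (hb : b ∈ 𝒜 j) : a * b ∈ 𝒜 (i + j) :=
  SetLike.GradedMul.mul_mem ha hb

theorem sub_internal (N : Submodule F A) (hN : ∀ x ∈ N, ∀ n,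
      (component (DirectSum.Decomposition.isInternal 𝒜) n x : A) ∈ N) :
    DirectSum.IsInternal (fun n => (𝒜 n).comap N.subtype) := by
  have hA := DirectSum.Decomposition.isInternal 𝒜
  refine isInternal_of_proj (fun n => LinearMap.restrict ((𝒜 n).subtype ∘ₗ component hA n)
    (fun x hx => hN x hx n)) ?_ ?_ ?_
  · intro n x hx
    have h := component_of_mem hA (x := x.1) hx
    refine Subtype.ext ?_
    change ((component hA n x.1 : 𝒜 n) : A) = x.1
    rw [h]
  · intro n m hnm x hx
    have h := component_of_mem_ne hA hnm.symm (x := x.1) hx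
    refine Subtype.ext ?_
    change ((component hA n x.1 : 𝒜 n) : A) = 0
    rw [h]
    rfl
  · rw [eq_top_iff]
    rintro x -
    classical
    have hs := DirectSum.sum_support_decompose 𝒜 (x : A)
    have hcomp : ∀ n, ((DirectSum.decompose 𝒜 (x : A) n : 𝒜 n) : A) ∈ N := fun n => by
      rw [← component_eq_decompose]
      exact hN x x.2 n
    have hx : x = ∑ n ∈ (DirectSum.decompose 𝒜 (x : A)).support,
        (⟨(DirectSum.decompose 𝒜 (x : A) n : A), hcomp n⟩ : N) := by
      apply Subtype.ext
      rw [AddSubmonoidClass.coe_finsetSum]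
      exact hs.symm
    rw [hx]
    refine sum_mem fun n _ => Submodule.mem_iSup_of_mem n ?_
    exact (DirectSum.decompose 𝒜 (x : A) n).2

theorem component_mul_right {a : A} {e : A} (he : e ∈ 𝒜 0) (n : ℤ) :
    (component (DirectSum.Decomposition.isInternal 𝒜) n (a * e) : A) =
      (component (DirectSum.Decomposition.isInternal 𝒜) n a : A) * e := by
  have hA := DirectSum.Decomposition.isInternal 𝒜
  refine homogeneous_induction hA ?_ ?_ ?_ a
  · intro i a ha
    have hae : a * e ∈ 𝒜 i := by simpa using SetLike.GradedMul.mul_mem ha he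
    by_cases h : i = n
    · subst h
      rw [component_of_mem hA ha, component_of_mem hA hae]
    · rw [component_of_mem_ne hA h ha, component_of_mem_ne hA h hae]
      simp
  · simp
  · intro x y hx hy
    simp only [add_mul, map_add, Submodule.coe_add, hx, hy]

theorem component_mul_left {a : A} {e : A} (he : e ∈ 𝒜 0) (n : ℤ) :
    (component (DirectSum.Decomposition.isInternal 𝒜) n (e * a) : A) =
      e * (component (DirectSum.Decomposition.isInternal 𝒜) n a : A) := by
  have hA := DirectSum.Decomposition.isInternal 𝒜
  refine homogeneous_induction hA ?_ ?_ ?_ a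
  · intro i a ha
    have hae : e * a ∈ 𝒜 i := by simpa using SetLike.GradedMul.mul_mem he ha
    by_cases h : i = n
    · subst h
      rw [component_of_mem hA ha, component_of_mem hA hae]
    · rw [component_of_mem_ne hA h ha, component_of_mem_ne hA h hae]
      simp
  · simp
  · intro x y hx hy
    simp only [mul_add, map_add, Submodule.coe_add, hx, hy]

variable (𝒜) in
/-- The graded left module `A e`, as a graded `A`-`F`-bimodule. -/
def leftIdeal (e : A) (he : e ∈ 𝒜 0) : GrBimod 𝒜 (conc F F 0) where
  carrier := LinearMap.range (LinearMap.mulRight F e)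
  L :=
    { toFun := fun a => (LinearMap.mulLeft F a).restrict (by
        rintro _ ⟨x, rfl⟩
        exact ⟨a * x, by simp [mul_assoc]⟩)
      map_one' := by ext; simp
      map_mul' := fun a b => by ext; simp [mul_assoc]
      map_zero' := by ext; simp
      map_add' := fun a b => by ext; simp [add_mul]
      commutes' := fun c => by ext; simp [Algebra.algebraMap_eq_smul_one] }
  R := scalarR F _
  comm _ b _ := map_smul _ b.unop _
  gr n := (𝒜 n).comap (LinearMap.range (LinearMap.mulRight F e)).subtype
  internal := sub_internal _ (by
    rintro _ ⟨x, rfl⟩ n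
    exact ⟨_, (component_mul_right he n).symm⟩)
  L_mem {_ _ _ x} ha hx := gmul_mem (b := x.1) ha hx
  R_mem {i j b x} hb hx := by
    rcases mem_conc.1 hb with rfl | rfl
    · rw [add_zero]
      exact Submodule.smul_mem _ b hx
    · rw [MulOpposite.op_zero, map_zero]
      exact zero_mem _

variable (𝒜) in
/-- The graded right module `e A`, as a graded `F`-`A`-bimodule. -/
def rightIdeal (e : A) (he : e ∈ 𝒜 0) : GrBimod (conc F F 0) 𝒜 where
  carrier := LinearMap.range (LinearMap.mulLeft F e)
  L := Algebra.ofId F _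
  R :=
    { toFun := fun a => (LinearMap.mulRight F a.unop).restrict (by
        rintro _ ⟨x, rfl⟩
        exact ⟨x * a.unop, by simp [mul_assoc]⟩)
      map_one' := by ext; simp
      map_mul' := fun a b => by ext; simp [mul_assoc]
      map_zero' := by ext; simp
      map_add' := fun a b => by ext; simp [mul_add]
      commutes' := fun c => by ext; simp [Algebra.algebraMap_eq_smul_one] }
  comm a b x := Subtype.ext (smul_mul_assoc a x.1 b.unop).symm
  gr n := (𝒜 n).comap (LinearMap.range (LinearMap.mulLeft F e)).subtype
  internal := sub_internal _ (by
    rintro _ ⟨x, rfl⟩ n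
    exact ⟨_, (component_mul_left he n).symm⟩)
  L_mem {i j b x} hb hx := by
    rcases mem_conc.1 hb with rfl | rfl
    · rw [zero_add]
      exact Submodule.smul_mem _ b hx
    · rw [map_zero]
      exact zero_mem _
  R_mem {_ _ _ x} hb hx := gmul_mem (a := x.1) hx hb

variable (𝒜) in
/-- The graded bimodule `A e ⊗_F e A`. -/
def projBimod (e : A) (he : e ∈ 𝒜 0) : GrBimod 𝒜 𝒜 :=
  GrBimod.tensor (leftIdeal 𝒜 e he) (rightIdeal 𝒜 e he)

/-- The multiplication map `A e × e A → A`. -/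
def evalBilin (e : A) : LinearMap.range (LinearMap.mulRight F e) →ₗ[F]
    LinearMap.range (LinearMap.mulLeft F e) →ₗ[F] A :=
  (LinearMap.mul F A).compl₁₂ (Submodule.subtype _) (Submodule.subtype _)

variable (𝒜) in
/-- The multiplication map `A e ⊗_F e A → A`. -/
def evalMap (e : A) (he : e ∈ 𝒜 0) : projBimod 𝒜 e he ⟶ GrBimod.regular 𝒜 :=
  GrBimod.homOfTensor (M := leftIdeal 𝒜 e he) (N := rightIdeal 𝒜 e he)
    (P := GrBimod.regular 𝒜)
    (show (leftIdeal 𝒜 e he).carrier →ₗ[F] (rightIdeal 𝒜 e he).carrier →ₗ[F]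
      (GrBimod.regular 𝒜).carrier from evalBilin e)
    (fun m b n => (smul_mul_assoc b (Subtype.val m : A) (Subtype.val n : A)).trans
      (mul_smul_comm b (Subtype.val m : A) (Subtype.val n : A)).symm)
    (fun a m n => mul_assoc a (Subtype.val m : A) (Subtype.val n : A))
    (fun c m n => (mul_assoc (Subtype.val m : A) (Subtype.val n : A) c.unop).symm)
    (fun _ _ m hm n hn => gmul_mem (𝒜 := 𝒜) (a := (Subtype.val m : A)) (b := (Subtype.val n : A)) hm hn)

/-- The complex `X_i = cone (A e_i ⊗_F e_i A → A)` of the spherical twist at `e_i`. -/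
def twist {r : ℕ} (v : VertexIdem 𝒜 r) (i : Fin r) : ChainComplex (GrBimod 𝒜 𝒜) ℕ :=
  GrBimod.coneTo (GrBimod.single (projBimod 𝒜 (v.e i) (v.mem i))) (GrBimod.regular 𝒜)
    (evalMap 𝒜 (v.e i) (v.mem i)) (GrBimod.single_d_comp _ _ _)

/-- The product `X_r ⊗_A ⋯ ⊗_A X_2 ⊗_A X_1` (the empty product being `A`), bracketed as
`X_r ⊗_A (⋯ ⊗_A (X_2 ⊗_A (X_1 ⊗_A A)))`. -/
def twistProduct {r : ℕ} (v : VertexIdem 𝒜 r) : ChainComplex (GrBimod 𝒜 𝒜) ℕ :=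
  Fin.foldl r (fun P i => GrBimod.tensorComplex (twist v i) P)
    (GrBimod.single (GrBimod.regular 𝒜))

end Twists

/-! ## Quadratic duals -/

section QuadraticDual

variable {F : Type u} [Field F] {B : Type u} [Ring B] [Algebra F B]
  {ℬ : ℤ → Submodule F B} [GradedAlgebra ℬ] {r : ℕ}

namespace VertexIdem

/-- The algebra map `S = F ^ r → B` sending the `i`-th standard idempotent to `e_i`. -/
def hom (v : VertexIdem ℬ r) : (Fin r → F) →ₐ[F] B :=
  AlgHom.ofLinearMap (∑ i, (LinearMap.proj i).smulRight (v.e i))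
    (by simp [v.complete.complete])
    (by
      intro s t
      simp only [LinearMap.sum_apply, LinearMap.smulRight_apply, LinearMap.proj_apply,
        Finset.sum_mul_sum, smul_mul_smul_comm]
      refine Finset.sum_congr rfl fun i _ => ?_
      rw [Finset.sum_eq_single i]
      · rw [(v.complete.idem i).eq]; rfl
      · intro j _ hj
        rw [v.complete.ortho hj.symm, smul_zero]
      · simp)

theorem hom_apply (v : VertexIdem ℬ r) (s : Fin r → F) : v.hom s = ∑ i, s i • v.e i := by
  simp [hom]

theorem hom_mem (v : VertexIdem ℬ r) (s : Fin r → F) : v.hom s ∈ ℬ 0 := by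
  rw [hom_apply]
  exact sum_mem fun i _ => Submodule.smul_mem _ _ (v.mem i)

theorem hom_single (v : VertexIdem ℬ r) (i : Fin r) : v.hom (Pi.single i 1) = v.e i := by
  rw [hom_apply, Finset.sum_eq_single i]
  · simp
  · intro j _ hj
    simp [Pi.single_eq_of_ne hj]
  · simp

/-- Left multiplication `x ↦ s x` on the degree `1` part `V`. -/
def lV (v : VertexIdem ℬ r) : (Fin r → F) →ₗ[F] (ℬ 1 →ₗ[F] ℬ 1) :=
  LinearMap.mk₂ F (fun s x => ⟨v.hom s * x, by simpa using gmul_mem (v.hom_mem s) x.2⟩)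
    (fun _ _ _ => Subtype.ext (by simp [add_mul])) (fun _ _ _ => Subtype.ext (by simp))
    (fun _ _ _ => Subtype.ext (by simp [mul_add])) (fun _ _ _ => Subtype.ext (by simp))

/-- Right multiplication `x ↦ x s` on the degree `1` part `V`. -/
def rV (v : VertexIdem ℬ r) : (Fin r → F) →ₗ[F] (ℬ 1 →ₗ[F] ℬ 1) :=
  LinearMap.mk₂ F (fun s x => ⟨x * v.hom s, by simpa using gmul_mem x.2 (v.hom_mem s)⟩)
    (fun _ _ _ => Subtype.ext (by simp [mul_add])) (fun _ _ _ => Subtype.ext (by simp))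
    (fun _ _ _ => Subtype.ext (by simp [add_mul])) (fun _ _ _ => Subtype.ext (by simp))

@[simp]
theorem coe_lV (v : VertexIdem ℬ r) (s : Fin r → F) (x : ℬ 1) :
    (v.lV s x : B) = v.hom s * x := rfl

@[simp]
theorem coe_rV (v : VertexIdem ℬ r) (s : Fin r → F) (x : ℬ 1) :
    (v.rV s x : B) = x * v.hom s := rfl

end VertexIdem

/-- The dual space `V^*` of the degree `1` part `V` of `B`. It is an `S`-`S`-bimodule through
`(s f t) (x) = f (t x s)`. -/
abbrev VDual (ℬ : ℤ → Submodule F B) : Type u := Module.Dual F (ℬ 1)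

variable (ℬ) in
/-- The multiplication map `V ⊗_F V → B`; its kernel is the preimage in `V ⊗_F V` of the space
of quadratic relations `R ⊆ V ⊗_S V`. -/
def mulVV : (ℬ 1 ⊗[F] ℬ 1) →ₗ[F] B :=
  TensorProduct.lift ((LinearMap.mul F B).compl₁₂ (ℬ 1).subtype (ℬ 1).subtype)

/-- The pairing between `V^* ⊗ V^*` and `V ⊗ V` which induces the canonical isomorphism
`V^* ⊗_S V^* = (V ⊗_S V)^*`, that is
`⟨f ⊗ g, x ⊗ y⟩ = ∑ k, g (x e_k) f (e_k y)`. -/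
def pairVV (v : VertexIdem ℬ r) :
    (VDual ℬ ⊗[F] VDual ℬ) →ₗ[F] Module.Dual F (ℬ 1 ⊗[F] ℬ 1) :=
  TensorProduct.lift (LinearMap.mk₂ F
    (fun f g => ∑ k : Fin r, TensorProduct.dualDistrib F (ℬ 1) (ℬ 1)
      ((g ∘ₗ v.rV (Pi.single k 1)) ⊗ₜ (f ∘ₗ v.lV (Pi.single k 1))))
    (fun f f' g => by
      simp [LinearMap.add_comp, TensorProduct.tmul_add, Finset.sum_add_distrib])
    (fun c f g => by simp [LinearMap.smul_comp, Finset.smul_sum])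
    (fun f g g' => by
      simp [LinearMap.add_comp, TensorProduct.add_tmul, Finset.sum_add_distrib])
    (fun c f g => by
      simp [LinearMap.smul_comp, Finset.smul_sum, ← TensorProduct.smul_tmul']))

theorem pairVV_tmul (v : VertexIdem ℬ r) (f g : VDual ℬ) (x y : ℬ 1) :
    pairVV v (f ⊗ₜ g) (x ⊗ₜ y) =
      ∑ k, g (v.rV (Pi.single k 1) x) * f (v.lV (Pi.single k 1) y) := by
  simp [pairVV]

/-- The free algebra on the vector space `S ⊕ V^*`. -/
abbrev QFree (ℬ : ℤ → Submodule F B) (r : ℕ) : Type u :=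
  TensorAlgebra F ((Fin r → F) × VDual ℬ)

/-- The generator of the free algebra given by an element of `S`. -/
def qS (ℬ : ℤ → Submodule F B) (r : ℕ) : (Fin r → F) →ₗ[F] QFree ℬ r :=
  TensorAlgebra.ι F ∘ₗ LinearMap.inl F _ _

/-- The generator of the free algebra given by an element of `V^*`. -/
def qV (ℬ : ℤ → Submodule F B) (r : ℕ) : VDual ℬ →ₗ[F] QFree ℬ r :=
  TensorAlgebra.ι F ∘ₗ LinearMap.inr F _ _

/-- The relations of the quadratic dual `B^! = Tens_S(V^*) / (R^⊥)`: the first four present the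
tensor algebra `Tens_S(V^*)`, and the last one divides out the orthogonal space of the
quadratic relations of `B`. -/
inductive QRel (v : VertexIdem ℬ r) : QFree ℬ r → QFree ℬ r → Prop
  | one : QRel v (qS ℬ r 1) 1
  | mul (s t : Fin r → F) : QRel v (qS ℬ r s * qS ℬ r t) (qS ℬ r (s * t))
  | left (s : Fin r → F) (f : VDual ℬ) :
      QRel v (qS ℬ r s * qV ℬ r f) (qV ℬ r (f ∘ₗ v.rV s))
  | right (s : Fin r → F) (f : VDual ℬ) :
      QRel v (qV ℬ r f * qS ℬ r s) (qV ℬ r (f ∘ₗ v.lV s))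
  | quad (t : VDual ℬ ⊗[F] VDual ℬ)
      (ht : ∀ x ∈ LinearMap.ker (mulVV ℬ), pairVV v t x = 0) :
      QRel v (TensorProduct.lift ((LinearMap.mul F (QFree ℬ r)).compl₁₂ (qV ℬ r) (qV ℬ r)) t) 0

/-- The quadratic dual `B^!` of a graded algebra `B` with degree `0` part `S = ⊕ F e_i`. -/
def QDual (v : VertexIdem ℬ r) : Type u := RingQuot (QRel v)

namespace QDual

variable (v : VertexIdem ℬ r)

instance : Ring (QDual v) := inferInstanceAs (Ring (RingQuot (QRel v)))

instance : Algebra F (QDual v) := inferInstanceAs (Algebra F (RingQuot (QRel v)))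

/-- The quotient map from the free algebra. -/
def mk : QFree ℬ r →ₐ[F] QDual v := RingQuot.mkAlgHom F (QRel v)

theorem mk_rel {x y : QFree ℬ r} (h : QRel v x y) : mk v x = mk v y :=
  RingQuot.mkAlgHom_rel F h

/-- The algebra map `S → B^!`. -/
def ofS : (Fin r → F) →ₐ[F] QDual v :=
  AlgHom.ofLinearMap ((mk v).toLinearMap ∘ₗ qS ℬ r)
    ((mk_rel v QRel.one).trans (map_one _))
    (fun s t => (mk_rel v (QRel.mul s t)).symm.trans (map_mul _ _ _))

/-- The inclusion of the generators `V^* → B^!`. -/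
def gen : VDual ℬ →ₗ[F] QDual v := (mk v).toLinearMap ∘ₗ qV ℬ r

theorem ofS_mul_gen (s : Fin r → F) (f : VDual ℬ) :
    ofS v s * gen v f = gen v (f ∘ₗ v.rV s) :=
  (map_mul (mk v) _ _).symm.trans (mk_rel v (QRel.left s f))

theorem gen_mul_ofS (s : Fin r → F) (f : VDual ℬ) :
    gen v f * ofS v s = gen v (f ∘ₗ v.lV s) :=
  (map_mul (mk v) _ _).symm.trans (mk_rel v (QRel.right s f))

/-- The map `V^* ⊗ V^* → B^!`. -/
def gen2 : (VDual ℬ ⊗[F] VDual ℬ) →ₗ[F] QDual v :=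
  TensorProduct.lift ((LinearMap.mul F (QDual v)).compl₁₂ (gen v) (gen v))

theorem gen2_eq_zero (t : VDual ℬ ⊗[F] VDual ℬ)
    (ht : ∀ x ∈ LinearMap.ker (mulVV ℬ), pairVV v t x = 0) : gen2 v t = 0 := by
  have h := mk_rel v (QRel.quad t ht)
  rw [map_zero] at h
  rw [← h]
  have : gen2 v = (mk v).toLinearMap ∘ₗ
      TensorProduct.lift ((LinearMap.mul F (QFree ℬ r)).compl₁₂ (qV ℬ r) (qV ℬ r)) :=
    TensorProduct.ext' fun f g => by simp [gen2, gen]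
  rw [this]
  rfl

/-- The universal property of `B^!`. -/
def lift {C : Type u} [Ring C] [Algebra F C] (φ : (Fin r → F) →ₐ[F] C) (ψ : VDual ℬ →ₗ[F] C)
    (hl : ∀ s f, φ s * ψ f = ψ (f ∘ₗ v.rV s)) (hr : ∀ s f, ψ f * φ s = ψ (f ∘ₗ v.lV s))
    (hq : ∀ t : VDual ℬ ⊗[F] VDual ℬ, (∀ x ∈ LinearMap.ker (mulVV ℬ), pairVV v t x = 0) →
      TensorProduct.lift ((LinearMap.mul F C).compl₁₂ ψ ψ) t = 0) : QDual v →ₐ[F] C :=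
  RingQuot.liftAlgHom F ⟨TensorAlgebra.lift F (φ.toLinearMap.coprod ψ), by
    intro x y h
    induction h with
    | one => simp [qS]
    | mul s t => simp [qS]
    | left s f => simp [qS, qV, hl]
    | right s f => simp [qS, qV, hr]
    | quad t ht =>
      rw [map_zero, ← hq t ht]
      have : (TensorAlgebra.lift F (φ.toLinearMap.coprod ψ)).toLinearMap ∘ₗ
          TensorProduct.lift ((LinearMap.mul F (QFree ℬ r)).compl₁₂ (qV ℬ r) (qV ℬ r)) =
          TensorProduct.lift ((LinearMap.mul F C).compl₁₂ ψ ψ) :=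
        TensorProduct.ext' fun f g => by simp [qV]
      rw [← this]
      rfl⟩

theorem lift_ofS {C : Type u} [Ring C] [Algebra F C] (φ : (Fin r → F) →ₐ[F] C)
    (ψ : VDual ℬ →ₗ[F] C) (hl) (hr) (hq) (s : Fin r → F) :
    lift v φ ψ hl hr hq (ofS v s) = φ s := by
  change RingQuot.liftAlgHom F _ (RingQuot.mkAlgHom F (QRel v) _) = _
  rw [RingQuot.liftAlgHom_mkAlgHom_apply]
  simp [qS]

theorem lift_gen {C : Type u} [Ring C] [Algebra F C] (φ : (Fin r → F) →ₐ[F] C)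
    (ψ : VDual ℬ →ₗ[F] C) (hl) (hr) (hq) (f : VDual ℬ) :
    lift v φ ψ hl hr hq (gen v f) = ψ f := by
  change RingQuot.liftAlgHom F _ (RingQuot.mkAlgHom F (QRel v) _) = _
  rw [RingQuot.liftAlgHom_mkAlgHom_apply]
  simp [qV]

theorem induction {P : QDual v → Prop} (hS : ∀ s, P (ofS v s)) (hV : ∀ f, P (gen v f))
    (hmul : ∀ x y, P x → P y → P (x * y)) (hadd : ∀ x y, P x → P y → P (x + y))
    (x : QDual v) : P x := by
  obtain ⟨t, rfl⟩ := RingQuot.mkAlgHom_surjective F (QRel v) x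
  change P (mk v t)
  induction t using TensorAlgebra.induction with
  | algebraMap c =>
    rw [AlgHom.commutes, ← AlgHom.commutes (ofS v)]
    exact hS _
  | ι m =>
    have : TensorAlgebra.ι F m = qS ℬ r m.1 + qV ℬ r m.2 := by
      simp [qS, qV, ← map_add]
    rw [this, map_add]
    exact hadd _ _ (hS _) (hV _)
  | mul a b ha hb => rw [map_mul]; exact hmul _ _ ha hb
  | add a b ha hb => rw [map_add]; exact hadd _ _ ha hb

/-- The degree `n` part of `B^!`, spanned by the products `s f_1 ⋯ f_n` with `s` in `S` and
`f_1, …, f_n` in `V^*`. -/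
def natGr (n : ℕ) : Submodule F (QDual v) :=
  LinearMap.range (ofS v).toLinearMap * LinearMap.range (gen v) ^ n

theorem genRange_mul_ofSRange :
    LinearMap.range (gen v) * LinearMap.range (ofS v).toLinearMap ≤
      LinearMap.range (ofS v).toLinearMap * LinearMap.range (gen v) := by
  rw [Submodule.mul_le]
  rintro _ ⟨f, rfl⟩ _ ⟨s, rfl⟩
  have h : gen v f * ofS v s = ofS v 1 * gen v (f ∘ₗ v.lV s) := by
    rw [map_one, one_mul, gen_mul_ofS]
  change gen v f * ofS v s ∈ _
  rw [h]
  exact Submodule.mul_mem_mul ⟨1, rfl⟩ ⟨_, rfl⟩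

theorem ofSRange_mul :
    LinearMap.range (ofS v).toLinearMap * LinearMap.range (ofS v).toLinearMap ≤
      LinearMap.range (ofS v).toLinearMap := by
  rw [Submodule.mul_le]
  rintro _ ⟨s, rfl⟩ _ ⟨t, rfl⟩
  exact ⟨s * t, map_mul (ofS v) s t⟩

theorem genRange_pow_mul (n : ℕ) :
    LinearMap.range (gen v) ^ n * LinearMap.range (ofS v).toLinearMap ≤
      LinearMap.range (ofS v).toLinearMap * LinearMap.range (gen v) ^ n := by
  induction n with
  | zero => simp
  | succ n ih =>
    calc LinearMap.range (gen v) ^ (n + 1) * LinearMap.range (ofS v).toLinearMap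
        = LinearMap.range (gen v) ^ n *
          (LinearMap.range (gen v) * LinearMap.range (ofS v).toLinearMap) := by
            rw [pow_succ, mul_assoc]
      _ ≤ LinearMap.range (gen v) ^ n *
          (LinearMap.range (ofS v).toLinearMap * LinearMap.range (gen v)) :=
            mul_le_mul' le_rfl (genRange_mul_ofSRange v)
      _ = LinearMap.range (gen v) ^ n * LinearMap.range (ofS v).toLinearMap *
          LinearMap.range (gen v) := by rw [mul_assoc]
      _ ≤ LinearMap.range (ofS v).toLinearMap * LinearMap.range (gen v) ^ n *
          LinearMap.range (gen v) := mul_le_mul' ih le_rfl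
      _ = _ := by rw [mul_assoc, ← pow_succ]

theorem natGr_mul (m n : ℕ) : natGr v m * natGr v n ≤ natGr v (m + n) := by
  unfold natGr
  calc _ = LinearMap.range (ofS v).toLinearMap * (LinearMap.range (gen v) ^ m *
          LinearMap.range (ofS v).toLinearMap) * LinearMap.range (gen v) ^ n := by
        simp only [mul_assoc]
    _ ≤ LinearMap.range (ofS v).toLinearMap * (LinearMap.range (ofS v).toLinearMap *
          LinearMap.range (gen v) ^ m) * LinearMap.range (gen v) ^ n :=
        mul_le_mul' (mul_le_mul' le_rfl (genRange_pow_mul v m)) le_rfl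
    _ = (LinearMap.range (ofS v).toLinearMap * LinearMap.range (ofS v).toLinearMap) *
          LinearMap.range (gen v) ^ (m + n) := by rw [pow_add]; simp only [mul_assoc]
    _ ≤ _ := mul_le_mul' (ofSRange_mul v) le_rfl

theorem one_mem_natGr : (1 : QDual v) ∈ natGr v 0 := by
  rw [natGr, pow_zero, mul_one]
  exact ⟨1, map_one (ofS v)⟩

theorem ofS_mem (s : Fin r → F) : ofS v s ∈ natGr v 0 := by
  rw [natGr, pow_zero, mul_one]
  exact ⟨s, rfl⟩

theorem gen_mem (f : VDual ℬ) : gen v f ∈ natGr v 1 := by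
  rw [natGr, pow_one, ← one_mul (gen v f), ← map_one (ofS v)]
  exact Submodule.mul_mem_mul ⟨1, rfl⟩ ⟨f, rfl⟩

/-- The algebra map `B^! → B^![T]` which multiplies an element of degree `n` by `T ^ n`. -/
def coact : QDual v →ₐ[F] Polynomial (QDual v) :=
  lift v ((Polynomial.CAlgHom).comp (ofS v)) (LinearMap.restrictScalars F
      (Polynomial.monomial (R := QDual v) 1) ∘ₗ gen v)
    (fun s f => by simp [Polynomial.C_mul_monomial, ofS_mul_gen])
    (fun s f => by simp [Polynomial.monomial_mul_C, gen_mul_ofS])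
    (fun t ht => by
      have : TensorProduct.lift ((LinearMap.mul F (Polynomial (QDual v))).compl₁₂
          (LinearMap.restrictScalars F (Polynomial.monomial (R := QDual v) 1) ∘ₗ gen v)
          (LinearMap.restrictScalars F (Polynomial.monomial (R := QDual v) 1) ∘ₗ gen v)) =
          LinearMap.restrictScalars F (Polynomial.monomial (R := QDual v) 2) ∘ₗ gen2 v :=
        TensorProduct.ext' fun f g => by simp [gen2, Polynomial.monomial_mul_monomial]
      rw [this, LinearMap.comp_apply, gen2_eq_zero v t ht, map_zero])

theorem coact_gen (f : VDual ℬ) : coact v (gen v f) = Polynomial.monomial 1 (gen v f) :=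
  lift_gen v _ _ _ _ _ f

theorem coact_ofS (s : Fin r → F) : coact v (ofS v s) = Polynomial.C (ofS v s) :=
  lift_ofS v _ _ _ _ _ s

theorem coact_of_mem (n : ℕ) {x : QDual v} (hx : x ∈ natGr v n) :
    coact v x = Polynomial.monomial n x := by
  have hpow : ∀ n, ∀ y ∈ LinearMap.range (gen v) ^ n, coact v y = Polynomial.monomial n y := by
    intro n
    induction n with
    | zero =>
      intro y hy
      rw [pow_zero] at hy
      obtain ⟨c, rfl⟩ := Submodule.mem_one.1 hy
      rw [AlgHom.commutes]
      rfl
    | succ n ih =>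
      intro y hy
      rw [pow_succ] at hy
      refine Submodule.mul_induction_on hy ?_ ?_
      · rintro a ha _ ⟨f, rfl⟩
        rw [map_mul, ih a ha, coact_gen]
        simp [Polynomial.monomial_mul_monomial]
      · intro a b ha hb
        rw [map_add, ha, hb, map_add]
  refine Submodule.mul_induction_on hx ?_ ?_
  · rintro _ ⟨s, rfl⟩ y hy
    rw [map_mul, hpow n y hy]
    change coact v (ofS v s) * _ = Polynomial.monomial n (ofS v s * y)
    rw [coact_ofS, Polynomial.C_mul_monomial]
  · intro a b ha hb
    rw [map_add, ha, hb, map_add]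

theorem natGr_internal : DirectSum.IsInternal (natGr v) := by
  refine isInternal_of_proj (fun n =>
    LinearMap.restrictScalars F (Polynomial.lcoeff (QDual v) n) ∘ₗ (coact v).toLinearMap)
    ?_ ?_ ?_
  · intro n x hx
    simp [coact_of_mem v n hx]
  · intro n m hnm x hx
    simp [coact_of_mem v m hx, Polynomial.coeff_monomial, hnm.symm]
  · rw [eq_top_iff]
    rintro x -
    refine induction v (P := fun x => x ∈ ⨆ n, natGr v n) ?_ ?_ ?_ ?_ x
    · intro s
      exact Submodule.mem_iSup_of_mem 0 (ofS_mem v s)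
    · intro f
      exact Submodule.mem_iSup_of_mem 1 (gen_mem v f)
    · intro x y hx hy
      have h := Submodule.mul_mem_mul hx hy
      rw [Submodule.iSup_mul] at h
      have hle : ⨆ m, natGr v m * ⨆ n, natGr v n ≤ ⨆ n, natGr v n := by
        refine iSup_le fun m => ?_
        rw [Submodule.mul_iSup]
        exact iSup_le fun n => (natGr_mul v m n).trans (le_iSup (natGr v) (m + n))
      exact hle h
    · intro x y hx hy
      exact add_mem hx hy

instance : GradedAlgebra (natGr v) :=
  gradedAlgebraOfInternal _ (one_mem_natGr v)
    (fun m n _ _ ha hb => natGr_mul v m n (Submodule.mul_mem_mul ha hb)) (natGr_internal v)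

/-- The grading of `B^!`. -/
abbrev gr : ℤ → Submodule F (QDual v) := zgr (natGr v)

/-- The idempotents of `B^!` corresponding to those of `B`. -/
def vertices : VertexIdem (gr v) r where
  e i := ofS v (Pi.single i 1)
  complete := (CompleteOrthogonalIdempotents.single fun _ : Fin r => F).map (ofS v).toRingHom
  mem i := ofS_mem v _

theorem vertices_hom (s : Fin r → F) : (vertices v).hom s = ofS v s := by
  rw [VertexIdem.hom_apply]
  simp only [vertices, ← map_smul, ← map_sum]
  congr 1
  ext i
  simp [Finset.sum_apply, Pi.single_apply]

instance [FiniteDimensional F (ℬ 1)] (n : ℤ) : FiniteDimensional F (gr v n) := by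
  rcases n with n | n
  · have h1 : (LinearMap.range (ofS v).toLinearMap).FG := Module.Finite.iff_fg.1 inferInstance
    have h2 : (LinearMap.range (gen v)).FG := Module.Finite.iff_fg.1 inferInstance
    exact Module.Finite.iff_fg.2 (h1.mul (h2.pow n))
  · exact inferInstanceAs (FiniteDimensional F (⊥ : Submodule F (QDual v)))

end QDual

end QuadraticDual

/-! ## Twisted trivial extensions -/

section TrivialExtension

variable {F : Type u} [Field F] {B : Type u} [Ring B] [Algebra F B]
  (ℬ : ℤ → Submodule F B) [GradedAlgebra ℬ]

/-- The linear map with `ζ a = (-1) ^ i a` for `a` homogeneous of degree `i`. -/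
def zetaLin : B →ₗ[F] B :=
  DirectSum.toModule F ℤ B (fun i => ((Int.negOnePow i : ℤˣ) : ℤ) • (ℬ i).subtype) ∘ₗ
    (DirectSum.decomposeLinearEquiv ℬ).toLinearMap

theorem zetaLin_of_mem {i : ℤ} {a : B} (ha : a ∈ ℬ i) :
    zetaLin ℬ a = ((Int.negOnePow i : ℤˣ) : ℤ) • a := by
  simp only [zetaLin, LinearMap.comp_apply, LinearEquiv.coe_coe,
    DirectSum.decomposeLinearEquiv_apply]
  rw [DirectSum.decompose_of_mem ℬ ha]
  erw [DirectSum.toModule_lof F i]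
  rfl

/-- The automorphism `ζ` of a graded algebra, with `ζ a = (-1) ^ i a` for `a` homogeneous of
degree `i`. -/
def zeta : B →ₐ[F] B :=
  AlgHom.ofLinearMap (zetaLin ℬ)
    (by
      rw [zetaLin_of_mem ℬ (SetLike.GradedOne.one_mem (A := ℬ))]
      simp)
    (by
      intro x y
      refine homogeneous_induction (DirectSum.Decomposition.isInternal ℬ) ?_ ?_ ?_ x
      · intro i x hx
        refine homogeneous_induction (DirectSum.Decomposition.isInternal ℬ) ?_ ?_ ?_ y
        · intro j y hy
          rw [zetaLin_of_mem ℬ hx, zetaLin_of_mem ℬ hy, zetaLin_of_mem ℬ (gmul_mem hx hy),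
            Int.negOnePow_add, Units.val_mul, smul_mul_smul_comm]
        · simp
        · intro y y' hy hy'
          simp only [mul_add, map_add, hy, hy']
      · simp
      · intro x x' hx hx'
        simp only [add_mul, map_add, hx, hx'])

theorem zeta_mem {i : ℤ} {a : B} (ha : a ∈ ℬ i) : zeta ℬ a ∈ ℬ i := by
  change zetaLin ℬ a ∈ ℬ i
  rw [zetaLin_of_mem ℬ ha]
  exact zsmul_mem ha _

theorem zeta_pow_mem (d : ℕ) {i : ℤ} {a : B} (ha : a ∈ ℬ i) : (zeta ℬ ^ d) a ∈ ℬ i := by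
  induction d with
  | zero => simpa using ha
  | succ d ih =>
    rw [pow_succ']
    exact zeta_mem ℬ ih

/-- The graded dual of `B`: the linear functionals which vanish on all but finitely many
components. If `B` is finite-dimensional then this is the full dual space `B^*`. -/
def gradedDual : Submodule F (Module.Dual F B) where
  carrier := {f | ∃ s : Finset ℤ, ∀ n ∉ s, ∀ x ∈ ℬ n, f x = 0}
  zero_mem' := ⟨∅, fun _ _ _ _ => rfl⟩
  add_mem' := by
    rintro f g ⟨s, hs⟩ ⟨t, ht⟩
    classical
    refine ⟨s ∪ t, fun n hn x hx => ?_⟩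
    rw [Finset.mem_union, not_or] at hn
    rw [LinearMap.add_apply, hs n hn.1 x hx, ht n hn.2 x hx, add_zero]
  smul_mem' := by
    rintro c f ⟨s, hs⟩
    exact ⟨s, fun n hn x hx => by rw [LinearMap.smul_apply, hs n hn x hx, smul_zero]⟩

theorem gradedDual_mulLeft {f : Module.Dual F B} (hf : f ∈ gradedDual ℬ) (b : B) :
    f ∘ₗ LinearMap.mulLeft F b ∈ gradedDual ℬ := by
  refine homogeneous_induction (DirectSum.Decomposition.isInternal ℬ) ?_ ?_ ?_ b
  · intro i b hb
    obtain ⟨s, hs⟩ := hf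
    refine ⟨s.image (fun n => n - i), fun n hn x hx => hs (i + n) (fun h => hn ?_) _
      (gmul_mem hb hx)⟩
    exact Finset.mem_image.2 ⟨i + n, h, by ring⟩
  · rw [LinearMap.mulLeft_zero_eq_zero, LinearMap.comp_zero]
    exact zero_mem _
  · intro x y hx hy
    have : f ∘ₗ LinearMap.mulLeft F (x + y) =
        f ∘ₗ LinearMap.mulLeft F x + f ∘ₗ LinearMap.mulLeft F y := by
      ext z
      simp [add_mul]
    rw [this]
    exact add_mem hx hy

theorem gradedDual_mulRight {f : Module.Dual F B} (hf : f ∈ gradedDual ℬ) (b : B) :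
    f ∘ₗ LinearMap.mulRight F b ∈ gradedDual ℬ := by
  refine homogeneous_induction (DirectSum.Decomposition.isInternal ℬ) ?_ ?_ ?_ b
  · intro i b hb
    obtain ⟨s, hs⟩ := hf
    refine ⟨s.image (fun n => n - i), fun n hn x hx => hs (n + i) (fun h => hn ?_) _
      (gmul_mem hx hb)⟩
    exact Finset.mem_image.2 ⟨n + i, h, by ring⟩
  · rw [LinearMap.mulRight_zero_eq_zero, LinearMap.comp_zero]
    exact zero_mem _
  · intro x y hx hy
    have : f ∘ₗ LinearMap.mulRight F (x + y) =
        f ∘ₗ LinearMap.mulRight F x + f ∘ₗ LinearMap.mulRight F y := by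
      ext z
      simp [mul_add]
    rw [this]
    exact add_mem hx hy

/-- The dual `B^*` as a `B`-`B`-bimodule with left action twisted by `ζ ^ d`, that is
`(a f b) (x) = f (b x ζ^d(a))`. -/
def TwDual (_d : ℕ) : Type u := gradedDual ℬ

namespace TwDual

variable (d : ℕ)

instance : AddCommGroup (TwDual ℬ d) := inferInstanceAs (AddCommGroup (gradedDual ℬ))

instance : Module F (TwDual ℬ d) := inferInstanceAs (Module F (gradedDual ℬ))

/-- The functional underlying an element of the twisted dual. -/
def val : TwDual ℬ d →ₗ[F] Module.Dual F B := (gradedDual ℬ).subtype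

variable {ℬ d} in
@[ext]
theorem ext {f g : TwDual ℬ d} (h : ∀ x, val ℬ d f x = val ℬ d g x) : f = g :=
  Subtype.ext (LinearMap.ext h)

instance : SMul B (TwDual ℬ d) :=
  ⟨fun a f => ⟨val ℬ d f ∘ₗ LinearMap.mulRight F ((zeta ℬ ^ d) a),
    gradedDual_mulRight ℬ f.2 _⟩⟩

instance : SMul Bᵐᵒᵖ (TwDual ℬ d) :=
  ⟨fun b f => ⟨val ℬ d f ∘ₗ LinearMap.mulLeft F b.unop, gradedDual_mulLeft ℬ f.2 _⟩⟩

@[simp]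
theorem smul_val (a : B) (f : TwDual ℬ d) (x : B) :
    val ℬ d (a • f) x = val ℬ d f (x * (zeta ℬ ^ d) a) := rfl

@[simp]
theorem op_smul_val (b : Bᵐᵒᵖ) (f : TwDual ℬ d) (x : B) :
    val ℬ d (b • f) x = val ℬ d f (b.unop * x) := rfl

instance : Module B (TwDual ℬ d) where
  one_smul f := by ext x; simp
  mul_smul a b f := by ext x; simp [mul_assoc]
  smul_zero a := by ext x; simp
  smul_add a f g := by ext x; simp
  add_smul a b f := by ext x; simp [mul_add]
  zero_smul f := by ext x; simp

instance : Module Bᵐᵒᵖ (TwDual ℬ d) where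
  one_smul f := by ext x; simp
  mul_smul a b f := by ext x; simp [mul_assoc]
  smul_zero a := by ext x; simp
  smul_add a f g := by ext x; simp
  add_smul a b f := by ext x; simp [add_mul]
  zero_smul f := by ext x; simp

instance : SMulCommClass B Bᵐᵒᵖ (TwDual ℬ d) :=
  ⟨fun a b f => by ext x; simp [mul_assoc]⟩

instance : IsScalarTower F B (TwDual ℬ d) :=
  ⟨fun c a f => by ext x; simp⟩

instance : IsScalarTower F Bᵐᵒᵖ (TwDual ℬ d) :=
  ⟨fun c a f => by ext x; simp⟩

end TwDual

/-- The `(d + 1)`-trivial extension of `B`: the vector space `B ⊕ B^*` with the multiplication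
`(a, f) (b, g) = (a b, f b + ζ^d(a)·g)`, that is `(a b, f b + (-1) ^ (d i) a g)` for `a` of
degree `i`. -/
def Triv (d : ℕ) : Type u := TrivSqZeroExt B (TwDual ℬ d)

namespace Triv

variable (d : ℕ)

instance : Ring (Triv ℬ d) := inferInstanceAs (Ring (TrivSqZeroExt B (TwDual ℬ d)))

instance : Algebra F (Triv ℬ d) := inferInstanceAs (Algebra F (TrivSqZeroExt B (TwDual ℬ d)))

/-- The inclusion of `B` as a subalgebra. -/
def inl : B →ₐ[F] Triv ℬ d := TrivSqZeroExt.inlAlgHom F B (TwDual ℬ d)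

/-- The component in `B`. -/
def fst : Triv ℬ d →ₗ[F] B := TrivSqZeroExt.fstHom F B (TwDual ℬ d) |>.toLinearMap

/-- The component in `B^*`. -/
def snd : Triv ℬ d →ₗ[F] TwDual ℬ d := TrivSqZeroExt.sndHom B (TwDual ℬ d) |>.restrictScalars F

@[simp] theorem fst_inl (b : B) : fst ℬ d (inl ℬ d b) = b := rfl

@[simp] theorem snd_inl (b : B) : snd ℬ d (inl ℬ d b) = 0 := rfl

@[simp] theorem fst_one : fst ℬ d 1 = 1 := rfl

@[simp] theorem snd_one : snd ℬ d 1 = 0 := rfl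

@[simp] theorem fst_mul (x y : Triv ℬ d) : fst ℬ d (x * y) = fst ℬ d x * fst ℬ d y := rfl

theorem snd_mul (x y : Triv ℬ d) : snd ℬ d (x * y) =
    fst ℬ d x • snd ℬ d y + MulOpposite.op (fst ℬ d y) • snd ℬ d x := rfl

variable {ℬ d} in
theorem ext {x y : Triv ℬ d} (h1 : fst ℬ d x = fst ℬ d y) (h2 : snd ℬ d x = snd ℬ d y) :
    x = y := TrivSqZeroExt.ext h1 h2

/-- The grading of `B ⊕ B^*⟨-d-1⟩`: the degree `n` part of `B^*⟨-d-1⟩` is the dual space of the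
degree `d + 1 - n` part of `B`. -/
def gr (n : ℤ) : Submodule F (Triv ℬ d) where
  carrier := {x | fst ℬ d x ∈ ℬ n ∧
    ∀ k, k + n ≠ d + 1 → ∀ y ∈ ℬ k, TwDual.val ℬ d (snd ℬ d x) y = 0}
  zero_mem' := ⟨by rw [map_zero]; exact zero_mem _, fun k _ y _ => by simp⟩
  add_mem' := fun {a b} ha hb => ⟨by rw [map_add]; exact add_mem ha.1 hb.1, fun k hk y hy => by
    rw [map_add, map_add, LinearMap.add_apply, ha.2 k hk y hy, hb.2 k hk y hy, add_zero]⟩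
  smul_mem' := fun c a ha => ⟨by rw [map_smul]; exact Submodule.smul_mem _ _ ha.1,
    fun k hk y hy => by
      rw [map_smul, map_smul, LinearMap.smul_apply, ha.2 k hk y hy, smul_zero]⟩

theorem inl_mem {n : ℤ} {b : B} (hb : b ∈ ℬ n) : inl ℬ d b ∈ gr ℬ d n :=
  ⟨hb, fun _ _ _ _ => by simp⟩

/-- The projections to the homogeneous components. -/
def prj (n : ℤ) : Triv ℬ d →ₗ[F] Triv ℬ d where
  toFun x := TrivSqZeroExt.inl
      (component (DirectSum.Decomposition.isInternal ℬ) n (fst ℬ d x) : B) +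
    TrivSqZeroExt.inr (⟨TwDual.val ℬ d (snd ℬ d x) ∘ₗ (ℬ (d + 1 - n)).subtype ∘ₗ
      component (DirectSum.Decomposition.isInternal ℬ) (d + 1 - n),
      ⟨{(d + 1 - n : ℤ)}, fun k hk y hy => by
        rw [Finset.mem_singleton] at hk
        simp [component_of_mem_ne _ hk hy]⟩⟩ : gradedDual ℬ)
  map_add' x y := by
    refine ext ?_ ?_
    · change (component _ n (fst ℬ d (x + y)) : B) + 0 =
        ((component _ n (fst ℬ d x) : B) + 0) + ((component _ n (fst ℬ d y) : B) + 0)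
      simp
    · refine TwDual.ext fun z => ?_
      change (0 : F) + TwDual.val ℬ d (snd ℬ d (x + y)) _ =
        (0 + TwDual.val ℬ d (snd ℬ d x) _) + (0 + TwDual.val ℬ d (snd ℬ d y) _)
      simp
  map_smul' c x := by
    refine ext ?_ ?_
    · change (component _ n (fst ℬ d (c • x)) : B) + 0 =
        c • ((component _ n (fst ℬ d x) : B) + 0)
      simp
    · refine TwDual.ext fun z => ?_
      change (0 : F) + TwDual.val ℬ d (snd ℬ d (c • x)) _ =
        c • ((0 : F) + TwDual.val ℬ d (snd ℬ d x) _)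
      simp

theorem fst_prj (n : ℤ) (x : Triv ℬ d) : fst ℬ d (prj ℬ d n x) =
    component (DirectSum.Decomposition.isInternal ℬ) n (fst ℬ d x) := by
  change (component _ n (fst ℬ d x) : B) + 0 = _
  rw [add_zero]

theorem snd_prj (n : ℤ) (x : Triv ℬ d) (z : B) :
    TwDual.val ℬ d (snd ℬ d (prj ℬ d n x)) z = TwDual.val ℬ d (snd ℬ d x)
      (component (DirectSum.Decomposition.isInternal ℬ) (d + 1 - n) z) := by
  change (0 : F) + TwDual.val ℬ d (snd ℬ d x) _ = _
  rw [zero_add]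
  rfl

theorem prj_mem (n : ℤ) (x : Triv ℬ d) : prj ℬ d n x ∈ gr ℬ d n := by
  refine ⟨?_, fun k hk y hy => ?_⟩
  · rw [fst_prj]
    exact Subtype.mem _
  · rw [snd_prj, component_of_mem_ne _ (by omega) hy]
    simp

theorem gr_internal : DirectSum.IsInternal (gr ℬ d) := by
  have hB := DirectSum.Decomposition.isInternal ℬ
  refine isInternal_of_proj (prj ℬ d) ?_ ?_ ?_
  · intro n x hx
    refine ext ?_ (TwDual.ext fun z => ?_)
    · rw [fst_prj, component_of_mem hB hx.1]
    · rw [snd_prj]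
      refine homogeneous_induction hB ?_ ?_ ?_ z
      · intro i z hz
        by_cases h : i = d + 1 - n
        · subst h
          rw [component_of_mem hB hz]
        · rw [component_of_mem_ne hB h hz, hx.2 i (by omega) z hz]
          simp
      · simp
      · intro y z hy hz
        simp only [map_add, Submodule.coe_add, hy, hz]
  · intro n m hnm x hx
    refine ext ?_ (TwDual.ext fun z => ?_)
    · rw [fst_prj, component_of_mem_ne hB hnm.symm hx.1]
      simp
    · rw [snd_prj, hx.2 _ (by omega) _ (Subtype.mem _)]
      simp
  · rw [eq_top_iff]
    rintro x -
    classical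
    obtain ⟨s, hs⟩ := (snd ℬ d x).2
    have h1 : ∃ t : Finset ℤ, ∑ n ∈ t, (component hB n (fst ℬ d x) : B) = fst ℬ d x ∧
        ∀ n ∉ t, component hB n (fst ℬ d x) = 0 := by
      refine ⟨(DirectSum.decompose ℬ (fst ℬ d x)).support, ?_, fun n hn => ?_⟩
      · simp only [component_eq_decompose]
        exact DirectSum.sum_support_decompose ℬ (fst ℬ d x)
      · rw [component_eq_decompose]
        simpa using hn
    obtain ⟨t, ht, ht'⟩ := h1
    have hx : x = ∑ n ∈ t ∪ s.image (fun k => d + 1 - k), prj ℬ d n x := by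
      refine ext ?_ (TwDual.ext fun z => ?_)
      · rw [map_sum]
        simp only [fst_prj]
        rw [← Finset.sum_subset Finset.subset_union_left
          (fun n _ hn => by rw [ht' n hn]; rfl), ht]
      · rw [map_sum, map_sum, LinearMap.sum_apply]
        simp only [snd_prj]
        refine homogeneous_induction hB ?_ ?_ ?_ z
        · intro i z hz
          by_cases hi : i ∈ s
          · rw [Finset.sum_eq_single ((d : ℤ) + 1 - i)]
            · have : (d : ℤ) + 1 - (d + 1 - i) = i := by ring
              rw [this, component_of_mem hB hz]
            · intro j _ hj
              rw [component_of_mem_ne hB (by omega) hz]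
              simp
            · intro h
              exact absurd (Finset.mem_union_right _ (Finset.mem_image_of_mem _ hi)) h
          · have h0 := hs i hi
            have h0' : ∀ y ∈ ℬ i, TwDual.val ℬ d (snd ℬ d x) y = 0 := h0
            rw [h0' z hz, Finset.sum_eq_zero]
            intro n _
            by_cases h : i = d + 1 - n
            · subst h
              exact h0' _ (Subtype.mem _)
            · rw [component_of_mem_ne hB h hz]
              simp
        · simp
        · intro y z hy hz
          simp only [map_add, Submodule.coe_add, hy, hz, Finset.sum_add_distrib]
    rw [hx]
    exact sum_mem fun n _ => Submodule.mem_iSup_of_mem n (prj_mem ℬ d n x)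

instance : GradedAlgebra (gr ℬ d) :=
  gradedAlgebraOfInternal _ ⟨SetLike.GradedOne.one_mem (A := ℬ), fun _ _ _ _ => rfl⟩
    (fun i j a b ha hb => ⟨gmul_mem ha.1 hb.1, fun k hk y hy => by
      rw [snd_mul, map_add, LinearMap.add_apply, TwDual.smul_val, TwDual.op_smul_val,
        MulOpposite.unop_op, hb.2 (k + i) (by omega) _ (gmul_mem hy (zeta_pow_mem ℬ d ha.1)),
        ha.2 (j + k) (by omega) _ (gmul_mem hb.1 hy), add_zero]⟩)
    (gr_internal ℬ d)

/-- The idempotents of the trivial extension. -/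
def vertices {r : ℕ} (v : VertexIdem ℬ r) : VertexIdem (gr ℬ d) r where
  e i := inl ℬ d (v.e i)
  complete := v.complete.map (inl ℬ d).toRingHom
  mem i := inl_mem ℬ d (v.mem i)

instance [∀ n, FiniteDimensional F (ℬ n)] (n : ℤ) : FiniteDimensional F (gr ℬ d n) := by
  have hB := DirectSum.Decomposition.isInternal ℬ
  let φ : gr ℬ d n →ₗ[F] ℬ n × Module.Dual F (ℬ (d + 1 - n)) :=
    (LinearMap.codRestrict (ℬ n) (fst ℬ d ∘ₗ (gr ℬ d n).subtype) fun x => x.2.1).prod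
      (LinearMap.lcomp F F (ℬ (d + 1 - n)).subtype ∘ₗ TwDual.val ℬ d ∘ₗ snd ℬ d ∘ₗ
        (gr ℬ d n).subtype)
  refine Module.Finite.of_injective φ ((injective_iff_map_eq_zero φ).2 fun x hx => ?_)
  have hx1 : fst ℬ d x.1 = 0 := congrArg (fun p => (p.1 : B)) hx
  have hx2 : ∀ y ∈ ℬ (d + 1 - n), TwDual.val ℬ d (snd ℬ d x.1) y = 0 := fun y hy =>
    LinearMap.congr_fun (congrArg Prod.snd hx) ⟨y, hy⟩
  refine Subtype.ext (ext ?_ (TwDual.ext fun z => ?_))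
  · rw [hx1]
    exact (map_zero _).symm
  · refine homogeneous_induction hB ?_ ?_ ?_ z
    · intro i z hz
      by_cases h : i = d + 1 - n
      · subst h
        exact hx2 z hz
      · exact x.2.2 i (by omega) z hz
    · rw [map_zero, map_zero]
    · intro y z hy hz
      rw [map_add, map_add, hy, hz]

end Triv

end TrivialExtension

/-! ## The functor `Q` -/

section DualBases

variable {F : Type u} [Field F] {V : Type u} [AddCommGroup V] [Module F V]

theorem sum_basis_comp {ι : Type} [Fintype ι] (b : Module.Basis ι F V) {P : Type u}
    [AddCommGroup P] [Module F P] (Ψ : V →ₗ[F] Module.Dual F V →ₗ[F] P) (T : V →ₗ[F] V) :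
    ∑ β, Ψ (T (b β)) (b.coord β) = ∑ β, Ψ (b β) (b.coord β ∘ₗ T) := by
  have h1 : ∀ β, Ψ (T (b β)) (b.coord β) =
      ∑ γ, b.coord γ (T (b β)) • Ψ (b γ) (b.coord β) := fun β => by
    conv_lhs => rw [← b.sum_repr (T (b β))]
    rw [map_sum, LinearMap.sum_apply]
    simp only [map_smul, LinearMap.smul_apply, Module.Basis.coord_apply]
  have h2 : ∀ γ, b.coord γ ∘ₗ T = ∑ β, b.coord γ (T (b β)) • b.coord β := fun γ => by
    refine b.ext fun δ => ?_
    classical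
    simp [LinearMap.sum_apply, Finsupp.single_apply]
  simp only [h1]
  rw [Finset.sum_comm]
  refine Finset.sum_congr rfl fun γ _ => ?_
  rw [h2 γ, map_sum]
  simp

end DualBases

section QFunctor

variable {F : Type u} [Field F] {A : Type u} [Ring A] [Algebra F A]
  {𝒜 : ℤ → Submodule F A} [GradedAlgebra 𝒜] [FiniteDimensional F (𝒜 1)] {r : ℕ}

/-- A basis `v_β` of the degree `1` part of `A`. -/
def basisV (𝒜 : ℤ → Submodule F A) [FiniteDimensional F (𝒜 1)] :
    Module.Basis (Fin (Module.finrank F (𝒜 1))) F (𝒜 1) := Module.finBasis F (𝒜 1)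

theorem pairVV_sum (v : VertexIdem 𝒜 r) (ψ : Module.Dual F (𝒜 1 ⊗[F] 𝒜 1)) (x y : 𝒜 1) :
    pairVV v (∑ β, ∑ γ, ψ (basisV 𝒜 γ ⊗ₜ basisV 𝒜 β) •
      ((basisV 𝒜).coord β ⊗ₜ[F] (basisV 𝒜).coord γ)) (x ⊗ₜ y) =
    ∑ k, ψ (v.rV (Pi.single k 1) x ⊗ₜ v.lV (Pi.single k 1) y) := by
  simp only [map_sum, map_smul, LinearMap.sum_apply, LinearMap.smul_apply, pairVV_tmul]
  simp only [Finset.smul_sum]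
  have h : ∀ x y : 𝒜 1, ψ (x ⊗ₜ y) = ∑ β, ∑ γ, ψ (basisV 𝒜 γ ⊗ₜ basisV 𝒜 β) •
      ((basisV 𝒜).coord γ x * (basisV 𝒜).coord β y) := fun x y => by
    conv_lhs => rw [← (basisV 𝒜).sum_repr x, ← (basisV 𝒜).sum_repr y]
    simp only [TensorProduct.sum_tmul, TensorProduct.tmul_sum, map_sum,
      TensorProduct.smul_tmul_smul, map_smul, smul_eq_mul, Module.Basis.coord_apply]
    refine Finset.sum_congr rfl fun β _ => Finset.sum_congr rfl fun γ _ => ?_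
    ring
  simp only [h (v.rV _ x) (v.lV _ y)]
  symm
  rw [Finset.sum_comm]
  refine Finset.sum_congr rfl fun β _ => ?_
  rw [Finset.sum_comm]

/-- The quadratic relations are orthogonal to their dual relations. -/
theorem pairVV_sum_ker (v : VertexIdem 𝒜 r) (ψ : Module.Dual F (𝒜 1 ⊗[F] 𝒜 1))
    (hψ : ∀ z ∈ LinearMap.ker (mulVV 𝒜), ψ z = 0) (z : 𝒜 1 ⊗[F] 𝒜 1)
    (hz : z ∈ LinearMap.ker (mulVV 𝒜)) :
    pairVV v (∑ β, ∑ γ, ψ (basisV 𝒜 γ ⊗ₜ basisV 𝒜 β) •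
      ((basisV 𝒜).coord β ⊗ₜ[F] (basisV 𝒜).coord γ)) z = 0 := by
  let q : (𝒜 1 ⊗[F] 𝒜 1) →ₗ[F] (𝒜 1 ⊗[F] 𝒜 1) :=
    ∑ k, TensorProduct.map (v.rV (Pi.single k 1)) (v.lV (Pi.single k 1))
  have h1 : pairVV v (∑ β, ∑ γ, ψ (basisV 𝒜 γ ⊗ₜ basisV 𝒜 β) •
      ((basisV 𝒜).coord β ⊗ₜ[F] (basisV 𝒜).coord γ)) = ψ ∘ₗ q :=
    TensorProduct.ext' fun x y => by
      rw [pairVV_sum]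
      simp [q, LinearMap.sum_apply]
  have h2 : mulVV 𝒜 ∘ₗ q = mulVV 𝒜 := TensorProduct.ext' fun x y => by
    simp only [q, LinearMap.comp_apply, LinearMap.sum_apply, TensorProduct.map_tmul, map_sum]
    simp only [mulVV, TensorProduct.lift.tmul, LinearMap.compl₁₂_apply, LinearMap.mul_apply',
      Submodule.subtype_apply, VertexIdem.coe_rV, VertexIdem.coe_lV, VertexIdem.hom_single]
    have : ∀ k, (x : A) * v.e k * (v.e k * (y : A)) = x * v.e k * y := fun k => by
      rw [mul_assoc, ← mul_assoc (v.e k), (v.complete.idem k).eq, mul_assoc]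
    simp only [this]
    rw [← Finset.sum_mul, ← Finset.mul_sum, v.complete.complete, mul_one]
  rw [h1, LinearMap.comp_apply]
  refine hψ _ ?_
  rw [LinearMap.mem_ker, ← LinearMap.comp_apply, h2]
  exact hz

theorem sum_quad (v : VertexIdem 𝒜 r) {P : Type u} [AddCommGroup P] [Module F P]
    (Φ : A →ₗ[F] QDual v →ₗ[F] P) :
    ∑ β, ∑ γ, Φ ((basisV 𝒜 γ : A) * (basisV 𝒜 β : A))
      (QDual.gen v ((basisV 𝒜).coord β) * QDual.gen v ((basisV 𝒜).coord γ)) = 0 := by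
  let D := LinearMap.range (mulVV 𝒜)
  let b := Module.finBasis F D
  have hm : ∀ β γ, (basisV 𝒜 γ : A) * (basisV 𝒜 β : A) =
      ∑ i, b.coord i (LinearMap.rangeRestrict (mulVV 𝒜) (basisV 𝒜 γ ⊗ₜ basisV 𝒜 β)) •
        (b i : A) := fun β γ => by
    have := congrArg (Subtype.val) (b.sum_repr
      (LinearMap.rangeRestrict (mulVV 𝒜) (basisV 𝒜 γ ⊗ₜ basisV 𝒜 β)))
    rw [AddSubmonoidClass.coe_finsetSum] at this
    exact this.symm
  have h0 : ∀ i, ∑ β, ∑ γ,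
      b.coord i (LinearMap.rangeRestrict (mulVV 𝒜) (basisV 𝒜 γ ⊗ₜ basisV 𝒜 β)) •
      (QDual.gen v ((basisV 𝒜).coord β) * QDual.gen v ((basisV 𝒜).coord γ)) = 0 := fun i => by
    have := QDual.gen2_eq_zero v _ (pairVV_sum_ker v
      (b.coord i ∘ₗ LinearMap.rangeRestrict (mulVV 𝒜)) (fun z hz => by
        have : LinearMap.rangeRestrict (mulVV 𝒜) z = 0 := Subtype.ext hz
        rw [LinearMap.comp_apply, this, map_zero]))
    simpa [QDual.gen2] using this
  simp only [hm, map_sum, map_smul, LinearMap.sum_apply, LinearMap.smul_apply]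
  have : ∀ i, ∑ β, ∑ γ,
      b.coord i (LinearMap.rangeRestrict (mulVV 𝒜) (basisV 𝒜 γ ⊗ₜ basisV 𝒜 β)) •
      Φ (b i : A)
        (QDual.gen v ((basisV 𝒜).coord β) * QDual.gen v ((basisV 𝒜).coord γ)) = 0 := fun i => by
    have := congrArg (Φ (b i : A)) (h0 i)
    simpa only [map_sum, map_smul, map_zero] using this
  rw [← Finset.sum_eq_zero (s := Finset.univ) (fun i _ => this i)]
  symm
  rw [Finset.sum_comm]
  refine Finset.sum_congr rfl fun β _ => ?_
  rw [Finset.sum_comm]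

theorem sum_left (v : VertexIdem 𝒜 r) {P : Type u} [AddCommGroup P] [Module F P]
    (Φ : A →ₗ[F] QDual v →ₗ[F] P) (s : Fin r → F) :
    ∑ β, Φ (v.hom s * (basisV 𝒜 β : A)) (QDual.gen v ((basisV 𝒜).coord β)) =
    ∑ β, Φ (basisV 𝒜 β : A) (QDual.gen v ((basisV 𝒜).coord β) * QDual.ofS v s) := by
  simp only [QDual.gen_mul_ofS]
  exact sum_basis_comp (basisV 𝒜) (Φ.compl₁₂ (𝒜 1).subtype (QDual.gen v)) (v.lV s)

theorem sum_right (v : VertexIdem 𝒜 r) {P : Type u} [AddCommGroup P] [Module F P]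
    (Φ : A →ₗ[F] QDual v →ₗ[F] P) (s : Fin r → F) :
    ∑ β, Φ ((basisV 𝒜 β : A) * v.hom s) (QDual.gen v ((basisV 𝒜).coord β)) =
    ∑ β, Φ (basisV 𝒜 β : A) (QDual.ofS v s * QDual.gen v ((basisV 𝒜).coord β)) := by
  simp only [QDual.ofS_mul_gen]
  exact sum_basis_comp (basisV 𝒜) (Φ.compl₁₂ (𝒜 1).subtype (QDual.gen v)) (v.rV s)

end QFunctor

/-! ## Triple tensor products -/

namespace GrBimod

section Triple

variable {F : Type u} [Field F] {A B C D : Type u} [Ring A] [Algebra F A] [Ring B] [Algebra F B]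
  [Ring C] [Algebra F C] [Ring D] [Algebra F D] {𝒜 : ℤ → Submodule F A} {ℬ : ℤ → Submodule F B}
  {𝒞 : ℤ → Submodule F C} {𝒟 : ℤ → Submodule F D} [GradedAlgebra ℬ] [GradedAlgebra 𝒞]
  (M : GrBimod 𝒜 ℬ) (N : GrBimod ℬ 𝒞) (P : GrBimod 𝒞 𝒟)

/-- The element `a ⊗ x ⊗ b` of a triple tensor product. -/
def tmul3 : M.carrier →ₗ[F] N.carrier →ₗ[F] P.carrier →ₗ[F] ((M.tensor N).tensor P).carrier :=
  LinearMap.compr₂ (tmul M N) (tmul (M.tensor N) P)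

theorem tmul3_apply (a : M.carrier) (x : N.carrier) (b : P.carrier) :
    tmul3 M N P a x b = tmul (M.tensor N) P (tmul M N a x) b := rfl

theorem tmul3_left (a : M.carrier) (s : B) (x : N.carrier) (b : P.carrier) :
    tmul3 M N P (M.R (MulOpposite.op s) a) x b = tmul3 M N P a (N.L s x) b := by
  rw [tmul3_apply, tmul3_apply, tmul_balanced]

theorem tmul3_right (a : M.carrier) (s : C) (x : N.carrier) (b : P.carrier) :
    tmul3 M N P a (N.R (MulOpposite.op s) x) b = tmul3 M N P a x (P.L s b) := by
  rw [tmul3_apply, tmul3_apply, ← tensor_R, tmul_balanced]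

theorem tmul3_L (c : A) (a : M.carrier) (x : N.carrier) (b : P.carrier) :
    ((M.tensor N).tensor P).L c (tmul3 M N P a x b) = tmul3 M N P (M.L c a) x b := by
  rw [tmul3_apply, tmul3_apply, tensor_L, tensor_L]

theorem tmul3_R (c : Dᵐᵒᵖ) (a : M.carrier) (x : N.carrier) (b : P.carrier) :
    ((M.tensor N).tensor P).R c (tmul3 M N P a x b) = tmul3 M N P a x (P.R c b) := by
  rw [tmul3_apply, tmul3_apply, tensor_R]

theorem tmul3_mem {i j k : ℤ} {a : M.carrier} {x : N.carrier} {b : P.carrier}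
    (ha : a ∈ M.gr i) (hx : x ∈ N.gr j) (hb : b ∈ P.gr k) :
    tmul3 M N P a x b ∈ ((M.tensor N).tensor P).gr (i + j + k) := by
  rw [tmul3_apply]
  exact tmul_mem _ _ (tmul_mem _ _ ha hx) hb

variable {M N P}

/-- Homomorphisms out of a triple tensor product are given by balanced trilinear maps. -/
def homOfTensor3 {X : GrBimod 𝒜 𝒟}
    (f : M.carrier →ₗ[F] N.carrier →ₗ[F] P.carrier →ₗ[F] X.carrier)
    (hl : ∀ a s x b, f (M.R (MulOpposite.op s) a) x b = f a (N.L s x) b)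
    (hr : ∀ a s x b, f a (N.R (MulOpposite.op s) x) b = f a x (P.L s b))
    (hL : ∀ c a x b, f (M.L c a) x b = X.L c (f a x b))
    (hR : ∀ c a x b, f a x (P.R c b) = X.R c (f a x b))
    (hmem : ∀ i j k, ∀ a ∈ M.gr i, ∀ x ∈ N.gr j, ∀ b ∈ P.gr k, f a x b ∈ X.gr (i + j + k)) :
    (M.tensor N).tensor P ⟶ X :=
  homOfTensor (tdesc M N f (fun a s x => LinearMap.ext (hl a s x)))
    (fun m s b => by
      refine tmul_induction (fun a x => ?_) (by simp) ?_ m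
      · rw [tensor_R, tdesc_tmul, tdesc_tmul, hr]
      · intro y z hy hz
        simp only [map_add, LinearMap.add_apply, hy, hz])
    (fun c m b => by
      refine tmul_induction (fun a x => ?_) (by simp) ?_ m
      · rw [tensor_L, tdesc_tmul, tdesc_tmul, hL]
      · intro y z hy hz
        simp only [map_add, LinearMap.add_apply, hy, hz])
    (fun c m b => by
      refine tmul_induction (fun a x => ?_) (by simp) ?_ m
      · rw [tdesc_tmul, hR]
      · intro y z hy hz
        simp only [map_add, LinearMap.add_apply, hy, hz])
    (fun i j m hm b hb => by
      refine Submodule.span_induction (p := fun m _ => tdesc M N f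
        (fun a s x => LinearMap.ext (hl a s x)) m b ∈ X.gr (i + j)) ?_ ?_ ?_ ?_ hm
      · rintro _ ⟨k, l, rfl, a, ha, x, hx, rfl⟩
        have h1 : tdesc M N f (fun a s x => LinearMap.ext (hl a s x)) (tmul M N a x) b =
          f a x b := by rw [tdesc_tmul]
        exact (congrArg (· ∈ X.gr (k + l + j)) h1).mpr (hmem k l j a ha x hx b hb)
      · rw [map_zero, LinearMap.zero_apply]; exact zero_mem _
      · intro y z _ _ hy hz
        rw [map_add, LinearMap.add_apply]; exact add_mem hy hz
      · intro c y _ hy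
        rw [map_smul, LinearMap.smul_apply]; exact Submodule.smul_mem _ _ hy)

theorem homOfTensor3_tmul {X : GrBimod 𝒜 𝒟}
    (f : M.carrier →ₗ[F] N.carrier →ₗ[F] P.carrier →ₗ[F] X.carrier) (hl) (hr) (hL) (hR) (hmem)
    (a : M.carrier) (x : N.carrier) (b : P.carrier) :
    Hom.toLin (homOfTensor3 (X := X) f hl hr hL hR hmem) (tmul3 M N P a x b) = f a x b := by
  rw [homOfTensor3, tmul3_apply, homOfTensor_tmul, tdesc_tmul]

theorem tensor3_hom_ext {X : GrBimod 𝒜 𝒟} {f g : (M.tensor N).tensor P ⟶ X}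
    (h : ∀ a x b, Hom.toLin f (tmul3 M N P a x b) = Hom.toLin g (tmul3 M N P a x b)) :
    f = g := by
  refine tensor_hom_ext fun m b => ?_
  refine tmul_induction (fun a x => h a x b) (by simp) ?_ m
  intro y z hy hz
  simp only [map_add, LinearMap.add_apply, hy, hz]

end Triple

end GrBimod

namespace QFunctor

variable {F : Type u} [Field F] {A : Type u} [Ring A] [Algebra F A]
  {𝒜 : ℤ → Submodule F A} [GradedAlgebra 𝒜] {r : ℕ} (v : VertexIdem 𝒜 r)
  (M : GrBimod (QDual.gr v) (QDual.gr v))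

/-- The right action of the quadratic dual on a bimodule, as a bilinear map. -/
def actR : QDual v →ₗ[F] M.carrier →ₗ[F] M.carrier :=
  M.R.toLinearMap ∘ₗ (MulOpposite.opLinearEquiv F).toLinearMap

/-- The left action of the quadratic dual on a bimodule, as a bilinear map. -/
def actL : QDual v →ₗ[F] M.carrier →ₗ[F] M.carrier := M.L.toLinearMap

theorem actR_mul (c c' : QDual v) (m : M.carrier) :
    actR v M (c * c') m = actR v M c' (actR v M c m) :=
  LinearMap.congr_fun (map_mul M.R (MulOpposite.op c') (MulOpposite.op c)) m

theorem actL_mul (c c' : QDual v) (m : M.carrier) :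
    actL v M (c * c') m = actL v M c (actL v M c' m) :=
  LinearMap.congr_fun (map_mul M.L c c') m

theorem actR_one (m : M.carrier) : actR v M 1 m = m :=
  LinearMap.congr_fun (map_one M.R) m

theorem actL_one (m : M.carrier) : actL v M 1 m = m :=
  LinearMap.congr_fun (map_one M.L) m

theorem act_comm (c c' : QDual v) (m : M.carrier) :
    actL v M c (actR v M c' m) = actR v M c' (actL v M c m) :=
  M.comm c (MulOpposite.op c') m

theorem actR_mem {i j : ℤ} {c : QDual v} {m : M.carrier} (hc : c ∈ QDual.gr v i)
    (hm : m ∈ M.gr j) : actR v M c m ∈ M.gr (j + i) := M.R_mem hc hm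

theorem actL_mem {i j : ℤ} {c : QDual v} {m : M.carrier} (hc : c ∈ QDual.gr v i)
    (hm : m ∈ M.gr j) : actL v M c m ∈ M.gr (i + j) := M.L_mem hc hm

/-- For `c` in `A^!` and a functional `x` on `M_k` this is the functional `m ↦ x (m c)` on
`M_n` (where only the component of `m c` in `M_k` is used). -/
def dualR (k n : ℤ) : QDual v →ₗ[F] Module.Dual F (M.gr k) →ₗ[F] Module.Dual F (M.gr n) :=
  LinearMap.mk₂ F (fun c x => x ∘ₗ component M.internal k ∘ₗ actR v M c ∘ₗ (M.gr n).subtype)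
    (fun _ _ _ => by ext; simp) (fun _ _ _ => by ext; simp) (fun _ _ _ => by ext; simp)
    (fun _ _ _ => by ext; simp)

/-- For `c` in `A^!` and a functional `x` on `M_k` this is the functional `m ↦ x (c m)` on
`M_n` (where only the component of `c m` in `M_k` is used). -/
def dualL (k n : ℤ) : QDual v →ₗ[F] Module.Dual F (M.gr k) →ₗ[F] Module.Dual F (M.gr n) :=
  LinearMap.mk₂ F (fun c x => x ∘ₗ component M.internal k ∘ₗ actL v M c ∘ₗ (M.gr n).subtype)
    (fun _ _ _ => by ext; simp) (fun _ _ _ => by ext; simp) (fun _ _ _ => by ext; simp)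
    (fun _ _ _ => by ext; simp)

theorem dualR_apply {k n : ℤ} {c : QDual v} (x : Module.Dual F (M.gr k)) (m : M.gr n)
    (h : actR v M c m ∈ M.gr k) : dualR v M k n c x m = x ⟨actR v M c m, h⟩ := by
  change x (component M.internal k (actR v M c m)) = _
  rw [component_of_mem M.internal h]

theorem dualL_apply {k n : ℤ} {c : QDual v} (x : Module.Dual F (M.gr k)) (m : M.gr n)
    (h : actL v M c m ∈ M.gr k) : dualL v M k n c x m = x ⟨actL v M c m, h⟩ := by
  change x (component M.internal k (actL v M c m)) = _
  rw [component_of_mem M.internal h]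

theorem actR_mem' {i j k : ℤ} {c : QDual v} {m : M.carrier} (hc : c ∈ QDual.gr v i)
    (hm : m ∈ M.gr j) (h : j + i = k) : actR v M c m ∈ M.gr k := h ▸ actR_mem v M hc hm

theorem actL_mem' {i j k : ℤ} {c : QDual v} {m : M.carrier} (hc : c ∈ QDual.gr v i)
    (hm : m ∈ M.gr j) (h : j + i = k) : actL v M c m ∈ M.gr k :=
  h ▸ (add_comm i j) ▸ actL_mem v M hc hm

theorem dualR_dualR {i j l k n : ℤ} {c c' : QDual v} (hc : c ∈ QDual.gr v i)
    (hc' : c' ∈ QDual.gr v j) (h1 : k + i = l) (h2 : n + j = k) (x : Module.Dual F (M.gr l)) :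
    dualR v M k n c' (dualR v M l k c x) = dualR v M l n (c' * c) x := by
  ext m
  have h3 := actR_mem' v M hc' m.2 h2
  have h4 := actR_mem' v M hc h3 h1
  rw [dualR_apply v M _ _ h3, dualR_apply v M _ _ h4, dualR_apply v M _ _
    ((actR_mul v M c' c m).symm ▸ h4)]
  simp only [actR_mul]

theorem dualL_dualL {i j l k n : ℤ} {c c' : QDual v} (hc : c ∈ QDual.gr v i)
    (hc' : c' ∈ QDual.gr v j) (h1 : k + i = l) (h2 : n + j = k) (x : Module.Dual F (M.gr l)) :
    dualL v M k n c' (dualL v M l k c x) = dualL v M l n (c * c') x := by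
  ext m
  have h3 := actL_mem' v M hc' m.2 h2
  have h4 := actL_mem' v M hc h3 h1
  rw [dualL_apply v M _ _ h3, dualL_apply v M _ _ h4, dualL_apply v M _ _
    ((actL_mul v M c c' m).symm ▸ h4)]
  simp only [actL_mul]

theorem dualL_dualR {i j l k k' n : ℤ} {c c' : QDual v} (hc : c ∈ QDual.gr v i)
    (hc' : c' ∈ QDual.gr v j) (h1 : k + i = l) (h2 : n + j = k) (h3 : k' + j = l)
    (h4 : n + i = k') (x : Module.Dual F (M.gr l)) :
    dualL v M k n c' (dualR v M l k c x) = dualR v M k' n c (dualL v M l k' c' x) := by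
  ext m
  have g1 := actL_mem' v M hc' m.2 h2
  have g2 := actR_mem' v M hc g1 h1
  have g3 := actR_mem' v M hc m.2 h4
  have g4 := actL_mem' v M hc' g3 h3
  rw [dualL_apply v M _ _ g1, dualR_apply v M _ _ g2, dualR_apply v M _ _ g3,
    dualL_apply v M _ _ g4]
  simp only [act_comm]

theorem ofS_mem' (s : Fin r → F) : QDual.ofS v s ∈ QDual.gr v 0 := QDual.ofS_mem v s

theorem gen_mem' (f : VDual 𝒜) : QDual.gen v f ∈ QDual.gr v 1 := QDual.gen_mem v f

theorem dualR_one (n : ℤ) (x : Module.Dual F (M.gr n)) : dualR v M n n 1 x = x := by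
  ext m
  rw [dualR_apply v M _ _ (by rw [actR_one]; exact m.2)]
  simp only [actR_one]

theorem dualL_one (n : ℤ) (x : Module.Dual F (M.gr n)) : dualL v M n n 1 x = x := by
  ext m
  rw [dualL_apply v M _ _ (by rw [actL_one]; exact m.2)]
  simp only [actL_one]

/-- The left action `(s x) (m) = x (m s)` of `S` on `(M_n)^*`. -/
def dualCompL (n : ℤ) : (Fin r → F) →ₐ[F] Module.End F (Module.Dual F (M.gr n)) :=
  AlgHom.ofLinearMap (dualR v M n n ∘ₗ (QDual.ofS v).toLinearMap)
    (LinearMap.ext fun x => by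
      rw [LinearMap.comp_apply, AlgHom.toLinearMap_apply, map_one, dualR_one]; rfl)
    (fun s t => LinearMap.ext fun x => by
      rw [LinearMap.comp_apply, AlgHom.toLinearMap_apply, map_mul, Module.End.mul_apply]
      exact (dualR_dualR v M (ofS_mem' v t) (ofS_mem' v s) (add_zero n) (add_zero n) x).symm)

/-- The right action `(x s) (m) = x (s m)` of `S` on `(M_n)^*`. -/
def dualCompR (n : ℤ) : (Fin r → F)ᵐᵒᵖ →ₐ[F] Module.End F (Module.Dual F (M.gr n)) :=
  AlgHom.ofLinearMap (dualL v M n n ∘ₗ (QDual.ofS v).toLinearMap ∘ₗ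
      (MulOpposite.opLinearEquiv F).symm.toLinearMap)
    (LinearMap.ext fun x => by
      change dualL v M n n (QDual.ofS v 1) x = x
      rw [map_one, dualL_one])
    (fun s t => LinearMap.ext fun x => by
      change dualL v M n n (QDual.ofS v (t.unop * s.unop)) x =
        dualL v M n n (QDual.ofS v s.unop) (dualL v M n n (QDual.ofS v t.unop) x)
      rw [map_mul]
      exact (dualL_dualL v M (ofS_mem' v t.unop) (ofS_mem' v s.unop) (add_zero n)
        (add_zero n) x).symm)

/-- The dual space `(M_n)^*` as an `S`-`S`-bimodule, with `(s x t) (m) = x (t m s)`. It is placed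
in degree `n`, as the shift `⟨-n⟩` in the definition of `Q` prescribes. -/
def dualComp (n : ℕ) : GrBimod (conc F (Fin r → F) 0) (conc F (Fin r → F) 0) where
  carrier := Module.Dual F (M.gr n)
  L := dualCompL v M n
  R := dualCompR v M n
  comm s t x := by
    change dualR v M n n (QDual.ofS v s) (dualL v M n n (QDual.ofS v t.unop) x) =
      dualL v M n n (QDual.ofS v t.unop) (dualR v M n n (QDual.ofS v s) x)
    exact (dualL_dualR v M (ofS_mem' v s) (ofS_mem' v t.unop) (add_zero _) (add_zero _)
      (add_zero _) (add_zero _) x).symm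
  gr := conc F _ n
  internal := conc_internal _ _
  L_mem {i j s x} hs hx := by
    rcases mem_conc.1 hs with rfl | rfl
    · rcases mem_conc.1 hx with rfl | rfl
      · exact mem_conc.2 (Or.inl (zero_add _))
      · rw [map_zero]; exact zero_mem _
    · rw [map_zero, LinearMap.zero_apply]; exact zero_mem _
  R_mem {i j s x} hs hx := by
    rcases mem_conc.1 hs with rfl | rfl
    · rcases mem_conc.1 hx with rfl | rfl
      · exact mem_conc.2 (Or.inl (add_zero _))
      · rw [map_zero]; exact zero_mem _
    · rw [MulOpposite.op_zero, map_zero, LinearMap.zero_apply]; exact zero_mem _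

theorem dualComp_L (n : ℕ) (s : Fin r → F) (x : Module.Dual F (M.gr n)) :
    (dualComp v M n).L s x = dualR v M n n (QDual.ofS v s) x := rfl

theorem dualComp_R (n : ℕ) (s : Fin r → F) (x : Module.Dual F (M.gr n)) :
    (dualComp v M n).R (MulOpposite.op s) x = dualL v M n n (QDual.ofS v s) x := rfl

theorem conc_hom_mem (n : ℤ) (s : Fin r → F) (hs : s ∈ conc F (Fin r → F) 0 n) :
    v.hom s ∈ 𝒜 n := by
  rcases mem_conc.1 hs with rfl | rfl
  · exact v.hom_mem s
  · rw [map_zero]; exact zero_mem _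

/-- `A` as an `A`-`S`-bimodule. -/
def regAS : GrBimod 𝒜 (conc F (Fin r → F) 0) :=
  (GrBimod.regular 𝒜).restrict (AlgHom.id F A) (fun _ _ h => h) v.hom (conc_hom_mem v)

/-- `A` as an `S`-`A`-bimodule. -/
def regSA : GrBimod (conc F (Fin r → F) 0) 𝒜 :=
  (GrBimod.regular 𝒜).restrict v.hom (conc_hom_mem v) (AlgHom.id F A) (fun _ _ h => h)

/-- The terms `A ⊗_S (M_n)^* ⊗_S A ⟨-n⟩` of the complex `Q (M)`. -/
def QX (n : ℕ) : GrBimod 𝒜 𝒜 := (((regAS v).tensor (dualComp v M n)).tensor (regSA v))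

/-- The element `a ⊗ x ⊗ b` of `A ⊗_S (M_n)^* ⊗_S A`. -/
def tri (n : ℕ) : A →ₗ[F] Module.Dual F (M.gr n) →ₗ[F] A →ₗ[F] (QX v M n).carrier :=
  GrBimod.tmul3 (regAS v) (dualComp v M n) (regSA v)

theorem tri_left (n : ℕ) (a : A) (s : Fin r → F) (x : Module.Dual F (M.gr n)) (b : A) :
    tri v M n (a * v.hom s) x b = tri v M n a (dualR v M n n (QDual.ofS v s) x) b :=
  GrBimod.tmul3_left (regAS v) (dualComp v M n) (regSA v) a s x b

theorem tri_right (n : ℕ) (a : A) (s : Fin r → F) (x : Module.Dual F (M.gr n)) (b : A) :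
    tri v M n a (dualL v M n n (QDual.ofS v s) x) b = tri v M n a x (v.hom s * b) :=
  GrBimod.tmul3_right (regAS v) (dualComp v M n) (regSA v) a s x b

theorem tri_L (n : ℕ) (c a : A) (x : Module.Dual F (M.gr n)) (b : A) :
    (QX v M n).L c (tri v M n a x b) = tri v M n (c * a) x b :=
  GrBimod.tmul3_L (regAS v) (dualComp v M n) (regSA v) c a x b

theorem tri_R (n : ℕ) (c : Aᵐᵒᵖ) (a : A) (x : Module.Dual F (M.gr n)) (b : A) :
    (QX v M n).R c (tri v M n a x b) = tri v M n a x (b * c.unop) :=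
  GrBimod.tmul3_R (regAS v) (dualComp v M n) (regSA v) c a x b

theorem tri_mem (n : ℕ) {i j : ℤ} {a b : A} (x : Module.Dual F (M.gr n)) (ha : a ∈ 𝒜 i)
    (hb : b ∈ 𝒜 j) : tri v M n a x b ∈ (QX v M n).gr (i + n + j) :=
  GrBimod.tmul3_mem (regAS v) (dualComp v M n) (regSA v) (i := i) (j := n) (k := j) ha
    (mem_conc.2 (Or.inl rfl)) hb

/-- Homomorphisms out of `A ⊗_S (M_n)^* ⊗_S A` are given by balanced trilinear maps. -/
def homOfTri (n : ℕ) {P : GrBimod 𝒜 𝒜}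
    (f : A →ₗ[F] Module.Dual F (M.gr n) →ₗ[F] A →ₗ[F] P.carrier)
    (hl : ∀ a s x b, f (a * v.hom s) x b = f a (dualR v M n n (QDual.ofS v s) x) b)
    (hr : ∀ a s x b, f a (dualL v M n n (QDual.ofS v s) x) b = f a x (v.hom s * b))
    (hL : ∀ c a x b, f (c * a) x b = P.L c (f a x b))
    (hR : ∀ c a x b, f a x (b * MulOpposite.unop c) = P.R c (f a x b))
    (hmem : ∀ i j, ∀ a ∈ 𝒜 i, ∀ x, ∀ b ∈ 𝒜 j, f a x b ∈ P.gr (i + n + j)) :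
    QX v M n ⟶ P :=
  GrBimod.homOfTensor3 (M := regAS v) (N := dualComp v M n) (P := regSA v) (X := P) f hl hr hL hR
    (fun i j k a ha x hx b hb => by
      rcases mem_conc.1 hx with rfl | h
      · exact hmem i k a ha x b hb
      · subst h
        have : f a 0 b = 0 := LinearMap.congr_fun (map_zero (f a)) b
        exact (congrArg (· ∈ P.gr (i + j + k)) this).mpr (zero_mem _))

theorem homOfTri_tri (n : ℕ) {P : GrBimod 𝒜 𝒜}
    (f : A →ₗ[F] Module.Dual F (M.gr n) →ₗ[F] A →ₗ[F] P.carrier) (hl) (hr) (hL) (hR) (hmem)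
    (a : A) (x : Module.Dual F (M.gr n)) (b : A) :
    GrBimod.Hom.toLin (homOfTri v M n (P := P) f hl hr hL hR hmem) (tri v M n a x b) =
      f a x b :=
  GrBimod.homOfTensor3_tmul (M := regAS v) (N := dualComp v M n) (P := regSA v) (X := P)
    f _ _ _ _ _ a x b

theorem QX_hom_ext (n : ℕ) {P : GrBimod 𝒜 𝒜} {f g : QX v M n ⟶ P}
    (h : ∀ a x b, GrBimod.Hom.toLin f (tri v M n a x b) =
      GrBimod.Hom.toLin g (tri v M n a x b)) : f = g :=
  GrBimod.tensor3_hom_ext (M := regAS v) (N := dualComp v M n) (P := regSA v) h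

theorem hom_mul_e (s : Fin r → F) (k : Fin r) : v.hom s * v.e k = s k • v.e k := by
  rw [← v.hom_single, ← map_mul, ← map_smul]
  congr 1
  ext i
  by_cases h : i = k
  · subst h; simp
  · simp [Pi.single_eq_of_ne h]

theorem e_mul_hom (s : Fin r → F) (k : Fin r) : v.e k * v.hom s = s k • v.e k := by
  rw [← hom_mul_e, ← v.hom_single, ← map_mul, mul_comm, map_mul]

theorem ofS_mul_single (s : Fin r → F) (k : Fin r) : QDual.ofS v s * QDual.ofS v (Pi.single k 1) =
    s k • QDual.ofS v (Pi.single k 1) := by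
  rw [← map_mul, ← map_smul]
  congr 1
  ext i
  by_cases h : i = k
  · subst h; simp
  · simp [Pi.single_eq_of_ne h]

theorem single_mul_ofS (s : Fin r → F) (k : Fin r) : QDual.ofS v (Pi.single k 1) * QDual.ofS v s =
    s k • QDual.ofS v (Pi.single k 1) := by
  rw [← ofS_mul_single, ← map_mul, mul_comm, map_mul]

theorem dualL_eq_dualR {k n : ℤ} (u : M.gr n) (c : QDual v) (hc : actL v M c u = actR v M c u)
    (x : Module.Dual F (M.gr k)) : dualL v M k n c x u = dualR v M k n c x u := by
  change x (component M.internal k (actL v M c u)) = x (component M.internal k (actR v M c u))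
  rw [hc]

end QFunctor

namespace QFunctor

variable {F : Type u} [Field F] {A : Type u} [Ring A] [Algebra F A]
  {𝒜 : ℤ → Submodule F A} [GradedAlgebra 𝒜] [FiniteDimensional F (𝒜 1)] {r : ℕ}
  (v : VertexIdem 𝒜 r) (M : GrBimod (QDual.gr v) (QDual.gr v))

/-- The element `v_β^*` of the dual basis, in the degree `1` part of `A^!`. -/
def cobasis (β : Fin (Module.finrank F (𝒜 1))) : QDual v := QDual.gen v ((basisV 𝒜).coord β)

theorem cobasis_mem (β : Fin (Module.finrank F (𝒜 1))) : cobasis v β ∈ QDual.gr v 1 :=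
  gen_mem' v _

theorem basisV_mem (β : Fin (Module.finrank F (𝒜 1))) : (basisV 𝒜 β : A) ∈ 𝒜 1 :=
  Subtype.mem _

/-- The trilinear map `(a, x, b) ↦ ∑ β, a v_β ⊗ x(- v_β^*) ⊗ b`. -/
def leftTri (n : ℕ) :
    A →ₗ[F] Module.Dual F (M.gr (n + 1 : ℕ)) →ₗ[F] A →ₗ[F] (QX v M n).carrier :=
  ∑ β, (tri v M n).compl₁₂ (LinearMap.mulRight F (basisV 𝒜 β : A))
    (dualR v M (n + 1 : ℕ) n (cobasis v β))

theorem leftTri_apply (n : ℕ) (a : A) (x : Module.Dual F (M.gr (n + 1 : ℕ))) (b : A) :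
    leftTri v M n a x b = ∑ β, tri v M n (a * (basisV 𝒜 β : A))
      (dualR v M (n + 1 : ℕ) n (cobasis v β) x) b := by
  simp [leftTri, LinearMap.sum_apply]

/-- The trilinear map `(a, x, b) ↦ ∑ β, a ⊗ x(v_β^* -) ⊗ v_β b`. -/
def rightTri (n : ℕ) :
    A →ₗ[F] Module.Dual F (M.gr (n + 1 : ℕ)) →ₗ[F] A →ₗ[F] (QX v M n).carrier :=
  ∑ β, ((tri v M n).compl₁₂ LinearMap.id
    (dualL v M (n + 1 : ℕ) n (cobasis v β))).compr₂
      (LinearMap.lcomp F _ (LinearMap.mulLeft F (basisV 𝒜 β : A)))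

theorem rightTri_apply (n : ℕ) (a : A) (x : Module.Dual F (M.gr (n + 1 : ℕ))) (b : A) :
    rightTri v M n a x b = ∑ β, tri v M n a
      (dualL v M (n + 1 : ℕ) n (cobasis v β) x) ((basisV 𝒜 β : A) * b) := by
  simp [rightTri, LinearMap.sum_apply]

theorem cast_succ_eq (n : ℕ) : ((n : ℤ) + 1) = ((n + 1 : ℕ) : ℤ) := by push_cast; rfl

/-- The part `a ⊗ x ⊗ b ↦ ∑ β, a v_β ⊗ x(- v_β^*) ⊗ b` of the differential. -/
def dLeft (n : ℕ) : QX v M (n + 1) ⟶ QX v M n :=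
  homOfTri v M (n + 1) (leftTri v M n)
    (fun a s x b => by
      rw [leftTri_apply, leftTri_apply]
      have h := sum_left v (((tri v M n).compl₁₂ (LinearMap.mulLeft F a)
        ((dualR v M (n + 1 : ℕ) n).flip x)).compr₂ (LinearMap.applyₗ b)) s
      simp only [LinearMap.compr₂_apply, LinearMap.compl₁₂_apply, LinearMap.mulLeft_apply,
        LinearMap.flip_apply, LinearMap.applyₗ_apply_apply] at h
      simp only [mul_assoc]
      refine h.trans (Finset.sum_congr rfl fun β _ => ?_)
      rw [dualR_dualR v M (ofS_mem' v s) (cobasis_mem v β) (add_zero _) (cast_succ_eq n)]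
      rfl)
    (fun a s x b => by
      rw [leftTri_apply, leftTri_apply]
      refine Finset.sum_congr rfl fun β _ => ?_
      rw [← tri_right, ← dualL_dualR v M (cobasis_mem v β) (ofS_mem' v s) (cast_succ_eq n)
        (add_zero _) (add_zero _) (cast_succ_eq n)])
    (fun c a x b => by
      rw [leftTri_apply, leftTri_apply, map_sum]
      simp only [tri_L, mul_assoc])
    (fun c a x b => by
      rw [leftTri_apply, leftTri_apply, map_sum]
      simp only [tri_R])
    (fun i j a ha x b hb => by
      rw [leftTri_apply]
      refine sum_mem fun β _ => ?_
      have h := tri_mem v M n (dualR v M (n + 1 : ℕ) n (cobasis v β) x)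
        (gmul_mem ha (basisV_mem β)) hb
      have e : i + 1 + (n : ℤ) + j = i + ((n + 1 : ℕ) : ℤ) + j := by push_cast; ring
      exact e ▸ h)

/-- The part `a ⊗ x ⊗ b ↦ ∑ β, a ⊗ x(v_β^* -) ⊗ v_β b` of the differential. -/
def dRight (n : ℕ) : QX v M (n + 1) ⟶ QX v M n :=
  homOfTri v M (n + 1) (rightTri v M n)
    (fun a s x b => by
      rw [rightTri_apply, rightTri_apply]
      refine Finset.sum_congr rfl fun β _ => ?_
      rw [tri_left, dualL_dualR v M (ofS_mem' v s) (cobasis_mem v β) (add_zero _)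
        (cast_succ_eq n) (cast_succ_eq n) (add_zero _)])
    (fun a s x b => by
      rw [rightTri_apply, rightTri_apply]
      have h := sum_right v ((tri v M n a).compl₁₂ 
        ((dualL v M (n + 1 : ℕ) n).flip x) (LinearMap.mulRight F b)).flip s
      simp only [LinearMap.compl₁₂_apply, LinearMap.mulRight_apply,
        LinearMap.flip_apply] at h
      simp only [mul_assoc] at h
      refine Eq.trans (Finset.sum_congr rfl fun β _ => ?_) h.symm
      rw [dualL_dualL v M (ofS_mem' v s) (cobasis_mem v β) (add_zero _) (cast_succ_eq n)]
      rfl)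
    (fun c a x b => by
      rw [rightTri_apply, rightTri_apply, map_sum]
      simp only [tri_L])
    (fun c a x b => by
      rw [rightTri_apply, rightTri_apply, map_sum]
      simp only [tri_R, mul_assoc])
    (fun i j a ha x b hb => by
      rw [rightTri_apply]
      refine sum_mem fun β _ => ?_
      have h := tri_mem v M n (dualL v M (n + 1 : ℕ) n (cobasis v β) x)
        ha (gmul_mem (basisV_mem β) hb)
      have e : i + (n : ℤ) + (1 + j) = i + ((n + 1 : ℕ) : ℤ) + j := by push_cast; ring
      exact e ▸ h)

theorem dLeft_tri (n : ℕ) (a : A) (x : Module.Dual F (M.gr (n + 1 : ℕ))) (b : A) :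
    GrBimod.Hom.toLin (dLeft v M n) (tri v M (n + 1) a x b) =
      ∑ β, tri v M n (a * (basisV 𝒜 β : A)) (dualR v M (n + 1 : ℕ) n (cobasis v β) x) b :=
  (homOfTri_tri v M (n + 1) _ _ _ _ _ _ a x b).trans (leftTri_apply v M n a x b)

theorem dRight_tri (n : ℕ) (a : A) (x : Module.Dual F (M.gr (n + 1 : ℕ))) (b : A) :
    GrBimod.Hom.toLin (dRight v M n) (tri v M (n + 1) a x b) =
      ∑ β, tri v M n a (dualL v M (n + 1 : ℕ) n (cobasis v β) x) ((basisV 𝒜 β : A) * b) :=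
  (homOfTri_tri v M (n + 1) _ _ _ _ _ _ a x b).trans (rightTri_apply v M n a x b)

theorem dLeft_dLeft (n : ℕ) : dLeft v M (n + 1) ≫ dLeft v M n = 0 := by
  refine QX_hom_ext v M _ fun a x b => ?_
  rw [GrBimod.comp_toLin, LinearMap.comp_apply, dLeft_tri, map_sum]
  simp only [dLeft_tri]
  rw [Finset.sum_comm]
  have h := sum_quad v (((tri v M n).compl₁₂ (LinearMap.mulLeft F a)
    ((dualR v M (n + 1 + 1 : ℕ) n).flip x)).compr₂ (LinearMap.applyₗ b))
  simp only [LinearMap.compr₂_apply, LinearMap.compl₁₂_apply, LinearMap.mulLeft_apply,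
    LinearMap.flip_apply, LinearMap.applyₗ_apply_apply] at h
  refine Eq.trans (Finset.sum_congr rfl fun β _ => Finset.sum_congr rfl fun γ _ => ?_) h
  rw [dualR_dualR v M (cobasis_mem v γ) (cobasis_mem v β) (cast_succ_eq (n + 1))
    (cast_succ_eq n), mul_assoc]
  rfl

theorem dRight_dRight (n : ℕ) : dRight v M (n + 1) ≫ dRight v M n = 0 := by
  refine QX_hom_ext v M _ fun a x b => ?_
  rw [GrBimod.comp_toLin, LinearMap.comp_apply, dRight_tri, map_sum]
  simp only [dRight_tri]
  have h := sum_quad v ((tri v M n a).compl₁₂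
    ((dualL v M (n + 1 + 1 : ℕ) n).flip x) (LinearMap.mulRight F b)).flip
  simp only [LinearMap.compl₁₂_apply, LinearMap.mulRight_apply, LinearMap.flip_apply] at h
  refine Eq.trans (Finset.sum_congr rfl fun β _ => Finset.sum_congr rfl fun γ _ => ?_) h
  rw [dualL_dualL v M (cobasis_mem v β) (cobasis_mem v γ) (cast_succ_eq (n + 1))
    (cast_succ_eq n), mul_assoc]
  rfl

theorem dLeft_dRight (n : ℕ) :
    dLeft v M (n + 1) ≫ dRight v M n = dRight v M (n + 1) ≫ dLeft v M n := by
  refine QX_hom_ext v M _ fun a x b => ?_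
  rw [GrBimod.comp_toLin, LinearMap.comp_apply, dLeft_tri, map_sum, GrBimod.comp_toLin,
    LinearMap.comp_apply, dRight_tri, map_sum]
  simp only [dRight_tri, dLeft_tri]
  rw [Finset.sum_comm]
  refine Finset.sum_congr rfl fun β _ => Finset.sum_congr rfl fun γ _ => ?_
  rw [dualL_dualR v M (cobasis_mem v γ) (cobasis_mem v β) (cast_succ_eq (n + 1))
    (cast_succ_eq n) (cast_succ_eq (n + 1)) (cast_succ_eq n)]

/-- The differential `Q_{n+1} → Q_n`,
`d (a ⊗ x ⊗ b) = ∑ β, a v_β ⊗ x(- v_β^*) ⊗ b + (-1) ^ (n+1) ∑ β, a ⊗ x(v_β^* -) ⊗ v_β b`. -/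
def d (n : ℕ) : QX v M (n + 1) ⟶ QX v M n :=
  dLeft v M n + ((-1 : ℤ) ^ (n + 1)) • dRight v M n

theorem d_comp_d (n : ℕ) : d v M (n + 1) ≫ d v M n = 0 := by
  simp only [d, Preadditive.add_comp, Preadditive.comp_add, Preadditive.zsmul_comp,
    Preadditive.comp_zsmul, dLeft_dLeft, dRight_dRight, dLeft_dRight, smul_zero, zero_add,
    add_zero]
  rw [← add_smul, pow_succ (-1 : ℤ) (n + 1)]
  simp

end QFunctor

/-- The complex `Q_A (M)` of graded `A`-`A`-bimodules associated to a graded `A^!`-`A^!`-bimodule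
`M` which is concentrated in nonnegative degrees, with terms
`Q_A (M)_n = A ⊗_S (M_n)^* ⊗_S A ⟨-n⟩`. The differential is induced by the duals of the left and
right actions of the degree `1` part of `A^!` on `M` and the multiplication of `A`. -/
def QComplex {F : Type u} [Field F] {A : Type u} [Ring A] [Algebra F A]
    {𝒜 : ℤ → Submodule F A} [GradedAlgebra 𝒜] [FiniteDimensional F (𝒜 1)] {r : ℕ}
    (v : VertexIdem 𝒜 r) (M : GrBimod (QDual.gr v) (QDual.gr v)) :
    ChainComplex (GrBimod 𝒜 𝒜) ℕ :=
  ChainComplex.of (QFunctor.QX v M) (QFunctor.d v M) (QFunctor.d_comp_d v M)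

namespace QFunctor

variable {F : Type u} [Field F] {A : Type u} [Ring A] [Algebra F A]
  {𝒜 : ℤ → Submodule F A} [GradedAlgebra 𝒜] [FiniteDimensional F (𝒜 1)] {r : ℕ}
  (v : VertexIdem 𝒜 r) (M : GrBimod (QDual.gr v) (QDual.gr v))

/-- The trilinear map `(a, x, b) ↦ ∑ k, x (u e_k) a e_k b`. -/
def augTri (u : M.gr (0 : ℕ)) : A →ₗ[F] Module.Dual F (M.gr (0 : ℕ)) →ₗ[F] A →ₗ[F] A :=
  ∑ k, LinearMap.mk₂ F
    (fun a x => dualR v M (0 : ℕ) (0 : ℕ) (QDual.ofS v (Pi.single k 1)) x u •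
      LinearMap.mulLeft F (a * v.e k))
    (fun _ _ _ => by ext; simp [add_mul, mul_assoc])
    (fun _ _ _ => by
      ext
      simp only [LinearMap.smul_apply, LinearMap.mulLeft_apply, smul_mul_assoc]
      rw [smul_comm])
    (fun _ _ _ => by ext; simp [add_smul]) (fun _ _ _ => by ext; simp [mul_smul])

theorem augTri_apply (u : M.gr (0 : ℕ)) (a : A) (x : Module.Dual F (M.gr (0 : ℕ))) (b : A) :
    augTri v M u a x b = ∑ k, dualR v M (0 : ℕ) (0 : ℕ) (QDual.ofS v (Pi.single k 1)) x u •
      (a * v.e k * b) := by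
  simp [augTri, LinearMap.sum_apply, mul_assoc]

/-- The augmentation `Q_A (M)_0 → A`, `a ⊗ x ⊗ b ↦ ∑ k, x (u e_k) a e_k b`, determined by a central
element `u` of degree `0` in `M`. -/
def aug (u : M.gr (0 : ℕ)) (hu : ∀ c, actL v M c u = actR v M c u) :
    QX v M 0 ⟶ GrBimod.regular 𝒜 :=
  homOfTri v M 0 (P := GrBimod.regular 𝒜) (augTri v M u)
    (fun a s x b => by
      refine (augTri_apply v M u _ _ _).trans (Eq.trans ?_ (augTri_apply v M u _ _ _).symm)
      refine Finset.sum_congr rfl fun k _ => ?_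
      rw [dualR_dualR v M (ofS_mem' v s) (ofS_mem' v _) (add_zero _) (add_zero _),
        single_mul_ofS, map_smul, mul_assoc a, hom_mul_e]
      simp [smul_smul, mul_comm])
    (fun a s x b => by
      refine (augTri_apply v M u _ _ _).trans (Eq.trans ?_ (augTri_apply v M u _ _ _).symm)
      refine Finset.sum_congr rfl fun k _ => ?_
      rw [← dualL_dualR v M (ofS_mem' v (Pi.single k 1)) (ofS_mem' v s) (add_zero _) (add_zero _)
        (add_zero _) (add_zero _), dualL_eq_dualR v M u _ (hu _),
        dualR_dualR v M (ofS_mem' v _) (ofS_mem' v _) (add_zero _) (add_zero _), ofS_mul_single,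
        map_smul, LinearMap.smul_apply, LinearMap.smul_apply]
      have h : a * v.e k * (v.hom s * b) = s k • (a * v.e k * b) := by
        rw [mul_assoc, ← mul_assoc (v.e k), e_mul_hom, smul_mul_assoc, mul_smul_comm, mul_assoc]
      rw [h, smul_assoc, smul_comm])
    (fun c a x b => by
      refine (augTri_apply v M u _ _ _).trans (Eq.trans ?_
        (congrArg (c * ·) (augTri_apply v M u _ _ _).symm))
      simp only [Finset.mul_sum, mul_smul_comm, mul_assoc])
    (fun c a x b => by
      refine (augTri_apply v M u _ _ _).trans (Eq.trans ?_
        (congrArg (· * c.unop) (augTri_apply v M u _ _ _).symm))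
      simp only [Finset.sum_mul, smul_mul_assoc, mul_assoc])
    (fun i j a ha x b hb => by
      refine (congrArg (· ∈ 𝒜 (i + ((0 : ℕ) : ℤ) + j)) (augTri_apply v M u a x b)).mpr ?_
      exact sum_mem fun k _ => Submodule.smul_mem _ _ (gmul_mem (gmul_mem ha (v.mem k)) hb))

theorem aug_tri (u : M.gr (0 : ℕ)) (hu) (a : A) (x : Module.Dual F (M.gr (0 : ℕ))) (b : A) :
    GrBimod.Hom.toLin (aug v M u hu) (tri v M 0 a x b) =
      ∑ k, dualR v M (0 : ℕ) (0 : ℕ) (QDual.ofS v (Pi.single k 1)) x u • (a * v.e k * b) :=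
  (homOfTri_tri v M 0 (P := GrBimod.regular 𝒜) (augTri v M u) _ _ _ _ _ a x b).trans
    (augTri_apply v M u a x b)

theorem d_aug (u : M.gr (0 : ℕ)) (hu : ∀ c, actL v M c u = actR v M c u) :
    d v M 0 ≫ aug v M u hu = 0 := by
  have key : dLeft v M 0 ≫ aug v M u hu = dRight v M 0 ≫ aug v M u hu := by
    refine QX_hom_ext v M _ fun a x b => ?_
    rw [GrBimod.comp_toLin, LinearMap.comp_apply, dLeft_tri, map_sum, GrBimod.comp_toLin,
      LinearMap.comp_apply, dRight_tri, map_sum]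
    simp only [aug_tri]
    have hL : ∀ k, ∑ β, dualR v M (0 : ℕ) (0 : ℕ) (QDual.ofS v (Pi.single k 1))
        (dualR v M (0 + 1 : ℕ) (0 : ℕ) (cobasis v β) x) u •
          (a * (basisV 𝒜 β : A) * v.e k * b) =
        ∑ β, dualR v M (0 + 1 : ℕ) (0 : ℕ) (cobasis v β) x u •
          (a * (basisV 𝒜 β : A) * v.e k * b) := fun k => by
      have h := sum_right v ((LinearMap.mk₂ F
        (fun (p : A) (c : QDual v) => dualR v M (0 + 1 : ℕ) (0 : ℕ) c x u • (a * p * v.e k * b))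
        (fun _ _ _ => by simp [mul_add, add_mul])
        (fun _ _ _ => by
          simp only [mul_smul_comm, smul_mul_assoc]
          rw [smul_comm])
        (fun _ _ _ => by simp [add_smul]) (fun _ _ _ => by simp [mul_smul]))) (Pi.single k 1)
      simp only [LinearMap.mk₂_apply, v.hom_single] at h
      have h2 : ∀ p, a * (p * v.e k) * v.e k * b = a * p * v.e k * b := fun p => by
        rw [← mul_assoc, mul_assoc (a * p), (v.complete.idem k).eq]
      simp only [h2] at h
      refine Eq.trans (Finset.sum_congr rfl fun β _ => ?_) h.symm
      rw [dualR_dualR v M (cobasis_mem v β) (ofS_mem' v _) (cast_succ_eq 0) (add_zero _)]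
      rfl
    have hR : ∀ k, ∑ β, dualR v M (0 : ℕ) (0 : ℕ) (QDual.ofS v (Pi.single k 1))
        (dualL v M (0 + 1 : ℕ) (0 : ℕ) (cobasis v β) x) u •
          (a * v.e k * ((basisV 𝒜 β : A) * b)) =
        ∑ β, dualL v M (0 + 1 : ℕ) (0 : ℕ) (cobasis v β) x u •
          (a * v.e k * ((basisV 𝒜 β : A) * b)) := fun k => by
      have h := sum_left v ((LinearMap.mk₂ F
        (fun (p : A) (c : QDual v) => dualL v M (0 + 1 : ℕ) (0 : ℕ) c x u • (a * v.e k * (p * b)))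
        (fun _ _ _ => by simp [mul_add, add_mul])
        (fun _ _ _ => by
          simp only [mul_smul_comm, smul_mul_assoc]
          rw [smul_comm])
        (fun _ _ _ => by simp [add_smul]) (fun _ _ _ => by simp [mul_smul]))) (Pi.single k 1)
      simp only [LinearMap.mk₂_apply, v.hom_single] at h
      have h2 : ∀ p, a * v.e k * (v.e k * p * b) = a * v.e k * (p * b) := fun p => by
        rw [mul_assoc (v.e k), ← mul_assoc (a * v.e k), mul_assoc a, (v.complete.idem k).eq]
      simp only [h2] at h
      refine Eq.trans (Finset.sum_congr rfl fun β _ => ?_) h.symm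
      rw [← dualL_eq_dualR v M u _ (hu _),
        dualL_dualL v M (cobasis_mem v β) (ofS_mem' v _) (cast_succ_eq 0) (add_zero _)]
      rfl
    refine Finset.sum_comm.trans (Eq.trans ?_ Finset.sum_comm)
    refine (Finset.sum_congr rfl fun k _ => hL k).trans
      (Eq.trans ?_ (Finset.sum_congr rfl fun k _ => (hR k).symm))
    refine Finset.sum_comm.trans (Eq.trans ?_ Finset.sum_comm)
    refine Finset.sum_congr rfl fun β _ => ?_
    have h1 : ∀ c : F, ∑ k, c • (a * (basisV 𝒜 β : A) * v.e k * b) =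
        c • (a * (basisV 𝒜 β : A) * b) := fun c => by
      rw [← Finset.smul_sum, ← Finset.sum_mul, ← Finset.mul_sum, v.complete.complete, mul_one]
    have h2 : ∀ c : F, ∑ k, c • (a * v.e k * ((basisV 𝒜 β : A) * b)) =
        c • (a * (basisV 𝒜 β : A) * b) := fun c => by
      rw [← Finset.smul_sum, ← Finset.sum_mul, ← Finset.mul_sum, v.complete.complete, mul_one,
        mul_assoc]
    refine (h1 _).trans (Eq.trans ?_ (h2 _).symm)
    rw [dualL_eq_dualR v M u _ (hu _)]
  simp [d, Preadditive.add_comp, key]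

end QFunctor

theorem QComplex_d_aug {F : Type u} [Field F] {A : Type u} [Ring A] [Algebra F A]
    {𝒜 : ℤ → Submodule F A} [GradedAlgebra 𝒜] [FiniteDimensional F (𝒜 1)] {r : ℕ}
    (v : VertexIdem 𝒜 r) (M : GrBimod (QDual.gr v) (QDual.gr v)) (u : M.gr (0 : ℕ))
    (hu : ∀ c, QFunctor.actL v M c u = QFunctor.actR v M c u) :
    (QComplex v M).d 1 0 ≫ (show (QComplex v M).X 0 ⟶ GrBimod.regular 𝒜 from
      QFunctor.aug v M u hu) = 0 := by
  have h : (QComplex v M).d 1 0 = QFunctor.d v M 0 :=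
    ChainComplex.of_d (QFunctor.QX v M) (QFunctor.d v M) 0
  rw [h]
  exact QFunctor.d_aug v M u hu

/-! ## Zigzag algebras and inflation -/

section Zigzag

variable {F : Type u} [Field F] {L : Type u} [Ring L] [Algebra F L]
  {𝒜 : ℤ → Submodule F L} [GradedAlgebra 𝒜] {r : ℕ} (v : VertexIdem 𝒜 r) (d : ℕ)

/-- The `(d + 1)`-zigzag algebra `Z_{d+1} (Λ)`: the `(d + 1)`-trivial extension of the quadratic
dual `Λ^!`. -/
abbrev Zigzag : Type u := Triv (QDual.gr v) d

namespace Zigzag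

/-- The grading of the zigzag algebra. -/
abbrev gr : ℤ → Submodule F (Zigzag v d) := Triv.gr (QDual.gr v) d

/-- The idempotents `e_1, …, e_r` of the zigzag algebra. -/
abbrev vertices : VertexIdem (gr v d) r := Triv.vertices (QDual.gr v) d (QDual.vertices v)

theorem vertices_hom (s : Fin r → F) :
    (vertices v d).hom s = Triv.inl (QDual.gr v) d (QDual.ofS v s) := by
  rw [VertexIdem.hom_apply, ← QDual.vertices_hom, VertexIdem.hom_apply, map_sum]
  simp only [map_smul]
  rfl

/-- The inclusion of `(Λ_1)^* = (Λ^!)_1` in the degree `1` part of the zigzag algebra. -/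
def incl : VDual 𝒜 →ₗ[F] gr v d 1 :=
  LinearMap.codRestrict _ ((Triv.inl (QDual.gr v) d).toLinearMap ∘ₗ QDual.gen v)
    fun f => Triv.inl_mem _ _ (QFunctor.gen_mem' v f)

theorem coe_incl (f : VDual 𝒜) :
    (incl v d f : Zigzag v d) = Triv.inl (QDual.gr v) d (QDual.gen v f) := rfl

theorem rV_incl (s : Fin r → F) (f : VDual 𝒜) :
    (vertices v d).rV s (incl v d f) = incl v d (f ∘ₗ v.lV s) := by
  apply Subtype.ext
  rw [VertexIdem.coe_rV, coe_incl, coe_incl, vertices_hom, ← map_mul, QDual.gen_mul_ofS]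

theorem lV_incl (s : Fin r → F) (f : VDual 𝒜) :
    (vertices v d).lV s (incl v d f) = incl v d (f ∘ₗ v.rV s) := by
  apply Subtype.ext
  rw [VertexIdem.coe_lV, coe_incl, coe_incl, vertices_hom, ← map_mul, QDual.ofS_mul_gen]

variable [FiniteDimensional F (𝒜 1)]

/-- The transpose `f ↦ ∑ β, f (v_β^*) v_β` of the inclusion `(Λ_1)^* → Z_{d+1} (Λ)_1`, as a map from
the dual space of `Z_{d+1} (Λ)_1` to `Λ_1`. -/
def transpose : VDual (gr v d) →ₗ[F] L :=
  ∑ β, (LinearMap.applyₗ (incl v d ((basisV 𝒜).coord β))).smulRight (basisV 𝒜 β : L)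

theorem transpose_apply (f : VDual (gr v d)) :
    transpose v d f = ∑ β, f (incl v d ((basisV 𝒜).coord β)) • (basisV 𝒜 β : L) := by
  simp [transpose, LinearMap.sum_apply]

theorem hom_mul_transpose (s : Fin r → F) (f : VDual (gr v d)) :
    v.hom s * transpose v d f = transpose v d (f ∘ₗ (vertices v d).rV s) := by
  rw [transpose_apply, transpose_apply, Finset.mul_sum]
  simp only [LinearMap.comp_apply, rV_incl, mul_smul_comm]
  exact sum_basis_comp (basisV 𝒜) (LinearMap.mk₂ F
    (fun (x : 𝒜 1) (g : VDual 𝒜) => f (incl v d g) • (x : L))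
    (fun _ _ _ => by simp) (fun _ _ _ => by rw [Submodule.coe_smul, smul_comm])
    (fun _ _ _ => by simp [add_smul]) (fun _ _ _ => by simp [mul_smul])) (v.lV s)

theorem transpose_mul_hom (s : Fin r → F) (f : VDual (gr v d)) :
    transpose v d f * v.hom s = transpose v d (f ∘ₗ (vertices v d).lV s) := by
  rw [transpose_apply, transpose_apply, Finset.sum_mul]
  simp only [LinearMap.comp_apply, lV_incl, smul_mul_assoc]
  exact sum_basis_comp (basisV 𝒜) (LinearMap.mk₂ F
    (fun (x : 𝒜 1) (g : VDual 𝒜) => f (incl v d g) • (x : L))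
    (fun _ _ _ => by simp) (fun _ _ _ => by rw [Submodule.coe_smul, smul_comm])
    (fun _ _ _ => by simp [add_smul]) (fun _ _ _ => by simp [mul_smul])) (v.rV s)

/-- A quadratic relation of the zigzag algebra. -/
def dualRel (ω : Module.Dual F L) : gr v d 1 ⊗[F] gr v d 1 :=
  ∑ β, ∑ γ, ω ((basisV 𝒜 γ : L) * (basisV 𝒜 β : L)) •
    (incl v d ((basisV 𝒜).coord β) ⊗ₜ[F] incl v d ((basisV 𝒜).coord γ))

theorem dualRel_mem (ω : Module.Dual F L) :
    dualRel v d ω ∈ LinearMap.ker (mulVV (gr v d)) := by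
  have h := congrArg (Triv.inl (QDual.gr v) d)
    (sum_quad v (LinearMap.mk₂ F (fun (p : L) (c : QDual v) => ω p • c)
    (fun _ _ _ => by simp [add_smul]) (fun _ _ _ => by simp [mul_smul])
    (fun _ _ _ => by simp) (fun _ _ _ => by rw [smul_comm])))
  simp only [LinearMap.mk₂_apply, map_sum, map_smul, map_mul, map_zero] at h
  rw [LinearMap.mem_ker, dualRel]
  simp only [map_sum, map_smul]
  exact h

theorem pairVV_dualRel (ω : Module.Dual F L) (f g : VDual (gr v d)) :
    pairVV (vertices v d) (f ⊗ₜ g) (dualRel v d ω) = ω (transpose v d f * transpose v d g) := by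
  have h2 : ∀ k : Fin r, ∑ β, ∑ γ, ω ((basisV 𝒜 γ : L) * (basisV 𝒜 β : L)) *
      (g (incl v d ((basisV 𝒜).coord β ∘ₗ v.lV (Pi.single k 1))) *
        f (incl v d ((basisV 𝒜).coord γ ∘ₗ v.rV (Pi.single k 1)))) =
      ω (transpose v d f * v.e k * transpose v d g) := fun k => by
    have e1 : v.e k * transpose v d g = ∑ β,
        g (incl v d ((basisV 𝒜).coord β ∘ₗ v.lV (Pi.single k 1))) • (basisV 𝒜 β : L) := by
      rw [← v.hom_single, hom_mul_transpose, transpose_apply]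
      simp only [LinearMap.comp_apply, rV_incl]
    have e2 : transpose v d f * v.e k = ∑ γ,
        f (incl v d ((basisV 𝒜).coord γ ∘ₗ v.rV (Pi.single k 1))) • (basisV 𝒜 γ : L) := by
      rw [← v.hom_single, transpose_mul_hom, transpose_apply]
      simp only [LinearMap.comp_apply, lV_incl]
    have e3 : transpose v d f * v.e k * transpose v d g =
        (transpose v d f * v.e k) * (v.e k * transpose v d g) := by
      rw [mul_assoc _ (v.e k) (v.e k * _), ← mul_assoc (v.e k), (v.complete.idem k).eq,
        mul_assoc]
    rw [e3, e1, e2, Finset.sum_mul_sum, Finset.sum_comm]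
    simp only [map_sum, smul_mul_smul_comm, map_smul, smul_eq_mul]
    refine Finset.sum_congr rfl fun γ _ => Finset.sum_congr rfl fun β _ => ?_
    ring
  rw [dualRel]
  simp only [map_sum, map_smul, pairVV_tmul, rV_incl, lV_incl, smul_eq_mul,
    Finset.mul_sum]
  have e4 : transpose v d f * transpose v d g =
      ∑ k, transpose v d f * v.e k * transpose v d g := by
    rw [← Finset.sum_mul, ← Finset.mul_sum, v.complete.complete, mul_one]
  rw [e4, map_sum]
  simp only [← h2]
  symm
  rw [Finset.sum_comm]
  refine Finset.sum_congr rfl fun β _ => ?_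
  rw [Finset.sum_comm]

/-- The homomorphism of graded algebras `Z_{d+1} (Λ)^! → Λ` which is quadratic dual to the
inclusion of `Λ^!` in `Z_{d+1} (Λ)`: it is the identity on `S`, and in degree `1` it is the transpose
of the inclusion. -/
def infl : QDual (vertices v d) →ₐ[F] L :=
  QDual.lift (vertices v d) v.hom (transpose v d) (hom_mul_transpose v d) (transpose_mul_hom v d)
    (fun t ht => by
      rw [← Module.forall_dual_apply_eq_zero_iff F]
      intro ω
      rw [← ht _ (dualRel_mem v d ω)]
      have : ω ∘ₗ TensorProduct.lift
          ((LinearMap.mul F L).compl₁₂ (transpose v d) (transpose v d)) =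
          LinearMap.applyₗ (dualRel v d ω) ∘ₗ pairVV (vertices v d) :=
        TensorProduct.ext' fun f g => by
          simp [pairVV_dualRel]
      exact LinearMap.congr_fun this t)

theorem infl_ofS (s : Fin r → F) : infl v d (QDual.ofS _ s) = v.hom s := QDual.lift_ofS ..

theorem infl_gen (f : VDual (gr v d)) : infl v d (QDual.gen _ f) = transpose v d f :=
  QDual.lift_gen ..

theorem infl_mem (n : ℤ) (c : QDual (vertices v d)) (hc : c ∈ QDual.gr (vertices v d) n) :
    infl v d c ∈ 𝒜 n := by
  have hgen : ∀ f, transpose v d f ∈ 𝒜 1 := fun f => by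
    rw [transpose_apply]
    exact sum_mem fun β _ => Submodule.smul_mem _ _ (Subtype.mem _)
  rcases n with n | n
  · have hpow : ∀ n : ℕ, ∀ y ∈ LinearMap.range (QDual.gen (vertices v d)) ^ n,
        infl v d y ∈ 𝒜 n := by
      intro n
      induction n with
      | zero =>
        intro y hy
        rw [pow_zero] at hy
        obtain ⟨c, rfl⟩ := Submodule.mem_one.1 hy
        rw [AlgHom.commutes, Algebra.algebraMap_eq_smul_one]
        exact Submodule.smul_mem _ _ (SetLike.GradedOne.one_mem (A := 𝒜))
      | succ n ih =>
        intro y hy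
        rw [pow_succ] at hy
        refine Submodule.mul_induction_on hy ?_ ?_
        · rintro a ha _ ⟨f, rfl⟩
          rw [map_mul, infl_gen]
          have := gmul_mem (ih a ha) (hgen f)
          push_cast
          exact this
        · intro a b ha hb
          rw [map_add]
          exact add_mem ha hb
    refine Submodule.mul_induction_on (M := LinearMap.range (QDual.ofS (vertices v d)).toLinearMap)
      (N := LinearMap.range (QDual.gen (vertices v d)) ^ n) hc ?_ ?_
    · rintro _ ⟨s, rfl⟩ y hy
      change infl v d (QDual.ofS _ s * y) ∈ _
      rw [map_mul, infl_ofS]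
      simpa using gmul_mem (v.hom_mem s) (hpow n y hy)
    · intro a b ha hb
      rw [map_add]
      exact add_mem ha hb
  · have : c = 0 := (Submodule.mem_bot F).1 hc
    rw [this, map_zero]
    exact zero_mem _

/-- The regular bimodule `Λ`, inflated to a `Z_{d+1} (Λ)^!`-`Z_{d+1} (Λ)^!`-bimodule. -/
def inflated : GrBimod (QDual.gr (vertices v d)) (QDual.gr (vertices v d)) :=
  (GrBimod.regular 𝒜).restrict (infl v d) (infl_mem v d) (infl v d) (infl_mem v d)

/-- The identity of `Λ`, as an element of the inflated bimodule. -/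
def inflatedOne : (inflated v d).gr (0 : ℕ) :=
  ⟨(1 : L), show (1 : L) ∈ 𝒜 0 from SetLike.GradedOne.one_mem⟩

theorem inflatedOne_central (c : QDual (vertices v d)) :
    QFunctor.actL _ (inflated v d) c (inflatedOne v d) =
      QFunctor.actR _ (inflated v d) c (inflatedOne v d) :=
  (mul_one (infl v d c)).trans (one_mul (infl v d c)).symm

/-- The augmentation `m : Q_A (Λ)_0 = A ⊗_S Λ_0^* ⊗_S A → A` for `A = Z_{d+1} (Λ)`,
`a ⊗ x ⊗ b ↦ ∑ k, x (e_k) a e_k b`. If `Λ_0 = S` this is the multiplication map of `A` under the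
identification of `S^*` with `S`. -/
def aug : (QComplex (vertices v d) (inflated v d)).X 0 ⟶ GrBimod.regular (gr v d) :=
  QFunctor.aug (vertices v d) (inflated v d) (inflatedOne v d) (inflatedOne_central v d)

/-- The cone of `m : Q_A (Λ) → A`, for `A = Z_{d+1} (Λ)`. -/
def coneAug : ChainComplex (GrBimod (gr v d) (gr v d)) ℕ :=
  GrBimod.coneTo (QComplex (vertices v d) (inflated v d)) (GrBimod.regular (gr v d)) (aug v d)
    (QComplex_d_aug _ _ _ (inflatedOne_central v d))

end Zigzag

end Zigzag

/-! ## Acyclic algebras, Koszul algebras, global dimension -/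

section Koszul

/-- Primitive idempotents: nonzero idempotents which are not the sum of two nonzero orthogonal
idempotents. -/
def IsPrimitiveIdem {L : Type u} [Ring L] (e : L) : Prop :=
  IsIdempotentElem e ∧ e ≠ 0 ∧ ∀ f g : L, IsIdempotentElem f → IsIdempotentElem g → f * g = 0 →
    g * f = 0 → e = f + g → f = 0 ∨ g = 0

variable {F : Type u} [Field F] {L : Type u} [Ring L] [Algebra F L]

/-- The algebra `Λ` is acyclic with respect to the ordered complete set of orthogonal idempotents
`e_1 < ⋯ < e_r`: these are primitive, `e_j Λ e_i = 0` for `i < j`, and `e_i Λ e_i = F e_i`. -/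
structure VertexIdem.IsAcyclic {𝒜 : ℤ → Submodule F L} {r : ℕ} (v : VertexIdem 𝒜 r) : Prop where
  primitive : ∀ i, IsPrimitiveIdem (v.e i)
  triangular : ∀ i j, i < j → ∀ x, v.e j * x * v.e i = 0
  scalar : ∀ i x, ∃ c : F, v.e i * x * v.e i = c • v.e i

/-- A linear projective resolution of the degree `0` part `S = Λ_0` of a nonnegatively graded
algebra `Λ` (on which `Λ` acts through the projection `Λ → Λ_0`): an exact complex
`⋯ → P_1 → P_0 → S → 0` of graded projective modules and homomorphisms of degree `0`, such that
`P_i` is generated in degree `i`. -/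
structure LinearResolution (𝒜 : ℕ → Submodule F L) [GradedAlgebra 𝒜] where
  P : ℕ → Type u
  [grp : ∀ i, AddCommGroup (P i)]
  [mod : ∀ i, Module L (P i)]
  projective : ∀ i, Module.Projective L (P i)
  gr : ∀ i, ℤ → AddSubgroup (P i)
  internal : ∀ i, DirectSum.IsInternal (gr i)
  smul_mem : ∀ i (m : ℕ) (n : ℤ) (a : L) (x : P i), a ∈ 𝒜 m → x ∈ gr i n → a • x ∈ gr i (m + n)
  d : ∀ i, P (i + 1) →ₗ[L] P i
  d_mem : ∀ i n x, x ∈ gr (i + 1) n → d i x ∈ gr i n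
  ε : P 0 →+ 𝒜 0
  ε_smul : ∀ (a : L) (x : P 0), (ε (a • x) : L) = (DirectSum.decompose 𝒜 a 0 : L) * (ε x : L)
  ε_eq_zero : ∀ n : ℤ, n ≠ 0 → ∀ x ∈ gr 0 n, ε x = 0
  ε_surjective : Function.Surjective ε
  exact_zero : ∀ x, ε x = 0 ↔ ∃ y, d 0 y = x
  exact_succ : ∀ i x, d i x = 0 ↔ ∃ y, d (i + 1) y = x
  generated : ∀ i, Submodule.span L (gr i i : Set (P i)) = ⊤

attribute [instance] LinearResolution.grp LinearResolution.mod

/-- Koszul algebras: nonnegatively graded algebras with semisimple degree `0` part, generated in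
degree `1`, whose degree `0` part has a linear projective resolution. -/
structure IsKoszul (𝒜 : ℕ → Submodule F L) [GradedAlgebra 𝒜] : Prop where
  semisimple : IsSemisimpleRing (𝒜 0)
  generated : ∀ n, 2 ≤ n → 𝒜 1 ^ n = 𝒜 n
  resolution : Nonempty (LinearResolution 𝒜)

/-- The global dimension of the ring `Λ` is at most `d`. -/
def GldimLE (L : Type u) [Ring L] (d : ℕ) : Prop :=
  ∀ M : ModuleCat.{u} L, HasProjectiveDimensionLE M d

instance (𝒜 : ℕ → Submodule F L) [h : FiniteDimensional F (𝒜 1)] :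
    FiniteDimensional F (zgr 𝒜 1) := h

end Koszul

end HigherZigzag

end

open HigherZigzag

/-!
Write `A` for the zigzag algebra, `C` for the cone of the augmentation `Q → A`, and `f_s` for the
sum of the first `s` vertex idempotents. The proof compares the partial products of twists with the
subcomplexes `C_s` of `C` that have `A` in degree `0` and `A f_s ⊗_S Λ_n^* ⊗_S A` in degree `n + 1`
(`Zigzag.initComplex`). They are subcomplexes because a nonzero element `γ^*` of `Λ_1^*` leads from
a later vertex to an earlier one, in the sense that `e_i γ^* e_k ≠ 0` forces `k < i`. As `f_0 = 0`
and `f_r = 1`, the complex `C_0` is `A` and `C_r` is `C`, so that the theorem follows by induction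
from a homotopy equivalence between `C_{i+1}` and `X_i ⊗_A C_i`, where vertices are numbered from
`0` (`Zigzag.nonempty_initComplex_succ`). The induction uses that tensoring with a complex
preserves homotopy equivalences (`GrBimod.tensorComplexHomotopyEquiv`).

The term of degree `n` of `X_i ⊗_A C_i` is the sum of the terms of `C_i` of degree `n` and of `A
e_i ⊗_F e_i C_i` of degree `n - 1`. The chain map `C_{i+1} → X_i ⊗_A C_i` is the projection to
`C_i` together with the map `a ⊗ x ⊗ b ↦ a e_i ⊗ ∂ (e_i ⊗ x ⊗ b)`, where `∂` is the part of the
differential of the cone which multiplies into the left factor `A` (`Zigzag.theta`). To see that it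
is a homotopy equivalence, one looks at `e_i C_i`. There are no paths in `Λ^!` from an earlier
vertex to a later one, hence `e_i A f_i` is contained in `Λ^!` (`Zigzag.single_mul_initS_eq_inl`),
and in positive degrees `e_i C_i` with the differential `∂` is, tensored with `A` on the right, the
part of the left Koszul complex `e_i Λ^! ⊗_S Λ_n^*` in which the degree of the factor in `Λ^!` is
at least `1`. The left Koszul complex is exact except for the copy of `S` in degree `0`, and has a
contraction that is equivariant for `S` on both sides
(`LinearResolution.nonempty_koszulContraction`). On elements with factor of degree `1` in `Λ^!`,
the contraction splits `theta` (`Zigzag.lam`), and on elements with factor of degree at least `2`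
it is a homotopy operator which vanishes on the image of `theta` (`Zigzag.nul`). This operator
lowers the degree of the factor in `Λ^!` by one, and the part of the differential other than `∂`
preserves this degree, so that the failure of the contraction identity has smaller degree
(`Zigzag.lowDeg_succ`). Since `Λ^!` vanishes in degrees at least `r`, the identity minus the
homotopy is nilpotent modulo the image of `C_{i+1}`, which suffices by the perturbation argument
`nonempty_homotopyEquiv_of_retract`.

Exactness of the left Koszul complex is obtained from the linear resolution `P` of `Λ_0`. If `U_j`
is the space of generators of `P_j`, then `P_j = Λ ⊗_S U_j` (`LinearResolution.exists_extension`),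
the differential followed by contraction with `Λ_1^*` makes the product of the `U_j` a module over
`Λ^!` (`LinearResolution.act`), and by induction on `j` the resulting pairing identifies `(Λ^!)_j`
with the dual of `U_j` (`LinearResolution.exists_pair_eq`, `LinearResolution.pair_injective`). This
turns the left Koszul complex into the dual of the resolution (`LinearResolution.Represents.dF`).

Acyclicity and the semisimplicity of `Λ_0` show that `Λ_0 = S`
(`VertexIdem.IsAcyclic.exists_hom_eq`). An element of `Λ^! ⊗_S Λ_n^*` is encoded as a right
`S`-linear map `Λ_n → Λ^!`, so that operators on the Koszul complex are operators on such maps;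
`Zigzag.tel` and `Zigzag.extE` transport these to the cone.
-/

set_option linter.unusedSectionVars false

noncomputable section

namespace HigherZigzag

/-! ### Degree zero part and linear resolutions -/

section Resolution

variable {F : Type u} [Field F] {L : Type u} [Ring L] [Algebra F L] {𝒜 : ℕ → Submodule F L}
  [GradedAlgebra 𝒜] {r : ℕ} {v : VertexIdem (zgr 𝒜) r}

theorem VertexIdem.e_mem (v : VertexIdem (zgr 𝒜) r) (k : Fin r) : v.e k ∈ 𝒜 0 := v.mem k

theorem VertexIdem.hom_mem_nat (v : VertexIdem (zgr 𝒜) r) (s : Fin r → F) : v.hom s ∈ 𝒜 0 :=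
  v.hom_mem s

theorem mul_mem_zero {x y : L} (hx : x ∈ 𝒜 0) (hy : y ∈ 𝒜 0) : x * y ∈ 𝒜 0 := by
  simpa using SetLike.GradedMul.mul_mem (A := 𝒜) hx hy

theorem mul_mem_right_zero {n : ℕ} {x y : L} (hx : x ∈ 𝒜 n) (hy : y ∈ 𝒜 0) : x * y ∈ 𝒜 n := by
  simpa using SetLike.GradedMul.mul_mem (A := 𝒜) hx hy

theorem mul_mem_left_zero {n : ℕ} {x y : L} (hx : x ∈ 𝒜 0) (hy : y ∈ 𝒜 n) : x * y ∈ 𝒜 n := by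
  simpa using SetLike.GradedMul.mul_mem (A := 𝒜) hx hy

/-- In a semisimple ring every element is of the form `x y x`. -/
theorem exists_mul_mul_eq {R : Type u} [Ring R] [IsSemisimpleRing R] (x : R) :
    ∃ y, x * y * x = x := by
  obtain ⟨e, he, hI⟩ := IsSemisimpleRing.ideal_eq_span_idempotent (Ideal.span {x})
  have h1 : x ∈ Ideal.span {e} := hI ▸ Ideal.mem_span_singleton_self x
  have h2 : e ∈ Ideal.span {x} := hI.symm ▸ Ideal.mem_span_singleton_self e
  obtain ⟨a, rfl⟩ := Ideal.mem_span_singleton'.1 h1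
  obtain ⟨b, hb⟩ := Ideal.mem_span_singleton'.1 h2
  refine ⟨b, ?_⟩
  rw [mul_assoc, hb, mul_assoc, he.eq]

/-- The degree zero part of an acyclic algebra is `S`: by triangularity an element of
`e_i Λ_0 e_j` with `i ≠ j` generates a nilpotent ideal, which vanishes by semisimplicity. -/
theorem VertexIdem.IsAcyclic.exists_hom_eq (hv : v.IsAcyclic) (hs : IsSemisimpleRing (𝒜 0))
    {x : L} (hx : x ∈ 𝒜 0) : ∃ s, v.hom s = x := by
  have off : ∀ i j, i ≠ j → v.e i * x * v.e j = 0 := by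
    intro i j hij
    rcases lt_or_gt_of_ne hij with h | h
    · obtain ⟨⟨y, hy⟩, hxy⟩ := exists_mul_mul_eq (R := 𝒜 0)
        ⟨v.e i * x * v.e j, mul_mem_zero (mul_mem_zero (v.e_mem i) hx) (v.e_mem j)⟩
      have h1 : v.e i * x * v.e j * y * (v.e i * x * v.e j) = v.e i * x * v.e j :=
        congrArg Subtype.val hxy
      rw [← h1]
      have h2 := hv.triangular i j h y
      calc v.e i * x * v.e j * y * (v.e i * x * v.e j)
          = v.e i * x * (v.e j * y * v.e i) * x * v.e j := by simp only [mul_assoc]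
        _ = 0 := by rw [h2]; simp
    · exact hv.triangular j i h x
  choose c hc using fun i => hv.scalar i x
  refine ⟨c, ?_⟩
  rw [v.hom_apply]
  calc ∑ i, c i • v.e i = ∑ i, ∑ j, v.e i * x * v.e j := by
        refine Finset.sum_congr rfl fun i _ => ?_
        rw [Finset.sum_eq_single i, hc]
        · exact fun j _ hj => off i j hj.symm
        · simp
    _ = x := by
        simp only [← Finset.mul_sum, ← Finset.sum_mul, v.complete.complete, one_mul, mul_one]

theorem VertexIdem.IsAcyclic.hom_injective (hv : v.IsAcyclic) : Function.Injective v.hom := by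
  rw [injective_iff_map_eq_zero]
  intro s hs
  ext k
  have h : v.hom s * v.e k = s k • v.e k := QFunctor.hom_mul_e v s k
  rw [hs, zero_mul] at h
  exact (smul_eq_zero.1 h.symm).resolve_right (hv.primitive k).2.1

namespace LinearResolution

variable (R : LinearResolution 𝒜)

instance (i : ℕ) : Module F (R.P i) := Module.compHom (R.P i) (algebraMap F L)

instance (i : ℕ) : IsScalarTower F L (R.P i) :=
  ⟨fun c a x => by
    change (c • a) • x = algebraMap F L c • (a • x)
    rw [Algebra.smul_def, mul_smul]⟩

theorem algebraMap_mem_zero (c : F) : algebraMap F L c ∈ 𝒜 0 := by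
  rw [Algebra.algebraMap_eq_smul_one]
  exact Submodule.smul_mem _ _ (SetLike.GradedOne.one_mem (A := 𝒜))

/-- The homogeneous components of `P_i`, as subspaces. -/
def comp (i : ℕ) (n : ℤ) : Submodule F (R.P i) where
  carrier := R.gr i n
  zero_mem' := zero_mem _
  add_mem' := add_mem
  smul_mem' := fun c x hx => by
    have := R.smul_mem i 0 n (algebraMap F L c) x (algebraMap_mem_zero c) hx
    simpa using this

theorem comp_internal (i : ℕ) : DirectSum.IsInternal (R.comp i) := R.internal i

theorem smul_mem_comp {i m : ℕ} {n : ℤ} {a : L} {x : R.P i} (ha : a ∈ 𝒜 m)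
    (hx : x ∈ R.comp i n) : a • x ∈ R.comp i (m + n) :=
  R.smul_mem i m n a x ha hx

theorem smul_zero_mem_comp {i : ℕ} {n : ℤ} {a : L} {x : R.P i} (ha : a ∈ 𝒜 0)
    (hx : x ∈ R.comp i n) : a • x ∈ R.comp i n := by
  simpa using R.smul_mem_comp ha hx

/-- The space of generators of `P_i`, its component of degree `i`. -/
abbrev U (i : ℕ) : Submodule F (R.P i) := R.comp i i

/-- The differential as an `F`-linear map. -/
def dF (i : ℕ) : R.P (i + 1) →ₗ[F] R.P i := (R.d i).restrictScalars F

theorem dF_smul (i : ℕ) (a : L) (x : R.P (i + 1)) : R.dF i (a • x) = a • R.dF i x :=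
  map_smul (R.d i) a x

theorem dF_mem {i : ℕ} {n : ℤ} {x : R.P (i + 1)} (hx : x ∈ R.comp (i + 1) n) :
    R.dF i x ∈ R.comp i n := R.d_mem i n x hx

theorem dF_dF (i : ℕ) (x : R.P (i + 1 + 1)) : R.dF i (R.dF (i + 1) x) = 0 :=
  (R.exact_succ i _).2 ⟨x, rfl⟩

/-- The part `Λ_m U_i` of `P_i`. -/
def genSpan (i m : ℕ) : Submodule F (R.P i) :=
  Submodule.span F {y | ∃ a ∈ 𝒜 m, ∃ u ∈ R.U i, y = a • u}

theorem induction_smul (i : ℕ) {p : R.P i → Prop} (zero : p 0)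
    (add : ∀ x y, p x → p y → p (x + y))
    (smul : ∀ m, ∀ a ∈ 𝒜 m, ∀ u ∈ R.U i, p (a • u)) (x : R.P i) : p x := by
  have hx : x ∈ Submodule.span L (R.gr i i : Set (R.P i)) := by rw [R.generated i]; trivial
  obtain ⟨n, f, g, rfl⟩ := Submodule.mem_span_set'.1 hx
  refine Finset.sum_induction _ p add zero fun j _ => ?_
  refine DirectSum.Decomposition.inductionOn 𝒜 (motive := fun a => p (a • (g j : R.P i))) ?_ ?_ ?_
    (f j)
  · rw [zero_smul]; exact zero
  · intro m a
    exact smul m a a.2 _ (g j).2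
  · intro a b ha hb
    rw [add_smul]; exact add _ _ ha hb

theorem component_mem_genSpan (i m : ℕ) (x : R.P i) :
    (component (R.comp_internal i) (m + i) x : R.P i) ∈ R.genSpan i m := by
  refine R.induction_smul i
    (p := fun x => (component (R.comp_internal i) (m + i) x : R.P i) ∈ R.genSpan i m) ?_ ?_ ?_ x
  · rw [map_zero]; exact zero_mem _
  · intro x y hx hy
    rw [map_add]; exact add_mem hx hy
  · intro n a ha u hu
    by_cases h : n = m
    · subst h
      rw [component_of_mem _ (R.smul_mem_comp ha hu)]
      exact Submodule.subset_span ⟨a, ha, u, hu, rfl⟩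
    · rw [component_of_mem_ne _ (by omega) (R.smul_mem_comp ha hu)]
      exact zero_mem _

theorem component_eq_zero (i : ℕ) {n : ℤ} (hn : n < i) (x : R.P i) :
    component (R.comp_internal i) n x = 0 := by
  refine R.induction_smul i (p := fun x => component (R.comp_internal i) n x = 0)
    (map_zero _) ?_ ?_ x
  · intro x y hx hy
    rw [map_add, hx, hy, add_zero]
  · intro m a ha u hu
    exact component_of_mem_ne _ (by omega) (R.smul_mem_comp ha hu)

theorem mem_genSpan {i m : ℕ} {n : ℤ} (h : n = m + i) {x : R.P i} (hx : x ∈ R.comp i n) :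
    x ∈ R.genSpan i m := by
  subst h
  have := R.component_mem_genSpan i m x
  rwa [component_of_mem _ hx] at this

theorem eq_zero_of_lt {i : ℕ} {n : ℤ} (h : n < i) {x : R.P i} (hx : x ∈ R.comp i n) : x = 0 := by
  have := R.component_eq_zero i h x
  rw [component_of_mem _ hx] at this
  exact congrArg Subtype.val this

/-- Linear maps commuting with the gradings commute with the projections to the components. -/
theorem map_component {i j : ℕ} (f : R.P i →ₗ[F] R.P j)
    (hf : ∀ n, ∀ x ∈ R.comp i n, f x ∈ R.comp j n) (n : ℤ) (x : R.P i) :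
    f (component (R.comp_internal i) n x) = component (R.comp_internal j) n (f x) := by
  refine homogeneous_induction (R.comp_internal i) ?_ (by simp) ?_ x
  · intro m x hx
    by_cases h : m = n
    · subst h
      rw [component_of_mem _ hx, component_of_mem _ (hf m x hx)]
    · rw [component_of_mem_ne _ h hx, component_of_mem_ne _ h (hf m x hx)]
      simp
  · intro x y hx hy
    simp only [map_add, Submodule.coe_add, hx, hy]

/-- Exactness of the resolution in every degree. -/
theorem exists_dF_eq {i : ℕ} {n : ℤ} {x : R.P (i + 1)} (hx : x ∈ R.comp (i + 1) n)
    (h : R.dF i x = 0) : ∃ y ∈ R.comp (i + 1 + 1) n, R.dF (i + 1) y = x := by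
  obtain ⟨y, rfl⟩ := (R.exact_succ i x).1 h
  refine ⟨component (R.comp_internal _) n y, Subtype.mem _, ?_⟩
  rw [R.map_component _ (fun n x hx => R.dF_mem hx)]
  have : R.dF (i + 1) y ∈ R.comp (i + 1) n := hx
  rw [component_of_mem _ this]
  rfl

theorem exists_dF_zero_eq {n : ℤ} {x : R.P 0} (hx : x ∈ R.comp 0 n)
    (h : R.ε x = 0) : ∃ y ∈ R.comp 1 n, R.dF 0 y = x := by
  obtain ⟨y, rfl⟩ := (R.exact_zero x).1 h
  refine ⟨component (R.comp_internal _) n y, Subtype.mem _, ?_⟩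
  rw [R.map_component _ (fun n x hx => R.dF_mem hx)]
  have : R.dF 0 y ∈ R.comp 0 n := hx
  rw [component_of_mem _ this]
  rfl

theorem dF_injOn {i : ℕ} {x : R.P (i + 1)} (hx : x ∈ R.U (i + 1)) (h : R.dF i x = 0) : x = 0 := by
  obtain ⟨y, hy, rfl⟩ := R.exists_dF_eq hx h
  rw [R.eq_zero_of_lt (by push_cast; omega) hy, map_zero]

/-- `P_i` is the module `Λ ⊗_S U_i`: a bilinear map on `Λ × U_i` which is balanced over `S` is
induced, on the part `Λ_n U_i`, by a linear map on `P_i`. It is obtained from a section of the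
projection `Λ ⊗ U_i → P_i`. -/
theorem exists_extension (hS : ∀ x ∈ 𝒜 0, ∃ s, v.hom s = x) (i n : ℕ) {X : Type u}
    [AddCommGroup X] [Module F X] (B : L →ₗ[F] R.U i →ₗ[F] X)
    (hB : ∀ a s (u u' : R.U i), (u' : R.P i) = v.hom s • (u : R.P i) →
      B (a * v.hom s) u = B a u') :
    ∃ Θ : R.P i →ₗ[F] X, ∀ a ∈ 𝒜 n, ∀ u : R.U i, Θ (a • (u : R.P i)) = B a u := by
  have := R.projective i
  let π : (L ⊗[F] R.U i) →ₗ[L] R.P i := TensorProduct.AlgebraTensorModule.lift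
    (LinearMap.toSpanSingleton L _ (R.U i).subtype)
  have hπ : ∀ a (u : R.U i), π (a ⊗ₜ u) = a • (u : R.P i) := fun a u => rfl
  have hsurj : Function.Surjective π := by
    intro x
    refine R.induction_smul i (p := fun x => ∃ t, π t = x) ⟨0, map_zero _⟩ ?_ ?_ x
    · rintro _ _ ⟨x, rfl⟩ ⟨y, rfl⟩
      exact ⟨x + y, map_add _ _ _⟩
    · intro m a _ u hu
      exact ⟨a ⊗ₜ ⟨u, hu⟩, hπ _ _⟩
  obtain ⟨σ, hσ⟩ := Module.projective_lifting_property π LinearMap.id hsurj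
  replace hσ : ∀ x, π (σ x) = x := fun x => LinearMap.congr_fun hσ x
  let q : ℕ → L →ₗ[F] L := fun n => GradedAlgebra.proj 𝒜 n
  have hq : ∀ n m : ℕ, ∀ a ∈ 𝒜 m, ∀ b, q (m + n) (a * b) = a * q n b := fun n m a ha b =>
    DirectSum.coe_decompose_mul_add_of_left_mem 𝒜 ha
  -- the degree `i` part of `π ∘ σ` involves only `Λ_0 ⊗ U_i`
  have hq0 : ∀ t : L ⊗[F] R.U i, π ((q 0).rTensor _ t) = component (R.comp_internal i) i (π t) := by
    intro t
    induction t using TensorProduct.induction_on with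
    | zero => simp
    | add x y hx hy => simp only [map_add, Submodule.coe_add, hx, hy]
    | tmul a u =>
      rw [LinearMap.rTensor_tmul, hπ, hπ]
      refine DirectSum.Decomposition.inductionOn 𝒜 (motive := fun a => q 0 a • (u : R.P i) =
        (component (R.comp_internal i) i (a • (u : R.P i)))) ?_ ?_ ?_ a
      · simp
      · intro m a
        have hm := R.smul_mem_comp a.2 u.2
        by_cases h : m = 0
        · subst h
          have h1 : q 0 (a : L) = a := DirectSum.decompose_of_mem_same 𝒜 a.2
          have h2 : (a : L) • (u : R.P i) ∈ R.comp i i := by simpa using hm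
          rw [component_of_mem _ h2, h1]
        · have h1 : q 0 (a : L) = 0 := DirectSum.decompose_of_mem_ne 𝒜 a.2 h
          rw [component_of_mem_ne _ (by omega) hm, h1, zero_smul]
          rfl
      · intro a b ha hb
        simp only [map_add, add_smul, Submodule.coe_add, ha, hb]
  let lB : L ⊗[F] R.U i →ₗ[F] X := TensorProduct.lift B
  -- by balancedness, the degree `0` part of `t` may be replaced by its image under `π`
  have hbal : ∀ (a : L) (t : L ⊗[F] R.U i), ∀ u : R.U i,
      (u : R.P i) = π ((q 0).rTensor _ t) →
      lB ((q 0).rTensor _ t |> (LinearMap.mulLeft F a).rTensor _) =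
        B a u := by
    intro a t
    induction t using TensorProduct.induction_on with
    | zero =>
      intro u hu
      have : u = 0 := Subtype.ext (by simpa using hu)
      simp [this]
    | add x y hx hy =>
      intro u hu
      have hmem : ∀ t : L ⊗[F] R.U i, π ((q 0).rTensor _ t) ∈ R.U i := fun t => by
        rw [hq0]; exact Subtype.mem _
      have hu' : u = ⟨_, hmem x⟩ + ⟨_, hmem y⟩ := Subtype.ext (by
        rw [hu]; simp only [map_add]; rfl)
      rw [hu', (B a).map_add, ← hx ⟨_, hmem x⟩ rfl, ← hy ⟨_, hmem y⟩ rfl]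
      simp only [map_add]
    | tmul b u' =>
      intro u hu
      obtain ⟨s, hs⟩ := hS (q 0 b) (SetLike.coe_mem _)
      rw [LinearMap.rTensor_tmul, hπ, ← hs] at hu
      simp only [LinearMap.rTensor_tmul, LinearMap.mulLeft_apply]
      rw [← hs]
      exact hB a s u' u hu
  refine ⟨lB ∘ₗ (q n).rTensor _ ∘ₗ σ.restrictScalars F, fun a ha u => ?_⟩
  have h1 : ∀ t : L ⊗[F] R.U i, (q n).rTensor (R.U i) (a • t) =
      (LinearMap.mulLeft F a).rTensor _ ((q 0).rTensor _ t) := by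
    intro t
    induction t using TensorProduct.induction_on with
    | zero => simp
    | add x y hx hy => simp only [smul_add, map_add, hx, hy]
    | tmul b u =>
      rw [TensorProduct.smul_tmul', LinearMap.rTensor_tmul, LinearMap.rTensor_tmul,
        LinearMap.rTensor_tmul, smul_eq_mul]
      have := hq 0 n a ha b
      rw [add_zero] at this
      rw [this]
      rfl
  change lB ((q n).rTensor _ (σ (a • (u : R.P i)))) = _
  rw [map_smul, h1]
  refine hbal a (σ u) u ?_
  rw [hq0, hσ, component_of_mem _ u.2]

end LinearResolution

end Resolution

/-! ### The Koszul complex and linear resolutions -/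

section Koszul

variable {F : Type u} [Field F] {L : Type u} [Ring L] [Algebra F L] (𝒜 : ℕ → Submodule F L)
  [GradedAlgebra 𝒜] {r : ℕ} (v : VertexIdem (zgr 𝒜) r)

/-- The projection `Λ → Λ_n`. -/
def projN (n : ℕ) : L →ₗ[F] 𝒜 n := component (DirectSum.Decomposition.isInternal (zgr 𝒜)) n

variable {𝒜}

theorem projN_of_mem {n : ℕ} {x : L} (hx : x ∈ 𝒜 n) : projN 𝒜 n x = ⟨x, hx⟩ :=
  component_of_mem (gr := zgr 𝒜) (DirectSum.Decomposition.isInternal (zgr 𝒜)) (n := n) hx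

theorem projN_coe {n : ℕ} (x : 𝒜 n) : projN 𝒜 n (x : L) = x := projN_of_mem x.2

/-- The multiplication `Λ_n × Λ_1 → Λ_{n+1}`. -/
def rmul (n : ℕ) : zgr 𝒜 1 →ₗ[F] 𝒜 n →ₗ[F] 𝒜 (n + 1) :=
  LinearMap.mk₂ F (fun x m => ⟨(m : L) * (x : L), SetLike.GradedMul.mul_mem (A := 𝒜) m.2 x.2⟩)
    (fun _ _ _ => Subtype.ext (mul_add _ _ _)) (fun _ _ _ => Subtype.ext (mul_smul_comm _ _ _))
    (fun _ _ _ => Subtype.ext (add_mul _ _ _)) (fun _ _ _ => Subtype.ext (smul_mul_assoc _ _ _))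

theorem coe_rmul (n : ℕ) (x : zgr 𝒜 1) (m : 𝒜 n) : (rmul n x m : L) = (m : L) * (x : L) := rfl

/-- The multiplication `Λ_1 × Λ_n → Λ_{n+1}`. -/
def lmul (n : ℕ) : zgr 𝒜 1 →ₗ[F] 𝒜 n →ₗ[F] 𝒜 (n + 1) :=
  LinearMap.mk₂ F (fun x m => ⟨(x : L) * (m : L), by
      rw [add_comm]; exact SetLike.GradedMul.mul_mem (A := 𝒜) (i := 1) x.2 m.2⟩)
    (fun _ _ _ => Subtype.ext (add_mul _ _ _)) (fun _ _ _ => Subtype.ext (smul_mul_assoc _ _ _))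
    (fun _ _ _ => Subtype.ext (mul_add _ _ _)) (fun _ _ _ => Subtype.ext (mul_smul_comm _ _ _))

theorem coe_lmul (n : ℕ) (x : zgr 𝒜 1) (m : 𝒜 n) : (lmul n x m : L) = (x : L) * (m : L) := rfl

/-- The right action of `S` on `Λ_n`. -/
def rS (n : ℕ) : (Fin r → F) →ₗ[F] 𝒜 n →ₗ[F] 𝒜 n :=
  LinearMap.mk₂ F (fun s m => ⟨(m : L) * v.hom s, mul_mem_right_zero m.2 (v.hom_mem_nat s)⟩)
    (fun _ _ _ => Subtype.ext (by simp [mul_add])) (fun _ _ _ => Subtype.ext (by simp))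
    (fun _ _ _ => Subtype.ext (by simp [add_mul])) (fun _ _ _ => Subtype.ext (by simp))

theorem coe_rS (n : ℕ) (s : Fin r → F) (m : 𝒜 n) : (rS v n s m : L) = (m : L) * v.hom s := rfl

/-- The left action of `S` on `Λ_n`. -/
def lS (n : ℕ) : (Fin r → F) →ₗ[F] 𝒜 n →ₗ[F] 𝒜 n :=
  LinearMap.mk₂ F (fun s m => ⟨v.hom s * (m : L), mul_mem_left_zero (v.hom_mem_nat s) m.2⟩)
    (fun _ _ _ => Subtype.ext (by simp [add_mul])) (fun _ _ _ => Subtype.ext (by simp))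
    (fun _ _ _ => Subtype.ext (by simp [mul_add])) (fun _ _ _ => Subtype.ext (by simp))

theorem coe_lS (n : ℕ) (s : Fin r → F) (m : 𝒜 n) : (lS v n s m : L) = v.hom s * (m : L) := rfl

/-- The space of right `S`-linear maps `Λ_n → (Λ^!)_j`, which is isomorphic to
`(Λ^!)_j ⊗_S (Λ_n)^*`. -/
def homS (n j : ℕ) : Submodule F (𝒜 n →ₗ[F] QDual v) where
  carrier := {φ | (∀ s m, φ (rS v n s m) = φ m * QDual.ofS v s) ∧ ∀ m, φ m ∈ QDual.natGr v j}
  zero_mem' := ⟨fun _ _ => by simp, fun _ => zero_mem _⟩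
  add_mem' := fun hφ hψ => ⟨fun s m => by
      simp only [LinearMap.add_apply, hφ.1, hψ.1, add_mul], fun m => add_mem (hφ.2 m) (hψ.2 m)⟩
  smul_mem' := fun c φ hφ => ⟨fun s m => by
      simp only [LinearMap.smul_apply, hφ.1, smul_mul_assoc],
      fun m => Submodule.smul_mem _ c (hφ.2 m)⟩

theorem natGr_mul_mem {i j : ℕ} {a b : QDual v} (ha : a ∈ QDual.natGr v i)
    (hb : b ∈ QDual.natGr v j) : a * b ∈ QDual.natGr v (i + j) :=
  QDual.natGr_mul v i j (Submodule.mul_mem_mul ha hb)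

theorem natGr_mul_ofS {j : ℕ} {a : QDual v} (ha : a ∈ QDual.natGr v j) (s : Fin r → F) :
    a * QDual.ofS v s ∈ QDual.natGr v j := by
  simpa using natGr_mul_mem v ha (QDual.ofS_mem v s)

theorem natGr_ofS_mul {j : ℕ} {a : QDual v} (ha : a ∈ QDual.natGr v j) (s : Fin r → F) :
    QDual.ofS v s * a ∈ QDual.natGr v j := by
  simpa using natGr_mul_mem v (QDual.ofS_mem v s) ha

section

variable [FiniteDimensional F (𝒜 1)]

/-- The differential of the left Koszul complex `Λ^! ⊗_S Λ^*`. -/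
def dK (n : ℕ) : (𝒜 (n + 1) →ₗ[F] QDual v) →ₗ[F] (𝒜 n →ₗ[F] QDual v) :=
  ∑ γ, (LinearMap.mulRight F (QFunctor.cobasis v γ)).compRight F ∘ₗ
    LinearMap.lcomp F (QDual v) (rmul n (basisV (zgr 𝒜) γ))

theorem dK_apply (n : ℕ) (φ : 𝒜 (n + 1) →ₗ[F] QDual v) (m : 𝒜 n) :
    dK v n φ m = ∑ γ, φ (rmul n (basisV (zgr 𝒜) γ) m) * QFunctor.cobasis v γ := by
  simp [dK, LinearMap.sum_apply]

theorem dK_dK (n : ℕ) (φ : 𝒜 (n + 1 + 1) →ₗ[F] QDual v) : dK v n (dK v (n + 1) φ) = 0 := by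
  ext m
  rw [dK_apply]
  simp only [dK_apply, Finset.sum_mul]
  have h := sum_quad v ((LinearMap.mul F (QDual v)) ∘ₗ φ ∘ₗ projN 𝒜 (n + 1 + 1) ∘ₗ
    LinearMap.mulLeft F (m : L))
  rw [Finset.sum_comm] at h
  refine Eq.trans (Finset.sum_congr rfl fun γ _ => Finset.sum_congr rfl fun β _ => ?_) h
  have : (m : L) * ((basisV (zgr 𝒜) γ : L) * (basisV (zgr 𝒜) β : L)) =
      (rmul (n + 1) (basisV (zgr 𝒜) β) (rmul n (basisV (zgr 𝒜) γ) m) : L) := by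
    rw [coe_rmul, coe_rmul, mul_assoc]
  simp only [LinearMap.comp_apply, LinearMap.mulLeft_apply, this, projN_coe, LinearMap.mul_apply',
    mul_assoc]
  rfl

theorem dK_mem {n j : ℕ} {φ : 𝒜 (n + 1) →ₗ[F] QDual v} (hφ : φ ∈ homS v (n + 1) j) :
    dK v n φ ∈ homS v n (j + 1) := by
  refine ⟨fun s m => ?_, fun m => ?_⟩
  · rw [dK_apply, dK_apply, Finset.sum_mul]
    have h := sum_left v ((LinearMap.mul F (QDual v)) ∘ₗ φ ∘ₗ projN 𝒜 (n + 1) ∘ₗ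
      LinearMap.mulLeft F (m : L)) s
    have h1 : ∀ γ, (m : L) * (v.hom s * (basisV (zgr 𝒜) γ : L)) =
        (rmul n (basisV (zgr 𝒜) γ) (rS v n s m) : L) := fun γ => by
      rw [coe_rmul, coe_rS, mul_assoc]
    have h2 : ∀ γ, (m : L) * (basisV (zgr 𝒜) γ : L) =
        (rmul n (basisV (zgr 𝒜) γ) m : L) := fun γ => rfl
    simp only [LinearMap.comp_apply, LinearMap.mulLeft_apply, h1, h2, projN_coe,
      LinearMap.mul_apply'] at h
    refine h.trans (Finset.sum_congr rfl fun γ _ => ?_)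
    rw [← mul_assoc]
    rfl
  · rw [dK_apply]
    exact sum_mem fun γ _ => natGr_mul_mem v (hφ.2 _) (QDual.gen_mem v _)

end

end Koszul

namespace LinearResolution

variable {F : Type u} [Field F] {L : Type u} [Ring L] [Algebra F L] {𝒜 : ℕ → Submodule F L}
  [GradedAlgebra 𝒜] {r : ℕ} {v : VertexIdem (zgr 𝒜) r} (R : LinearResolution 𝒜)

theorem eqOn_comp {j m : ℕ} {X : Type u} [AddCommGroup X] [Module F X] {g g' : R.P j →ₗ[F] X}
    (h : ∀ a ∈ 𝒜 m, ∀ u : R.U j, g (a • (u : R.P j)) = g' (a • (u : R.P j))) {n : ℤ}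
    (hn : n = m + j) {x : R.P j} (hx : x ∈ R.comp j n) : g x = g' x := by
  have hle : R.genSpan j m ≤ LinearMap.eqLocus g g' := by
    refine Submodule.span_le.2 ?_
    rintro _ ⟨a, ha, u, hu, rfl⟩
    exact h a ha ⟨u, hu⟩
  exact hle (R.mem_genSpan hn hx)

variable (v) in
/-- The action of `S` on the generators of `P_i`. -/
def actS (i : ℕ) : (Fin r → F) →ₐ[F] Module.End F (R.U i) :=
  AlgHom.ofLinearMap
    (LinearMap.mk₂ F (fun s u => ⟨v.hom s • (u : R.P i),
        R.smul_zero_mem_comp (v.hom_mem_nat s) u.2⟩)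
      (fun _ _ _ => Subtype.ext (by simp [add_smul])) (fun _ _ _ => Subtype.ext (by simp))
      (fun _ _ _ => Subtype.ext (by simp)) (fun c s u => Subtype.ext (by
        change v.hom s • c • (u : R.P i) = c • v.hom s • (u : R.P i)
        rw [smul_algebra_smul_comm])))
    (by ext u; simp) (fun s t => by ext u; simp [mul_smul])

theorem coe_actS (i : ℕ) (s : Fin r → F) (u : R.U i) :
    (R.actS v i s u : R.P i) = v.hom s • (u : R.P i) := rfl

theorem actS_single (i : ℕ) (s : Fin r → F) (k : Fin r) (u : R.U i) :
    R.actS v i (Pi.single k 1) (R.actS v i s u) = s k • R.actS v i (Pi.single k 1) u := by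
  apply Subtype.ext
  rw [coe_actS, coe_actS, ← mul_smul, v.hom_single, QFunctor.e_mul_hom]
  simp [coe_actS, v.hom_single]

variable (hS : ∀ x ∈ 𝒜 0, ∃ s, v.hom s = x)

/-- The functional on `Λ` induced by a functional on `Λ_1`. -/
def extV (f : VDual (zgr 𝒜)) : L →ₗ[F] F :=
  f ∘ₗ component (DirectSum.Decomposition.isInternal (zgr 𝒜)) 1

theorem extV_coe (f : VDual (zgr 𝒜)) (x : zgr 𝒜 1) : extV f (x : L) = f x :=
  congrArg f (component_of_mem _ x.2)

theorem extV_rV (f : VDual (zgr 𝒜)) (s : Fin r → F) {a : L} (ha : a ∈ 𝒜 1) :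
    extV (f ∘ₗ v.rV s) a = extV f (a * v.hom s) := by
  rw [show a = ((⟨a, ha⟩ : zgr 𝒜 1) : L) from rfl, extV_coe, LinearMap.comp_apply,
    ← VertexIdem.coe_rV, extV_coe]

theorem extV_lV (f : VDual (zgr 𝒜)) (s : Fin r → F) {a : L} (ha : a ∈ 𝒜 1) :
    extV (f ∘ₗ v.lV s) a = extV f (v.hom s * a) := by
  rw [show a = ((⟨a, ha⟩ : zgr 𝒜 1) : L) from rfl, extV_coe, LinearMap.comp_apply,
    ← VertexIdem.coe_lV, extV_coe]

include hS in
theorem exists_contraction (i n : ℕ) {W : Type u} [AddCommGroup W] [Module F W]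
    (ev : L →ₗ[F] Module.Dual F W) :
    ∃ C : R.P i →ₗ[F] W →ₗ[F] R.U i, ∀ a ∈ 𝒜 n, ∀ (u : R.U i) (f : W),
      C (a • (u : R.P i)) f = ∑ k, ev (a * v.e k) f • R.actS v i (Pi.single k 1) u := by
  let B : L →ₗ[F] R.U i →ₗ[F] W →ₗ[F] R.U i :=
    ∑ k, (LinearMap.smulRightₗ ∘ₗ ev ∘ₗ LinearMap.mulRight F (v.e k)).compl₂
      (R.actS v i (Pi.single k 1))
  have hB : ∀ a u f, B a u f = ∑ k, ev (a * v.e k) f • R.actS v i (Pi.single k 1) u := by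
    intro a u f
    simp [B, LinearMap.sum_apply]
  obtain ⟨C, hC⟩ := R.exists_extension hS i n B (fun a s u u' hu => by
    have hu' : u' = R.actS v i s u := Subtype.ext hu
    subst hu'
    ext1 f
    rw [hB, hB]
    refine Finset.sum_congr rfl fun k _ => ?_
    rw [actS_single, mul_assoc, QFunctor.hom_mul_e, mul_smul_comm, map_smul, LinearMap.smul_apply,
      smul_assoc, smul_comm])
  exact ⟨C, fun a ha u f => by rw [hC a ha, hB]⟩

/-- The contraction `Λ_1 ⊗_S U_i → U_i` with a functional on `Λ_1`. -/
def contr (i : ℕ) : R.P i →ₗ[F] VDual (zgr 𝒜) →ₗ[F] R.U i :=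
  (R.exists_contraction hS i 1 (Module.Dual.eval F (zgr 𝒜 1) ∘ₗ
    component (DirectSum.Decomposition.isInternal (zgr 𝒜)) 1)).choose

theorem contr_smul (i : ℕ) {a : L} (ha : a ∈ 𝒜 1) (u : R.U i) (f : VDual (zgr 𝒜)) :
    R.contr hS i (a • (u : R.P i)) f =
      ∑ k, extV f (a * v.e k) • R.actS v i (Pi.single k 1) u :=
  (R.exists_contraction hS i 1 (Module.Dual.eval F (zgr 𝒜 1) ∘ₗ
    component (DirectSum.Decomposition.isInternal (zgr 𝒜)) 1)).choose_spec a ha u f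

theorem actS_contr (i : ℕ) (s : Fin r → F) (f : VDual (zgr 𝒜)) {x : R.P i} {n : ℤ}
    (hn : n = 1 + i) (hx : x ∈ R.comp i n) :
    R.actS v i s (R.contr hS i x f) = R.contr hS i x (f ∘ₗ v.rV s) := by
  refine R.eqOn_comp (m := 1) (g := R.actS v i s ∘ₗ (R.contr hS i).flip f)
    (g' := (R.contr hS i).flip (f ∘ₗ v.rV s)) ?_ hn hx
  intro a ha u
  simp only [LinearMap.comp_apply, LinearMap.flip_apply, contr_smul R hS i ha, map_sum, map_smul]
  refine Finset.sum_congr rfl fun k _ => ?_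
  rw [extV_rV f s (mul_mem_right_zero ha (v.e_mem k)), mul_assoc, QFunctor.e_mul_hom,
    mul_smul_comm, map_smul, smul_assoc, smul_comm]
  congr 1
  rw [← Module.End.mul_apply, ← map_mul, mul_comm, map_mul, Module.End.mul_apply, actS_single]

theorem contr_hom_smul (i : ℕ) (s : Fin r → F) (f : VDual (zgr 𝒜)) {x : R.P i} {n : ℤ}
    (hn : n = 1 + i) (hx : x ∈ R.comp i n) :
    R.contr hS i (v.hom s • x) f = R.contr hS i x (f ∘ₗ v.lV s) := by
  refine R.eqOn_comp (m := 1)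
    (g := (R.contr hS i).flip f ∘ₗ (Algebra.lsmul F F (R.P i) (v.hom s)))
    (g' := (R.contr hS i).flip (f ∘ₗ v.lV s)) ?_ hn hx
  intro a ha u
  change R.contr hS i (v.hom s • a • (u : R.P i)) f = R.contr hS i (a • (u : R.P i)) _
  rw [← mul_smul, contr_smul R hS i (mul_mem_left_zero (v.hom_mem_nat s) ha),
    contr_smul R hS i ha]
  refine Finset.sum_congr rfl fun k _ => ?_
  rw [extV_lV f s (mul_mem_right_zero ha (v.e_mem k)), mul_assoc]

end LinearResolution

/-! ### Linear algebra of pairings -/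

section Linear

variable {F V W X : Type*} [Field F] [AddCommGroup V] [Module F V] [AddCommGroup W] [Module F W]
  [AddCommGroup X] [Module F X]

/-- Every linear map over a field has a von Neumann quasi-inverse. -/
theorem exists_quasiInverse (f : V →ₗ[F] W) : ∃ s : W →ₗ[F] V, ∀ x, f (s (f x)) = f x := by
  obtain ⟨s, hs⟩ := f.rangeRestrict.exists_rightInverse_of_surjective f.range_rangeRestrict
  obtain ⟨t, ht⟩ := s.exists_extend
  refine ⟨t, fun x => ?_⟩
  have h1 : t (f x) = s (f.rangeRestrict x) := LinearMap.congr_fun ht (f.rangeRestrict x)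
  rw [h1]
  exact congrArg Subtype.val (LinearMap.congr_fun hs (f.rangeRestrict x))

theorem exists_factor (f : V →ₗ[F] W) (g : V →ₗ[F] X) (h : ∀ x, f x = 0 → g x = 0) :
    ∃ χ : W →ₗ[F] X, ∀ x, χ (f x) = g x := by
  obtain ⟨s, hs⟩ := exists_quasiInverse f
  refine ⟨g ∘ₗ s, fun x => ?_⟩
  rw [LinearMap.comp_apply, ← sub_eq_zero, ← map_sub]
  exact h _ (by rw [map_sub, hs, sub_self])

end Linear

namespace LinearResolution

variable {F : Type u} [Field F] {L : Type u} [Ring L] [Algebra F L] {𝒜 : ℕ → Submodule F L}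
  [GradedAlgebra 𝒜] {r : ℕ} {v : VertexIdem (zgr 𝒜) r} (R : LinearResolution 𝒜)

variable (hS : ∀ x ∈ 𝒜 0, ∃ s, v.hom s = x)

/-- The operator `u ↦ f ⌟ d u` on the product of the spaces of generators. -/
def genOp : VDual (zgr 𝒜) →ₗ[F] Module.End F (∀ j, R.U j) :=
  LinearMap.mk₂ F (fun f u j => R.contr hS j (R.dF j (u (j + 1))) f)
    (fun _ _ _ => by ext; simp) (fun _ _ _ => by ext; simp)
    (fun _ _ _ => by ext; simp) (fun _ _ _ => by ext; simp)

theorem genOp_apply (f : VDual (zgr 𝒜)) (u : ∀ j, R.U j) (j : ℕ) :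
    R.genOp hS f u j = R.contr hS j (R.dF j (u (j + 1))) f := rfl

variable (v) in
/-- The diagonal action of `S` on the product of the spaces of generators. -/
def ofSOp : (Fin r → F) →ₐ[F] Module.End F (∀ j, R.U j) :=
  AlgHom.ofLinearMap
    (LinearMap.mk₂ F (fun s u j => R.actS v j s (u j))
      (fun _ _ _ => by ext; simp) (fun _ _ _ => by ext; simp)
      (fun _ _ _ => by ext; simp) (fun _ _ _ => by ext; simp))
    (by ext u j; simp) (fun s t => by ext u j; simp)

theorem ofSOp_apply (s : Fin r → F) (u : ∀ j, R.U j) (j : ℕ) :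
    R.ofSOp v s u j = R.actS v j s (u j) := rfl

theorem dF_mem_comp (j : ℕ) (u : R.U (j + 1)) : R.dF j (u : R.P (j + 1)) ∈ R.comp j (1 + j) := by
  have := R.dF_mem u.2
  push_cast at this
  rwa [add_comm] at this

theorem dF_contr_smul (j : ℕ) {a : L} (ha : a ∈ 𝒜 1) (u : R.U (j + 1)) (g : VDual (zgr 𝒜)) :
    R.dF j (R.contr hS (j + 1) (a • (u : R.P (j + 1))) g : R.P (j + 1)) =
      ∑ k, extV g (a * v.e k) • v.e k • R.dF j (u : R.P (j + 1)) := by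
  rw [contr_smul R hS (j + 1) ha, AddSubmonoidClass.coe_finsetSum, map_sum]
  refine Finset.sum_congr rfl fun k _ => ?_
  rw [Submodule.coe_smul, map_smul, coe_actS, dF_smul, v.hom_single]

/-- The quadratic relations of `Λ^!` hold for the contraction operators because `d² = 0`. -/
theorem genOp_quad (t : VDual (zgr 𝒜) ⊗[F] VDual (zgr 𝒜))
    (ht : ∀ x ∈ LinearMap.ker (mulVV (zgr 𝒜)), pairVV v t x = 0) :
    TensorProduct.lift ((LinearMap.mul F (Module.End F (∀ j, R.U j))).compl₁₂
      (R.genOp hS) (R.genOp hS)) t = 0 := by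
  have ht' : ∀ x, mulVV (zgr 𝒜) x = 0 → pairVV v t x = 0 := fun x hx =>
    ht x (LinearMap.mem_ker.2 hx)
  obtain ⟨ω, hω⟩ := exists_factor (F := F) (V := zgr 𝒜 1 ⊗[F] zgr 𝒜 1) (W := L) (X := F)
    (mulVV (zgr 𝒜)) (pairVV v t) ht'
  obtain ⟨S, rfl⟩ := TensorProduct.exists_finset t
  have hω' : ∀ a b : zgr 𝒜 1, ω ((a : L) * (b : L)) = ∑ i ∈ S, ∑ k,
      i.2 (v.rV (Pi.single k 1) a) * i.1 (v.lV (Pi.single k 1) b) := fun a b => by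
    have := hω (a ⊗ₜ b)
    rw [map_sum, LinearMap.sum_apply] at this
    simp only [pairVV_tmul] at this
    exact this
  refine LinearMap.ext fun u => funext fun j => ?_
  obtain ⟨Θ, hΘ⟩ := R.exists_contraction hS j 2 (LinearMap.mul F F ∘ₗ ω)
  let G : R.P (j + 1) →ₗ[F] R.U j := ∑ i ∈ S, (R.contr hS j).flip i.1 ∘ₗ R.dF j ∘ₗ
    (R.U (j + 1)).subtype ∘ₗ (R.contr hS (j + 1)).flip i.2
  have hG : ∀ x, G x = ∑ i ∈ S,
      R.contr hS j (R.dF j (R.contr hS (j + 1) x i.2 : R.P (j + 1))) i.1 := fun x => by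
    simp [G, LinearMap.sum_apply]
  have h1 : ∀ a ∈ 𝒜 1, ∀ y ∈ R.comp j (1 + j), ∑ i ∈ S, ∑ k, extV i.2 (a * v.e k) •
      R.contr hS j (v.e k • y) i.1 = Θ (a • y) 1 := by
    intro a ha y hy
    let N : R.P j →ₗ[F] R.U j := ∑ i ∈ S, ∑ k, extV i.2 (a * v.e k) •
      ((R.contr hS j).flip i.1 ∘ₗ Algebra.lsmul F F (R.P j) (v.e k))
    have hN : ∀ y, N y = ∑ i ∈ S, ∑ k, extV i.2 (a * v.e k) •
        R.contr hS j (v.e k • y) i.1 := fun y => by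
      simp [N, LinearMap.sum_apply]
    rw [← hN]
    refine R.eqOn_comp (m := 1) (g := N) (g' := Θ.flip 1 ∘ₗ Algebra.lsmul F F (R.P j) a) ?_
      (by norm_num) hy
    intro b hb w
    rw [hN]
    change _ = Θ (a • b • (w : R.P j)) 1
    rw [← mul_smul, hΘ _ (SetLike.GradedMul.mul_mem (A := 𝒜) (i := 1) (j := 1) ha hb)]
    have h2 : ∀ k, v.e k • b • (w : R.P j) = (v.e k * b) • (w : R.P j) := fun k =>
      (mul_smul _ _ _).symm
    simp only [h2, contr_smul R hS j (mul_mem_left_zero (v.e_mem _) hb), Finset.smul_sum]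
    have h3 : ∀ l, (LinearMap.mul F F ∘ₗ ω) (a * b * v.e l) 1 =
        ∑ i ∈ S, ∑ k, extV i.2 (a * v.e k) * extV i.1 (v.e k * b * v.e l) := fun l => by
      have := hω' ⟨a, ha⟩ ⟨b * v.e l, mul_mem_right_zero hb (v.e_mem l)⟩
      rw [LinearMap.comp_apply, LinearMap.mul_apply', mul_one, mul_assoc, this]
      simp only [← extV_coe, VertexIdem.coe_lV, VertexIdem.coe_rV, v.hom_single, mul_assoc]
    simp only [h3, Finset.sum_smul, mul_smul]
    conv_rhs => rw [Finset.sum_comm]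
    refine Finset.sum_congr rfl fun i _ => ?_
    conv_rhs => rw [Finset.sum_comm]
  have h4 : G (R.dF (j + 1) (u (j + 1 + 1) : R.P (j + 1 + 1))) =
      (Θ.flip 1 ∘ₗ R.dF j) (R.dF (j + 1) (u (j + 1 + 1) : R.P (j + 1 + 1))) := by
    refine R.eqOn_comp (m := 1) ?_ (by norm_num) (R.dF_mem_comp (j + 1) (u (j + 1 + 1)))
    intro a ha w
    rw [hG]
    change _ = Θ (R.dF j (a • (w : R.P (j + 1)))) 1
    rw [dF_smul, ← h1 a ha _ (R.dF_mem_comp j w)]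
    refine Finset.sum_congr rfl fun i _ => ?_
    rw [dF_contr_smul R hS j ha, map_sum, LinearMap.sum_apply]
    simp
  rw [hG, LinearMap.comp_apply, dF_dF, map_zero] at h4
  rw [map_sum, LinearMap.sum_apply, Finset.sum_apply]
  refine Eq.trans (Finset.sum_congr rfl fun i _ => ?_) h4
  rw [TensorProduct.lift.tmul, LinearMap.compl₁₂_apply, LinearMap.mul_apply', Module.End.mul_apply,
    genOp_apply, genOp_apply]

/-- The action of `Λ^!` on the product of the spaces of generators, where an element of `Λ_1^*`
acts through the differential followed by contraction. -/
def act : QDual v →ₐ[F] Module.End F (∀ j, R.U j) :=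
  QDual.lift v (R.ofSOp v) (R.genOp hS)
    (fun s f => by
      refine LinearMap.ext fun u => funext fun j => ?_
      rw [Module.End.mul_apply, ofSOp_apply, genOp_apply, genOp_apply]
      exact R.actS_contr hS j s f rfl (R.dF_mem_comp j _))
    (fun s f => by
      refine LinearMap.ext fun u => funext fun j => ?_
      rw [Module.End.mul_apply, genOp_apply, genOp_apply, ofSOp_apply, coe_actS, dF_smul]
      exact R.contr_hom_smul hS j s f rfl (R.dF_mem_comp j _))
    (R.genOp_quad hS)

theorem act_gen (f : VDual (zgr 𝒜)) : R.act hS (QDual.gen v f) = R.genOp hS f :=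
  QDual.lift_gen ..

theorem act_ofS (s : Fin r → F) : R.act hS (QDual.ofS v s) = R.ofSOp v s := QDual.lift_ofS ..

theorem genOp_single (f : VDual (zgr 𝒜)) (j : ℕ) (u : R.U (j + 1)) :
    R.genOp hS f (Pi.single (j + 1) u) =
      Pi.single j (R.contr hS j (R.dF j (u : R.P (j + 1))) f) := by
  funext i
  rw [genOp_apply]
  by_cases h : i = j
  · subst h; simp
  · rw [Pi.single_eq_of_ne (by omega), Pi.single_eq_of_ne h]; simp

theorem ofSOp_single (s : Fin r → F) (j : ℕ) (u : R.U j) :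
    R.ofSOp v s (Pi.single j u) = Pi.single j (R.actS v j s u) := by
  funext i
  rw [ofSOp_apply]
  by_cases h : i = j
  · subst h; simp
  · rw [Pi.single_eq_of_ne h, Pi.single_eq_of_ne h]; simp

/-- The augmentation of the resolution, as an `F`-linear map to `Λ`. -/
def εF : R.P 0 →ₗ[F] L where
  toFun x := R.ε x
  map_add' x y := by rw [map_add]; rfl
  map_smul' c x := by
    have h := R.ε_smul (algebraMap F L c) x
    rw [DirectSum.decompose_of_mem_same 𝒜 (algebraMap_mem_zero c)] at h
    rw [algebraMap_smul] at h
    rw [h, RingHom.id_apply, Algebra.smul_def]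

theorem εF_apply (x : R.P 0) : R.εF x = R.ε x := rfl

theorem εF_smul {a : L} (ha : a ∈ 𝒜 0) (x : R.P 0) : R.εF (a • x) = a * R.εF x := by
  rw [εF_apply, R.ε_smul, DirectSum.decompose_of_mem_same 𝒜 ha]
  rfl

theorem εF_injOn {u : R.P 0} (hu : u ∈ R.U 0) (h : R.εF u = 0) : u = 0 := by
  obtain ⟨y, hy, rfl⟩ := R.exists_dF_zero_eq hu (Subtype.ext h)
  rw [R.eq_zero_of_lt (by norm_num) hy, map_zero]

theorem exists_εF_eq {x : L} (hx : x ∈ 𝒜 0) : ∃ u : R.U 0, R.εF (u : R.P 0) = x := by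
  obtain ⟨y, hy⟩ := R.ε_surjective ⟨x, hx⟩
  refine ⟨component (R.comp_internal 0) 0 y, ?_⟩
  have h : ∀ y, R.εF (component (R.comp_internal 0) 0 y : R.P 0) = R.εF y := by
    intro y
    refine homogeneous_induction (R.comp_internal 0) ?_ (by simp) ?_ y
    · intro n y hy
      by_cases h : n = 0
      · subst h
        rw [component_of_mem _ hy]
      · rw [component_of_mem_ne _ h hy]
        rw [εF_apply, εF_apply, R.ε_eq_zero n h y hy]
        simp
    · intro x y hx hy
      simp only [map_add, Submodule.coe_add, hx, hy]
  exact (h y).trans (congrArg Subtype.val hy)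

end LinearResolution

/-! ### Exactness of the Koszul complex -/

section Scalars

variable {F : Type u} [Field F] {L : Type u} [Ring L] [Algebra F L] {𝒜 : ℕ → Submodule F L}
  [GradedAlgebra 𝒜] {r : ℕ} (v : VertexIdem (zgr 𝒜) r)

/-- The sum of the coefficients of an element of `S`, extended to `Λ` by a choice of a linear
left inverse of the inclusion `S → Λ`. -/
def trS : L →ₗ[F] F :=
  (∑ k, LinearMap.proj k) ∘ₗ (exists_quasiInverse v.hom.toLinearMap).choose

theorem trS_hom (hinj : Function.Injective v.hom) (s : Fin r → F) : trS v (v.hom s) = ∑ k, s k := by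
  have h : (exists_quasiInverse v.hom.toLinearMap).choose (v.hom s) = s :=
    hinj ((exists_quasiInverse v.hom.toLinearMap).choose_spec s)
  rw [trS, LinearMap.comp_apply, h, LinearMap.sum_apply]
  rfl

/-- The unit of `Λ`, as an element of `Λ_0`. -/
def oneN (𝒜 : ℕ → Submodule F L) [GradedAlgebra 𝒜] : 𝒜 0 :=
  ⟨1, SetLike.GradedOne.one_mem (A := 𝒜)⟩

theorem projN_mul_hom (n : ℕ) (a : L) (s : Fin r → F) :
    projN 𝒜 n (a * v.hom s) = rS v n s (projN 𝒜 n a) :=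
  Subtype.ext (component_mul_right (𝒜 := zgr 𝒜) (v.hom_mem s) (n : ℤ))

variable [FiniteDimensional F (𝒜 1)]

/-- `Λ^!` is generated in degree `1`, expressed through the Koszul differential. -/
theorem exists_dK_one {j : ℕ} {a : QDual v} (ha : a ∈ QDual.natGr v (j + 1)) :
    ∃ φ ∈ homS v (0 + 1) j, dK v 0 φ (oneN 𝒜) = a := by
  have ha' : a ∈ QDual.natGr v j * LinearMap.range (QDual.gen v) := by
    rw [QDual.natGr, mul_assoc, ← pow_succ]; exact ha
  refine Submodule.mul_induction_on ha' ?_ ?_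
  · rintro c hc _ ⟨f, rfl⟩
    let φ₀ : zgr 𝒜 1 →ₗ[F] QDual v := ∑ k, (f ∘ₗ v.rV (Pi.single k 1)).smulRight
      (c * QDual.ofS v (Pi.single k 1))
    let φ : 𝒜 (0 + 1) →ₗ[F] QDual v := φ₀
    have hφ : ∀ m, φ₀ m = ∑ k, (f ∘ₗ v.rV (Pi.single k 1)) m •
        (c * QDual.ofS v (Pi.single k 1)) := fun m => by
      rw [LinearMap.sum_apply]
      rfl
    have hlin : ∀ s (m m' : zgr 𝒜 1), (m' : L) = (m : L) * v.hom s →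
        φ₀ m' = φ₀ m * QDual.ofS v s := fun s m m' hm => by
      rw [hφ, hφ, Finset.sum_mul]
      refine Finset.sum_congr rfl fun k _ => ?_
      rw [smul_mul_assoc, mul_assoc, QFunctor.single_mul_ofS, mul_smul_comm, smul_smul]
      congr 1
      have : v.rV (Pi.single k 1) m' = s k • v.rV (Pi.single k 1) m := by
        refine Subtype.ext ?_
        rw [VertexIdem.coe_rV, hm, mul_assoc, v.hom_single, QFunctor.hom_mul_e, mul_smul_comm,
          Submodule.coe_smul, VertexIdem.coe_rV, v.hom_single]
      rw [LinearMap.comp_apply, this, map_smul, smul_eq_mul, mul_comm]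
      rfl
    have hdeg : ∀ m, φ₀ m ∈ QDual.natGr v j := fun m => by
      rw [hφ]
      exact sum_mem fun k _ => Submodule.smul_mem _ _ (natGr_mul_ofS v hc _)
    refine ⟨φ, ⟨fun s m => hlin s m (rS v (0 + 1) s m) rfl, hdeg⟩, ?_⟩
    · rw [dK_apply]
      have h1 : ∀ γ, φ (rmul 0 (basisV (zgr 𝒜) γ) (oneN 𝒜)) = φ₀ (basisV (zgr 𝒜) γ) := fun γ =>
        congrArg φ₀ (Subtype.ext (one_mul _))
      simp only [h1, hφ, Finset.sum_mul, smul_mul_assoc]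
      rw [Finset.sum_comm]
      have h2 : ∀ k, ∑ γ, (f ∘ₗ v.rV (Pi.single k 1)) (basisV (zgr 𝒜) γ) •
          (c * QDual.ofS v (Pi.single k 1) * QFunctor.cobasis v γ) =
          c * QDual.ofS v (Pi.single k 1) * QDual.gen v f := fun k => by
        have h3 : f ∘ₗ v.rV (Pi.single k 1) =
            ∑ γ, (f ∘ₗ v.rV (Pi.single k 1)) (basisV (zgr 𝒜) γ) • (basisV (zgr 𝒜)).coord γ :=
          ((basisV (zgr 𝒜)).sum_dual_apply_smul_coord _).symm
        have h4 : QDual.ofS v (Pi.single k 1) * QDual.gen v f = QDual.ofS v (Pi.single k 1) *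
            QDual.gen v (f ∘ₗ v.rV (Pi.single k 1)) := by
          rw [← QDual.ofS_mul_gen, ← mul_assoc, ← map_mul]
          congr 2
          ext i
          by_cases h : i = k
          · subst h; simp
          · simp [Pi.single_eq_of_ne h]
        rw [mul_assoc, h4, h3]
        simp only [map_sum, map_smul, Finset.mul_sum, mul_smul_comm, mul_assoc]
        refine Finset.sum_congr rfl fun γ _ => ?_
        rw [← h3]
        rfl
      refine (Finset.sum_congr rfl fun k _ => h2 k).trans ?_
      rw [← Finset.sum_mul, ← Finset.mul_sum, ← map_sum]
      have h5 : ∑ k : Fin r, (Pi.single k 1 : Fin r → F) = 1 :=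
        Finset.univ_sum_single (1 : Fin r → F)
      rw [h5, map_one, mul_one]
  · rintro _ _ ⟨φ, hφ, rfl⟩ ⟨ψ, hψ, rfl⟩
    exact ⟨φ + ψ, add_mem hφ hψ, by rw [map_add]; rfl⟩

end Scalars

namespace LinearResolution

variable {F : Type u} [Field F] {L : Type u} [Ring L] [Algebra F L] {𝒜 : ℕ → Submodule F L}
  [GradedAlgebra 𝒜] {r : ℕ} {v : VertexIdem (zgr 𝒜) r} (R : LinearResolution 𝒜)
  (hS : ∀ x ∈ 𝒜 0, ∃ s, v.hom s = x)

/-- The pairing between `(Λ^!)_j` and the space `U_j` of generators of `P_j`, which identifies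
`(Λ^!)_j` with the dual space of `U_j`. -/
def pair (j : ℕ) : QDual v →ₗ[F] R.U j →ₗ[F] F :=
  LinearMap.mk₂ F (fun a u => trS v (R.εF (R.act hS a (Pi.single j u) 0 : R.P 0)))
    (fun _ _ _ => by simp) (fun _ _ _ => by simp)
    (fun _ _ _ => by simp [Pi.single_add]) (fun _ _ _ => by simp [Pi.single_smul])

theorem pair_apply (j : ℕ) (a : QDual v) (u : R.U j) :
    R.pair hS j a u = trS v (R.εF (R.act hS a (Pi.single j u) 0 : R.P 0)) := rfl

theorem pair_mul_gen (j : ℕ) (a : QDual v) (f : VDual (zgr 𝒜)) (u : R.U (j + 1)) :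
    R.pair hS (j + 1) (a * QDual.gen v f) u =
      R.pair hS j a (R.contr hS j (R.dF j (u : R.P (j + 1))) f) := by
  rw [pair_apply, pair_apply, map_mul, Module.End.mul_apply, act_gen, genOp_single]

theorem pair_mul_ofS (j : ℕ) (a : QDual v) (s : Fin r → F) (u : R.U j) :
    R.pair hS j (a * QDual.ofS v s) u = R.pair hS j a (R.actS v j s u) := by
  rw [pair_apply, pair_apply, map_mul, Module.End.mul_apply, act_ofS, ofSOp_single]

theorem pair_ofS (s : Fin r → F) (u : R.U 0) :
    R.pair hS 0 (QDual.ofS v s) u = trS v (v.hom s * R.εF (u : R.P 0)) := by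
  rw [pair_apply, act_ofS, ofSOp_single, Pi.single_eq_same, coe_actS, εF_smul R (v.hom_mem_nat s)]

variable [FiniteDimensional F (𝒜 1)]

theorem sum_contr (j : ℕ) {y : R.P j} (hy : y ∈ R.comp j (1 + j)) :
    ∑ γ, (basisV (zgr 𝒜) γ : L) • (R.contr hS j y ((basisV (zgr 𝒜)).coord γ) : R.P j) = y := by
  let N : R.P j →ₗ[F] R.P j := ∑ γ, Algebra.lsmul F F (R.P j) (basisV (zgr 𝒜) γ : L) ∘ₗ
    (R.U j).subtype ∘ₗ (R.contr hS j).flip ((basisV (zgr 𝒜)).coord γ)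
  have hN : ∀ y, N y = ∑ γ, (basisV (zgr 𝒜) γ : L) •
      (R.contr hS j y ((basisV (zgr 𝒜)).coord γ) : R.P j) := fun y => by
    simp [N, LinearMap.sum_apply]
  rw [← hN]
  refine R.eqOn_comp (m := 1) (g := N) (g' := LinearMap.id) ?_ (by norm_num) hy
  intro a ha u
  rw [hN, LinearMap.id_apply]
  simp only [contr_smul R hS j ha, AddSubmonoidClass.coe_finsetSum, Submodule.coe_smul,
    Finset.smul_sum]
  rw [Finset.sum_comm]
  have h1 : ∀ k, ∑ γ, (basisV (zgr 𝒜) γ : L) • extV ((basisV (zgr 𝒜)).coord γ) (a * v.e k) •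
      (R.actS v j (Pi.single k 1) u : R.P j) = (a * v.e k) • (u : R.P j) := fun k => by
    have hm : a * v.e k ∈ zgr 𝒜 1 := mul_mem_right_zero ha (v.e_mem k)
    have h2 := congrArg (fun x : zgr 𝒜 1 => (x : L)) ((basisV (zgr 𝒜)).sum_repr ⟨a * v.e k, hm⟩)
    simp only [AddSubmonoidClass.coe_finsetSum, Submodule.coe_smul] at h2
    have h3 : (a * v.e k) • (u : R.P j) =
        (a * v.e k) • (R.actS v j (Pi.single k 1) u : R.P j) := by
      rw [coe_actS, ← mul_smul, v.hom_single, mul_assoc, (v.complete.idem k).eq]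
    rw [h3]
    conv_rhs => rw [← h2]
    rw [Finset.sum_smul]
    refine Finset.sum_congr rfl fun γ _ => ?_
    rw [smul_assoc, smul_algebra_smul_comm]
    congr 1
    exact extV_coe _ (⟨a * v.e k, hm⟩ : zgr 𝒜 1)
  refine (Finset.sum_congr rfl fun k _ => h1 k).trans ?_
  rw [← Finset.sum_smul, ← Finset.mul_sum, v.complete.complete, mul_one]

/-- The pairing is onto the dual of `U_j`, as the differential is injective on `U_{j+1}` and its
image is determined by the contractions. -/
theorem exists_pair_eq (hinj : Function.Injective v.hom) (j : ℕ) (l : R.U j →ₗ[F] F) :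
    ∃ a ∈ QDual.natGr v j, R.pair hS j a = l := by
  induction j with
  | zero =>
    choose u hu using fun k => R.exists_εF_eq (v.e_mem k)
    refine ⟨QDual.ofS v fun k => l (u k), QDual.ofS_mem v _, LinearMap.ext fun w => ?_⟩
    obtain ⟨t, ht⟩ := hS (R.εF (w : R.P 0)) (SetLike.coe_mem _)
    have hw : w = ∑ k, t k • u k := by
      rw [← sub_eq_zero]
      refine Subtype.ext (R.εF_injOn (Subtype.mem _) ?_)
      rw [AddSubgroupClass.coe_sub, map_sub, ← ht, AddSubmonoidClass.coe_finsetSum, map_sum,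
        v.hom_apply, sub_eq_zero]
      simp only [Submodule.coe_smul, map_smul, hu]
    rw [pair_ofS, ← ht, ← map_mul, trS_hom v hinj, hw, map_sum]
    refine Finset.sum_congr rfl fun k _ => ?_
    rw [map_smul, smul_eq_mul, Pi.mul_apply, mul_comm]
  | succ j ih =>
    obtain ⟨l', hl'⟩ := exists_factor (R.dF j ∘ₗ (R.U (j + 1)).subtype) l (fun u hu => by
      rw [show u = 0 from Subtype.ext (R.dF_injOn u.2 hu), map_zero])
    choose a ha ha' using fun γ : Fin (Module.finrank F (zgr 𝒜 1)) =>
      ih (l' ∘ₗ Algebra.lsmul F F (R.P j) (basisV (zgr 𝒜) γ : L) ∘ₗ (R.U j).subtype)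
    refine ⟨∑ γ, a γ * QFunctor.cobasis v γ,
      sum_mem fun γ _ => natGr_mul_mem v (ha γ) (QDual.gen_mem v _), LinearMap.ext fun u => ?_⟩
    have h1 := hl' u
    rw [LinearMap.comp_apply, Submodule.subtype_apply,
      ← R.sum_contr hS j (R.dF_mem_comp j u), map_sum] at h1
    rw [map_sum, LinearMap.sum_apply, ← h1]
    refine Finset.sum_congr rfl fun γ _ => ?_
    rw [QFunctor.cobasis, pair_mul_gen, ha']
    rfl

/-- The functional `Θ` on `P_j` is the one which corresponds to `φ : Λ_n → (Λ^!)_j` under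
`Hom_S (Λ_n, (Λ^!)_j) = (Λ_n ⊗_S U_j)^*`. -/
def Represents {n : ℕ} (j : ℕ) (φ : 𝒜 n →ₗ[F] QDual v) (Θ : R.P j →ₗ[F] F) : Prop :=
  ∀ (m : 𝒜 n) (u : R.U j), Θ ((m : L) • (u : R.P j)) = R.pair hS j (φ m) u

theorem exists_represents {n j : ℕ} {φ : 𝒜 n →ₗ[F] QDual v} (hφ : φ ∈ homS v n j) :
    ∃ Θ, R.Represents hS j φ Θ := by
  obtain ⟨Θ, hΘ⟩ := R.exists_extension hS j n (R.pair hS j ∘ₗ φ ∘ₗ projN 𝒜 n)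
    (fun a s u u' hu => by
      have hu' : u' = R.actS v j s u := Subtype.ext hu
      subst hu'
      simp only [LinearMap.comp_apply]
      rw [projN_mul_hom, hφ.1, pair_mul_ofS])
  refine ⟨Θ, fun m u => ?_⟩
  rw [hΘ m m.2 u, LinearMap.comp_apply, LinearMap.comp_apply, projN_coe]

variable {R hS}

theorem Represents.eq_zero {n j : ℕ} {φ : 𝒜 n →ₗ[F] QDual v} {Θ : R.P j →ₗ[F] F}
    (h : R.Represents hS j φ Θ) (h0 : ∀ m, R.pair hS j (φ m) = 0) {y : R.P j}
    (hy : y ∈ R.comp j (n + j)) : Θ y = 0 := by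
  refine R.eqOn_comp (m := n) (g := Θ) (g' := 0) (fun a ha u => ?_) rfl hy
  rw [h ⟨a, ha⟩ u, h0]
  rfl

theorem Represents.dF {n j : ℕ} {φ : 𝒜 (n + 1) →ₗ[F] QDual v} {Θ : R.P j →ₗ[F] F}
    (h : R.Represents hS j φ Θ) : R.Represents hS (j + 1) (dK v n φ) (Θ ∘ₗ R.dF j) := by
  intro m u
  have h1 := R.sum_contr hS j (R.dF_mem_comp j u)
  rw [LinearMap.comp_apply, dF_smul, ← h1, Finset.smul_sum, map_sum, dK_apply, map_sum,
    LinearMap.sum_apply]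
  refine Finset.sum_congr rfl fun γ _ => ?_
  rw [QFunctor.cobasis, pair_mul_gen, ← mul_smul, ← coe_rmul, h]

variable (R hS)

/-- Exactness of the left Koszul complex at `φ`, provided that the pairing is perfect in the two
degrees involved: if `Θ` vanishes on the kernel of the differential of the resolution, it factors
through the differential, and the factor represents a preimage of `φ`. -/
theorem exists_dK_eq {n j : ℕ} (hinj : Function.Injective v.hom)
    (inj0 : ∀ a ∈ QDual.natGr v j, R.pair hS j a = 0 → a = 0)
    (inj1 : ∀ a ∈ QDual.natGr v (j + 1), R.pair hS (j + 1) a = 0 → a = 0)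
    {φ : 𝒜 n →ₗ[F] QDual v} (hφ : φ ∈ homS v n (j + 1)) {Θ : R.P (j + 1) →ₗ[F] F}
    (h : R.Represents hS (j + 1) φ Θ)
    (h0 : ∀ y ∈ R.comp (j + 1) (n + (j + 1 : ℕ)), R.dF j y = 0 → Θ y = 0) :
    ∃ ψ ∈ homS v (n + 1) j, dK v n ψ = φ := by
  obtain ⟨χ, hχ⟩ := exists_factor (R.dF j ∘ₗ (R.comp (j + 1) (n + (j + 1 : ℕ))).subtype)
    (Θ ∘ₗ (R.comp (j + 1) (n + (j + 1 : ℕ))).subtype) (fun y hy => h0 y y.2 hy)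
  let E : QDual.natGr v j ≃ₗ[F] (R.U j →ₗ[F] F) :=
    LinearEquiv.ofBijective (R.pair hS j ∘ₗ (QDual.natGr v j).subtype)
      ⟨(injective_iff_map_eq_zero _).2 fun a ha => Subtype.ext (inj0 a a.2 ha), fun l => by
        obtain ⟨a, ha, h⟩ := R.exists_pair_eq hS hinj j l
        exact ⟨⟨a, ha⟩, h⟩⟩
  let B : L →ₗ[F] R.U j →ₗ[F] F := LinearMap.mk₂ F (fun a u => χ (a • (u : R.P j)))
    (fun _ _ _ => by simp [add_smul]) (fun _ _ _ => by simp) (fun _ _ _ => by simp)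
    (fun c a u => by rw [Submodule.coe_smul, smul_algebra_smul_comm, map_smul])
  let ψ : 𝒜 (n + 1) →ₗ[F] QDual v :=
    (QDual.natGr v j).subtype ∘ₗ E.symm.toLinearMap ∘ₗ B ∘ₗ (𝒜 (n + 1)).subtype
  have hψm : ∀ m, ψ m ∈ QDual.natGr v j := fun m => Subtype.mem _
  have hψ : R.Represents hS j ψ χ := fun m u =>
    (LinearMap.congr_fun (E.apply_symm_apply (B m)) u).symm
  have hmem : ψ ∈ homS v (n + 1) j := by
    refine ⟨fun s m => ?_, hψm⟩
    rw [← sub_eq_zero]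
    refine inj0 _ (sub_mem (hψm _) (natGr_mul_ofS v (hψm _) s)) (LinearMap.ext fun u => ?_)
    rw [map_sub, LinearMap.sub_apply, pair_mul_ofS, ← hψ, ← hψ, coe_rS, coe_actS, mul_smul,
      sub_self]
    rfl
  refine ⟨ψ, hmem, LinearMap.ext fun m => ?_⟩
  rw [← sub_eq_zero]
  refine inj1 _ (sub_mem ((dK_mem v hmem).2 m) (hφ.2 m)) (LinearMap.ext fun u => ?_)
  rw [map_sub, LinearMap.sub_apply, ← hψ.dF, ← h]
  exact sub_eq_zero.2 (hχ ⟨_, R.smul_mem_comp m.2 u.2⟩)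

theorem pair_injective_zero (hinj : Function.Injective v.hom) (a : QDual v)
    (ha : a ∈ QDual.natGr v 0) (h : R.pair hS 0 a = 0) : a = 0 := by
  rw [QDual.natGr, pow_zero, mul_one] at ha
  obtain ⟨s, rfl⟩ := ha
  change QDual.ofS v s = 0
  change R.pair hS 0 (QDual.ofS v s) = 0 at h
  have : s = 0 := by
    ext k
    obtain ⟨u, hu⟩ := R.exists_εF_eq (v.e_mem k)
    have h1 := R.pair_ofS hS s u
    rw [h, hu, ← v.hom_single, ← map_mul, trS_hom v hinj] at h1
    rw [LinearMap.zero_apply, Finset.sum_eq_single k (fun i _ hi => by simp [Pi.single_eq_of_ne hi])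
      (by simp)] at h1
    simpa using h1.symm
  rw [this, map_zero]

theorem pair_injective_succ {j : ℕ} {a : QDual v} (ha : a ∈ QDual.natGr v (j + 1))
    (h : R.pair hS (j + 1) a = 0)
    (key : ∀ φ ∈ homS v (0 + 1) j, ∀ Θ, R.Represents hS j φ Θ →
      (∀ y ∈ R.U (j + 1), Θ (R.dF j y) = 0) → dK v 0 φ = 0) : a = 0 := by
  obtain ⟨φ, hφ, rfl⟩ := exists_dK_one v ha
  obtain ⟨Θ, hΘ⟩ := R.exists_represents hS hφ
  rw [key φ hφ Θ hΘ fun y hy => ?_]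
  · rfl
  · refine hΘ.dF.eq_zero (fun m => ?_) (by rw [Nat.cast_zero, zero_add]; exact hy)
    obtain ⟨s, hs⟩ := hS m m.2
    have hm : m = rS v 0 s (oneN 𝒜) := Subtype.ext (by rw [coe_rS, hs]; exact (one_mul _).symm)
    rw [hm, (dK_mem v hφ).1]
    ext u
    rw [pair_mul_ofS, h]
    rfl

/-- The pairing is injective on `(Λ^!)_j`. Two consecutive degrees are treated together: injectivity
in the degrees `j` and `j + 1` yields exactness of the Koszul complex at maps of degree `j + 1`,
from which injectivity in degree `j + 2` follows. -/
theorem pair_injective (hinj : Function.Injective v.hom) (j : ℕ) :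
    (∀ a ∈ QDual.natGr v j, R.pair hS j a = 0 → a = 0) ∧
      ∀ a ∈ QDual.natGr v (j + 1), R.pair hS (j + 1) a = 0 → a = 0 := by
  induction j with
  | zero =>
    refine ⟨R.pair_injective_zero hS hinj, fun a ha h => ?_⟩
    refine R.pair_injective_succ hS ha h fun φ hφ Θ hΘ h0 => ?_
    have : φ = 0 := by
      ext1 m
      refine R.pair_injective_zero hS hinj _ (hφ.2 m) (LinearMap.ext fun u => ?_)
      have hm : (m : L) • (u : R.P 0) ∈ R.comp 0 ((0 + 1 : ℕ) + (0 : ℕ)) :=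
        R.smul_mem_comp m.2 u.2
      obtain ⟨y, hy, h1⟩ := R.exists_dF_zero_eq hm (R.ε_eq_zero _ (by norm_num) _ hm)
      rw [← hΘ, ← h1]
      refine h0 y ?_
      have e : (((0 + 1 : ℕ) : ℤ) + ((0 : ℕ) : ℤ)) = ((0 + 1 : ℕ) : ℤ) := by simp
      rw [e] at hy
      exact hy
    rw [this, map_zero]
  | succ j ih =>
    refine ⟨ih.2, fun a ha h => ?_⟩
    refine R.pair_injective_succ hS ha h fun φ hφ Θ hΘ h0 => ?_
    obtain ⟨ψ, -, rfl⟩ := R.exists_dK_eq hS hinj ih.1 ih.2 hφ hΘ (fun y hy h1 => by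
      obtain ⟨z, hz, rfl⟩ := R.exists_dF_eq hy h1
      refine h0 z ?_
      have e : (((0 + 1 : ℕ) : ℤ) + (j + 1 : ℕ)) = ((j + 1 + 1 : ℕ) : ℤ) := by push_cast; ring
      rw [e] at hz
      exact hz)
    exact dK_dK v 0 ψ

include R hS in
theorem exists_dK_eq_zero (hinj : Function.Injective v.hom) {j : ℕ}
    {φ : 𝒜 0 →ₗ[F] QDual v} (hφ : φ ∈ homS v 0 (j + 1)) :
    ∃ ψ ∈ homS v (0 + 1) j, dK v 0 ψ = φ := by
  obtain ⟨Θ, hΘ⟩ := R.exists_represents hS hφ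
  obtain ⟨i0, i1⟩ := R.pair_injective hS hinj j
  refine R.exists_dK_eq hS hinj i0 i1 hφ hΘ fun y hy h1 => ?_
  obtain ⟨z, hz, rfl⟩ := R.exists_dF_eq hy h1
  rw [R.eq_zero_of_lt (by push_cast; omega) hz, map_zero, map_zero]

include R hS in
theorem exists_dK_eq_succ (hinj : Function.Injective v.hom) {n j : ℕ}
    {φ : 𝒜 (n + 1) →ₗ[F] QDual v} (hφ : φ ∈ homS v (n + 1) (j + 1)) (h : dK v n φ = 0) :
    ∃ ψ ∈ homS v (n + 1 + 1) j, dK v (n + 1) ψ = φ := by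
  obtain ⟨Θ, hΘ⟩ := R.exists_represents hS hφ
  obtain ⟨i0, i1⟩ := R.pair_injective hS hinj j
  refine R.exists_dK_eq hS hinj i0 i1 hφ hΘ fun y hy h1 => ?_
  obtain ⟨z, hz, rfl⟩ := R.exists_dF_eq hy h1
  refine hΘ.dF.eq_zero (fun m => ?_) (y := z) ?_
  · rw [h]
    simp
  · have e : (((n + 1 : ℕ) : ℤ) + (j + 1 : ℕ)) = (n : ℤ) + ((j + 1 + 1 : ℕ) : ℤ) := by
      push_cast; ring
    rw [e] at hz
    exact hz

include R hS in
theorem eq_zero_of_dK_eq_zero (hinj : Function.Injective v.hom) {n : ℕ}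
    {φ : 𝒜 (n + 1) →ₗ[F] QDual v} (hφ : φ ∈ homS v (n + 1) 0) (h : dK v n φ = 0) : φ = 0 := by
  obtain ⟨Θ, hΘ⟩ := R.exists_represents hS hφ
  ext1 m
  refine R.pair_injective_zero hS hinj _ (hφ.2 m) (LinearMap.ext fun u => ?_)
  have hm := R.smul_mem_comp m.2 u.2
  obtain ⟨y, hy, h1⟩ := R.exists_dF_zero_eq hm (R.ε_eq_zero _ (by push_cast; omega) _ hm)
  rw [← hΘ, ← h1]
  refine hΘ.dF.eq_zero (fun m => ?_) (y := y) ?_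
  · rw [h]
    simp
  · have e : (((n + 1 : ℕ) : ℤ) + (0 : ℕ)) = (n : ℤ) + ((0 + 1 : ℕ) : ℤ) := by push_cast; ring
    rw [e] at hy
    exact hy

end LinearResolution

/-! ### A contraction of the Koszul complex -/

section Contraction

variable {F : Type u} [Field F] {L : Type u} [Ring L] [Algebra F L] {𝒜 : ℕ → Submodule F L}
  [GradedAlgebra 𝒜] {r : ℕ} (v : VertexIdem (zgr 𝒜) r)

/-- The left action of `S` on maps `Λ_n → Λ^!`, through `Λ^!`. -/
def lmulS (n : ℕ) (s : Fin r → F) : (𝒜 n →ₗ[F] QDual v) →ₗ[F] (𝒜 n →ₗ[F] QDual v) :=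
  (LinearMap.mulLeft F (QDual.ofS v s)).compRight F

theorem lmulS_apply (n : ℕ) (s : Fin r → F) (φ : 𝒜 n →ₗ[F] QDual v) (m : 𝒜 n) :
    lmulS v n s φ m = QDual.ofS v s * φ m := rfl

/-- The right action of `S` on maps `Λ_n → Λ^!`, through the left action on `Λ_n`. -/
def precS (n : ℕ) (s : Fin r → F) : (𝒜 n →ₗ[F] QDual v) →ₗ[F] (𝒜 n →ₗ[F] QDual v) :=
  LinearMap.lcomp F (QDual v) (lS v n s)

theorem precS_apply (n : ℕ) (s : Fin r → F) (φ : 𝒜 n →ₗ[F] QDual v) (m : 𝒜 n) :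
    precS v n s φ m = φ (lS v n s m) := rfl

theorem lS_mul (n : ℕ) (s t : Fin r → F) (m : 𝒜 n) : lS v n s (lS v n t m) = lS v n (s * t) m :=
  Subtype.ext (by rw [coe_lS, coe_lS, coe_lS, map_mul, mul_assoc])

theorem lmulS_mul (n : ℕ) (s t : Fin r → F) (φ : 𝒜 n →ₗ[F] QDual v) :
    lmulS v n s (lmulS v n t φ) = lmulS v n (s * t) φ := by
  ext m
  rw [lmulS_apply, lmulS_apply, lmulS_apply, map_mul, mul_assoc]

theorem precS_mul (n : ℕ) (s t : Fin r → F) (φ : 𝒜 n →ₗ[F] QDual v) :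
    precS v n s (precS v n t φ) = precS v n (s * t) φ := by
  ext m
  rw [precS_apply, precS_apply, precS_apply, lS_mul, mul_comm]

theorem lmulS_precS (n : ℕ) (s t : Fin r → F) (φ : 𝒜 n →ₗ[F] QDual v) :
    lmulS v n s (precS v n t φ) = precS v n t (lmulS v n s φ) := rfl

theorem lmulS_smul (n : ℕ) (c : F) (s : Fin r → F) (φ : 𝒜 n →ₗ[F] QDual v) :
    lmulS v n (c • s) φ = c • lmulS v n s φ := by
  ext m
  rw [lmulS_apply, map_smul, smul_mul_assoc]; rfl

theorem precS_smul (n : ℕ) (c : F) (s : Fin r → F) (φ : 𝒜 n →ₗ[F] QDual v) :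
    precS v n (c • s) φ = c • precS v n s φ := by
  ext m
  rw [precS_apply, map_smul, LinearMap.smul_apply, map_smul]; rfl

theorem mul_single_eq (s : Fin r → F) (k : Fin r) :
    s * Pi.single k 1 = s k • (Pi.single k 1 : Fin r → F) := by
  ext i
  by_cases h : i = k
  · subst h; simp
  · simp [Pi.single_eq_of_ne h]

theorem sum_single_one : ∑ k : Fin r, (Pi.single k 1 : Fin r → F) = 1 :=
  Finset.univ_sum_single (1 : Fin r → F)

theorem sum_lmulS (n : ℕ) (φ : 𝒜 n →ₗ[F] QDual v) : ∑ k, lmulS v n (Pi.single k 1) φ = φ := by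
  ext m
  rw [LinearMap.sum_apply]
  simp only [lmulS_apply]
  rw [← Finset.sum_mul, ← map_sum, sum_single_one, map_one, one_mul]

theorem sum_precS (n : ℕ) (φ : 𝒜 n →ₗ[F] QDual v) : ∑ k, precS v n (Pi.single k 1) φ = φ := by
  ext m
  rw [LinearMap.sum_apply]
  simp only [precS_apply]
  rw [← map_sum, ← LinearMap.sum_apply, ← map_sum, sum_single_one]
  congr 1
  exact Subtype.ext (by rw [coe_lS, map_one, one_mul])

theorem lmulS_mem {n j : ℕ} (s : Fin r → F) {φ : 𝒜 n →ₗ[F] QDual v} (hφ : φ ∈ homS v n j) :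
    lmulS v n s φ ∈ homS v n j :=
  ⟨fun t m => by rw [lmulS_apply, lmulS_apply, hφ.1, mul_assoc],
    fun m => natGr_ofS_mul v (hφ.2 m) s⟩

theorem precS_mem {n j : ℕ} (s : Fin r → F) {φ : 𝒜 n →ₗ[F] QDual v} (hφ : φ ∈ homS v n j) :
    precS v n s φ ∈ homS v n j :=
  ⟨fun t m => by
    rw [precS_apply, precS_apply, ← hφ.1]
    congr 1
    exact Subtype.ext (by rw [coe_lS, coe_rS, coe_rS, coe_lS, mul_assoc]), fun m => hφ.2 _⟩

variable [FiniteDimensional F (𝒜 1)]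

theorem dK_lmulS (n : ℕ) (s : Fin r → F) (φ : 𝒜 (n + 1) →ₗ[F] QDual v) :
    dK v n (lmulS v (n + 1) s φ) = lmulS v n s (dK v n φ) := by
  ext m
  rw [dK_apply, lmulS_apply, dK_apply, Finset.mul_sum]
  simp only [lmulS_apply, mul_assoc]

theorem dK_precS (n : ℕ) (s : Fin r → F) (φ : 𝒜 (n + 1) →ₗ[F] QDual v) :
    dK v n (precS v (n + 1) s φ) = precS v n s (dK v n φ) := by
  ext m
  rw [dK_apply, precS_apply, dK_apply]
  refine Finset.sum_congr rfl fun γ _ => ?_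
  rw [precS_apply]
  congr 2
  exact Subtype.ext (by rw [coe_lS, coe_rmul, coe_rmul, coe_lS, mul_assoc])

/-- An `S`-`S`-equivariant contraction of the left Koszul complex. The operator `h n j` is used on
maps `Λ_n → (Λ^!)_{j+1}` only; its index is the degree of the values of the result. The remaining
fields say that `h` is a contraction away from the copy of `S` in degree `0`. -/
structure KoszulContraction where
  h : ∀ n _j : ℕ, (𝒜 n →ₗ[F] QDual v) →ₗ[F] (𝒜 (n + 1) →ₗ[F] QDual v)
  mem : ∀ n j φ, φ ∈ homS v n (j + 1) → h n j φ ∈ homS v (n + 1) j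
  dK_zero : ∀ j φ, φ ∈ homS v 0 (j + 1) → dK v 0 (h 0 j φ) = φ
  dK_succ : ∀ n j φ, φ ∈ homS v (n + 1) (j + 1) →
    dK v (n + 1) (h (n + 1) j φ) + h n (j + 1) (dK v n φ) = φ
  h_dK : ∀ n φ, φ ∈ homS v (n + 1) 0 → h n 0 (dK v n φ) = φ
  lmulS : ∀ n j s φ, h n j (lmulS v n s φ) = HigherZigzag.lmulS v (n + 1) s (h n j φ)
  precS : ∀ n j s φ, h n j (precS v n s φ) = HigherZigzag.precS v (n + 1) s (h n j φ)

/-- The projection `φ ↦ e_k φ e_l`. -/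
def blockS (n : ℕ) (k l : Fin r) : (𝒜 n →ₗ[F] QDual v) →ₗ[F] (𝒜 n →ₗ[F] QDual v) :=
  lmulS v n (Pi.single k 1) ∘ₗ precS v n (Pi.single l 1)

theorem blockS_apply (n : ℕ) (k l : Fin r) (φ : 𝒜 n →ₗ[F] QDual v) :
    blockS v n k l φ = lmulS v n (Pi.single k 1) (precS v n (Pi.single l 1) φ) := rfl

theorem blockS_lmulS (n : ℕ) (k l : Fin r) (s : Fin r → F) (φ : 𝒜 n →ₗ[F] QDual v) :
    blockS v n k l (lmulS v n s φ) = s k • blockS v n k l φ := by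
  rw [blockS_apply, ← lmulS_precS, lmulS_mul, mul_comm, mul_single_eq, lmulS_smul, blockS_apply]

theorem lmulS_blockS (n : ℕ) (k l : Fin r) (s : Fin r → F) (φ : 𝒜 n →ₗ[F] QDual v) :
    lmulS v n s (blockS v n k l φ) = s k • blockS v n k l φ := by
  rw [blockS_apply, lmulS_mul, mul_single_eq, lmulS_smul]

theorem blockS_precS (n : ℕ) (k l : Fin r) (s : Fin r → F) (φ : 𝒜 n →ₗ[F] QDual v) :
    blockS v n k l (precS v n s φ) = s l • blockS v n k l φ := by
  rw [blockS_apply, precS_mul, mul_comm, mul_single_eq, precS_smul, map_smul, blockS_apply]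

theorem precS_blockS (n : ℕ) (k l : Fin r) (s : Fin r → F) (φ : 𝒜 n →ₗ[F] QDual v) :
    precS v n s (blockS v n k l φ) = s l • blockS v n k l φ := by
  rw [blockS_apply, ← lmulS_precS, precS_mul, mul_single_eq, precS_smul, map_smul]

theorem blockS_blockS (n : ℕ) (k l : Fin r) (φ : 𝒜 n →ₗ[F] QDual v) :
    blockS v n k l (blockS v n k l φ) = blockS v n k l φ := by
  conv_lhs => rw [blockS_apply, precS_blockS, map_smul, lmulS_blockS]
  simp

theorem sum_blockS (n : ℕ) (φ : 𝒜 n →ₗ[F] QDual v) : ∑ k, ∑ l, blockS v n k l φ = φ := by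
  simp only [blockS_apply, ← map_sum, sum_precS, sum_lmulS]

theorem blockS_mem {n j : ℕ} (k l : Fin r) {φ : 𝒜 n →ₗ[F] QDual v} (hφ : φ ∈ homS v n j) :
    blockS v n k l φ ∈ homS v n j := lmulS_mem v _ (precS_mem v _ hφ)

theorem dK_blockS (n : ℕ) (k l : Fin r) (φ : 𝒜 (n + 1) →ₗ[F] QDual v) :
    dK v n (blockS v (n + 1) k l φ) = blockS v n k l (dK v n φ) := by
  rw [blockS_apply, dK_lmulS, dK_precS, blockS_apply]

theorem exists_dK_quasiInverse (n j : ℕ) :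
    ∃ s : (𝒜 n →ₗ[F] QDual v) →ₗ[F] (𝒜 (n + 1) →ₗ[F] QDual v), (∀ φ, s φ ∈ homS v (n + 1) j) ∧
      ∀ φ ∈ homS v (n + 1) j, dK v n (s (dK v n φ)) = dK v n φ := by
  obtain ⟨s, hs⟩ := exists_quasiInverse (F := F) (V := homS v (n + 1) j)
    (W := 𝒜 n →ₗ[F] QDual v) (dK v n ∘ₗ (homS v (n + 1) j).subtype)
  exact ⟨(homS v (n + 1) j).subtype ∘ₗ s, fun φ => Subtype.mem _, fun φ hφ => hs ⟨φ, hφ⟩⟩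

/-- The exactness of the left Koszul complex yields a contraction. It can be made equivariant by
averaging, as `S` is a product of copies of the ground field. -/
theorem LinearResolution.nonempty_koszulContraction (R : LinearResolution 𝒜)
    (hS : ∀ x ∈ 𝒜 0, ∃ s, v.hom s = x) (hinj : Function.Injective v.hom) :
    Nonempty (KoszulContraction v) := by
  choose s hs hds using exists_dK_quasiInverse v
  let h : ∀ n _j : ℕ, (𝒜 n →ₗ[F] QDual v) →ₗ[F] (𝒜 (n + 1) →ₗ[F] QDual v) := fun n j =>
    match n with
    | 0 => s 0 j
    | n + 1 => s (n + 1) j ∘ₗ (LinearMap.id - s n (j + 1) ∘ₗ dK v n)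
  have hd : ∀ n j φ, h n j (dK v n φ) = s n j (dK v n φ) := fun n j φ => by
    cases n with
    | zero => rfl
    | succ n =>
      change s (n + 1) j (dK v (n + 1) φ - s n (j + 1) (dK v n (dK v (n + 1) φ))) = _
      rw [dK_dK, map_zero, sub_zero]
  have mem : ∀ n j φ, h n j φ ∈ homS v (n + 1) j := fun n j φ => by
    cases n with
    | zero => exact hs _ _ _
    | succ n => exact hs _ _ _
  have dK_zero : ∀ j φ, φ ∈ homS v 0 (j + 1) → dK v 0 (h 0 j φ) = φ := fun j φ hφ => by
    obtain ⟨ψ, hψ, rfl⟩ := R.exists_dK_eq_zero hS hinj hφ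
    exact hds 0 j ψ hψ
  have dK_succ : ∀ n j φ, φ ∈ homS v (n + 1) (j + 1) →
      dK v (n + 1) (h (n + 1) j φ) + h n (j + 1) (dK v n φ) = φ := fun n j φ hφ => by
    have h1 : φ - s n (j + 1) (dK v n φ) ∈ homS v (n + 1) (j + 1) := sub_mem hφ (hs _ _ _)
    obtain ⟨ψ, hψ, h2⟩ := R.exists_dK_eq_succ hS hinj h1 (by
      rw [map_sub, hds n (j + 1) φ hφ, sub_self])
    rw [hd]
    change dK v (n + 1) (s (n + 1) j (φ - s n (j + 1) (dK v n φ))) + _ = _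
    rw [← h2, hds (n + 1) j ψ hψ, h2, sub_add_cancel]
  have h_dK : ∀ n φ, φ ∈ homS v (n + 1) 0 → h n 0 (dK v n φ) = φ := fun n φ hφ => by
    rw [hd, ← sub_eq_zero]
    refine R.eq_zero_of_dK_eq_zero hS hinj (sub_mem (hs _ _ _) hφ) ?_
    rw [map_sub, hds n 0 φ hφ, sub_self]
  let h' : ∀ n _j : ℕ, (𝒜 n →ₗ[F] QDual v) →ₗ[F] (𝒜 (n + 1) →ₗ[F] QDual v) := fun n j =>
    ∑ k, ∑ l, blockS v (n + 1) k l ∘ₗ h n j ∘ₗ blockS v n k l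
  have hh' : ∀ n j φ, h' n j φ =
      ∑ k, ∑ l, blockS v (n + 1) k l (h n j (blockS v n k l φ)) := fun n j φ => by
    simp [h', LinearMap.sum_apply]
  refine ⟨⟨h', fun n j φ hφ => ?_, fun j φ hφ => ?_, fun n j φ hφ => ?_, fun n φ hφ => ?_,
    fun n j t φ => ?_, fun n j t φ => ?_⟩⟩
  · rw [hh']
    exact sum_mem fun k _ => sum_mem fun l _ => blockS_mem v k l (mem _ _ _)
  · rw [hh']
    simp only [map_sum, dK_blockS]
    rw [← sum_blockS v 0 φ]
    refine Finset.sum_congr rfl fun k _ => Finset.sum_congr rfl fun l _ => ?_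
    rw [dK_zero j _ (blockS_mem v k l (by rw [sum_blockS]; exact hφ)), sum_blockS, blockS_blockS]
  · rw [hh', hh']
    simp only [map_sum, dK_blockS, ← Finset.sum_add_distrib, ← map_add]
    conv_rhs => rw [← sum_blockS v (n + 1) φ]
    refine Finset.sum_congr rfl fun k _ => Finset.sum_congr rfl fun l _ => ?_
    rw [← dK_blockS, dK_succ n j _ (blockS_mem v k l hφ), blockS_blockS]
  · rw [hh']
    conv_rhs => rw [← sum_blockS v (n + 1) φ]
    refine Finset.sum_congr rfl fun k _ => Finset.sum_congr rfl fun l _ => ?_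
    rw [← dK_blockS, h_dK n _ (blockS_mem v k l hφ), blockS_blockS]
  · rw [hh', hh']
    simp only [map_sum, blockS_lmulS, lmulS_blockS, map_smul]
  · rw [hh', hh']
    simp only [map_sum, blockS_precS, precS_blockS, map_smul]

end Contraction

/-! ### Triangularity of the quadratic dual -/

section Triangular

variable {F : Type u} [Field F] {L : Type u} [Ring L] [Algebra F L] {𝒜 : ℕ → Submodule F L}
  [GradedAlgebra 𝒜] {r : ℕ} {v : VertexIdem (zgr 𝒜) r}

theorem VertexIdem.IsAcyclic.ofS_mul_gen_mul_ofS (hv : v.IsAcyclic) {i k : Fin r} (h : i ≤ k)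
    (f : VDual (zgr 𝒜)) :
    QDual.ofS v (Pi.single i 1) * QDual.gen v f * QDual.ofS v (Pi.single k 1) = 0 := by
  rw [QDual.ofS_mul_gen, QDual.gen_mul_ofS]
  have : (f ∘ₗ v.rV (Pi.single i 1)) ∘ₗ v.lV (Pi.single k 1) = 0 := by
    ext x
    have h1 : v.rV (Pi.single i 1) (v.lV (Pi.single k 1) x) = 0 := by
      refine Subtype.ext ?_
      rw [VertexIdem.coe_rV, VertexIdem.coe_lV, v.hom_single, v.hom_single]
      rcases h.lt_or_eq with h | rfl
      · exact hv.triangular i k h x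
      · obtain ⟨c, hc⟩ := hv.scalar i x
        have h2 : v.e i * (x : L) * v.e i ∈ 𝒜 1 :=
          mul_mem_right_zero (mul_mem_left_zero (v.e_mem i) x.2) (v.e_mem i)
        have h3 : v.e i * (x : L) * v.e i ∈ 𝒜 0 := by
          rw [hc]
          exact Submodule.smul_mem _ _ (v.e_mem i)
        exact (DirectSum.decompose_of_mem_same 𝒜 h2).symm.trans
          (DirectSum.decompose_of_mem_ne 𝒜 h3 zero_ne_one)
    rw [LinearMap.comp_apply, LinearMap.comp_apply, h1, map_zero]
    rfl
  rw [this, map_zero]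

theorem QDual.sum_ofS_mul (a : QDual v) : ∑ k, QDual.ofS v (Pi.single k 1) * a = a := by
  rw [← Finset.sum_mul, ← map_sum, sum_single_one, map_one, one_mul]

theorem QDual.sum_mul_ofS (a : QDual v) : ∑ k, a * QDual.ofS v (Pi.single k 1) = a := by
  rw [← Finset.mul_sum, ← map_sum, sum_single_one, map_one, mul_one]

/-- A nonzero element of `e_i (Λ^!)_j e_k` is a combination of paths of length `j`, along which
the vertices strictly decrease. -/
theorem VertexIdem.IsAcyclic.ofS_mul_mul_ofS (hv : v.IsAcyclic) (j : ℕ) {i k : Fin r}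
    (h : (i : ℕ) < k + j) {a : QDual v} (ha : a ∈ QDual.natGr v j) :
    QDual.ofS v (Pi.single i 1) * a * QDual.ofS v (Pi.single k 1) = 0 := by
  induction j generalizing i k a with
  | zero =>
    rw [QDual.natGr, pow_zero, mul_one] at ha
    obtain ⟨s, rfl⟩ := ha
    change _ * QDual.ofS v s * _ = 0
    have hik : i ≠ k := by rintro rfl; omega
    rw [QFunctor.single_mul_ofS, smul_mul_assoc, QFunctor.ofS_mul_single,
      Pi.single_eq_of_ne hik.symm, zero_smul, smul_zero]
  | succ j ih =>
    have ha' : a ∈ QDual.natGr v j * LinearMap.range (QDual.gen v) := by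
      rw [QDual.natGr, mul_assoc, ← pow_succ]; exact ha
    refine Submodule.mul_induction_on ha' ?_ ?_
    · rintro c hc _ ⟨f, rfl⟩
      have h1 : ∀ l, QDual.ofS v (Pi.single i 1) * (c * QDual.ofS v (Pi.single l 1)) *
          (QDual.ofS v (Pi.single l 1) * QDual.gen v f * QDual.ofS v (Pi.single k 1)) = 0 := by
        intro l
        by_cases hl : l ≤ k
        · rw [hv.ofS_mul_gen_mul_ofS hl, mul_zero]
        · have hl' : (k : ℕ) < l := by simpa using hl
          rw [← mul_assoc (QDual.ofS v (Pi.single i 1)), ih (by omega) hc, zero_mul]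
      rw [← QDual.sum_mul_ofS c]
      simp only [Finset.sum_mul, Finset.mul_sum]
      refine Finset.sum_eq_zero fun l _ => ?_
      rw [← h1 l]
      have h2 : QDual.ofS v (Pi.single l 1) * QDual.ofS v (Pi.single l 1) =
          QDual.ofS v (Pi.single l 1) := by simp [QFunctor.ofS_mul_single]
      conv_lhs => rw [← h2]
      simp only [mul_assoc]
    · intro x y hx hy
      rw [mul_add, add_mul, hx, hy, add_zero]

theorem VertexIdem.IsAcyclic.eq_zero_of_mem (hv : v.IsAcyclic) {j : ℕ} (h : r ≤ j) {a : QDual v}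
    (ha : a ∈ QDual.natGr v j) : a = 0 := by
  rw [← QDual.sum_mul_ofS a, ← QDual.sum_ofS_mul (∑ k, _)]
  refine Finset.sum_eq_zero fun i _ => ?_
  rw [Finset.mul_sum]
  refine Finset.sum_eq_zero fun k _ => ?_
  rw [← mul_assoc]
  exact hv.ofS_mul_mul_ofS j (by omega) ha

end Triangular

/-! ### The terms of the complex `Q` -/

namespace GrBimod

section Span

variable {F : Type u} [Field F] {A B C D : Type u} [Ring A] [Algebra F A] [Ring B] [Algebra F B]
  [Ring C] [Algebra F C] [Ring D] [Algebra F D] {𝒜 : ℤ → Submodule F A} {ℬ : ℤ → Submodule F B}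
  {𝒞 : ℤ → Submodule F C} {𝒟 : ℤ → Submodule F D} [GradedAlgebra ℬ]
  {M : GrBimod 𝒜 ℬ} {N : GrBimod ℬ 𝒞} {P : GrBimod 𝒞 𝒟}

theorem tensor_gr_le {n : ℤ} {W : Submodule F (tensor M N).carrier}
    (h : ∀ i j, i + j = n → ∀ x ∈ M.gr i, ∀ y ∈ N.gr j, tmul M N x y ∈ W) :
    (tensor M N).gr n ≤ W := by
  refine Submodule.span_le.2 ?_
  rintro _ ⟨i, j, hij, x, hx, y, hy, rfl⟩
  exact h i j hij x hx y hy

variable [GradedAlgebra 𝒞]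

theorem tensor3_gr_le {n : ℤ} {W : Submodule F ((M.tensor N).tensor P).carrier}
    (h : ∀ i j k, i + j + k = n → ∀ x ∈ M.gr i, ∀ y ∈ N.gr j, ∀ z ∈ P.gr k,
      tmul3 M N P x y z ∈ W) : ((M.tensor N).tensor P).gr n ≤ W := by
  refine tensor_gr_le fun i k hik t ht z hz => ?_
  have h1 : (tensor M N).gr i ≤ W.comap ((tmul (M.tensor N) P).flip z) :=
    tensor_gr_le fun i' j hij x hx y hy => h i' j k (by rw [hij, hik]) x hx y hy z hz
  exact h1 ht

theorem tensor3_induction {p : ((M.tensor N).tensor P).carrier → Prop}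
    (mk : ∀ a x b, p (tmul3 M N P a x b)) (zero : p 0) (add : ∀ x y, p x → p y → p (x + y))
    (x : ((M.tensor N).tensor P).carrier) : p x := by
  refine tmul_induction (fun m b => ?_) zero add x
  refine tmul_induction (P := fun m => p (tmul (M.tensor N) P m b)) (fun a x => mk a x b) ?_ ?_ m
  · rw [map_zero]; exact zero
  · intro y z hy hz
    rw [map_add]; exact add _ _ hy hz

/-- The universal property of `M ⊗ N ⊗ P`. -/
def tdesc3 (M : GrBimod 𝒜 ℬ) (N : GrBimod ℬ 𝒞) (P : GrBimod 𝒞 𝒟) {X : Type u} [AddCommGroup X]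
    [Module F X] (f : M.carrier →ₗ[F] N.carrier →ₗ[F] P.carrier →ₗ[F] X)
    (hl : ∀ a s x b, f (M.R (MulOpposite.op s) a) x b = f a (N.L s x) b)
    (hr : ∀ a s x b, f a (N.R (MulOpposite.op s) x) b = f a x (P.L s b)) :
    ((M.tensor N).tensor P).carrier →ₗ[F] X :=
  tdesc (M.tensor N) P (tdesc M N f (fun a s x => LinearMap.ext (hl a s x)))
    (fun m s b => by
      refine tmul_induction (fun a x => ?_) (by simp) ?_ m
      · rw [tensor_R, tdesc_tmul, tdesc_tmul, hr]
      · intro y z hy hz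
        simp only [map_add, LinearMap.add_apply, hy, hz])

theorem tdesc3_tmul3 (M : GrBimod 𝒜 ℬ) (N : GrBimod ℬ 𝒞) (P : GrBimod 𝒞 𝒟) {X : Type u}
    [AddCommGroup X] [Module F X] (f : M.carrier →ₗ[F] N.carrier →ₗ[F] P.carrier →ₗ[F] X)
    (hl) (hr) (a : M.carrier) (x : N.carrier) (b : P.carrier) :
    tdesc3 M N P f hl hr (tmul3 M N P a x b) = f a x b := by
  rw [tdesc3, tmul3_apply, tdesc_tmul, tdesc_tmul]

end Span

end GrBimod

section BasisComp

variable {F : Type u} [Field F] {V W P : Type u} [AddCommGroup V] [Module F V] [AddCommGroup W]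
  [Module F W] [AddCommGroup P] [Module F P]

theorem sum_coord_smul {ι : Type} [Fintype ι] (b : Module.Basis ι F V) (x : Module.Dual F V) :
    ∑ i, x (b i) • b.coord i = x := b.sum_dual_apply_smul_coord x

theorem sum_basis_map {ι κ : Type} [Fintype ι] [Fintype κ] (b : Module.Basis ι F V)
    (c : Module.Basis κ F W) (Ψ : W →ₗ[F] Module.Dual F V →ₗ[F] P) (T : V →ₗ[F] W) :
    ∑ i, Ψ (T (b i)) (b.coord i) = ∑ j, Ψ (c j) (c.coord j ∘ₗ T) := by
  have h1 : ∀ i, Ψ (T (b i)) (b.coord i) =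
      ∑ j, c.coord j (T (b i)) • Ψ (c j) (b.coord i) := fun i => by
    conv_lhs => rw [← c.sum_repr (T (b i))]
    rw [map_sum, LinearMap.sum_apply]
    simp only [map_smul, LinearMap.smul_apply, Module.Basis.coord_apply]
  simp only [h1]
  rw [Finset.sum_comm]
  refine Finset.sum_congr rfl fun j _ => ?_
  conv_rhs => rw [← sum_coord_smul b (c.coord j ∘ₗ T), map_sum]
  simp only [map_smul, LinearMap.comp_apply]

end BasisComp

namespace Zigzag

variable {F : Type u} [Field F] {L : Type u} [Ring L] [Algebra F L] {𝒜 : ℕ → Submodule F L}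
  [GradedAlgebra 𝒜] {r : ℕ} (v : VertexIdem (zgr 𝒜) r) (d : ℕ)

/-- The inclusion of `Λ^!` in the zigzag algebra. -/
abbrev ι : QDual v →ₐ[F] Zigzag v d := Triv.inl (QDual.gr v) d

/-- The component in `Λ^!` of an element of the zigzag algebra. -/
abbrev pr : Zigzag v d →ₗ[F] QDual v := Triv.fst (QDual.gr v) d

/-- The inclusion of `S` in the zigzag algebra. -/
def sA : (Fin r → F) →ₐ[F] Zigzag v d := (ι v d).comp (QDual.ofS v)

theorem sA_apply (s : Fin r → F) : sA v d s = ι v d (QDual.ofS v s) := rfl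

theorem vertices_hom_eq (s : Fin r → F) : (vertices v d).hom s = sA v d s := vertices_hom v d s

theorem sA_mem (s : Fin r → F) : sA v d s ∈ gr v d 0 :=
  Triv.inl_mem _ _ (QFunctor.ofS_mem' v s)

theorem ι_mem {n : ℕ} {a : QDual v} (ha : a ∈ QDual.natGr v n) : ι v d a ∈ gr v d n :=
  Triv.inl_mem _ _ ha

variable [hfin : ∀ n, FiniteDimensional F (𝒜 n)]

/-- The term `A ⊗_S Λ_n^* ⊗_S A` of the complex `Q`. -/
def qx (n : ℕ) : GrBimod (gr v d) (gr v d) := QFunctor.QX (vertices v d) (inflated v d) n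

/-- The element `a ⊗ x ⊗ b` of `A ⊗_S Λ_n^* ⊗_S A`. -/
def qtri (n : ℕ) : Zigzag v d →ₗ[F] Module.Dual F (𝒜 n) →ₗ[F] Zigzag v d →ₗ[F]
    (qx v d n).carrier :=
  QFunctor.tri (vertices v d) (inflated v d) n

theorem dualR_eq {k n : ℕ} (c : QDual (vertices v d)) (x : Module.Dual F (𝒜 k))
    (T : 𝒜 n →ₗ[F] 𝒜 k) (hT : ∀ m, (T m : L) = (m : L) * infl v d c) :
    QFunctor.dualR (vertices v d) (inflated v d) k n c x = x ∘ₗ T := by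
  refine LinearMap.ext fun (m : 𝒜 n) => ?_
  have h : QFunctor.actR (vertices v d) (inflated v d) c m.1 ∈ (inflated v d).gr (k : ℕ) := by
    change (m : L) * infl v d c ∈ 𝒜 k
    rw [← hT m]
    exact Subtype.mem _
  refine (QFunctor.dualR_apply (k := (k : ℤ)) (n := (n : ℤ)) (c := c) (vertices v d)
    (inflated v d) x m h).trans ?_
  exact congrArg x (Subtype.ext (hT m).symm)

theorem dualL_eq {k n : ℕ} (c : QDual (vertices v d)) (x : Module.Dual F (𝒜 k))
    (T : 𝒜 n →ₗ[F] 𝒜 k) (hT : ∀ m, (T m : L) = infl v d c * (m : L)) :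
    QFunctor.dualL (vertices v d) (inflated v d) k n c x = x ∘ₗ T := by
  refine LinearMap.ext fun (m : 𝒜 n) => ?_
  have h : QFunctor.actL (vertices v d) (inflated v d) c m.1 ∈ (inflated v d).gr (k : ℕ) := by
    change infl v d c * (m : L) ∈ 𝒜 k
    rw [← hT m]
    exact Subtype.mem _
  refine (QFunctor.dualL_apply (k := (k : ℤ)) (n := (n : ℤ)) (c := c) (vertices v d)
    (inflated v d) x m h).trans ?_
  exact congrArg x (Subtype.ext (hT m).symm)

theorem dualR_ofS (n : ℕ) (s : Fin r → F) (x : Module.Dual F (𝒜 n)) :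
    QFunctor.dualR (vertices v d) (inflated v d) n n (QDual.ofS _ s) x = x ∘ₗ rS v n s :=
  dualR_eq v d _ x _ fun m => by rw [infl_ofS, coe_rS]

theorem dualL_ofS (n : ℕ) (s : Fin r → F) (x : Module.Dual F (𝒜 n)) :
    QFunctor.dualL (vertices v d) (inflated v d) n n (QDual.ofS _ s) x = x ∘ₗ lS v n s :=
  dualL_eq v d _ x _ fun m => by rw [infl_ofS, coe_lS]

theorem qtri_left (n : ℕ) (a : Zigzag v d) (s : Fin r → F) (x : Module.Dual F (𝒜 n))
    (b : Zigzag v d) : qtri v d n (a * sA v d s) x b = qtri v d n a (x ∘ₗ rS v n s) b := by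
  rw [← dualR_ofS v d, ← vertices_hom_eq]
  exact QFunctor.tri_left (vertices v d) (inflated v d) n a s x b

theorem qtri_right (n : ℕ) (a : Zigzag v d) (s : Fin r → F) (x : Module.Dual F (𝒜 n))
    (b : Zigzag v d) : qtri v d n a (x ∘ₗ lS v n s) b = qtri v d n a x (sA v d s * b) := by
  rw [← dualL_ofS v d, ← vertices_hom_eq]
  exact QFunctor.tri_right (vertices v d) (inflated v d) n a s x b

theorem qtri_L (n : ℕ) (c a : Zigzag v d) (x : Module.Dual F (𝒜 n)) (b : Zigzag v d) :
    (qx v d n).L c (qtri v d n a x b) = qtri v d n (c * a) x b :=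
  QFunctor.tri_L (vertices v d) (inflated v d) n c a x b

theorem qtri_R (n : ℕ) (c : (Zigzag v d)ᵐᵒᵖ) (a : Zigzag v d) (x : Module.Dual F (𝒜 n))
    (b : Zigzag v d) : (qx v d n).R c (qtri v d n a x b) = qtri v d n a x (b * c.unop) :=
  QFunctor.tri_R (vertices v d) (inflated v d) n c a x b

theorem qtri_mem (n : ℕ) {i j : ℤ} {a b : Zigzag v d} (x : Module.Dual F (𝒜 n))
    (ha : a ∈ gr v d i) (hb : b ∈ gr v d j) : qtri v d n a x b ∈ (qx v d n).gr (i + n + j) :=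
  QFunctor.tri_mem (vertices v d) (inflated v d) n x ha hb

theorem qx_gr_le (n : ℕ) {N : ℤ} {W : Submodule F (qx v d n).carrier}
    (h : ∀ i j, i + n + j = N → ∀ a ∈ gr v d i, ∀ x, ∀ b ∈ gr v d j, qtri v d n a x b ∈ W) :
    (qx v d n).gr N ≤ W := by
  refine GrBimod.tensor3_gr_le (M := QFunctor.regAS (vertices v d))
    (N := QFunctor.dualComp (vertices v d) (inflated v d) n)
    (P := QFunctor.regSA (vertices v d)) fun i j k hijk a ha x hx b hb => ?_
  rcases mem_conc.1 hx with rfl | h0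
  · exact h i k hijk a ha x b hb
  · subst h0
    have h1 := LinearMap.congr_fun (map_zero (qtri v d n a)) b
    exact (congrArg (· ∈ W) h1).mpr (zero_mem _)

@[elab_as_elim]
theorem qx_induction (n : ℕ) {p : (qx v d n).carrier → Prop}
    (mk : ∀ a x b, p (qtri v d n a x b)) (zero : p 0) (add : ∀ x y, p x → p y → p (x + y))
    (t : (qx v d n).carrier) : p t :=
  GrBimod.tensor3_induction (M := QFunctor.regAS (vertices v d))
    (N := QFunctor.dualComp (vertices v d) (inflated v d) n)
    (P := QFunctor.regSA (vertices v d)) (p := p) mk zero add t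

theorem qx_ext (n : ℕ) {X : Type u} [AddCommGroup X] [Module F X]
    {f g : (qx v d n).carrier →ₗ[F] X}
    (h : ∀ a x b, f (qtri v d n a x b) = g (qtri v d n a x b)) : f = g :=
  LinearMap.ext fun t => qx_induction v d n (p := fun t => f t = g t) h (by simp)
    (fun x y hx hy => by rw [map_add, map_add, hx, hy]) t

/-- Linear maps out of `A ⊗_S Λ_n^* ⊗_S A` are given by balanced trilinear maps. -/
def qlift (n : ℕ) {X : Type u} [AddCommGroup X] [Module F X]
    (f : Zigzag v d →ₗ[F] Module.Dual F (𝒜 n) →ₗ[F] Zigzag v d →ₗ[F] X)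
    (hl : ∀ a s x b, f (a * sA v d s) x b = f a (x ∘ₗ rS v n s) b)
    (hr : ∀ a s x b, f a (x ∘ₗ lS v n s) b = f a x (sA v d s * b)) :
    (qx v d n).carrier →ₗ[F] X :=
  GrBimod.tdesc3 (QFunctor.regAS (vertices v d))
    (QFunctor.dualComp (vertices v d) (inflated v d) n) (QFunctor.regSA (vertices v d)) f
    (fun (a : Zigzag v d) s (x : Module.Dual F (𝒜 n)) (b : Zigzag v d) => by
      refine Eq.trans ?_ (congrArg (fun y => f a y b) (dualR_ofS v d n s x).symm)
      refine Eq.trans (congrArg (fun y => f y x b) ?_) (hl a s x b)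
      exact congrArg (a * ·) (vertices_hom_eq v d s))
    (fun (a : Zigzag v d) s (x : Module.Dual F (𝒜 n)) (b : Zigzag v d) => by
      refine Eq.trans (congrArg (fun y => f a y b) (dualL_ofS v d n s x)) ?_
      refine (hr a s x b).trans (congrArg (f a x) ?_)
      exact congrArg (· * b) (vertices_hom_eq v d s).symm)

theorem qlift_qtri (n : ℕ) {X : Type u} [AddCommGroup X] [Module F X]
    (f : Zigzag v d →ₗ[F] Module.Dual F (𝒜 n) →ₗ[F] Zigzag v d →ₗ[F] X) (hl) (hr)
    (a : Zigzag v d) (x : Module.Dual F (𝒜 n)) (b : Zigzag v d) :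
    qlift v d n f hl hr (qtri v d n a x b) = f a x b :=
  GrBimod.tdesc3_tmul3 (QFunctor.regAS (vertices v d))
    (QFunctor.dualComp (vertices v d) (inflated v d) n) (QFunctor.regSA (vertices v d)) f _ _ a x b

/-- Homomorphisms of bimodules out of `A ⊗_S Λ_n^* ⊗_S A`. -/
def qhom (n : ℕ) {P : GrBimod (gr v d) (gr v d)}
    (f : Zigzag v d →ₗ[F] Module.Dual F (𝒜 n) →ₗ[F] Zigzag v d →ₗ[F] P.carrier)
    (hl : ∀ a s x b, f (a * sA v d s) x b = f a (x ∘ₗ rS v n s) b)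
    (hr : ∀ a s x b, f a (x ∘ₗ lS v n s) b = f a x (sA v d s * b))
    (hL : ∀ c a x b, f (c * a) x b = P.L c (f a x b))
    (hR : ∀ c a x b, f a x (b * MulOpposite.unop c) = P.R c (f a x b))
    (hmem : ∀ i j, ∀ a ∈ gr v d i, ∀ x, ∀ b ∈ gr v d j, f a x b ∈ P.gr (i + n + j)) :
    qx v d n ⟶ P where
  toLin := qlift v d n f hl hr
  map_L c t := by
    refine qx_induction v d n (p := fun t => qlift v d n f hl hr ((qx v d n).L c t) =
      P.L c (qlift v d n f hl hr t)) (fun a x b => ?_) (by simp) (fun x y hx hy => ?_) t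
    · rw [qtri_L, qlift_qtri, qlift_qtri, hL]
    · simp only [map_add, hx, hy]
  map_R c t := by
    refine qx_induction v d n (p := fun t => qlift v d n f hl hr ((qx v d n).R c t) =
      P.R c (qlift v d n f hl hr t)) (fun a x b => ?_) (by simp) (fun x y hx hy => ?_) t
    · rw [qtri_R, qlift_qtri, qlift_qtri, hR]
    · simp only [map_add, hx, hy]
  map_mem N t ht := by
    have h : (qx v d n).gr N ≤ (P.gr N).comap (qlift v d n f hl hr) :=
      qx_gr_le v d n fun i j hij a ha x b hb => by
        rw [Submodule.mem_comap, qlift_qtri, ← hij]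
        exact hmem i j a ha x b hb
    exact h ht

theorem qhom_qtri (n : ℕ) {P : GrBimod (gr v d) (gr v d)}
    (f : Zigzag v d →ₗ[F] Module.Dual F (𝒜 n) →ₗ[F] Zigzag v d →ₗ[F] P.carrier)
    (hl) (hr) (hL) (hR) (hmem) (a : Zigzag v d) (x : Module.Dual F (𝒜 n)) (b : Zigzag v d) :
    GrBimod.Hom.toLin (qhom v d n (P := P) f hl hr hL hR hmem) (qtri v d n a x b) = f a x b :=
  qlift_qtri v d n f hl hr a x b

theorem qx_hom_ext (n : ℕ) {P : GrBimod (gr v d) (gr v d)} {f g : qx v d n ⟶ P}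
    (h : ∀ a x b, GrBimod.Hom.toLin f (qtri v d n a x b) =
      GrBimod.Hom.toLin g (qtri v d n a x b)) : f = g :=
  GrBimod.hom_ext (qx_ext v d n h)

/-- The transpose `A_1^* → Λ_1` of the inclusion, with values in `Λ_1`. -/
def transpose₁ : VDual (gr v d) →ₗ[F] zgr 𝒜 1 :=
  ∑ γ, (LinearMap.applyₗ (incl v d ((basisV (zgr 𝒜)).coord γ))).smulRight (basisV (zgr 𝒜) γ)

theorem transpose₁_apply (f : VDual (gr v d)) :
    transpose₁ v d f = ∑ γ, f (incl v d ((basisV (zgr 𝒜)).coord γ)) • basisV (zgr 𝒜) γ := by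
  simp [transpose₁, LinearMap.sum_apply]

theorem coe_transpose₁ (f : VDual (gr v d)) : (transpose₁ v d f : L) = transpose v d f := by
  rw [transpose₁_apply, transpose_apply, AddSubmonoidClass.coe_finsetSum]
  rfl

/-- The part `a ⊗ x ⊗ b ↦ ∑ a γ^* ⊗ x (- γ) ⊗ b` of the differential of `Q`, where `γ` runs over
a basis of `Λ_1`. -/
def qdL (n : ℕ) : qx v d (n + 1) ⟶ qx v d n := QFunctor.dLeft (vertices v d) (inflated v d) n

/-- The part `a ⊗ x ⊗ b ↦ ∑ a ⊗ x (γ -) ⊗ γ^* b` of the differential of `Q`. -/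
def qdR (n : ℕ) : qx v d (n + 1) ⟶ qx v d n := QFunctor.dRight (vertices v d) (inflated v d) n

/-- The element `γ^*` of the zigzag algebra, for `γ` in the chosen basis of `Λ_1`. -/
def zgen (γ : Fin (Module.finrank F (zgr 𝒜 1))) : Zigzag v d := ι v d (QFunctor.cobasis v γ)

theorem sum_coord_incl {X : Type u} [AddCommGroup X] [Module F X]
    (Ψ : Zigzag v d →ₗ[F] zgr 𝒜 1 →ₗ[F] X) :
    ∑ β, Ψ (basisV (gr v d) β : Zigzag v d) (transpose₁ v d ((basisV (gr v d)).coord β)) =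
      ∑ γ, Ψ (zgen v d γ) (basisV (zgr 𝒜) γ) := by
  simp only [transpose₁_apply, map_sum, map_smul]
  rw [Finset.sum_comm]
  refine Finset.sum_congr rfl fun γ _ => ?_
  have h := congrArg (fun y : gr v d 1 => Ψ (y : Zigzag v d) (basisV (zgr 𝒜) γ))
    ((basisV (gr v d)).sum_repr (incl v d ((basisV (zgr 𝒜)).coord γ)))
  simp only [AddSubmonoidClass.coe_finsetSum, map_sum, LinearMap.sum_apply, Submodule.coe_smul,
    map_smul, LinearMap.smul_apply] at h
  exact h

theorem qdL_qtri (n : ℕ) (a : Zigzag v d) (x : Module.Dual F (𝒜 (n + 1))) (b : Zigzag v d) :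
    GrBimod.Hom.toLin (qdL v d n) (qtri v d (n + 1) a x b) =
      ∑ γ, qtri v d n (a * zgen v d γ) (x ∘ₗ rmul n (basisV (zgr 𝒜) γ)) b := by
  have h := sum_coord_incl v d (LinearMap.mk₂ F
    (fun p q => qtri v d n (a * p) (x ∘ₗ rmul n q) b)
    (fun _ _ _ => by simp [mul_add]) (fun _ _ _ => by simp)
    (fun _ _ _ => by simp [LinearMap.comp_add]) (fun _ _ _ => by simp [LinearMap.comp_smul]))
  simp only [LinearMap.mk₂_apply] at h
  rw [← h]
  refine (QFunctor.dLeft_tri (vertices v d) (inflated v d) n a x b).trans ?_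
  refine Finset.sum_congr rfl fun β _ => ?_
  congr 2
  refine dualR_eq v d _ x _ fun m => ?_
  rw [coe_rmul, coe_transpose₁, QFunctor.cobasis, infl_gen]

theorem qdR_qtri (n : ℕ) (a : Zigzag v d) (x : Module.Dual F (𝒜 (n + 1))) (b : Zigzag v d) :
    GrBimod.Hom.toLin (qdR v d n) (qtri v d (n + 1) a x b) =
      ∑ γ, qtri v d n a (x ∘ₗ lmul n (basisV (zgr 𝒜) γ)) (zgen v d γ * b) := by
  have h := sum_coord_incl v d (LinearMap.mk₂ F
    (fun p q => qtri v d n a (x ∘ₗ lmul n q) (p * b))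
    (fun _ _ _ => by simp [add_mul]) (fun _ _ _ => by simp)
    (fun _ _ _ => by simp [LinearMap.comp_add]) (fun _ _ _ => by simp [LinearMap.comp_smul]))
  simp only [LinearMap.mk₂_apply] at h
  rw [← h]
  refine (QFunctor.dRight_tri (vertices v d) (inflated v d) n a x b).trans ?_
  refine Finset.sum_congr rfl fun β _ => ?_
  congr 2
  refine dualL_eq v d _ x _ fun m => ?_
  rw [coe_lmul, coe_transpose₁, QFunctor.cobasis, infl_gen]

/-- The idempotent `e_k` of `Λ`, as an element of `Λ_0`. -/
def eN (k : Fin r) : 𝒜 0 := ⟨v.e k, v.e_mem k⟩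

theorem aug_qtri (a : Zigzag v d) (x : Module.Dual F (𝒜 0)) (b : Zigzag v d) :
    GrBimod.Hom.toLin (aug v d) (qtri v d 0 a x b) =
      ∑ k, x (eN v k) • (a * sA v d (Pi.single k 1) * b) := by
  refine (QFunctor.aug_tri (vertices v d) (inflated v d) (inflatedOne v d)
    (inflatedOne_central v d) a x b).trans ?_
  refine Finset.sum_congr rfl fun k _ => ?_
  have h1 : QFunctor.dualR (vertices v d) (inflated v d) (0 : ℕ) (0 : ℕ)
      (QDual.ofS _ (Pi.single k 1)) x (inflatedOne v d) = x (eN v k) := by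
    rw [dualR_ofS v d 0]
    refine congrArg x (Subtype.ext ?_)
    change (1 : L) * v.hom (Pi.single k 1) = v.e k
    rw [one_mul, v.hom_single]
  have h2 : (vertices v d).e k = sA v d (Pi.single k 1) := by
    rw [← vertices_hom_eq, VertexIdem.hom_single]
  rw [← h2]
  exact congrArg (fun c : F => c • (a * (vertices v d).e k * b)) h1

/-- Right multiplication of the left factor of `A ⊗_S Λ_n^* ⊗_S A` by an element of `S`. -/
def qmulS (n : ℕ) (s : Fin r → F) : qx v d n ⟶ qx v d n :=
  qhom v d n ((qtri v d n).compl₁₂ (LinearMap.mulRight F (sA v d s)) LinearMap.id)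
    (fun a t x b => by
      simp only [LinearMap.compl₁₂_apply, LinearMap.mulRight_apply, LinearMap.id_apply]
      rw [← qtri_left, mul_assoc, mul_assoc, ← map_mul, ← map_mul, mul_comm t])
    (fun a t x b => qtri_right v d n _ t x b)
    (fun c a x b => by
      simp only [LinearMap.compl₁₂_apply, LinearMap.mulRight_apply, LinearMap.id_apply, qtri_L,
        mul_assoc])
    (fun c a x b => (qtri_R v d n c _ x b).symm)
    (fun i j a ha x b hb => qtri_mem v d n x (by simpa using gmul_mem ha (sA_mem v d s)) hb)

theorem qmulS_qtri (n : ℕ) (s : Fin r → F) (a : Zigzag v d) (x : Module.Dual F (𝒜 n))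
    (b : Zigzag v d) : GrBimod.Hom.toLin (qmulS v d n s) (qtri v d n a x b) =
      qtri v d n (a * sA v d s) x b := qhom_qtri v d n _ _ _ _ _ _ a x b

end Zigzag

/-! ### Operators on `Q` induced by operators on the left Koszul complex -/

namespace Zigzag

variable {F : Type u} [Field F] {L : Type u} [Ring L] [Algebra F L] {𝒜 : ℕ → Submodule F L}
  [GradedAlgebra 𝒜] {r : ℕ} (v : VertexIdem (zgr 𝒜) r) (d : ℕ)

section Average

variable {v} in
theorem ofS_single_mul (k : Fin r) (s : Fin r → F) (a : QDual v) :
    a * QDual.ofS v s * QDual.ofS v (Pi.single k 1) = s k • (a * QDual.ofS v (Pi.single k 1)) := by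
  rw [mul_assoc, QFunctor.ofS_mul_single, mul_smul_comm]

/-- The projection `φ ↦ ∑ φ (- e_k) e_k` onto the right `S`-linear maps. -/
def avgS (n : ℕ) : (𝒜 n →ₗ[F] QDual v) →ₗ[F] (𝒜 n →ₗ[F] QDual v) :=
  ∑ k, (LinearMap.mulRight F (QDual.ofS v (Pi.single k 1))).compRight F ∘ₗ
    LinearMap.lcomp F (QDual v) (rS v n (Pi.single k 1))

theorem avgS_apply (n : ℕ) (φ : 𝒜 n →ₗ[F] QDual v) (m : 𝒜 n) :
    avgS v n φ m = ∑ k, φ (rS v n (Pi.single k 1) m) * QDual.ofS v (Pi.single k 1) := by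
  simp [avgS, LinearMap.sum_apply]

theorem rS_rS (n : ℕ) (s t : Fin r → F) (m : 𝒜 n) :
    rS v n s (rS v n t m) = rS v n (t * s) m :=
  Subtype.ext (by rw [coe_rS, coe_rS, coe_rS, map_mul, mul_assoc])

theorem rS_single (n : ℕ) (s : Fin r → F) (k : Fin r) (m : 𝒜 n) :
    rS v n (Pi.single k 1) (rS v n s m) = s k • rS v n (Pi.single k 1) m := by
  rw [rS_rS, mul_single_eq, map_smul, LinearMap.smul_apply]

theorem sum_rS (n : ℕ) (m : 𝒜 n) : ∑ k, rS v n (Pi.single k 1) m = m := by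
  rw [← LinearMap.sum_apply, ← map_sum, sum_single_one]
  exact Subtype.ext (by rw [coe_rS, map_one, mul_one])

theorem avgS_mem {n j : ℕ} {φ : 𝒜 n →ₗ[F] QDual v} (hφ : ∀ m, φ m ∈ QDual.natGr v j) :
    avgS v n φ ∈ homS v n j := by
  refine ⟨fun s m => ?_, fun m => ?_⟩
  · rw [avgS_apply, avgS_apply, Finset.sum_mul]
    refine Finset.sum_congr rfl fun k _ => ?_
    rw [rS_single, map_smul, mul_assoc, QFunctor.single_mul_ofS, mul_smul_comm, smul_mul_assoc]
  · rw [avgS_apply]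
    exact sum_mem fun k _ => natGr_mul_ofS v (hφ _) _

theorem avgS_of_mem {n j : ℕ} {φ : 𝒜 n →ₗ[F] QDual v} (hφ : φ ∈ homS v n j) :
    avgS v n φ = φ := by
  ext m
  rw [avgS_apply]
  conv_rhs => rw [← QDual.sum_mul_ofS (φ m)]
  refine Finset.sum_congr rfl fun k _ => ?_
  rw [hφ.1, ofS_single_mul, Pi.single_eq_same, one_smul]

theorem avgS_precS (n : ℕ) (s : Fin r → F) (φ : 𝒜 n →ₗ[F] QDual v) :
    avgS v n (precS v n s φ) = precS v n s (avgS v n φ) := by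
  ext m
  rw [avgS_apply, precS_apply, avgS_apply]
  refine Finset.sum_congr rfl fun k _ => ?_
  rw [precS_apply]
  congr 2
  exact Subtype.ext (by rw [coe_lS, coe_rS, coe_rS, coe_lS, mul_assoc])

theorem avgS_smulRight_mul (n : ℕ) (x : Module.Dual F (𝒜 n)) (c : QDual v) (s : Fin r → F) :
    avgS v n (x.smulRight (c * QDual.ofS v s)) = avgS v n ((x ∘ₗ rS v n s).smulRight c) := by
  ext m
  rw [avgS_apply, avgS_apply]
  refine Finset.sum_congr rfl fun k _ => ?_
  rw [LinearMap.smulRight_apply, LinearMap.smulRight_apply, smul_mul_assoc, smul_mul_assoc,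
    ofS_single_mul, LinearMap.comp_apply, rS_rS, mul_comm, mul_single_eq, map_smul,
    LinearMap.smul_apply, map_smul, smul_smul, smul_eq_mul, mul_comm]

/-- The projection of `Λ^!` onto its component of degree `j`. -/
def degE (j : ℕ) : QDual v →ₗ[F] QDual v :=
  (QDual.gr v (j : ℤ)).subtype ∘ₗ
    component (DirectSum.Decomposition.isInternal (QDual.gr v)) (j : ℤ)

theorem degE_of_mem {j : ℕ} {a : QDual v} (ha : a ∈ QDual.natGr v j) : degE v j a = a := by
  have h := component_of_mem (DirectSum.Decomposition.isInternal (QDual.gr v)) (n := (j : ℤ)) ha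
  exact congrArg Subtype.val h

theorem degE_of_mem_ne {j k : ℕ} (hjk : k ≠ j) {a : QDual v} (ha : a ∈ QDual.natGr v k) :
    degE v j a = 0 := by
  have h := component_of_mem_ne (DirectSum.Decomposition.isInternal (QDual.gr v))
    (m := (k : ℤ)) (n := (j : ℤ)) (by exact_mod_cast hjk) ha
  exact congrArg Subtype.val h

/-- The components of degree `j` of the values of a map to `Λ^!`. -/
def degHom (n j : ℕ) : (𝒜 n →ₗ[F] QDual v) →ₗ[F] (𝒜 n →ₗ[F] QDual v) :=
  (degE v j).compRight F

theorem degHom_of_mem {n j : ℕ} {φ : 𝒜 n →ₗ[F] QDual v} (hφ : φ ∈ homS v n j) :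
    degHom v n j φ = φ := LinearMap.ext fun m => degE_of_mem v (hφ.2 m)

theorem degHom_of_mem_ne {n j k : ℕ} (hjk : k ≠ j) {φ : 𝒜 n →ₗ[F] QDual v}
    (hφ : φ ∈ homS v n k) : degHom v n j φ = 0 :=
  LinearMap.ext fun m => degE_of_mem_ne v hjk (hφ.2 m)

theorem degHom_precS (n j : ℕ) (s : Fin r → F) (φ : 𝒜 n →ₗ[F] QDual v) :
    degHom v n j (precS v n s φ) = precS v n s (degHom v n j φ) := rfl

end Average

variable [hfin : ∀ n, FiniteDimensional F (𝒜 n)]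

/-- The image in `A ⊗_S Λ_n^* ⊗_S A` of the element of `Λ^! ⊗ Λ_n^* = Hom (Λ_n, Λ^!)` given by `φ`
and of `b`. -/
def tau (n : ℕ) : (𝒜 n →ₗ[F] QDual v) →ₗ[F] Zigzag v d →ₗ[F] (qx v d n).carrier :=
  ∑ μ, (qtri v d n).flip ((Module.finBasis F (𝒜 n)).coord μ) ∘ₗ (ι v d).toLinearMap ∘ₗ
    LinearMap.applyₗ (Module.finBasis F (𝒜 n) μ)

theorem tau_apply (n : ℕ) (φ : 𝒜 n →ₗ[F] QDual v) (b : Zigzag v d) :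
    tau v d n φ b = ∑ μ, qtri v d n (ι v d (φ (Module.finBasis F (𝒜 n) μ)))
      ((Module.finBasis F (𝒜 n)).coord μ) b := by
  simp [tau, LinearMap.sum_apply]

theorem tau_smulRight (n : ℕ) (x : Module.Dual F (𝒜 n)) (c : QDual v) (b : Zigzag v d) :
    tau v d n (x.smulRight c) b = qtri v d n (ι v d c) x b := by
  rw [tau_apply]
  conv_rhs => rw [← sum_coord_smul (Module.finBasis F (𝒜 n)) x]
  simp only [LinearMap.smulRight_apply, map_sum, map_smul, LinearMap.sum_apply,
    LinearMap.smul_apply]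

theorem tau_comp {n k : ℕ} (φ : 𝒜 k →ₗ[F] QDual v) (T : 𝒜 n →ₗ[F] 𝒜 k) (b : Zigzag v d) :
    tau v d n (φ ∘ₗ T) b = ∑ μ, qtri v d n (ι v d (φ (Module.finBasis F (𝒜 k) μ)))
      ((Module.finBasis F (𝒜 k)).coord μ ∘ₗ T) b := by
  have h := sum_basis_map (Module.finBasis F (𝒜 n)) (Module.finBasis F (𝒜 k))
    (((qtri v d n ∘ₗ (ι v d).toLinearMap) ∘ₗ φ).compr₂ (LinearMap.applyₗ b)) T
  rw [tau_apply]
  exact h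

theorem tau_precS (n : ℕ) (s : Fin r → F) (φ : 𝒜 n →ₗ[F] QDual v) (b : Zigzag v d) :
    tau v d n (precS v n s φ) b = tau v d n φ (sA v d s * b) := by
  refine (tau_comp v d φ (lS v n s) b).trans ?_
  rw [tau_apply]
  simp only [qtri_right]

theorem tau_lmulS (n : ℕ) (s : Fin r → F) (φ : 𝒜 n →ₗ[F] QDual v) (b : Zigzag v d) :
    tau v d n (lmulS v n s φ) b = (qx v d n).L (sA v d s) (tau v d n φ b) := by
  rw [tau_apply, tau_apply, map_sum]
  simp only [qtri_L, lmulS_apply, map_mul, sA_apply]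

theorem tau_avgS (n : ℕ) (φ : 𝒜 n →ₗ[F] QDual v) (b : Zigzag v d) :
    tau v d n (avgS v n φ) b = tau v d n φ b := by
  have h2 : avgS v n φ = ∑ k, ((LinearMap.mulRight F (QDual.ofS v (Pi.single k 1))) ∘ₗ φ) ∘ₗ
    rS v n (Pi.single k 1) := by
      ext m
      rw [avgS_apply, LinearMap.sum_apply]; rfl
  rw [h2, map_sum, LinearMap.sum_apply]
  simp only [tau_comp, LinearMap.comp_apply, LinearMap.mulRight_apply, map_mul]
  rw [Finset.sum_comm, tau_apply]
  refine Finset.sum_congr rfl fun μ _ => ?_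
  simp only [← sA_apply, qtri_left]
  rw [← LinearMap.sum_apply, ← map_sum]
  congr 2
  ext m
  rw [LinearMap.sum_apply]
  simp only [LinearMap.comp_apply, rS_single, Pi.single_eq_same, one_smul]
  rw [← map_sum, sum_rS]

theorem tau_mem {n j : ℕ} {k : ℤ} {φ : 𝒜 n →ₗ[F] QDual v} (hφ : ∀ m, φ m ∈ QDual.natGr v j)
    {b : Zigzag v d} (hb : b ∈ gr v d k) : tau v d n φ b ∈ (qx v d n).gr (j + n + k) := by
  rw [tau_apply]
  exact sum_mem fun μ _ => qtri_mem v d n _ (ι_mem v d (hφ _)) hb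

theorem tau_R (n : ℕ) (c : (Zigzag v d)ᵐᵒᵖ) (φ : 𝒜 n →ₗ[F] QDual v) (b : Zigzag v d) :
    (qx v d n).R c (tau v d n φ b) = tau v d n φ (b * c.unop) := by
  rw [tau_apply, tau_apply, map_sum]
  simp only [qtri_R]

/-- The left part of the differential of `Q` is induced by the differential of the left Koszul
complex. -/
theorem qdL_tau (n : ℕ) (φ : 𝒜 (n + 1) →ₗ[F] QDual v) (b : Zigzag v d) :
    GrBimod.Hom.toLin (qdL v d n) (tau v d (n + 1) φ b) = tau v d n (dK v n φ) b := by
  rw [tau_apply, map_sum]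
  simp only [qdL_qtri]
  have h2 : dK v n φ = ∑ γ, ((LinearMap.mulRight F (QFunctor.cobasis v γ)) ∘ₗ φ) ∘ₗ
      rmul n (basisV (zgr 𝒜) γ) := by
    ext m
    rw [dK_apply, LinearMap.sum_apply]; rfl
  rw [h2, map_sum, LinearMap.sum_apply, Finset.sum_comm]
  refine Finset.sum_congr rfl fun γ _ => ?_
  rw [tau_comp]
  simp only [LinearMap.comp_apply, LinearMap.mulRight_apply, map_mul, zgen]

theorem qdR_tau (n : ℕ) (φ : 𝒜 (n + 1) →ₗ[F] QDual v) (b : Zigzag v d) :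
    GrBimod.Hom.toLin (qdR v d n) (tau v d (n + 1) φ b) =
      ∑ γ, tau v d n (φ ∘ₗ lmul n (basisV (zgr 𝒜) γ)) (zgen v d γ * b) := by
  rw [tau_apply, map_sum]
  simp only [qdR_qtri, tau_comp]
  rw [Finset.sum_comm]

/-- The right linear map `Q_n → Q_k` induced by an operator `K : Hom (Λ_n, Λ^!) → Hom (Λ_k, Λ^!)`.
The part of `Q_n` coming from the summand `(Λ^!)^*` of the zigzag algebra is mapped to zero. -/
def qext {n k : ℕ} (K : (𝒜 n →ₗ[F] QDual v) →ₗ[F] (𝒜 k →ₗ[F] QDual v))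
    (hK : ∀ s φ, K (precS v n s φ) = precS v k s (K φ)) :
    (qx v d n).carrier →ₗ[F] (qx v d k).carrier :=
  qlift v d n (LinearMap.mk₂ F
      (fun a x => tau v d k (K (avgS v n (x.smulRight (pr v d a)))))
      (fun a b x => by rw [← map_add, ← map_add, ← map_add]; congr 3; ext; simp)
      (fun c a x => by
        rw [← map_smul, ← map_smul, ← map_smul]
        congr 3
        ext m
        simp only [LinearMap.smulRight_apply, map_smul, LinearMap.smul_apply, smul_comm c])
      (fun a x y => by rw [← map_add, ← map_add, ← map_add]; congr 3; ext; simp [add_smul])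
      (fun c a x => by rw [← map_smul, ← map_smul, ← map_smul]; congr 3; ext; simp [mul_smul]))
    (fun a s x b => by
      simp only [LinearMap.mk₂_apply]
      rw [Triv.fst_mul, sA_apply, Triv.fst_inl, avgS_smulRight_mul])
    (fun a s x b => by
      simp only [LinearMap.mk₂_apply]
      rw [← tau_precS, ← hK, ← avgS_precS]
      rfl)

section Qext

variable {n k : ℕ} (K : (𝒜 n →ₗ[F] QDual v) →ₗ[F] (𝒜 k →ₗ[F] QDual v))
  (hK : ∀ s φ, K (precS v n s φ) = precS v k s (K φ))

theorem qext_qtri (a : Zigzag v d) (x : Module.Dual F (𝒜 n)) (b : Zigzag v d) :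
    qext v d K hK (qtri v d n a x b) =
      tau v d k (K (avgS v n (x.smulRight (pr v d a)))) b := by
  rw [qext, qlift_qtri]; rfl

theorem qext_tau (φ : 𝒜 n →ₗ[F] QDual v) (b : Zigzag v d) :
    qext v d K hK (tau v d n φ b) = tau v d k (K (avgS v n φ)) b := by
  rw [tau_apply, map_sum]
  simp only [qext_qtri, Triv.fst_inl]
  rw [← LinearMap.sum_apply, ← map_sum, ← map_sum, ← map_sum]
  congr 4
  ext m
  rw [LinearMap.sum_apply]
  simp only [LinearMap.smulRight_apply, Module.Basis.coord_apply]
  conv_rhs => rw [← (Module.finBasis F (𝒜 n)).sum_repr m, map_sum]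
  simp only [map_smul]

theorem qext_R (c : (Zigzag v d)ᵐᵒᵖ) (t : (qx v d n).carrier) :
    qext v d K hK ((qx v d n).R c t) = (qx v d k).R c (qext v d K hK t) := by
  refine qx_induction v d n (p := fun t => qext v d K hK ((qx v d n).R c t) =
      (qx v d k).R c (qext v d K hK t)) (fun a x b => ?_) (by simp) (fun x y hx hy => ?_) t
  · rw [qtri_R, qext_qtri, qext_qtri, tau_R]
  · simp only [map_add, hx, hy]

end Qext

theorem qext_mem {n : ℕ} (K : (𝒜 n →ₗ[F] QDual v) →ₗ[F] (𝒜 (n + 1) →ₗ[F] QDual v))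
    (hK : ∀ s φ, K (precS v n s φ) = precS v (n + 1) s (K φ))
    (h0 : ∀ φ ∈ homS v n 0, K φ = 0) (h1 : ∀ j, ∀ φ ∈ homS v n (j + 1), K φ ∈ homS v (n + 1) j)
    {N : ℤ} {t : (qx v d n).carrier} (ht : t ∈ (qx v d n).gr N) :
    qext v d K hK t ∈ (qx v d (n + 1)).gr N := by
  have h : (qx v d n).gr N ≤ ((qx v d (n + 1)).gr N).comap (qext v d K hK) := by
    refine qx_gr_le v d n fun i j hij a ha x b hb => ?_
    rw [Submodule.mem_comap, qext_qtri]
    have hφ : ∀ p : ℕ, pr v d a ∈ QDual.natGr v p →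
        avgS v n (x.smulRight (pr v d a)) ∈ homS v n p := fun p hp =>
      avgS_mem v fun m => Submodule.smul_mem _ _ hp
    rcases i with p | p
    · have hp := hφ p ha.1
      rcases p with _ | p
      · rw [h0 _ hp, map_zero]
        exact zero_mem _
      · have := tau_mem v d (h1 p _ hp).2 hb
        have e : (p : ℤ) + ((n + 1 : ℕ) : ℤ) + j = N := by
          rw [← hij]; simp only [Int.ofNat_eq_natCast]; push_cast; ring
        rwa [e] at this
    · have hp : pr v d a = 0 := (Submodule.mem_bot F).1 ha.1
      have h2 : (x.smulRight (pr v d a) : 𝒜 n →ₗ[F] QDual v) = 0 := by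
        rw [hp]; ext; simp
      rw [h2, map_zero, map_zero, map_zero]
      exact zero_mem _
  exact h ht

end Zigzag

/-! ### Homotopies of chain complexes -/

section NullMap

universe w z

variable {V : Type w} [Category.{z} V] [Preadditive V] {C D : ChainComplex V ℕ}

/-- A family of maps `C_n → D_{n + 1}` as a family indexed by all pairs of degrees. -/
def homExt (h : ∀ n, C.X n ⟶ D.X (n + 1)) (i j : ℕ) : C.X i ⟶ D.X j :=
  if e : i + 1 = j then h i ≫ eqToHom (congrArg D.X e) else 0

theorem homExt_self (h : ∀ n, C.X n ⟶ D.X (n + 1)) (n : ℕ) : homExt h n (n + 1) = h n := by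
  simp [homExt]

theorem homExt_zero (h : ∀ n, C.X n ⟶ D.X (n + 1)) (i j : ℕ)
    (hij : ¬(ComplexShape.down ℕ).Rel j i) : homExt h i j = 0 := dif_neg hij

/-- The null-homotopic chain map `d h + h d`. -/
def nullMap (h : ∀ n, C.X n ⟶ D.X (n + 1)) : C ⟶ D := Homotopy.nullHomotopicMap (homExt h)

theorem nullMap_zero (h : ∀ n, C.X n ⟶ D.X (n + 1)) : (nullMap h).f 0 = h 0 ≫ D.d 1 0 := by
  rw [nullMap, Homotopy.nullHomotopicMap_f_of_not_rel_left (k₁ := 1) (k₀ := 0) rfl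
    (fun l hl => absurd hl (Nat.succ_ne_zero l)), homExt_self]

theorem nullMap_succ (h : ∀ n, C.X n ⟶ D.X (n + 1)) (n : ℕ) :
    (nullMap h).f (n + 1) = C.d (n + 1) n ≫ h n + h (n + 1) ≫ D.d (n + 1 + 1) (n + 1) := by
  rw [nullMap, Homotopy.nullHomotopicMap_f (k₂ := n + 1 + 1) (k₁ := n + 1) (k₀ := n) rfl rfl,
    homExt_self, homExt_self]

/-- The map `d h + h d` is homotopic to zero. -/
def nullMapHomotopy (h : ∀ n, C.X n ⟶ D.X (n + 1)) : Homotopy (nullMap h) 0 :=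
  Homotopy.nullHomotopy (homExt h) (homExt_zero h)

end NullMap

section Retract

variable {F : Type u} [Field F] {A B : Type u} [Ring A] [Algebra F A] [Ring B] [Algebra F B]
  {𝒜 : ℤ → Submodule F A} {ℬ : ℤ → Submodule F B} {C D : ChainComplex (GrBimod 𝒜 ℬ) ℕ}

theorem GrBimod.comp_apply {M N P : GrBimod 𝒜 ℬ} (f : M ⟶ N) (g : N ⟶ P) (x : M.carrier) :
    Hom.toLin (f ≫ g) x = Hom.toLin g (Hom.toLin f x) := rfl

theorem GrBimod.hom_ext_apply {M N : GrBimod 𝒜 ℬ} {f g : M ⟶ N}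
    (h : ∀ x, Hom.toLin f x = Hom.toLin g x) : f = g := hom_ext (LinearMap.ext h)

/-- Powers of the chain map `p = 1 - (d H + H d)`. -/
def pertPow (H : ∀ n, D.X n ⟶ D.X (n + 1)) : ℕ → (D ⟶ D)
  | 0 => 𝟙 D
  | k + 1 => (𝟙 D - nullMap H) ≫ pertPow H k

/-- The powers of `1 - (d H + H d)` are homotopic to the identity. -/
def pertPowHomotopy (H : ∀ n, D.X n ⟶ D.X (n + 1)) : ∀ k, Homotopy (pertPow H k) (𝟙 D)
  | 0 => Homotopy.refl _
  | k + 1 =>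
    let h1 : Homotopy (𝟙 D - nullMap H) (𝟙 D) :=
      (Homotopy.ofEq (add_zero _).symm).trans
        (((Homotopy.refl (𝟙 D - nullMap H)).add (nullMapHomotopy H).symm).trans
          (Homotopy.ofEq (sub_add_cancel _ _)))
    (h1.compRightId (pertPow H k)).trans (pertPowHomotopy H k)

theorem GrBimod.sub_toLin {M N : GrBimod 𝒜 ℬ} (f g : M ⟶ N) :
    Hom.toLin (f - g) = Hom.toLin f - Hom.toLin g := by
  rw [sub_eq_add_neg, add_toLin, neg_toLin, sub_eq_add_neg]

theorem comp_nullMap (H : ∀ n, D.X n ⟶ D.X (n + 1)) (f : C ⟶ D) (hH : ∀ n, f.f n ≫ H n = 0) :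
    f ≫ nullMap H = 0 := by
  refine HomologicalComplex.Hom.ext (funext fun n => ?_)
  rw [HomologicalComplex.comp_f, HomologicalComplex.zero_f]
  cases n with
  | zero => rw [nullMap_zero, ← Category.assoc, hH, Limits.zero_comp]
  | succ n =>
    rw [nullMap_succ, Preadditive.comp_add, ← Category.assoc, ← Category.assoc, hH,
      HomologicalComplex.Hom.comm, Category.assoc, hH, Limits.zero_comp, Limits.comp_zero,
      add_zero]

theorem comp_pertPow (H : ∀ n, D.X n ⟶ D.X (n + 1)) (f : C ⟶ D) (hH : ∀ n, f.f n ≫ H n = 0)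
    (k : ℕ) : f ≫ pertPow H k = f := by
  induction k with
  | zero => exact Category.comp_id f
  | succ k ih =>
    change f ≫ (𝟙 D - nullMap H) ≫ pertPow H k = f
    rw [← Category.assoc, Preadditive.comp_sub, comp_nullMap H f hH, Category.comp_id, sub_zero, ih]

/-- A degreewise split chain map `f : C → D` is a homotopy equivalence if there is a homotopy
operator `H` which vanishes on its image, such that `p = 1 - (d H + H d)` is nilpotent modulo the
image: then a power of `p` is a projection onto the image. -/
theorem nonempty_homotopyEquiv_of_retract (f : C ⟶ D) (g : ∀ n, D.X n ⟶ C.X n)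
    (hfg : ∀ n, f.f n ≫ g n = 𝟙 (C.X n)) (H : ∀ n, D.X n ⟶ D.X (n + 1))
    (hH : ∀ n, f.f n ≫ H n = 0) (k : ℕ) (fil : ∀ n, ℕ → Submodule F (D.X n).carrier)
    (hzero : ∀ n, fil n 0 ≤ LinearMap.range (GrBimod.Hom.toLin (f.f n)))
    (hsucc : ∀ n j, ∀ x ∈ fil n (j + 1),
      x - GrBimod.Hom.toLin ((nullMap H).f n) x ∈ fil n j)
    (htop : ∀ n, fil n k = ⊤) : Nonempty (HomotopyEquiv C D) := by
  have hrange : ∀ k n, ∀ x ∈ fil n k, ∃ y, GrBimod.Hom.toLin (f.f n) y =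
      GrBimod.Hom.toLin ((pertPow H k).f n) x := by
    intro k
    induction k with
    | zero => exact fun n x hx => hzero n hx
    | succ k ih =>
      intro n x hx
      obtain ⟨y, hy⟩ := ih n _ (hsucc n k x hx)
      refine ⟨y, hy.trans ?_⟩
      change _ = GrBimod.Hom.toLin ((𝟙 D - nullMap H : D ⟶ D).f n ≫ (pertPow H k).f n) x
      rw [GrBimod.comp_apply, HomologicalComplex.sub_f_apply, GrBimod.sub_toLin]
      rfl
  have hgf : ∀ n, ((pertPow H k).f n ≫ g n) ≫ f.f n = (pertPow H k).f n := fun n =>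
    GrBimod.hom_ext_apply fun x => by
      obtain ⟨y, hy⟩ := hrange k n x (by rw [htop]; trivial)
      have h1 : GrBimod.Hom.toLin (g n) (GrBimod.Hom.toLin (f.f n) y) = y :=
        LinearMap.congr_fun (congrArg GrBimod.Hom.toLin (hfg n)) y
      rw [GrBimod.comp_apply, GrBimod.comp_apply, ← hy, h1]
  have hmono : ∀ n (M : GrBimod 𝒜 ℬ) (a b : M ⟶ C.X n), a ≫ f.f n = b ≫ f.f n → a = b :=
    fun n M a b h => by
      rw [← Category.comp_id a, ← hfg, ← Category.assoc, h, Category.assoc, hfg,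
        Category.comp_id]
  let g' : D ⟶ C :=
    { f := fun n => (pertPow H k).f n ≫ g n
      comm' := fun i j _ => hmono j _ _ _ (by
        rw [Category.assoc, ← HomologicalComplex.Hom.comm, ← Category.assoc, hgf,
          HomologicalComplex.Hom.comm, Category.assoc (D.d i j), hgf]) }
  have h1 : g' ≫ f = pertPow H k := HomologicalComplex.Hom.ext (funext fun n => hgf n)
  have h2 : f ≫ g' = 𝟙 C := HomologicalComplex.Hom.ext (funext fun n => by
    change f.f n ≫ (pertPow H k).f n ≫ g n = 𝟙 (C.X n)
    rw [← Category.assoc, ← HomologicalComplex.comp_f, comp_pertPow H f hH, hfg])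
  exact ⟨⟨f, g', Homotopy.ofEq h2, (Homotopy.ofEq h1).trans (pertPowHomotopy H k)⟩⟩

end Retract

/-! ### Functoriality of the tensor product of complexes -/

namespace GrBimod

section Functorial

variable {F : Type u} [Field F] {A B C : Type u} [Ring A] [Algebra F A] [Ring B] [Algebra F B]
  [Ring C] [Algebra F C] {𝒜 : ℤ → Submodule F A} {ℬ : ℤ → Submodule F B}
  {𝒞 : ℤ → Submodule F C} [GradedAlgebra ℬ]

theorem tensorMap_id (M : GrBimod 𝒜 ℬ) (N : GrBimod ℬ 𝒞) :
    tensorMap (𝟙 M) (𝟙 N) = 𝟙 (tensor M N) := tensor_hom_ext fun m n => by simp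

theorem tensorMap_add_right (M : GrBimod 𝒜 ℬ) {N N' : GrBimod ℬ 𝒞} (g g' : N ⟶ N') :
    tensorMap (𝟙 M) (g + g') = tensorMap (𝟙 M) g + tensorMap (𝟙 M) g' :=
  tensor_hom_ext fun m n => by simp

theorem tensorMap_neg_right (M : GrBimod 𝒜 ℬ) {N N' : GrBimod ℬ 𝒞} (g : N ⟶ N') :
    tensorMap (𝟙 M) (-g) = -tensorMap (𝟙 M) g :=
  tensor_hom_ext fun m n => by simp

variable (X : ChainComplex (GrBimod 𝒜 ℬ) ℕ) {Y Z : ChainComplex (GrBimod ℬ 𝒞) ℕ}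

theorem tensorComplex_d (Y : ChainComplex (GrBimod ℬ 𝒞) ℕ) (n : ℕ) :
    (tensorComplex X Y).d (n + 1) n = totalD X Y n := ChainComplex.of_d (totalX X Y) (totalD X Y) n

theorem totalD_totalProj (Y : ChainComplex (GrBimod ℬ 𝒞) ℕ) (n p q : ℕ) (h : p + q = n) :
    totalD X Y n ≫ totalProj X Y p q h =
      totalProj X Y (p + 1) q (by omega) ≫ tensorMap (X.d (p + 1) p) (𝟙 (Y.X q)) +
      (-1 : ℤ) ^ p • (totalProj X Y p (q + 1) (by omega) ≫
        tensorMap (𝟙 (X.X p)) (Y.d (q + 1) q)) := totalLift_totalProj X Y _ p q h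

/-- The map `1 ⊗ g` between the terms of degree `n`. -/
def totalMap (g : ∀ q, Y.X q ⟶ Z.X q) (n : ℕ) : totalX X Y n ⟶ totalX X Z n :=
  totalLift X Z fun p q h => totalProj X Y p q h ≫ tensorMap (𝟙 (X.X p)) (g q)

theorem totalMap_totalProj (g : ∀ q, Y.X q ⟶ Z.X q) (n p q : ℕ) (h : p + q = n) :
    totalMap X g n ≫ totalProj X Z p q h = totalProj X Y p q h ≫ tensorMap (𝟙 (X.X p)) (g q) :=
  totalLift_totalProj X Z _ p q h

theorem totalMap_totalD (g : Y ⟶ Z) (n : ℕ) :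
    totalMap X g.f (n + 1) ≫ totalD X Z n = totalD X Y n ≫ totalMap X g.f n := by
  refine total_hom_ext fun p q h => ?_
  rw [Category.assoc, Category.assoc, totalD_totalProj, totalMap_totalProj, ← Category.assoc,
    totalD_totalProj, Preadditive.comp_add, Preadditive.add_comp, Preadditive.comp_zsmul,
    Preadditive.zsmul_comp, ← Category.assoc, ← Category.assoc, totalMap_totalProj,
    totalMap_totalProj]
  simp only [Category.assoc, tensorMap_comp, Category.comp_id, Category.id_comp, g.comm]

/-- The chain map `1 ⊗ g`. -/
def tensorComplexMap (g : Y ⟶ Z) : tensorComplex X Y ⟶ tensorComplex X Z where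
  f n := totalMap X g.f n
  comm' i n hij := by
    obtain rfl : n + 1 = i := hij
    exact (congrArg (totalMap X g.f (n + 1) ≫ ·) (tensorComplex_d X Z n)).trans
      ((totalMap_totalD X g n).trans
        (congrArg (· ≫ totalMap X g.f n) (tensorComplex_d X Y n).symm))

/-- The homotopy `x ⊗ y ↦ (-1) ^ p x ⊗ h y`, for `x` of degree `p`. -/
def totalHtpy (h : ∀ q, Y.X q ⟶ Z.X (q + 1)) (n : ℕ) : totalX X Y n ⟶ totalX X Z (n + 1) :=
  totalLift X Z fun p q hpq => match q, hpq with
    | 0, _ => 0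
    | q + 1, hpq => (-1 : ℤ) ^ p • (totalProj X Y p q (by omega) ≫ tensorMap (𝟙 (X.X p)) (h q))

theorem totalHtpy_zero (h : ∀ q, Y.X q ⟶ Z.X (q + 1)) (n p : ℕ) (hp : p + 0 = n + 1) :
    totalHtpy X h n ≫ totalProj X Z p 0 hp = 0 := totalLift_totalProj X Z _ p 0 hp

theorem totalHtpy_succ (h : ∀ q, Y.X q ⟶ Z.X (q + 1)) (n p q : ℕ) (hp : p + (q + 1) = n + 1) :
    totalHtpy X h n ≫ totalProj X Z p (q + 1) hp =
      (-1 : ℤ) ^ p • (totalProj X Y p q (by omega) ≫ tensorMap (𝟙 (X.X p)) (h q)) :=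
  totalLift_totalProj X Z _ p (q + 1) hp

theorem totalHtpy_totalD (h : ∀ q, Y.X q ⟶ Z.X (q + 1)) (n p q : ℕ) (hpq : p + q = n) :
    (totalHtpy X h n ≫ totalD X Z n) ≫ totalProj X Z p q hpq =
      totalHtpy X h n ≫ totalProj X Z (p + 1) q (by omega) ≫
          tensorMap (X.d (p + 1) p) (𝟙 (Z.X q)) +
        totalProj X Y p q hpq ≫ tensorMap (𝟙 (X.X p)) (h q ≫ Z.d (q + 1) q) := by
  rw [Category.assoc, totalD_totalProj, Preadditive.comp_add, Preadditive.comp_zsmul]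
  congr 1
  rw [← Category.assoc, totalHtpy_succ, Preadditive.zsmul_comp, smul_smul, ← mul_pow]
  simp [tensorMap_comp]

theorem totalHtpy_totalD_zero (h : ∀ q, Y.X q ⟶ Z.X (q + 1)) :
    totalHtpy X h 0 ≫ totalD X Z 0 = totalMap X (nullMap h).f 0 := by
  refine total_hom_ext fun p q hpq => ?_
  obtain ⟨rfl, rfl⟩ : p = 0 ∧ q = 0 := by omega
  rw [totalHtpy_totalD, totalMap_totalProj, nullMap_zero, ← Category.assoc, totalHtpy_zero,
    Limits.zero_comp, zero_add]

theorem totalHtpy_totalD_succ (h : ∀ q, Y.X q ⟶ Z.X (q + 1)) (n : ℕ) :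
    totalD X Y n ≫ totalHtpy X h n + totalHtpy X h (n + 1) ≫ totalD X Z (n + 1) =
      totalMap X (nullMap h).f (n + 1) := by
  refine total_hom_ext fun p q hpq => ?_
  rw [Preadditive.add_comp, totalHtpy_totalD, totalMap_totalProj]
  cases q with
  | zero =>
    rw [Category.assoc, totalHtpy_zero, nullMap_zero, ← Category.assoc (totalHtpy X h (n + 1)),
      totalHtpy_zero, Limits.zero_comp, zero_add, Limits.comp_zero, zero_add]
  | succ q =>
    rw [Category.assoc, totalHtpy_succ, nullMap_succ,
      ← Category.assoc (totalHtpy X h (n + 1)), totalHtpy_succ, Preadditive.comp_zsmul,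
      ← Category.assoc, totalD_totalProj, tensorMap_add_right]
    simp only [Preadditive.add_comp, Preadditive.comp_add, Preadditive.zsmul_comp,
      Category.assoc, tensorMap_comp, Category.comp_id, Category.id_comp, smul_add, smul_smul,
      ← mul_pow, pow_succ]
    simp
    abel

theorem tensorComplexMap_nullMap (h : ∀ q, Y.X q ⟶ Z.X (q + 1)) :
    nullMap (C := tensorComplex X Y) (D := tensorComplex X Z) (totalHtpy X h) =
      tensorComplexMap X (nullMap h) := by
  refine HomologicalComplex.Hom.ext (funext fun n => ?_)
  cases n with
  | zero =>
    exact (nullMap_zero (C := tensorComplex X Y) (D := tensorComplex X Z) (totalHtpy X h)).trans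
      ((congrArg (totalHtpy X h 0 ≫ ·) (tensorComplex_d X Z 0)).trans
        (totalHtpy_totalD_zero X h))
  | succ n =>
    exact (nullMap_succ (C := tensorComplex X Y) (D := tensorComplex X Z) (totalHtpy X h) n).trans
      ((congrArg₂ (fun a b : totalX X Y (n + 1) ⟶ totalX X Z (n + 1) => a + b)
        (congrArg (· ≫ totalHtpy X h n) (tensorComplex_d X Y n))
        (congrArg (totalHtpy X h (n + 1) ≫ ·) (tensorComplex_d X Z (n + 1)))).trans
        (totalHtpy_totalD_succ X h n))

/-- Tensoring with a complex preserves homotopies. -/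
def tensorComplexHomotopy {f g : Y ⟶ Z} (H : Homotopy f g) :
    Homotopy (tensorComplexMap X f) (tensorComplexMap X g) :=
  have hf : nullMap (fun n => H.hom n (n + 1)) = f - g := by
    refine HomologicalComplex.Hom.ext (funext fun n => ?_)
    have hc := H.comm n
    rw [HomologicalComplex.sub_f_apply]
    cases n with
    | zero =>
      rw [nullMap_zero, hc, Homotopy.dNext_zero_chainComplex, Homotopy.prevD_chainComplex]
      abel
    | succ n =>
      rw [nullMap_succ, hc, Homotopy.dNext_succ_chainComplex, Homotopy.prevD_chainComplex]
      abel
  have hg : tensorComplexMap X (f - g) = tensorComplexMap X f - tensorComplexMap X g := by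
    refine HomologicalComplex.Hom.ext (funext fun n => ?_)
    refine total_hom_ext fun p q hpq => ?_
    refine (totalMap_totalProj X (f - g).f n p q hpq).trans ?_
    have e : (tensorComplexMap X f - tensorComplexMap X g).f n =
      totalMap X f.f n - totalMap X g.f n := HomologicalComplex.sub_f_apply _ _ _
    refine Eq.trans ?_ (congrArg (· ≫ totalProj X Z p q hpq) e).symm
    change _ = (totalMap X f.f n - totalMap X g.f n) ≫ _
    rw [Preadditive.sub_comp, totalMap_totalProj, totalMap_totalProj,
      HomologicalComplex.sub_f_apply, sub_eq_add_neg, tensorMap_add_right, tensorMap_neg_right,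
      Preadditive.comp_add, Preadditive.comp_neg, sub_eq_add_neg]
  Homotopy.equivSubZero.symm ((Homotopy.ofEq (by
    rw [← hg, ← hf, ← tensorComplexMap_nullMap])).trans
    (nullMapHomotopy (C := tensorComplex X Y) (D := tensorComplex X Z)
      (totalHtpy X fun n => H.hom n (n + 1))))

theorem tensorComplexMap_id (Y : ChainComplex (GrBimod ℬ 𝒞) ℕ) :
    tensorComplexMap X (𝟙 Y) = 𝟙 (tensorComplex X Y) :=
  HomologicalComplex.Hom.ext (funext fun n => total_hom_ext fun p q hpq => by
    refine (totalMap_totalProj X (𝟙 Y : Y ⟶ Y).f n p q hpq).trans ?_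
    rw [HomologicalComplex.id_f, tensorMap_id, Category.comp_id]
    rfl)

theorem tensorComplexMap_comp {W : ChainComplex (GrBimod ℬ 𝒞) ℕ} (f : Y ⟶ Z) (g : Z ⟶ W) :
    tensorComplexMap X (f ≫ g) = tensorComplexMap X f ≫ tensorComplexMap X g :=
  HomologicalComplex.Hom.ext (funext fun n => total_hom_ext fun p q hpq => by
    refine (totalMap_totalProj X (f ≫ g).f n p q hpq).trans ?_
    change _ = (totalMap X f.f n ≫ totalMap X g.f n) ≫ totalProj X W p q hpq
    rw [Category.assoc, totalMap_totalProj, ← Category.assoc, totalMap_totalProj, Category.assoc,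
      tensorMap_comp, Category.comp_id, HomologicalComplex.comp_f])

/-- Tensoring with a complex preserves homotopy equivalences. -/
def tensorComplexHomotopyEquiv (e : HomotopyEquiv Y Z) :
    HomotopyEquiv (tensorComplex X Y) (tensorComplex X Z) where
  hom := tensorComplexMap X e.hom
  inv := tensorComplexMap X e.inv
  homotopyHomInvId := (Homotopy.ofEq (tensorComplexMap_comp X _ _).symm).trans
    ((tensorComplexHomotopy X e.homotopyHomInvId).trans
      (Homotopy.ofEq (tensorComplexMap_id X Y)))
  homotopyInvHomId := (Homotopy.ofEq (tensorComplexMap_comp X _ _).symm).trans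
    ((tensorComplexHomotopy X e.homotopyInvHomId).trans
      (Homotopy.ofEq (tensorComplexMap_id X Z)))

end Functorial

end GrBimod

/-! ### Tensoring a complex with a twist -/

namespace GrBimod

section Unit

variable {F : Type u} [Field F] {A C : Type u} [Ring A] [Algebra F A]
  [Ring C] [Algebra F C] {𝒜 : ℤ → Submodule F A} {𝒞 : ℤ → Submodule F C} [GradedAlgebra 𝒜]

theorem L_mul (M : GrBimod 𝒜 𝒞) (a b : A) (m : M.carrier) : M.L (a * b) m = M.L a (M.L b m) := by
  rw [map_mul]; rfl

theorem L_one (M : GrBimod 𝒜 𝒞) (m : M.carrier) : M.L 1 m = m := by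
  rw [map_one]; rfl

/-- The isomorphism `A ⊗_A M → M`. -/
def unitL (M : GrBimod 𝒜 𝒞) : tensor (regular 𝒜) M ⟶ M :=
  homOfTensor (M := regular 𝒜) (N := M) (P := M) M.L.toLinearMap
    (fun (a : A) b m => L_mul M a b m)
    (fun (a : A) (b : A) m => L_mul M a b m)
    (fun c (a : A) m => M.comm a c m)
    (fun _ _ _ ha _ hm => M.L_mem ha hm)

/-- The canonical bilinear map `A × M → A ⊗_A M`. -/
def rtmul (M : GrBimod 𝒜 𝒞) : A →ₗ[F] M.carrier →ₗ[F] (tensor (regular 𝒜) M).carrier :=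
  tmul (regular 𝒜) M

theorem unitL_rtmul (M : GrBimod 𝒜 𝒞) (a : A) (m : M.carrier) :
    Hom.toLin (unitL M) (rtmul M a m) = M.L a m :=
  homOfTensor_tmul (M := regular 𝒜) (N := M) (P := M) _ _ _ _ _ a m

theorem rtmul_L (M : GrBimod 𝒜 𝒞) (a b : A) (m : M.carrier) :
    rtmul M a (M.L b m) = rtmul M (a * b) m :=
  (tmul_balanced (regular 𝒜) M a b m).symm

theorem L_rtmul (M : GrBimod 𝒜 𝒞) (a b : A) (m : M.carrier) :
    (tensor (regular 𝒜) M).L a (rtmul M b m) = rtmul M (a * b) m :=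
  tensor_L (regular 𝒜) M a b m

theorem regular_hom_ext {M : GrBimod 𝒜 𝒞} {P : GrBimod 𝒜 𝒞} {f g : tensor (regular 𝒜) M ⟶ P}
    (h : ∀ a m, Hom.toLin f (rtmul M a m) = Hom.toLin g (rtmul M a m)) : f = g :=
  tensor_hom_ext (M := regular 𝒜) h

theorem tensorMap_rtmul {M N : GrBimod 𝒜 𝒞} (f : M ⟶ N) (a : A) (m : M.carrier) :
    Hom.toLin (tensorMap (𝟙 (regular 𝒜)) f) (rtmul M a m) = rtmul N a (Hom.toLin f m) :=
  tensorMap_tmul (𝟙 (regular 𝒜)) f a m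

/-- The inverse `m ↦ 1 ⊗ m` of the isomorphism `A ⊗_A M → M`. -/
def unitR (M : GrBimod 𝒜 𝒞) : M ⟶ tensor (regular 𝒜) M where
  toLin := rtmul M 1
  map_L a m := by rw [rtmul_L, L_rtmul, one_mul, mul_one]
  map_R c m := (tensor_R (regular 𝒜) M c _ m).symm
  map_mem n m hm := by
    have h := tmul_mem (regular 𝒜) M (i := 0) (j := n) (x := (1 : A))
      (show (1 : A) ∈ 𝒜 0 from SetLike.GradedOne.one_mem) hm
    rwa [zero_add] at h

theorem unitR_unitL (M : GrBimod 𝒜 𝒞) : unitR M ≫ unitL M = 𝟙 M :=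
  hom_ext_apply fun m => (unitL_rtmul M 1 m).trans (L_one M m)

theorem unitL_unitR (M : GrBimod 𝒜 𝒞) : unitL M ≫ unitR M = 𝟙 _ :=
  regular_hom_ext fun a m => by
    rw [comp_apply, unitL_rtmul]
    exact (rtmul_L M 1 a m).trans (congrArg (fun b => rtmul M b m) (one_mul a))

theorem unitL_naturality {M N : GrBimod 𝒜 𝒞} (f : M ⟶ N) :
    tensorMap (𝟙 (regular 𝒜)) f ≫ unitL N = unitL M ≫ f :=
  regular_hom_ext fun a m => by
    rw [comp_apply, comp_apply, unitL_rtmul, tensorMap_rtmul, unitL_rtmul, Hom.map_L]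

theorem unitL_cancel {M P : GrBimod 𝒜 𝒞} {f g : P ⟶ tensor (regular 𝒜) M}
    (h : f ≫ unitL M = g ≫ unitL M) : f = g := by
  rw [← Category.comp_id f, ← Category.comp_id g, ← unitL_unitR, ← Category.assoc, h,
    Category.assoc]

end Unit

section TotalIn

variable {F : Type u} [Field F] {A B C : Type u} [Ring A] [Algebra F A] [Ring B] [Algebra F B]
  [Ring C] [Algebra F C] {𝒜 : ℤ → Submodule F A} {ℬ : ℤ → Submodule F B}
  {𝒞 : ℤ → Submodule F C} [GradedAlgebra ℬ]
  (X : ChainComplex (GrBimod 𝒜 ℬ) ℕ) (Y : ChainComplex (GrBimod ℬ 𝒞) ℕ)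

/-- The inclusion of a summand in the term of degree `n` of `X ⊗_B Y`. -/
def totalIn {n : ℕ} (p q : ℕ) (h : p + q = n) : tensor (X.X p) (Y.X q) ⟶ totalX X Y n :=
  totalLift X Y fun p' q' h' => if e : p' = p then
    eqToHom (by obtain rfl := e; obtain rfl : q' = q := by omega
                rfl) else 0

theorem totalIn_totalProj {n : ℕ} (p q : ℕ) (h : p + q = n) :
    totalIn X Y p q h ≫ totalProj X Y p q h = 𝟙 _ := by
  rw [totalIn, totalLift_totalProj, dif_pos rfl, eqToHom_refl]

theorem totalIn_totalProj_ne {n : ℕ} {p q p' q' : ℕ} (h : p + q = n) (h' : p' + q' = n)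
    (hp : p' ≠ p) : totalIn X Y p q h ≫ totalProj X Y p' q' h' = 0 := by
  rw [totalIn, totalLift_totalProj, dif_neg hp]

end TotalIn

end GrBimod

namespace Twist

open GrBimod

variable {F : Type u} [Field F] {A C : Type u} [Ring A] [Algebra F A] {𝒜 : ℤ → Submodule F A}
  [GradedAlgebra 𝒜] [Ring C] [Algebra F C] {𝒞 : ℤ → Submodule F C} {r : ℕ} (v : VertexIdem 𝒜 r)
  (i : Fin r)

/-- The bimodule `A e_i ⊗ e_i M`. -/
abbrev ind (M : GrBimod 𝒜 𝒞) : GrBimod 𝒜 𝒞 := tensor (projBimod 𝒜 (v.e i) (v.mem i)) M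

/-- The map `A e_i ⊗ e_i M → A e_i ⊗ e_i N` induced by a map of bimodules. -/
def indMap {M N : GrBimod 𝒜 𝒞} (f : M ⟶ N) : ind v i M ⟶ ind v i N := tensorMap (𝟙 _) f

/-- The multiplication map `A e_i ⊗ e_i M → M`. -/
def ev (M : GrBimod 𝒜 𝒞) : ind v i M ⟶ M :=
  tensorMap (evalMap 𝒜 (v.e i) (v.mem i)) (𝟙 M) ≫ unitL M

theorem indMap_comp {M N P : GrBimod 𝒜 𝒞} (f : M ⟶ N) (g : N ⟶ P) :
    indMap v i f ≫ indMap v i g = indMap v i (f ≫ g) := by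
  refine (tensorMap_comp _ _ _ _).trans ?_
  rw [Category.comp_id]; rfl

theorem ev_naturality {M N : GrBimod 𝒜 𝒞} (f : M ⟶ N) :
    indMap v i f ≫ ev v i N = ev v i M ≫ f := by
  rw [indMap, ev, ev, ← Category.assoc, Category.assoc _ (unitL M), ← unitL_naturality,
    ← Category.assoc, tensorMap_comp, tensorMap_comp, Category.id_comp, Category.comp_id,
    Category.id_comp, Category.comp_id]

variable (Y : ChainComplex (GrBimod 𝒜 𝒞) ℕ)

/-- The complex `X_i ⊗_A Y`. -/
abbrev tw : ChainComplex (GrBimod 𝒜 𝒞) ℕ := tensorComplex (twist v i) Y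

/-- The component in `A ⊗_A Y_n = Y_n`. -/
def outA (n : ℕ) : (tw v i Y).X n ⟶ Y.X n :=
  show totalX (twist v i) Y n ⟶ Y.X n from
    (show totalX (twist v i) Y n ⟶ tensor (regular 𝒜) (Y.X n) from
      totalProj (twist v i) Y 0 n (zero_add n)) ≫ unitL (Y.X n)

/-- The component in `A e_i ⊗ e_i Y_n`. -/
def outP (n : ℕ) : (tw v i Y).X (n + 1) ⟶ ind v i (Y.X n) :=
  totalProj (twist v i) Y 1 n (add_comm 1 n)

/-- The inclusion of `Y_n = A ⊗_A Y_n`. -/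
def inA (n : ℕ) : Y.X n ⟶ (tw v i Y).X n :=
  show Y.X n ⟶ totalX (twist v i) Y n from
    unitR (Y.X n) ≫ (show tensor (regular 𝒜) (Y.X n) ⟶ totalX (twist v i) Y n from
      totalIn (twist v i) Y 0 n (zero_add n))

/-- The inclusion of `A e_i ⊗ e_i Y_n`. -/
def inP (n : ℕ) : ind v i (Y.X n) ⟶ (tw v i Y).X (n + 1) :=
  totalIn (twist v i) Y 1 n (add_comm 1 n)

theorem inA_outA (n : ℕ) : inA v i Y n ≫ outA v i Y n = 𝟙 _ := by
  have h := congrArg (fun f => unitR (Y.X n) ≫ f ≫ unitL (Y.X n))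
    (totalIn_totalProj (twist v i) Y 0 n (zero_add n))
  exact h.trans (unitR_unitL (Y.X n))

theorem inP_outP (n : ℕ) : inP v i Y n ≫ outP v i Y n = 𝟙 _ :=
  totalIn_totalProj (twist v i) Y 1 n (add_comm 1 n)

theorem inA_outP (n : ℕ) : inA v i Y (n + 1) ≫ outP v i Y n = 0 :=
  (congrArg (fun f => unitR (Y.X (n + 1)) ≫ f)
    (totalIn_totalProj_ne (twist v i) Y (zero_add (n + 1)) (add_comm 1 n) one_ne_zero)).trans
    Limits.comp_zero

theorem inP_outA (n : ℕ) : inP v i Y n ≫ outA v i Y (n + 1) = 0 :=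
  (congrArg (fun f => f ≫ unitL (Y.X (n + 1)))
    (totalIn_totalProj_ne (twist v i) Y (add_comm 1 n) (zero_add (n + 1)) zero_ne_one)).trans
    Limits.zero_comp

theorem twist_d : (show projBimod 𝒜 (v.e i) (v.mem i) ⟶ regular 𝒜 from (twist v i).d 1 0) =
    evalMap 𝒜 (v.e i) (v.mem i) :=
  ChainComplex.of_d (coneX (single (projBimod 𝒜 (v.e i) (v.mem i))) (regular 𝒜))
    (coneD (single (projBimod 𝒜 (v.e i) (v.mem i))) (regular 𝒜) (evalMap 𝒜 (v.e i) (v.mem i))) 0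

theorem twist_d_succ (n : ℕ) : (twist v i).d (n + 2) (n + 1) = 0 :=
  hom_ext (LinearMap.ext fun (_ : PUnit) => (map_zero _ : _ = _))

theorem d_outA (n : ℕ) : (tw v i Y).d (n + 1) n ≫ outA v i Y n =
    outA v i Y (n + 1) ≫ Y.d (n + 1) n + outP v i Y n ≫ ev v i (Y.X n) := by
  have h := totalD_totalProj (twist v i) Y n 0 n (zero_add n)
  have h2 := congrArg (fun f => f ≫ unitL (Y.X n)) h
  refine (congrArg (· ≫ outA v i Y n) (tensorComplex_d (twist v i) Y n)).trans (h2.trans ?_)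
  refine (congrArg (· ≫ unitL (Y.X n)) (congrArg₂ (· + ·) rfl (one_smul ℤ _))).trans ?_
  refine (Preadditive.add_comp _ _ _ _ _ _).trans ((add_comm _ _).trans ?_)
  refine congrArg₂ (· + ·) ?_ ?_
  · exact congrArg (totalProj (twist v i) Y 0 (n + 1) (zero_add (n + 1)) ≫ ·)
      (unitL_naturality (Y.d (n + 1) n))
  · exact congrArg (fun f => totalProj (twist v i) Y 1 n (add_comm 1 n) ≫
      tensorMap (M := projBimod 𝒜 (v.e i) (v.mem i)) (M' := regular 𝒜) f (𝟙 (Y.X n)) ≫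
        unitL (Y.X n)) (twist_d v i)

theorem d_outP (n : ℕ) : (tw v i Y).d (n + 2) (n + 1) ≫ outP v i Y n =
    -(outP v i Y (n + 1) ≫ indMap v i (Y.d (n + 1) n)) := by
  have h := totalD_totalProj (twist v i) Y (n + 1) 1 n (add_comm 1 n)
  refine (congrArg (· ≫ outP v i Y n) (tensorComplex_d (twist v i) Y (n + 1))).trans (h.trans ?_)
  rw [twist_d_succ, tensorMap_zero_left, Limits.comp_zero, zero_add, pow_one, neg_smul, one_smul]
  rfl

theorem hom_ext_zero {M : GrBimod 𝒜 𝒞} {f g : M ⟶ (tw v i Y).X 0}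
    (hA : f ≫ outA v i Y 0 = g ≫ outA v i Y 0) : f = g := by
  refine total_hom_ext (X := twist v i) (Y := Y) fun p q h => ?_
  obtain ⟨rfl, rfl⟩ : p = 0 ∧ q = 0 := by omega
  exact unitL_cancel ((Category.assoc _ _ _).trans (hA.trans (Category.assoc _ _ _).symm))

theorem hom_ext_succ {n : ℕ} {M : GrBimod 𝒜 𝒞} {f g : M ⟶ (tw v i Y).X (n + 1)}
    (hA : f ≫ outA v i Y (n + 1) = g ≫ outA v i Y (n + 1))
    (hP : f ≫ outP v i Y n = g ≫ outP v i Y n) : f = g := by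
  refine total_hom_ext (X := twist v i) (Y := Y) fun p q h => ?_
  rcases p with _ | _ | p
  · obtain rfl : q = n + 1 := by omega
    exact unitL_cancel ((Category.assoc _ _ _).trans (hA.trans (Category.assoc _ _ _).symm))
  · obtain rfl : q = n := by omega
    exact hP
  · -- the terms of degree at least `2` of the twist vanish
    have hz : ∀ t : (tensor ((twist v i).X (p + 2)) (Y.X q)).carrier, t = 0 := fun t =>
      tmul_induction (M := (twist v i).X (p + 2)) (N := Y.X q) (P := fun t => t = 0)
        (fun (m : PUnit) y => LinearMap.congr_fun
          (map_zero (tmul ((twist v i).X (p + 2)) (Y.X q))) y) rfl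
        (fun x y hx hy => by rw [hx, hy, add_zero]) t
    exact hom_ext_apply fun x => (hz _).trans (hz _).symm

end Twist

/-! ### Recognizing the tensor product with a twist -/

namespace Twist

open GrBimod

section Perturbation

variable {F : Type u} [Field F] {A C : Type u} [Ring A] [Algebra F A] {𝒜 : ℤ → Submodule F A}
  [GradedAlgebra 𝒜] [Ring C] [Algebra F C] {𝒞 : ℤ → Submodule F C} {r : ℕ} (v : VertexIdem 𝒜 r)
  (i : Fin r) (Y : ChainComplex (GrBimod 𝒜 𝒞) ℕ)

theorem inA_d (n : ℕ) : inA v i Y (n + 1) ≫ (tw v i Y).d (n + 1) n =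
    Y.d (n + 1) n ≫ inA v i Y n := by
  cases n with
  | zero =>
    refine hom_ext_zero v i Y ?_
    rw [Category.assoc, Category.assoc, d_outA, inA_outA, Preadditive.comp_add, ← Category.assoc,
      ← Category.assoc, inA_outA, inA_outP, Limits.zero_comp, add_zero, Category.id_comp,
      Category.comp_id]
  | succ n =>
    refine hom_ext_succ v i Y ?_ ?_
    · rw [Category.assoc, Category.assoc, d_outA, inA_outA, Preadditive.comp_add,
        ← Category.assoc, ← Category.assoc, inA_outA, inA_outP, Limits.zero_comp, add_zero,
        Category.id_comp, Category.comp_id]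
    · rw [Category.assoc, Category.assoc, d_outP, inA_outP, Limits.comp_zero,
        Preadditive.comp_neg, ← Category.assoc, inA_outP, Limits.zero_comp, neg_zero]

theorem inP_d_zero : inP v i Y 0 ≫ (tw v i Y).d 1 0 = ev v i (Y.X 0) ≫ inA v i Y 0 := by
  refine hom_ext_zero v i Y ?_
  rw [Category.assoc, Category.assoc, d_outA, inA_outA, Preadditive.comp_add, ← Category.assoc,
    ← Category.assoc, inP_outA, inP_outP, Limits.zero_comp, zero_add, Category.id_comp,
    Category.comp_id]

theorem inP_d_succ (n : ℕ) : inP v i Y (n + 1) ≫ (tw v i Y).d (n + 2) (n + 1) =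
    ev v i (Y.X (n + 1)) ≫ inA v i Y (n + 1) - indMap v i (Y.d (n + 1) n) ≫ inP v i Y n := by
  refine hom_ext_succ v i Y ?_ ?_
  · rw [Category.assoc, Preadditive.sub_comp, Category.assoc, Category.assoc, d_outA, inA_outA,
      Preadditive.comp_add, ← Category.assoc, ← Category.assoc, inP_outA, inP_outP, inP_outA,
      Limits.zero_comp, zero_add, Category.id_comp, Category.comp_id, Limits.comp_zero, sub_zero]
  · rw [Category.assoc, Preadditive.sub_comp, Category.assoc, Category.assoc, d_outP, inA_outP,
      inP_outP, Preadditive.comp_neg, ← Category.assoc, inP_outP, Limits.comp_zero, zero_sub,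
      Category.id_comp, Category.comp_id]

theorem eq_inA (x : ((tw v i Y).X 0).carrier) :
    Hom.toLin (inA v i Y 0) (Hom.toLin (outA v i Y 0) x) = x := by
  have h : outA v i Y 0 ≫ inA v i Y 0 = 𝟙 _ := hom_ext_zero v i Y (by
    rw [Category.assoc, inA_outA, Category.comp_id, Category.id_comp])
  exact LinearMap.congr_fun (congrArg Hom.toLin h) x

theorem eq_inA_add_inP (n : ℕ) (x : ((tw v i Y).X (n + 1)).carrier) :
    Hom.toLin (inA v i Y (n + 1)) (Hom.toLin (outA v i Y (n + 1)) x) +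
      Hom.toLin (inP v i Y n) (Hom.toLin (outP v i Y n) x) = x := by
  have h : outA v i Y (n + 1) ≫ inA v i Y (n + 1) + outP v i Y n ≫ inP v i Y n = 𝟙 _ :=
    hom_ext_succ v i Y (by
      rw [Preadditive.add_comp, Category.assoc, Category.assoc, inA_outA, inP_outA,
        Category.comp_id, Limits.comp_zero, add_zero, Category.id_comp]) (by
      rw [Preadditive.add_comp, Category.assoc, Category.assoc, inA_outP, inP_outP,
        Category.comp_id, Limits.comp_zero, zero_add, Category.id_comp])
  exact LinearMap.congr_fun (congrArg Hom.toLin h) x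

variable {Y' : ChainComplex (GrBimod 𝒜 𝒞) ℕ} (q : ∀ n, Y'.X n ⟶ Y.X n)
  (j : ∀ n, Y.X n ⟶ Y'.X n) (θ : ∀ n, Y'.X (n + 1) ⟶ ind v i (Y.X n))
  (lam : ∀ n, ind v i (Y.X n) ⟶ Y'.X (n + 1))
  (η : ∀ n, ind v i (Y.X n) ⟶ ind v i (Y.X (n + 1)))

/-- The terms `y ↦ q y + θ y` of a chain map `Y' → X_i ⊗ Y`. -/
def stepMap : ∀ n, Y'.X n ⟶ (tw v i Y).X n
  | 0 => q 0 ≫ inA v i Y 0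
  | n + 1 => q (n + 1) ≫ inA v i Y (n + 1) + θ n ≫ inP v i Y n

/-- The terms of a left inverse. -/
def stepInv : ∀ n, (tw v i Y).X n ⟶ Y'.X n
  | 0 => outA v i Y 0 ≫ j 0
  | n + 1 => outA v i Y (n + 1) ≫ j (n + 1) + outP v i Y n ≫ lam n

/-- The homotopy operator on `X_i ⊗ Y` induced by `η`. -/
def stepHtpy : ∀ n, (tw v i Y).X n ⟶ (tw v i Y).X (n + 1)
  | 0 => 0
  | n + 1 => outP v i Y n ≫ η n ≫ inP v i Y (n + 1)

/-- Conditions under which `X_i ⊗ Y` is homotopy equivalent to `Y'`: the part `A e_i ⊗ e_i Y` of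
`X_i ⊗ Y` is contracted, up to the image of `Y'`, by the operators `η`. The chain map `Y' → X_i ⊗ Y`
is given by `q` and `θ`, and has the degreewise left inverse given by `j` and `lam`. The operators
`η` vanish on the image of `θ` and contract modulo the image of `θ`, up to an error which is
nilpotent by means of the filtration `G`. -/
theorem nonempty_homotopyEquiv_tw (hjq : ∀ n, j n ≫ q n = 𝟙 _)
    (hjθ : ∀ n, j (n + 1) ≫ θ n = 0)
    (hd : ∀ n, q (n + 1) ≫ Y.d (n + 1) n + θ n ≫ ev v i (Y.X n) = Y'.d (n + 1) n ≫ q n)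
    (hdθ : ∀ n, θ (n + 1) ≫ indMap v i (Y.d (n + 1) n) = -(Y'.d (n + 2) (n + 1) ≫ θ n))
    (hinv0 : q 0 ≫ j 0 = 𝟙 _) (hinv : ∀ n, q (n + 1) ≫ j (n + 1) + θ n ≫ lam n = 𝟙 _)
    (hθη : ∀ n, θ n ≫ η n = 0) (hθ0 : Function.Surjective (Hom.toLin (θ 0)))
    (G : ∀ n, ℕ → Submodule F (ind v i (Y.X (n + 1))).carrier) (k : ℕ)
    (hG0 : ∀ n, G n 0 ≤ LinearMap.range (Hom.toLin (θ (n + 1))))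
    (hGk : ∀ n, G n k ⊔ LinearMap.range (Hom.toLin (θ (n + 1))) = ⊤)
    (hG : ∀ n l, ∀ z ∈ G n (l + 1),
      z + Hom.toLin (indMap v i (Y.d (n + 2) (n + 1))) (Hom.toLin (η (n + 1)) z) +
        Hom.toLin (η n) (Hom.toLin (indMap v i (Y.d (n + 1) n)) z) ∈
      G n l ⊔ LinearMap.range (Hom.toLin (θ (n + 1)))) :
    Nonempty (HomotopyEquiv Y' (tw v i Y)) := by
  let f : Y' ⟶ tw v i Y :=
    { f := stepMap v i Y q θ
      comm' := fun m n hmn => by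
        obtain rfl : n + 1 = m := hmn
        cases n with
        | zero =>
          change (q 1 ≫ inA v i Y 1 + θ 0 ≫ inP v i Y 0) ≫ (tw v i Y).d 1 0 =
            Y'.d 1 0 ≫ q 0 ≫ inA v i Y 0
          rw [Preadditive.add_comp, Category.assoc, Category.assoc, inA_d, inP_d_zero,
            ← Category.assoc (Y'.d 1 0), ← hd, Preadditive.add_comp, Category.assoc,
            Category.assoc]
        | succ n =>
          change (q (n + 2) ≫ inA v i Y (n + 2) + θ (n + 1) ≫ inP v i Y (n + 1)) ≫
            (tw v i Y).d (n + 2) (n + 1) =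
            Y'.d (n + 2) (n + 1) ≫ (q (n + 1) ≫ inA v i Y (n + 1) + θ n ≫ inP v i Y n)
          rw [Preadditive.add_comp, Category.assoc, Category.assoc, inA_d, inP_d_succ,
            Preadditive.comp_add, ← Category.assoc (Y'.d (n + 2) (n + 1)), ← hd,
            Preadditive.add_comp, Preadditive.comp_sub, ← Category.assoc (θ (n + 1)) (indMap v i _),
            hdθ, Preadditive.neg_comp, sub_neg_eq_add]
          simp only [Category.assoc]
          exact (add_assoc _ _ _).symm }
  have hf0 : f.f 0 = q 0 ≫ inA v i Y 0 := rfl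
  have hf : ∀ n, f.f (n + 1) = q (n + 1) ≫ inA v i Y (n + 1) + θ n ≫ inP v i Y n := fun n => rfl
  have hA : ∀ n y, Hom.toLin (inA v i Y n) y ∈ LinearMap.range (Hom.toLin (f.f n)) := fun n y => by
    refine ⟨Hom.toLin (j n) y, ?_⟩
    rw [← GrBimod.comp_apply]
    refine LinearMap.congr_fun (congrArg Hom.toLin ?_) y
    cases n with
    | zero => rw [hf0, ← Category.assoc, hjq, Category.id_comp]
    | succ n =>
      rw [hf, Preadditive.comp_add, ← Category.assoc, ← Category.assoc, hjq, hjθ,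
        Category.id_comp, Limits.zero_comp, add_zero]
  have hP : ∀ n, (LinearMap.range (Hom.toLin (θ n))).map (Hom.toLin (inP v i Y n)) ≤
      LinearMap.range (Hom.toLin (f.f (n + 1))) := fun n => by
    rintro _ ⟨_, ⟨y, rfl⟩, rfl⟩
    have h1 : Hom.toLin (f.f (n + 1)) y = Hom.toLin (inA v i Y (n + 1)) (Hom.toLin (q (n + 1)) y) +
        Hom.toLin (inP v i Y n) (Hom.toLin (θ n) y) := rfl
    rw [← sub_eq_iff_eq_add'] at h1
    rw [← h1]
    exact sub_mem ⟨y, rfl⟩ (hA _ _)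
  have hH : ∀ n, f.f n ≫ stepHtpy v i Y η n = 0 := fun n => by
    cases n with
    | zero => exact Limits.comp_zero
    | succ n =>
      change f.f (n + 1) ≫ outP v i Y n ≫ η n ≫ inP v i Y (n + 1) = 0
      rw [hf, Preadditive.add_comp, Category.assoc, Category.assoc, ← Category.assoc (inA v i Y _),
        ← Category.assoc (inP v i Y _), inA_outP, inP_outP, Category.id_comp, Limits.zero_comp,
        Limits.comp_zero, zero_add, ← Category.assoc, hθη, Limits.zero_comp]
  let fil : ∀ n, ℕ → Submodule F ((tw v i Y).X n).carrier := fun n => match n with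
    | 0 => fun _ => ⊤
    | 1 => fun _ => ⊤
    | n + 2 => fun l => LinearMap.range (Hom.toLin (f.f (n + 2))) ⊔
        (G n l).map (Hom.toLin (inP v i Y (n + 1)))
  refine nonempty_homotopyEquiv_of_retract f (stepInv v i Y j lam) (fun n => ?_)
    (stepHtpy v i Y η) hH k fil (fun n => ?_) (fun n l x hx => ?_) (fun n => ?_)
  · cases n with
    | zero =>
      change f.f 0 ≫ outA v i Y 0 ≫ j 0 = 𝟙 _
      rw [hf0, Category.assoc, ← Category.assoc (inA v i Y 0), inA_outA, Category.id_comp, hinv0]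
    | succ n =>
      change f.f (n + 1) ≫ (outA v i Y (n + 1) ≫ j (n + 1) + outP v i Y n ≫ lam n) = 𝟙 _
      rw [hf, Preadditive.comp_add, Preadditive.add_comp, Preadditive.add_comp]
      simp only [Category.assoc]
      rw [← Category.assoc (inA v i Y _), ← Category.assoc (inA v i Y _),
        ← Category.assoc (inP v i Y _), ← Category.assoc (inP v i Y _), inA_outA, inA_outP,
        inP_outA, inP_outP]
      simp only [Category.id_comp, Limits.zero_comp, Limits.comp_zero, add_zero, zero_add]
      exact hinv n
  · match n with
    | 0 =>
      intro x _
      rw [← eq_inA v i Y x]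
      exact hA _ _
    | 1 =>
      intro x _
      rw [← eq_inA_add_inP v i Y 0 x]
      refine add_mem (hA _ _) (hP 0 (Submodule.mem_map_of_mem ?_))
      exact hθ0 _
    | n + 2 =>
      exact sup_le le_rfl ((Submodule.map_mono (hG0 n)).trans (hP (n + 1)))
  · match n with
    | 0 => trivial
    | 1 => trivial
    | n + 2 =>
      obtain ⟨_, ⟨y, rfl⟩, _, ⟨z, hz, rfl⟩, rfl⟩ := Submodule.mem_sup.1 hx
      have h1 : Hom.toLin ((nullMap (stepHtpy v i Y η)).f (n + 2)) (Hom.toLin (f.f (n + 2)) y) =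
          0 := by
        have h := comp_nullMap (stepHtpy v i Y η) f hH
        exact LinearMap.congr_fun
          (congrArg (fun g => Hom.toLin (HomologicalComplex.Hom.f g (n + 2))) h) y
      have h2 : inP v i Y (n + 1) ≫ (nullMap (stepHtpy v i Y η)).f (n + 2) =
          -(indMap v i (Y.d (n + 1) n) ≫ η n ≫ inP v i Y (n + 1)) +
          (η (n + 1) ≫ ev v i (Y.X (n + 2)) ≫ inA v i Y (n + 2) -
            η (n + 1) ≫ indMap v i (Y.d (n + 2) (n + 1)) ≫ inP v i Y (n + 1)) := by
        rw [nullMap_succ]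
        change inP v i Y (n + 1) ≫ ((tw v i Y).d (n + 2) (n + 1) ≫
            (outP v i Y n ≫ η n ≫ inP v i Y (n + 1)) +
          (outP v i Y (n + 1) ≫ η (n + 1) ≫ inP v i Y (n + 2)) ≫
            (tw v i Y).d (n + 3) (n + 2)) = _
        rw [Preadditive.comp_add, ← Category.assoc ((tw v i Y).d _ _), d_outP, Category.assoc,
          Category.assoc, inP_d_succ, ← Category.assoc (inP v i Y (n + 1)) (outP v i Y (n + 1)),
          inP_outP, Category.id_comp, Preadditive.comp_sub, Preadditive.neg_comp,
          Preadditive.comp_neg]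
        simp only [Category.assoc]
        rw [← Category.assoc (inP v i Y (n + 1)) (outP v i Y (n + 1)),
          inP_outP, Category.id_comp]
      have h3 : Hom.toLin ((nullMap (stepHtpy v i Y η)).f (n + 2))
          (Hom.toLin (inP v i Y (n + 1)) z) =
          Hom.toLin (inA v i Y (n + 2)) (Hom.toLin (ev v i (Y.X (n + 2)))
            (Hom.toLin (η (n + 1)) z)) - Hom.toLin (inP v i Y (n + 1))
          (Hom.toLin (indMap v i (Y.d (n + 2) (n + 1))) (Hom.toLin (η (n + 1)) z) +
            Hom.toLin (η n) (Hom.toLin (indMap v i (Y.d (n + 1) n)) z)) := by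
        refine (LinearMap.congr_fun (congrArg Hom.toLin h2) z).trans ?_
        rw [add_toLin, neg_toLin, sub_toLin, LinearMap.add_apply, LinearMap.neg_apply,
          LinearMap.sub_apply, map_add]
        simp only [comp_toLin, LinearMap.comp_apply]
        abel
      have h4 : ∀ z ∈ G n l ⊔ LinearMap.range (Hom.toLin (θ (n + 1))),
          Hom.toLin (inP v i Y (n + 1)) z ∈ fil (n + 2) l := fun z hz => by
        obtain ⟨a, ha, b, hb, rfl⟩ := Submodule.mem_sup.1 hz
        rw [map_add]
        exact add_mem (Submodule.mem_sup_right (Submodule.mem_map_of_mem ha))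
          (Submodule.mem_sup_left (hP (n + 1) (Submodule.mem_map_of_mem hb)))
      rw [map_add, h1, h3, zero_add, add_sub_assoc]
      refine add_mem (Submodule.mem_sup_left ⟨y, rfl⟩) ?_
      rw [← sub_add, sub_add_eq_add_sub, ← map_add, ← add_assoc]
      exact sub_mem (h4 _ (hG n l z hz)) (Submodule.mem_sup_left (hA _ _))
  · match n with
    | 0 => rfl
    | 1 => rfl
    | n + 2 =>
      refine eq_top_iff.2 fun x _ => ?_
      rw [← eq_inA_add_inP v i Y (n + 1) x]
      refine add_mem (Submodule.mem_sup_left (hA _ _)) ?_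
      have h5 : Hom.toLin (outP v i Y (n + 1)) x ∈
          G n k ⊔ LinearMap.range (Hom.toLin (θ (n + 1))) := by rw [hGk]; trivial
      obtain ⟨a, ha, b, hb, hab⟩ := Submodule.mem_sup.1 h5
      rw [← hab, map_add]
      exact add_mem (Submodule.mem_sup_right (Submodule.mem_map_of_mem ha))
        (Submodule.mem_sup_left (hP (n + 1) (Submodule.mem_map_of_mem hb)))

end Perturbation

end Twist

/-! ### Images of idempotents -/

namespace GrBimod

section Image

variable {F : Type u} [Field F] {A B : Type u} [Ring A] [Algebra F A] [Ring B] [Algebra F B]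
  {𝒜 : ℤ → Submodule F A} {ℬ : ℤ → Submodule F B}

theorem prj_hom {M N : GrBimod 𝒜 ℬ} (f : M ⟶ N) (n : ℤ) (x : M.carrier) :
    N.prj n (Hom.toLin f x) = Hom.toLin f (M.prj n x) := by
  refine homogeneous_induction M.internal ?_ ?_ ?_ x
  · intro i x hx
    by_cases h : i = n
    · subst h
      rw [prj_of_mem M hx, prj_of_mem N (Hom.map_mem f _ _ hx)]
    · rw [prj_of_mem_ne M h hx, prj_of_mem_ne N h (Hom.map_mem f _ _ hx), map_zero]
  · simp
  · intro x y hx hy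
    simp only [map_add, hx, hy]

/-- The image of a homomorphism of bimodules. -/
def image {M : GrBimod 𝒜 ℬ} (f : M ⟶ M) : GrBimod 𝒜 ℬ where
  carrier := LinearMap.range (Hom.toLin f)
  L :=
    { toFun := fun a => (M.L a).restrict (by
        rintro _ ⟨x, rfl⟩
        exact ⟨M.L a x, Hom.map_L f a x⟩)
      map_one' := by ext; simp
      map_mul' := fun a b => by ext; simp
      map_zero' := by ext; simp
      map_add' := fun a b => by ext; simp
      commutes' := fun c => by ext x; simp }
  R :=
    { toFun := fun b => (M.R b).restrict (by
        rintro _ ⟨x, rfl⟩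
        exact ⟨M.R b x, Hom.map_R f b x⟩)
      map_one' := by ext; simp
      map_mul' := fun a b => by ext; simp
      map_zero' := by ext; simp
      map_add' := fun a b => by ext; simp
      commutes' := fun c => LinearMap.ext fun x => Subtype.ext (by
        change M.R (algebraMap F Bᵐᵒᵖ c) x.1 = c • x.1
        rw [AlgHom.commutes]; rfl) }
  comm a b x := Subtype.ext (M.comm a b x.1)
  gr n := (M.gr n).comap (LinearMap.range (Hom.toLin f)).subtype
  internal := by
    have hp : ∀ n : ℤ, ∀ x ∈ LinearMap.range (Hom.toLin f),
        M.prj n x ∈ LinearMap.range (Hom.toLin f) := by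
      rintro n _ ⟨x, rfl⟩
      exact ⟨M.prj n x, (prj_hom f n x).symm⟩
    refine isInternal_of_proj (fun n => (M.prj n).restrict (hp n)) ?_ ?_ ?_
    · exact fun n x hx => Subtype.ext (prj_of_mem M hx)
    · exact fun n m hnm x hx => Subtype.ext (prj_of_mem_ne M hnm.symm hx)
    · rw [eq_top_iff]
      rintro ⟨_, y, rfl⟩ -
      refine homogeneous_induction M.internal (P := fun y => (⟨Hom.toLin f y, y, rfl⟩ :
        LinearMap.range (Hom.toLin f)) ∈ ⨆ n, (M.gr n).comap
          (LinearMap.range (Hom.toLin f)).subtype) ?_ ?_ ?_ y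
      · exact fun n y hy => Submodule.mem_iSup_of_mem n (Hom.map_mem f n y hy)
      · have : (⟨Hom.toLin f 0, 0, rfl⟩ : LinearMap.range (Hom.toLin f)) = 0 :=
          Subtype.ext (map_zero _)
        rw [this]; exact zero_mem _
      · intro x y hx hy
        have : (⟨Hom.toLin f (x + y), x + y, rfl⟩ : LinearMap.range (Hom.toLin f)) =
          ⟨Hom.toLin f x, x, rfl⟩ + ⟨Hom.toLin f y, y, rfl⟩ := Subtype.ext (map_add _ x y)
        rw [this]; exact add_mem hx hy
  L_mem {_ _ _ x} ha hx := M.L_mem (x := x.1) ha hx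
  R_mem {_ _ _ x} hb hx := M.R_mem (x := x.1) hb hx

/-- The inclusion of the image. -/
def incl {M : GrBimod 𝒜 ℬ} (f : M ⟶ M) : image f ⟶ M where
  toLin := (LinearMap.range (Hom.toLin f)).subtype
  map_L _ _ := rfl
  map_R _ _ := rfl
  map_mem _ _ h := h

/-- The map onto the image. -/
def proj {M : GrBimod 𝒜 ℬ} (f : M ⟶ M) : M ⟶ image f where
  toLin := (Hom.toLin f).rangeRestrict
  map_L a x := Subtype.ext (Hom.map_L f a x)
  map_R b x := Subtype.ext (Hom.map_R f b x)
  map_mem n x hx := Hom.map_mem f n x hx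

theorem proj_incl {M : GrBimod 𝒜 ℬ} (f : M ⟶ M) : proj f ≫ incl f = f := rfl

theorem incl_proj {M : GrBimod 𝒜 ℬ} {f : M ⟶ M} (hf : f ≫ f = f) :
    incl f ≫ proj f = 𝟙 (image f) := by
  refine hom_ext_apply ?_
  rintro ⟨_, y, rfl⟩
  exact Subtype.ext (LinearMap.congr_fun (congrArg Hom.toLin hf) y)

theorem proj_incl_assoc {M P : GrBimod 𝒜 ℬ} (f : M ⟶ M) (g : M ⟶ P) :
    proj f ≫ incl f ≫ g = f ≫ g := rfl

theorem incl_comp {M : GrBimod 𝒜 ℬ} {f : M ⟶ M} (hf : f ≫ f = f) : incl f ≫ f = incl f := by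
  have h := Category.id_comp (incl f)
  rwa [← incl_proj hf, Category.assoc, proj_incl] at h

theorem comp_proj {M : GrBimod 𝒜 ℬ} {f : M ⟶ M} (hf : f ≫ f = f) : f ≫ proj f = proj f := by
  have h := Category.comp_id (proj f)
  rwa [← incl_proj hf, ← Category.assoc, proj_incl] at h

/-- The subcomplex cut out by idempotent endomorphisms `π n` of the terms of a complex, if their
images are stable under the differential. -/
def imageComplex (C : ChainComplex (GrBimod 𝒜 ℬ) ℕ) (π : ∀ n, C.X n ⟶ C.X n)
    (hπ : ∀ n, π n ≫ π n = π n)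
    (hd : ∀ n, π (n + 1) ≫ C.d (n + 1) n ≫ π n = π (n + 1) ≫ C.d (n + 1) n) :
    ChainComplex (GrBimod 𝒜 ℬ) ℕ :=
  ChainComplex.of (fun n => image (π n))
    (fun n => incl (π (n + 1)) ≫ C.d (n + 1) n ≫ proj (π n)) fun n => by
      have h := congrArg (fun f => incl (π (n + 2)) ≫ f ≫ C.d (n + 1) n) (hd (n + 1))
      simp only [Category.assoc, C.d_comp_d, Limits.comp_zero] at h
      rw [← Category.assoc (incl (π (n + 2))), incl_comp (hπ (n + 2))] at h
      simp only [Category.assoc, proj_incl_assoc]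
      have h2 := congrArg (· ≫ proj (π n)) h
      simp only [Category.assoc, Limits.zero_comp] at h2
      exact h2

theorem imageComplex_d (C : ChainComplex (GrBimod 𝒜 ℬ) ℕ) (π : ∀ n, C.X n ⟶ C.X n) (hπ) (hd)
    (n : ℕ) : (imageComplex C π hπ hd).d (n + 1) n =
      incl (π (n + 1)) ≫ C.d (n + 1) n ≫ proj (π n) :=
  ChainComplex.of_d (fun n => image (π n))
    (fun n => incl (π (n + 1)) ≫ C.d (n + 1) n ≫ proj (π n)) n

end Image

end GrBimod

namespace Twist

open GrBimod

section Step

variable {F : Type u} [Field F] {A C : Type u} [Ring A] [Algebra F A] {𝒜 : ℤ → Submodule F A}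
  [GradedAlgebra 𝒜] [Ring C] [Algebra F C] {𝒞 : ℤ → Submodule F C} {r : ℕ} (v : VertexIdem 𝒜 r)
  (i : Fin r)

/-- The criterion `nonempty_homotopyEquiv_tw` for two subcomplexes, given by idempotents `π` and
`π'`, of the same complex, in terms of maps between the terms of the ambient complex. -/
theorem nonempty_homotopyEquiv_image (D : ChainComplex (GrBimod 𝒜 𝒞) ℕ)
    (π π' : ∀ n, D.X n ⟶ D.X n) (hπ : ∀ n, π n ≫ π n = π n) (hπ' : ∀ n, π' n ≫ π' n = π' n)
    (hd : ∀ n, π (n + 1) ≫ D.d (n + 1) n ≫ π n = π (n + 1) ≫ D.d (n + 1) n)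
    (hd' : ∀ n, π' (n + 1) ≫ D.d (n + 1) n ≫ π' n = π' (n + 1) ≫ D.d (n + 1) n)
    (hππ' : ∀ n, π n ≫ π' n = π n)
    (Θ : ∀ n, D.X (n + 1) ⟶ ind v i (D.X n)) (Lam : ∀ n, ind v i (D.X n) ⟶ D.X (n + 1))
    (N : ∀ n, ind v i (D.X n) ⟶ ind v i (D.X (n + 1)))
    (hπΘ : ∀ n, π (n + 1) ≫ Θ n = 0)
    (hev : ∀ n, π' (n + 1) ≫ (π (n + 1) ≫ D.d (n + 1) n + Θ n ≫ ev v i (D.X n)) ≫ π n =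
      π' (n + 1) ≫ D.d (n + 1) n ≫ π n)
    (hdΘ : ∀ n, π' (n + 2) ≫ Θ (n + 1) ≫ indMap v i (π (n + 1) ≫ D.d (n + 1) n ≫ π n) =
      -(π' (n + 2) ≫ D.d (n + 2) (n + 1) ≫ Θ n ≫ indMap v i (π n)))
    (h0 : π 0 = π' 0)
    (hinv : ∀ n, π' (n + 1) ≫ (π (n + 1) + Θ n ≫ indMap v i (π n) ≫ Lam n) ≫ π' (n + 1) =
      π' (n + 1))
    (hΘN : ∀ n, π' (n + 1) ≫ Θ n ≫ indMap v i (π n) ≫ N n ≫ indMap v i (π (n + 1)) = 0)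
    (hΘ0 : ∀ z, ∃ t, Hom.toLin (indMap v i (π 0)) (Hom.toLin (Θ 0) (Hom.toLin (π' 1) t)) =
      Hom.toLin (indMap v i (π 0)) z)
    (G : ∀ n, ℕ → Submodule F (ind v i (D.X (n + 1))).carrier) (k : ℕ)
    (hG0 : ∀ n, G n 0 = ⊥)
    (hGk : ∀ n z, Hom.toLin (indMap v i (π (n + 1))) z ∈ G n k)
    (hGπ : ∀ n l, ∀ z ∈ G n l, Hom.toLin (indMap v i (π (n + 1))) z = z)
    (hNπ : ∀ n l, ∀ z ∈ G n l, Hom.toLin (indMap v i (π (n + 2))) (Hom.toLin (N (n + 1)) z) =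
      Hom.toLin (N (n + 1)) z)
    (hG : ∀ n l, ∀ z ∈ G n (l + 1), ∃ g ∈ G n l, ∃ t,
      z + Hom.toLin (indMap v i (D.d (n + 2) (n + 1))) (Hom.toLin (N (n + 1)) z) +
        Hom.toLin (N n) (Hom.toLin (indMap v i (D.d (n + 1) n)) z) =
      g + Hom.toLin (Θ (n + 1)) (Hom.toLin (π' (n + 2)) t)) :
    Nonempty (HomotopyEquiv (imageComplex D π' hπ' hd')
      (tw v i (imageComplex D π hπ hd))) := by
  have hdY := imageComplex_d D π hπ hd
  have hdY' := imageComplex_d D π' hπ' hd'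
  have e1 : ∀ n, incl (π' n) ≫ π' n = incl (π' n) := fun n => incl_comp (hπ' n)
  have e2 : ∀ n, incl (π n) ≫ π n = incl (π n) := fun n => incl_comp (hπ n)
  have e3 : ∀ n, π n ≫ proj (π n) = proj (π n) := fun n => comp_proj (hπ n)
  have e4 : ∀ n, π' n ≫ proj (π' n) = proj (π' n) := fun n => comp_proj (hπ' n)
  have e5 : ∀ n, incl (π' (n + 1)) ≫ D.d (n + 1) n ≫ π' n = incl (π' (n + 1)) ≫ D.d (n + 1) n :=
    fun n => by rw [← e1, Category.assoc, Category.assoc, hd']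
  have e1' : ∀ n {P : GrBimod 𝒜 𝒞} (f : D.X n ⟶ P),
      incl (π' n) ≫ π' n ≫ f = incl (π' n) ≫ f := fun n P f => by rw [← Category.assoc, e1]
  have e5' : ∀ n {P : GrBimod 𝒜 𝒞} (f : D.X n ⟶ P), incl (π' (n + 1)) ≫ D.d (n + 1) n ≫ π' n ≫ f =
      incl (π' (n + 1)) ≫ D.d (n + 1) n ≫ f := fun n P f => by
    have h := congrArg (· ≫ f) (e5 n)
    simpa only [Category.assoc] using h
  have hmap : ∀ n, indMap v i (proj (π n)) ≫ indMap v i (incl (π n)) = indMap v i (π n) :=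
    fun n => by rw [indMap_comp, proj_incl]
  have hmap3 : ∀ n, indMap v i (π n) ≫ indMap v i (proj (π n)) = indMap v i (proj (π n)) :=
    fun n => by rw [indMap_comp, e3]
  refine nonempty_homotopyEquiv_tw (Y := imageComplex D π hπ hd)
    (Y' := imageComplex D π' hπ' hd') v i
    (fun n => incl (π' n) ≫ proj (π n)) (fun n => incl (π n) ≫ proj (π' n))
    (fun n => incl (π' (n + 1)) ≫ Θ n ≫ indMap v i (proj (π n)))
    (fun n => indMap v i (incl (π n)) ≫ Lam n ≫ proj (π' (n + 1)))
    (fun n => indMap v i (incl (π n)) ≫ N n ≫ indMap v i (proj (π (n + 1))))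
    (fun n => ?_) (fun n => ?_) (fun n => ?_) (fun n => ?_) ?_ (fun n => ?_) (fun n => ?_) ?_
    (fun n l => (G n l).map (Hom.toLin (indMap v i (proj (π (n + 1)))))) k
    (fun n => ?_) (fun n => ?_) (fun n l => ?_)
  · change (incl (π n) ≫ proj (π' n)) ≫ incl (π' n) ≫ proj (π n) = 𝟙 (image (π n))
    rw [Category.assoc, ← Category.assoc (proj (π' n)), proj_incl, ← e2, Category.assoc,
      ← Category.assoc (π n), hππ', e3, incl_proj (hπ n)]
  · change (incl (π (n + 1)) ≫ proj (π' (n + 1))) ≫ incl (π' (n + 1)) ≫ Θ n ≫ _ = 0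
    rw [Category.assoc, ← Category.assoc (proj (π' (n + 1))), proj_incl, ← e2, Category.assoc,
      ← Category.assoc (π (n + 1)), hππ', ← Category.assoc (π (n + 1)), hπΘ, Limits.zero_comp,
      Limits.comp_zero]
  · rw [hdY, hdY']
    change (incl (π' (n + 1)) ≫ proj (π (n + 1))) ≫ incl (π (n + 1)) ≫ D.d (n + 1) n ≫ proj (π n) +
      (incl (π' (n + 1)) ≫ Θ n ≫ indMap v i (proj (π n))) ≫ ev v i (image (π n)) =
      (incl (π' (n + 1)) ≫ D.d (n + 1) n ≫ proj (π' n)) ≫ incl (π' n) ≫ proj (π n)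
    have h := congrArg (fun f => incl (π' (n + 1)) ≫ f ≫ proj (π n)) (hev n)
    simp only [Preadditive.add_comp, Preadditive.comp_add, Category.assoc, e3] at h
    simp only [e1'] at h
    simp only [Category.assoc, ev_naturality]
    rw [proj_incl_assoc, h, proj_incl_assoc, e5']
  · rw [hdY, hdY']
    change (incl (π' (n + 2)) ≫ Θ (n + 1) ≫ indMap v i (proj (π (n + 1)))) ≫
      indMap v i (incl (π (n + 1)) ≫ D.d (n + 1) n ≫ proj (π n)) =
      -((incl (π' (n + 2)) ≫ D.d (n + 2) (n + 1) ≫ proj (π' (n + 1))) ≫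
        incl (π' (n + 1)) ≫ Θ n ≫ indMap v i (proj (π n)))
    have h := congrArg (fun f => incl (π' (n + 2)) ≫ f ≫ indMap v i (proj (π n))) (hdΘ n)
    simp only [Preadditive.neg_comp, Preadditive.comp_neg, Category.assoc, hmap3,
      indMap_comp, e3] at h
    simp only [e1'] at h
    simp only [Category.assoc, indMap_comp]
    rw [proj_incl_assoc, h, proj_incl_assoc, e5']
  · change (incl (π' 0) ≫ proj (π 0)) ≫ incl (π 0) ≫ proj (π' 0) = 𝟙 (image (π' 0))
    rw [Category.assoc, ← Category.assoc (proj (π 0)), proj_incl, h0, e4, incl_proj (hπ' 0)]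
  · change (incl (π' (n + 1)) ≫ proj (π (n + 1))) ≫ incl (π (n + 1)) ≫ proj (π' (n + 1)) +
      (incl (π' (n + 1)) ≫ Θ n ≫ indMap v i (proj (π n))) ≫ indMap v i (incl (π n)) ≫ Lam n ≫
        proj (π' (n + 1)) = 𝟙 (image (π' (n + 1)))
    have h := congrArg (fun f => incl (π' (n + 1)) ≫ f ≫ proj (π' (n + 1))) (hinv n)
    simp only [Preadditive.add_comp, Preadditive.comp_add, Category.assoc, e4] at h
    simp only [e1'] at h
    simp only [Category.assoc]
    rw [← Category.assoc (proj (π (n + 1))), proj_incl,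
      ← Category.assoc (indMap v i (proj (π n))), hmap, h, incl_proj (hπ' (n + 1))]
  · change (incl (π' (n + 1)) ≫ Θ n ≫ indMap v i (proj (π n))) ≫ indMap v i (incl (π n)) ≫ N n ≫
      indMap v i (proj (π (n + 1))) = 0
    have h := congrArg (fun f => incl (π' (n + 1)) ≫ f ≫ indMap v i (proj (π (n + 1)))) (hΘN n)
    simp only [Category.assoc, hmap3, Limits.zero_comp, Limits.comp_zero] at h
    simp only [e1'] at h
    simp only [Category.assoc]
    rw [← Category.assoc (indMap v i (proj (π n))), hmap, h]
  · intro (z : (ind v i (image (π 0))).carrier)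
    obtain ⟨t, ht⟩ := hΘ0 (Hom.toLin (indMap v i (incl (π 0))) z)
    refine ⟨Hom.toLin (proj (π' 1)) t, ?_⟩
    have h1 := congrArg (Hom.toLin (indMap v i (proj (π 0)))) ht
    have e6 : indMap v i (incl (π 0)) ≫ indMap v i (π 0) ≫ indMap v i (proj (π 0)) = 𝟙 _ := by
      rw [hmap3, indMap_comp, incl_proj (hπ 0)]
      exact tensorMap_id _ _
    have e7 : Hom.toLin (indMap v i (incl (π 0)) ≫ indMap v i (π 0) ≫ indMap v i (proj (π 0))) z =
        z := by rw [e6]; rfl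
    refine Eq.trans ?_ (h1.trans e7)
    exact (LinearMap.congr_fun (congrArg Hom.toLin (hmap3 0)) _).symm
  · rw [hG0, Submodule.map_bot]
    exact bot_le
  · refine eq_top_iff.2 fun (z : (ind v i (image (π (n + 1)))).carrier) _ => ?_
    refine Submodule.mem_sup_left ?_
    refine ⟨_, hGk n (Hom.toLin (indMap v i (incl (π (n + 1)))) z), ?_⟩
    have e6 : indMap v i (incl (π (n + 1))) ≫ indMap v i (π (n + 1)) ≫
        indMap v i (proj (π (n + 1))) = 𝟙 _ := by
      rw [hmap3, indMap_comp, incl_proj (hπ (n + 1))]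
      exact tensorMap_id _ _
    exact LinearMap.congr_fun (congrArg Hom.toLin e6) z
  · rintro _ ⟨z, hz, rfl⟩
    obtain ⟨g, hg, t, hgt⟩ := hG n l z hz
    rw [hdY, hdY]
    -- all intermediate elements are fixed by the idempotent
    have e8 : Hom.toLin (indMap v i (incl (π (n + 1))))
        (Hom.toLin (indMap v i (proj (π (n + 1)))) z) =
        z := (LinearMap.congr_fun (congrArg Hom.toLin (hmap (n + 1))) z).trans (hGπ n (l + 1) z hz)
    have e9 : Hom.toLin (indMap v i (incl (π (n + 1)) ≫ D.d (n + 1) n ≫ proj (π n)))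
        (Hom.toLin (indMap v i (proj (π (n + 1)))) z) =
        Hom.toLin (indMap v i (proj (π n))) (Hom.toLin (indMap v i (D.d (n + 1) n)) z) := by
      rw [← indMap_comp, ← indMap_comp, GrBimod.comp_apply, GrBimod.comp_apply, e8]
    have e10 : Hom.toLin (indMap v i (π n)) (Hom.toLin (indMap v i (D.d (n + 1) n)) z) =
        Hom.toLin (indMap v i (D.d (n + 1) n)) z := by
      conv_lhs => rw [← hGπ n (l + 1) z hz]
      conv_rhs => rw [← hGπ n (l + 1) z hz]
      simp only [← GrBimod.comp_apply, indMap_comp, Category.assoc, hd]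
    have e11 : Hom.toLin (indMap v i (incl (π n))) (Hom.toLin (indMap v i (proj (π n)))
        (Hom.toLin (indMap v i (D.d (n + 1) n)) z)) = Hom.toLin (indMap v i (D.d (n + 1) n)) z :=
      (LinearMap.congr_fun (congrArg Hom.toLin (hmap n)) _).trans e10
    have e12 : Hom.toLin (indMap v i (incl (π (n + 2)))) (Hom.toLin (indMap v i (proj (π (n + 2))))
        (Hom.toLin (N (n + 1)) z)) = Hom.toLin (N (n + 1)) z :=
      (LinearMap.congr_fun (congrArg Hom.toLin (hmap (n + 2))) _).trans (hNπ n (l + 1) z hz)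
    have e13 : Hom.toLin (indMap v i (incl (π (n + 2)) ≫ D.d (n + 2) (n + 1) ≫ proj (π (n + 1))))
        (Hom.toLin (indMap v i (proj (π (n + 2)))) (Hom.toLin (N (n + 1)) z)) =
        Hom.toLin (indMap v i (proj (π (n + 1))))
          (Hom.toLin (indMap v i (D.d (n + 2) (n + 1))) (Hom.toLin (N (n + 1)) z)) := by
      rw [← indMap_comp, ← indMap_comp, GrBimod.comp_apply, GrBimod.comp_apply, e12]
    have h1 := congrArg (Hom.toLin (indMap v i (proj (π (n + 1))))) hgt
    rw [map_add, map_add, map_add] at h1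
    refine Submodule.mem_sup.2 ⟨_, Submodule.mem_map_of_mem hg, _,
      ⟨Hom.toLin (proj (π' (n + 2))) t, rfl⟩, h1.symm.trans ?_⟩
    refine congrArg₂ (· + ·) (congrArg₂ (· + ·) rfl ?_) ?_
    · refine e13.symm.trans ?_
      exact congrArg (fun w => Hom.toLin (indMap v i (incl (π (n + 2)) ≫ D.d (n + 2) (n + 1) ≫
        proj (π (n + 1)))) (Hom.toLin (indMap v i (proj (π (n + 2)))) (Hom.toLin (N (n + 1)) w)))
        e8.symm
    · refine Eq.trans (congrArg (fun w => Hom.toLin (indMap v i (proj (π (n + 1))))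
        (Hom.toLin (N n) w)) e11.symm) ?_
      exact congrArg (fun w => Hom.toLin (indMap v i (proj (π (n + 1))))
        (Hom.toLin (N n) (Hom.toLin (indMap v i (incl (π n))) w))) e9.symm

end Step

end Twist

/-! ### Elements of `A e_i ⊗ e_i M` -/

namespace Twist

open GrBimod

section Elements

variable {F : Type u} [Field F] {A C : Type u} [Ring A] [Algebra F A] {𝒜 : ℤ → Submodule F A}
  [GradedAlgebra 𝒜] [Ring C] [Algebra F C] {𝒞 : ℤ → Submodule F C} {r : ℕ} (v : VertexIdem 𝒜 r)
  (i : Fin r)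

/-- The map `A → A e_i`, `a ↦ a e_i`. -/
def toLeft : A →ₗ[F] (leftIdeal 𝒜 (v.e i) (v.mem i)).carrier :=
  (LinearMap.mulRight F (v.e i)).rangeRestrict

/-- The map `A → e_i A`, `b ↦ e_i b`. -/
def toRight : A →ₗ[F] (rightIdeal 𝒜 (v.e i) (v.mem i)).carrier :=
  (LinearMap.mulLeft F (v.e i)).rangeRestrict

theorem e_mul_e : v.e i * v.e i = v.e i := (v.complete.idem i).eq

/-- The element `a e_i ⊗ e_i m` of `A e_i ⊗ e_i M`. -/
def brk (M : GrBimod 𝒜 𝒞) : A →ₗ[F] M.carrier →ₗ[F] (ind v i M).carrier :=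
  ((tmul3 (leftIdeal 𝒜 (v.e i) (v.mem i)) (rightIdeal 𝒜 (v.e i) (v.mem i)) M).flip
    (toRight v i 1)) ∘ₗ toLeft v i

variable {v i}

theorem tmul3_eq_brk (M : GrBimod 𝒜 𝒞) (a b : A) (m : M.carrier) :
    tmul3 (leftIdeal 𝒜 (v.e i) (v.mem i)) (rightIdeal 𝒜 (v.e i) (v.mem i)) M (toLeft v i a)
      (toRight v i b) m = brk v i M a (M.L b m) := by
  have h : (rightIdeal 𝒜 (v.e i) (v.mem i)).R (MulOpposite.op b) (toRight v i 1) =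
      toRight v i b := Subtype.ext (by
    change v.e i * 1 * b = v.e i * b
    rw [mul_one])
  rw [← h]
  exact tmul3_right _ _ M (toLeft v i a) b (toRight v i 1) m

@[elab_as_elim]
theorem ind_induction (M : GrBimod 𝒜 𝒞) {p : (ind v i M).carrier → Prop}
    (mk : ∀ a m, p (brk v i M a m)) (zero : p 0) (add : ∀ x y, p x → p y → p (x + y))
    (z : (ind v i M).carrier) : p z := by
  refine tensor3_induction (M := leftIdeal 𝒜 (v.e i) (v.mem i))
    (N := rightIdeal 𝒜 (v.e i) (v.mem i)) (P := M) (p := p) ?_ zero add z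
  rintro ⟨_, a, rfl⟩ ⟨_, b, rfl⟩ m
  have h := tmul3_eq_brk (v := v) (i := i) M a b m
  exact (congrArg p h).mpr (mk _ _)

theorem brk_mul_e (M : GrBimod 𝒜 𝒞) (a : A) (m : M.carrier) :
    brk v i M (a * v.e i) m = brk v i M a m := by
  have h : toLeft v i (a * v.e i) = toLeft v i a := Subtype.ext (by
    change a * v.e i * v.e i = a * v.e i
    rw [mul_assoc, e_mul_e])
  exact congrArg (fun y => tmul3 (leftIdeal 𝒜 (v.e i) (v.mem i))
    (rightIdeal 𝒜 (v.e i) (v.mem i)) M y (toRight v i 1) m) h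

theorem brk_L_e (M : GrBimod 𝒜 𝒞) (a : A) (m : M.carrier) :
    brk v i M a (M.L (v.e i) m) = brk v i M a m := by
  have h : toRight v i (v.e i) = toRight v i 1 := Subtype.ext (by
    change v.e i * v.e i = v.e i * 1
    rw [mul_one, e_mul_e])
  rw [← tmul3_eq_brk, h]; rfl

theorem brk_L (M : GrBimod 𝒜 𝒞) (c a : A) (m : M.carrier) :
    (ind v i M).L c (brk v i M a m) = brk v i M (c * a) m := by
  refine (tmul3_L _ _ M c (toLeft v i a) (toRight v i 1) m).trans ?_
  have h : (leftIdeal 𝒜 (v.e i) (v.mem i)).L c (toLeft v i a) = toLeft v i (c * a) :=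
    Subtype.ext (mul_assoc _ _ _).symm
  rw [h]; rfl

theorem brk_R (M : GrBimod 𝒜 𝒞) (c : Cᵐᵒᵖ) (a : A) (m : M.carrier) :
    (ind v i M).R c (brk v i M a m) = brk v i M a (M.R c m) :=
  tmul3_R _ _ M c (toLeft v i a) (toRight v i 1) m

theorem brk_mem (M : GrBimod 𝒜 𝒞) {k l : ℤ} {a : A} {m : M.carrier} (ha : a ∈ 𝒜 k)
    (hm : m ∈ M.gr l) : brk v i M a m ∈ (ind v i M).gr (k + l) := by
  have h1 : toLeft v i a ∈ (leftIdeal 𝒜 (v.e i) (v.mem i)).gr k := by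
    have := gmul_mem ha (v.mem i)
    rwa [add_zero] at this
  have h2 : toRight v i (1 : A) ∈ (rightIdeal 𝒜 (v.e i) (v.mem i)).gr 0 := by
    have := gmul_mem (v.mem i) (SetLike.GradedOne.one_mem (A := 𝒜))
    rwa [add_zero] at this
  have h := tmul3_mem _ _ M h1 h2 hm
  rw [add_zero] at h
  exact h

theorem indMap_brk {M N : GrBimod 𝒜 𝒞} (f : M ⟶ N) (a : A) (m : M.carrier) :
    Hom.toLin (indMap v i f) (brk v i M a m) = brk v i N a (Hom.toLin f m) :=
  tensorMap_tmul (𝟙 (projBimod 𝒜 (v.e i) (v.mem i))) f _ m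

theorem ev_brk (M : GrBimod 𝒜 𝒞) (a : A) (m : M.carrier) :
    Hom.toLin (ev v i M) (brk v i M a m) = M.L (a * v.e i) m := by
  have h1 : Hom.toLin (tensorMap (evalMap 𝒜 (v.e i) (v.mem i)) (𝟙 M)) (brk v i M a m) =
      rtmul M (a * v.e i) m := by
    refine (tensorMap_tmul (evalMap 𝒜 (v.e i) (v.mem i)) (𝟙 M) _ m).trans ?_
    refine congrArg (fun y => rtmul M y m) ?_
    refine (homOfTensor_tmul (M := leftIdeal 𝒜 (v.e i) (v.mem i))
      (N := rightIdeal 𝒜 (v.e i) (v.mem i)) (P := regular 𝒜) _ _ _ _ _ (toLeft v i a)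
      (toRight v i 1)).trans ?_
    change a * v.e i * (v.e i * 1) = a * v.e i
    rw [mul_one, mul_assoc, e_mul_e]
  refine (congrArg (Hom.toLin (unitL M)) h1).trans ?_
  exact unitL_rtmul M _ m

theorem ind_hom_ext {M : GrBimod 𝒜 𝒞} {N : GrBimod 𝒜 𝒞} {f g : ind v i M ⟶ N}
    (h : ∀ a m, Hom.toLin f (brk v i M a m) = Hom.toLin g (brk v i M a m)) : f = g :=
  hom_ext_apply fun z => ind_induction M (p := fun z => Hom.toLin f z = Hom.toLin g z) h
    (by simp) (fun x y hx hy => by simp [hx, hy]) z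

/-- The trilinear map `(p, q, m) ↦ p κ (q m)` on `A e_i × e_i A × M`. -/
def indLiftTri {M N : GrBimod 𝒜 𝒞} (κ : M.carrier →ₗ[F] N.carrier) :
    (leftIdeal 𝒜 (v.e i) (v.mem i)).carrier →ₗ[F] (rightIdeal 𝒜 (v.e i) (v.mem i)).carrier →ₗ[F]
      M.carrier →ₗ[F] N.carrier :=
  show LinearMap.range (LinearMap.mulRight F (v.e i)) →ₗ[F]
      LinearMap.range (LinearMap.mulLeft F (v.e i)) →ₗ[F] M.carrier →ₗ[F] N.carrier from
    LinearMap.mk₂ F (fun p q => N.L p.1 ∘ₗ κ ∘ₗ M.L q.1)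
      (fun _ _ _ => by ext; simp) (fun _ _ _ => by ext; simp)
      (fun _ _ _ => by ext; simp) (fun _ _ _ => by ext; simp)

/-- The homomorphism `A e_i ⊗ e_i M → N`, `a e_i ⊗ e_i m ↦ a e_i κ (e_i m)` associated to a right
linear map `κ : M → N`. -/
def indLift {M N : GrBimod 𝒜 𝒞} (κ : M.carrier →ₗ[F] N.carrier)
    (hR : ∀ c m, κ (M.R c m) = N.R c (κ m)) (hmem : ∀ n, ∀ m ∈ M.gr n, κ m ∈ N.gr n) :
    ind v i M ⟶ N :=
  homOfTensor3 (M := leftIdeal 𝒜 (v.e i) (v.mem i)) (N := rightIdeal 𝒜 (v.e i) (v.mem i)) (P := M)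
    (indLiftTri κ)
    (fun p s q m => by
      have h1 := LinearMap.congr_fun₂ ((indLiftTri (v := v) (i := i) κ).map_smul s p) q m
      have h2 := LinearMap.congr_fun ((indLiftTri (v := v) (i := i) κ p).map_smul s q) m
      exact h1.trans h2.symm)
    (fun p b q m => congrArg (fun y => N.L (Subtype.val p) (κ y))
      (L_mul M (Subtype.val q) b m))
    (fun c p q m => L_mul N c (Subtype.val p) _)
    (fun c p q m => by
      have h1 : M.L (Subtype.val q) (M.R c m) = M.R c (M.L (Subtype.val q) m) := M.comm _ _ _
      refine (congrArg (fun y => N.L (Subtype.val p) (κ y)) h1).trans ?_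
      refine (congrArg (N.L (Subtype.val p)) (hR c _)).trans ?_
      exact N.comm _ _ _)
    (fun j k l p hp q hq m hm => by
      have h1 : M.L (Subtype.val q) m ∈ M.gr (k + l) := M.L_mem hq hm
      rw [add_assoc]
      exact N.L_mem hp (hmem _ _ h1))

theorem indLift_brk {M N : GrBimod 𝒜 𝒞} (κ : M.carrier →ₗ[F] N.carrier) (hR) (hmem) (a : A)
    (m : M.carrier) : Hom.toLin (indLift (v := v) (i := i) κ hR hmem) (brk v i M a m) =
      N.L (a * v.e i) (κ (M.L (v.e i) m)) := by
  refine (homOfTensor3_tmul (M := leftIdeal 𝒜 (v.e i) (v.mem i))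
    (N := rightIdeal 𝒜 (v.e i) (v.mem i)) (P := M) (indLiftTri κ) _ _ _ _ _ (toLeft v i a)
      (toRight v i 1) m).trans ?_
  refine congrArg (fun y => N.L (a * v.e i) (κ (M.L y m))) ?_
  exact mul_one (v.e i)

end Elements

end Twist

/-! ### The cone of the augmentation -/

namespace Zigzag

open GrBimod

section Vertices

variable {F : Type u} [Field F] {L : Type u} [Ring L] [Algebra F L] {𝒜 : ℕ → Submodule F L}
  [GradedAlgebra 𝒜] {r : ℕ} (v : VertexIdem (zgr 𝒜) r) (d : ℕ)

theorem vertices_e (i : Fin r) : (vertices v d).e i = sA v d (Pi.single i 1) := by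
  rw [← vertices_hom_eq, VertexIdem.hom_single]

/-- The indicator function of the first `s` vertices. -/
def initS (F : Type u) [Field F] (r s : ℕ) : Fin r → F := fun k => if (k : ℕ) < s then 1 else 0

theorem initS_mul_self (s : ℕ) : initS F r s * initS F r s = initS F r s := by
  ext k; simp [initS]

theorem initS_mul_succ (s : ℕ) : initS F r s * initS F r (s + 1) = initS F r s := by
  ext k
  simp only [initS, Pi.mul_apply]
  split_ifs with h1 h2
  · simp
  · omega
  · simp
  · simp

theorem initS_succ (i : Fin r) : initS F r (i + 1) = initS F r i + Pi.single i 1 := by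
  ext k
  simp only [initS, Pi.add_apply, Pi.single_apply, Fin.ext_iff]
  split_ifs with h1 h2 h3 <;> first | omega | simp

theorem initS_mul_single (i : Fin r) : initS F r i * Pi.single i 1 = 0 := by
  rw [mul_single_eq]; simp [initS]

theorem single_mul_initS (i : Fin r) : Pi.single i 1 * initS F r i = 0 := by
  rw [mul_comm, initS_mul_single]

theorem single_mul_initS_succ (i : Fin r) :
    Pi.single i 1 * initS F r (i + 1) = (Pi.single i 1 : Fin r → F) := by
  rw [mul_comm, mul_single_eq]; simp [initS]

theorem single_mul_single (i : Fin r) :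
    Pi.single i 1 * Pi.single i 1 = (Pi.single i 1 : Fin r → F) := by
  rw [mul_single_eq]; simp

variable {v}

theorem ofS_mul_mul_ofS_eq_zero {s t : Fin r → F} (a : QDual v)
    (h : ∀ k l, s k ≠ 0 → t l ≠ 0 →
      QDual.ofS v (Pi.single k 1) * a * QDual.ofS v (Pi.single l 1) = 0) :
    QDual.ofS v s * a * QDual.ofS v t = 0 := by
  have e : ∀ u : Fin r → F, QDual.ofS v u = ∑ k, u k • QDual.ofS v (Pi.single k 1) := fun u => by
    rw [← mul_one u, ← sum_single_one, Finset.mul_sum, map_sum]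
    simp only [mul_single_eq, map_smul]
    simp [Finset.sum_apply, Pi.single_apply]
  rw [e s, e t, Finset.sum_mul, Finset.sum_mul]
  refine Finset.sum_eq_zero fun k _ => ?_
  rw [Finset.mul_sum]
  refine Finset.sum_eq_zero fun l _ => ?_
  rw [smul_mul_assoc, smul_mul_assoc, mul_smul_comm]
  by_cases hs : s k = 0
  · rw [hs, zero_smul]
  by_cases ht : t l = 0
  · rw [ht, zero_smul, smul_zero]
  rw [h k l hs ht, smul_zero, smul_zero]

theorem ofS_gen_ofS (hv : v.IsAcyclic) {s t u : Fin r → F} (hu : u + t = 1)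
    (h : ∀ k l, s k ≠ 0 → t l ≠ 0 → k ≤ l)    (f : VDual (zgr 𝒜)) :
    QDual.ofS v s * QDual.gen v f * QDual.ofS v u = QDual.ofS v s * QDual.gen v f := by
  have h0 : QDual.ofS v s * QDual.gen v f * QDual.ofS v t = 0 :=
    ofS_mul_mul_ofS_eq_zero _ fun k l hk hl => hv.ofS_mul_gen_mul_ofS (h k l hk hl) f
  conv_rhs => rw [← mul_one (QDual.ofS v s * QDual.gen v f), ← map_one (QDual.ofS v), ← hu,
    map_add, mul_add, h0, add_zero]

theorem initS_gen_initS (hv : v.IsAcyclic) (s : ℕ) (f : VDual (zgr 𝒜)) :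
    QDual.ofS v (initS F r s) * QDual.gen v f * QDual.ofS v (initS F r s) =
      QDual.ofS v (initS F r s) * QDual.gen v f := by
  refine ofS_gen_ofS hv (t := 1 - initS F r s) (by simp) (fun k l hk hl => ?_) f
  simp only [initS, Pi.sub_apply, Pi.one_apply] at hk hl
  split_ifs at hk hl with h1 h2 <;>
    first | (rw [Fin.le_def]; omega) | exact absurd rfl hk | exact absurd (sub_self (1 : F)) hl

theorem single_gen_initS (hv : v.IsAcyclic) (i : Fin r) (f : VDual (zgr 𝒜)) :
    QDual.ofS v (Pi.single i 1) * QDual.gen v f * QDual.ofS v (initS F r i) =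
      QDual.ofS v (Pi.single i 1) * QDual.gen v f := by
  refine ofS_gen_ofS hv (t := 1 - initS F r i) (by simp) (fun k l hk hl => ?_) f
  obtain rfl : k = i := by
    by_contra hne
    exact hk (Pi.single_eq_of_ne hne 1)
  simp only [initS, Pi.sub_apply, Pi.one_apply] at hl
  split_ifs at hl with h
  · exact absurd (sub_self (1 : F)) hl
  · rw [Fin.le_def]; omega

theorem initS_gen_single (hv : v.IsAcyclic) (i : Fin r) (f : VDual (zgr 𝒜)) :
    QDual.ofS v (initS F r (i + 1)) * QDual.gen v f * QDual.ofS v (Pi.single i 1) = 0 := by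
  refine ofS_mul_mul_ofS_eq_zero _ fun k l hk hl => hv.ofS_mul_gen_mul_ofS ?_ f
  obtain rfl : l = i := by
    by_contra hne
    exact hl (Pi.single_eq_of_ne hne 1)
  simp only [initS] at hk
  split_ifs at hk with h
  · rw [Fin.le_def]; omega
  · exact absurd rfl hk

/-- There are no paths in `Λ^!` from an earlier vertex to a later one. -/
theorem initS_mul_single_eq_zero (hv : v.IsAcyclic) (i : Fin r) (a : QDual v) :
    QDual.ofS v (initS F r i) * a * QDual.ofS v (Pi.single i 1) = 0 := by
  refine homogeneous_induction (DirectSum.Decomposition.isInternal (QDual.gr v)) (fun n a ha => ?_)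
    (by simp) (fun x y hx hy => by rw [mul_add, add_mul, hx, hy, add_zero]) a
  rcases n with j | j
  · refine ofS_mul_mul_ofS_eq_zero _ fun k l hk hl => hv.ofS_mul_mul_ofS j ?_ ha
    obtain rfl : l = i := by
      by_contra hne
      exact hl (Pi.single_eq_of_ne hne 1)
    simp only [initS] at hk
    split_ifs at hk with h
    · omega
    · exact absurd rfl hk
  · rw [(Submodule.mem_bot F).1 ha, mul_zero, zero_mul]

theorem zeta_pow_ofS (s : Fin r → F) :
    (zeta (QDual.gr v) ^ d) (QDual.ofS v s) = QDual.ofS v s := by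
  induction d with
  | zero => rfl
  | succ d ih =>
    rw [pow_succ, AlgHom.mul_apply]
    have h : zeta (QDual.gr v) (QDual.ofS v s) = QDual.ofS v s := by
      refine (zetaLin_of_mem (QDual.gr v) (QFunctor.ofS_mem' v s)).trans ?_
      simp
    rw [h, ih]

/-- As there are no paths from an earlier vertex to a later one, the part `e_i A f` of the zigzag
algebra, with `f` the sum of the idempotents before `e_i`, is contained in `Λ^!`. -/
theorem single_mul_initS_eq_inl (hv : v.IsAcyclic) (i : Fin r) (a : Zigzag v d) :
    sA v d (Pi.single i 1) * a * sA v d (initS F r i) =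
      ι v d (QDual.ofS v (Pi.single i 1) * pr v d a * QDual.ofS v (initS F r i)) := by
  refine Triv.ext ?_ ?_
  · rw [Triv.fst_mul, Triv.fst_mul, sA_apply, sA_apply, Triv.fst_inl, Triv.fst_inl, Triv.fst_inl]
  · refine TwDual.ext fun x => ?_
    simp only [Triv.snd_mul, sA_apply, Triv.fst_inl, Triv.snd_inl, smul_zero, zero_add, add_zero,
      Triv.fst_mul]
    rw [TwDual.op_smul_val, TwDual.smul_val, zeta_pow_ofS, MulOpposite.unop_op,
      initS_mul_single_eq_zero hv, map_zero]
    rfl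

end Vertices

section Cone

variable {F : Type u} [Field F] {L : Type u} [Ring L] [Algebra F L] {𝒜 : ℕ → Submodule F L}
  [GradedAlgebra 𝒜] {r : ℕ} (v : VertexIdem (zgr 𝒜) r) (d : ℕ)
  [hfin : ∀ n, FiniteDimensional F (𝒜 n)]

/-- The element `a ⊗ x ⊗ b` of the term of degree `n + 1` of the cone. -/
def qel (n : ℕ) : Zigzag v d →ₗ[F] Module.Dual F (𝒜 n) →ₗ[F] Zigzag v d →ₗ[F]
    ((coneAug v d).X (n + 1)).carrier := qtri v d n

/-- The part `∑ a γ^* ⊗ x (- γ) ⊗ b` of the differential of the cone, up to sign. In degree `1`,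
this is the augmentation. -/
def dL : ∀ n, (coneAug v d).X (n + 1) ⟶ (coneAug v d).X n
  | 0 => show qx v d 0 ⟶ regular (gr v d) from aug v d
  | n + 1 => show qx v d (n + 1) ⟶ qx v d n from -qdL v d n

/-- The part `∑ a ⊗ x (γ -) ⊗ γ^* b` of the differential of the cone, up to sign. -/
def dR : ∀ n, (coneAug v d).X (n + 1) ⟶ (coneAug v d).X n
  | 0 => 0
  | n + 1 => show qx v d (n + 1) ⟶ qx v d n from (-1 : ℤ) ^ n • qdR v d n

theorem cone_d (n : ℕ) : (coneAug v d).d (n + 1) n = dL v d n + dR v d n := by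
  have h := ChainComplex.of_d (coneX (QComplex (vertices v d) (inflated v d)) (regular (gr v d)))
    (coneD (QComplex (vertices v d) (inflated v d)) (regular (gr v d)) (aug v d)) n
  refine Eq.trans h ?_
  rcases n with _ | n
  · exact (add_zero (dL v d 0)).symm
  · have h2 : (QComplex (vertices v d) (inflated v d)).d (n + 1) n =
        (show qx v d (n + 1) ⟶ qx v d n from qdL v d n + (-1 : ℤ) ^ (n + 1) • qdR v d n) :=
      ChainComplex.of_d (QFunctor.QX (vertices v d) (inflated v d))
        (QFunctor.d (vertices v d) (inflated v d)) n
    refine (congrArg Neg.neg h2).trans ?_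
    change -(qdL v d n + (-1 : ℤ) ^ (n + 1) • qdR v d n) = -qdL v d n + (-1 : ℤ) ^ n • qdR v d n
    rw [neg_add, pow_succ, mul_neg_one, neg_smul, neg_neg]

theorem dR_zero : dR v d 0 = 0 := rfl

theorem dL_zero_qel (a : Zigzag v d) (x : Module.Dual F (𝒜 0)) (b : Zigzag v d) :
    Hom.toLin (dL v d 0) (qel v d 0 a x b) =
      (∑ k, x (eN v k) • (a * sA v d (Pi.single k 1) * b) : Zigzag v d) := aug_qtri v d a x b

theorem dR_dR (n : ℕ) : dR v d (n + 1) ≫ dR v d n = 0 := by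
  rcases n with _ | n
  · exact Limits.comp_zero
  · have h : qdR v d (n + 1) ≫ qdR v d n = 0 :=
      QFunctor.dRight_dRight (vertices v d) (inflated v d) n
    change ((-1 : ℤ) ^ (n + 1) • qdR v d (n + 1)) ≫ ((-1 : ℤ) ^ n • qdR v d n) = 0
    rw [Preadditive.zsmul_comp, Preadditive.comp_zsmul, h, smul_zero, smul_zero]

theorem dL_d (n : ℕ) :
    dL v d (n + 1) ≫ (coneAug v d).d (n + 1) n = -(dR v d (n + 1) ≫ dL v d n) := by
  have h := (coneAug v d).d_comp_d (n + 2) (n + 1) n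
  rw [cone_d v d (n + 1), cone_d v d n, Preadditive.add_comp,
    Preadditive.comp_add _ _ _ (dR v d (n + 1)), dR_dR, add_zero] at h
  rw [cone_d v d n]
  exact eq_neg_of_add_eq_zero_left h

/-- Right multiplication of the left factors by an element of `S` on the terms of positive degree
of the cone, and the identity in degree `0`. -/
def mS (s : Fin r → F) : ∀ n, (coneAug v d).X n ⟶ (coneAug v d).X n
  | 0 => 𝟙 _
  | n + 1 => show qx v d n ⟶ qx v d n from qmulS v d n s

@[elab_as_elim]
theorem qel_induction {n : ℕ} {p : ((coneAug v d).X (n + 1)).carrier → Prop}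
    (mk : ∀ a x b, p (qel v d n a x b)) (zero : p 0) (add : ∀ x y, p x → p y → p (x + y))
    (t : ((coneAug v d).X (n + 1)).carrier) : p t :=
  qx_induction v d n (p := p) mk zero add t

theorem qel_hom_ext {n : ℕ} {P : GrBimod (gr v d) (gr v d)} {f g : (coneAug v d).X (n + 1) ⟶ P}
    (h : ∀ a x b, Hom.toLin f (qel v d n a x b) = Hom.toLin g (qel v d n a x b)) : f = g :=
  qx_hom_ext v d n h

theorem qel_L {n : ℕ} (c a : Zigzag v d) (x : Module.Dual F (𝒜 n)) (b : Zigzag v d) :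
    ((coneAug v d).X (n + 1)).L c (qel v d n a x b) = qel v d n (c * a) x b := qtri_L v d n c a x b

theorem qel_R {n : ℕ} (c : (Zigzag v d)ᵐᵒᵖ) (a : Zigzag v d) (x : Module.Dual F (𝒜 n))
    (b : Zigzag v d) : ((coneAug v d).X (n + 1)).R c (qel v d n a x b) =
      qel v d n a x (b * c.unop) := qtri_R v d n c a x b

theorem qel_mem (n : ℕ) {i j : ℤ} {a b : Zigzag v d} (x : Module.Dual F (𝒜 n))
    (ha : a ∈ gr v d i) (hb : b ∈ gr v d j) :
    qel v d n a x b ∈ ((coneAug v d).X (n + 1)).gr (i + n + j) := qtri_mem v d n x ha hb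

theorem qel_left (n : ℕ) (a : Zigzag v d) (s : Fin r → F) (x : Module.Dual F (𝒜 n))
    (b : Zigzag v d) : qel v d n (a * sA v d s) x b = qel v d n a (x ∘ₗ rS v n s) b :=
  qtri_left v d n a s x b

theorem qel_right (n : ℕ) (a : Zigzag v d) (s : Fin r → F) (x : Module.Dual F (𝒜 n))
    (b : Zigzag v d) : qel v d n a (x ∘ₗ lS v n s) b = qel v d n a x (sA v d s * b) :=
  qtri_right v d n a s x b

theorem mS_qel (n : ℕ) (s : Fin r → F) (a : Zigzag v d) (x : Module.Dual F (𝒜 n))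
    (b : Zigzag v d) : Hom.toLin (mS v d s (n + 1)) (qel v d n a x b) =
      qel v d n (a * sA v d s) x b := qmulS_qtri v d n s a x b

theorem dL_qel (n : ℕ) (a : Zigzag v d) (x : Module.Dual F (𝒜 (n + 1))) (b : Zigzag v d) :
    Hom.toLin (dL v d (n + 1)) (qel v d (n + 1) a x b) =
      -∑ γ, qel v d n (a * zgen v d γ) (x ∘ₗ rmul n (basisV (zgr 𝒜) γ)) b :=
  congrArg Neg.neg (qdL_qtri v d n a x b)

theorem zsmul_toLin {B B' : Type u} [Ring B] [Algebra F B] [Ring B'] [Algebra F B']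
    {ℬ : ℤ → Submodule F B} {ℬ' : ℤ → Submodule F B'} {M N : GrBimod ℬ ℬ'} (k : ℤ) (f : M ⟶ N)
    (x : M.carrier) : Hom.toLin (k • f) x = k • Hom.toLin f x := by
  let φ : (M ⟶ N) →+ N.carrier :=
    { toFun := fun f => Hom.toLin f x
      map_zero' := rfl
      map_add' := fun _ _ => rfl }
  exact map_zsmul φ k f

theorem dR_qel (n : ℕ) (a : Zigzag v d) (x : Module.Dual F (𝒜 (n + 1))) (b : Zigzag v d) :
    Hom.toLin (dR v d (n + 1)) (qel v d (n + 1) a x b) =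
      (-1 : ℤ) ^ n • ∑ γ, qel v d n a (x ∘ₗ lmul n (basisV (zgr 𝒜) γ)) (zgen v d γ * b) :=
  (zsmul_toLin ((-1 : ℤ) ^ n) (qdR v d n) _).trans
    (congrArg (fun t => (-1 : ℤ) ^ n • t) (qdR_qtri v d n a x b))

theorem mS_comp (n : ℕ) (s t : Fin r → F) : mS v d s n ≫ mS v d t n = mS v d (s * t) n := by
  rcases n with _ | n
  · exact Category.comp_id (𝟙 ((coneAug v d).X 0))
  · refine qel_hom_ext v d fun a x b => ?_
    rw [GrBimod.comp_apply, mS_qel, mS_qel, mS_qel, mul_assoc, ← map_mul (sA v d)]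

theorem mS_add (n : ℕ) (s t : Fin r → F) :
    mS v d (s + t) (n + 1) = mS v d s (n + 1) + mS v d t (n + 1) := by
  refine qel_hom_ext v d fun a x b => ?_
  rw [mS_qel, map_add, mul_add, map_add]
  exact congrArg₂ (· + ·) (mS_qel v d n s a x b).symm (mS_qel v d n t a x b).symm

theorem mS_zero (n : ℕ) : mS v d (0 : Fin r → F) (n + 1) = 0 := by
  refine qel_hom_ext v d fun a x b => ?_
  rw [mS_qel, map_zero, mul_zero, map_zero]; rfl

theorem mS_one (n : ℕ) : mS v d (1 : Fin r → F) n = 𝟙 _ := by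
  rcases n with _ | n
  · rfl
  · refine qel_hom_ext v d fun a x b => ?_
    rw [mS_qel, map_one, mul_one]; rfl

theorem dR_mS (n : ℕ) (s : Fin r → F) :
    dR v d (n + 1) ≫ mS v d s (n + 1) = mS v d s (n + 2) ≫ dR v d (n + 1) := by
  refine qel_hom_ext v d fun a x b => ?_
  rw [GrBimod.comp_apply, GrBimod.comp_apply, mS_qel, dR_qel, dR_qel, map_zsmul, map_sum]
  simp only [mS_qel]

theorem zgen_eq (γ : Fin (Module.finrank F (zgr 𝒜 1))) :
    ∃ f, zgen v d γ = ι v d (QDual.gen v f) := ⟨_, rfl⟩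

variable {v}

theorem mul_zgen_initS (hv : v.IsAcyclic) (s : ℕ) (a : Zigzag v d)
    (γ : Fin (Module.finrank F (zgr 𝒜 1))) :
    a * sA v d (initS F r s) * zgen v d γ * sA v d (initS F r s) =
      a * sA v d (initS F r s) * zgen v d γ := by
  obtain ⟨f, hf⟩ := zgen_eq v d γ
  have h : sA v d (initS F r s) * zgen v d γ * sA v d (initS F r s) =
      sA v d (initS F r s) * zgen v d γ := by
    rw [hf, sA_apply, ← map_mul, ← map_mul, initS_gen_initS hv]
  rw [mul_assoc a, mul_assoc a, h]

theorem mul_single_zgen (hv : v.IsAcyclic) (i : Fin r) (a : Zigzag v d)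
    (γ : Fin (Module.finrank F (zgr 𝒜 1))) :
    a * sA v d (Pi.single i 1) * zgen v d γ * sA v d (initS F r i) =
      a * sA v d (Pi.single i 1) * zgen v d γ := by
  obtain ⟨f, hf⟩ := zgen_eq v d γ
  have h : sA v d (Pi.single i 1) * zgen v d γ * sA v d (initS F r i) =
      sA v d (Pi.single i 1) * zgen v d γ := by
    rw [hf, sA_apply, sA_apply, ← map_mul, ← map_mul, single_gen_initS hv]
  rw [mul_assoc a, mul_assoc a, h]

theorem initS_zgen_single (hv : v.IsAcyclic) (i : Fin r) (a : Zigzag v d)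
    (γ : Fin (Module.finrank F (zgr 𝒜 1))) :
    a * sA v d (initS F r (i + 1)) * zgen v d γ * sA v d (Pi.single i 1) = 0 := by
  obtain ⟨f, hf⟩ := zgen_eq v d γ
  have h : sA v d (initS F r (i + 1)) * zgen v d γ * sA v d (Pi.single i 1) = 0 := by
    rw [hf, sA_apply, sA_apply, ← map_mul, ← map_mul, initS_gen_single hv, map_zero]
  rw [mul_assoc a, mul_assoc a, h, mul_zero]

theorem mS_initS_dL (hv : v.IsAcyclic) (n s : ℕ) :
    mS v d (initS F r s) (n + 1) ≫ dL v d n ≫ mS v d (initS F r s) n =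
      mS v d (initS F r s) (n + 1) ≫ dL v d n := by
  rcases n with _ | n
  · exact congrArg (mS v d (initS F r s) 1 ≫ ·) (Category.comp_id (dL v d 0))
  · refine qel_hom_ext v d fun a x b => ?_
    rw [GrBimod.comp_apply, GrBimod.comp_apply, GrBimod.comp_apply, mS_qel, dL_qel, map_neg,
      map_sum]
    simp only [mS_qel, mul_zgen_initS d hv]

theorem mS_single_dL (hv : v.IsAcyclic) (n : ℕ) (i : Fin r) :
    mS v d (Pi.single i 1) (n + 1) ≫ dL v d n ≫ mS v d (initS F r i) n =
      mS v d (Pi.single i 1) (n + 1) ≫ dL v d n := by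
  rcases n with _ | n
  · exact congrArg (mS v d (Pi.single i 1) 1 ≫ ·) (Category.comp_id (dL v d 0))
  · refine qel_hom_ext v d fun a x b => ?_
    rw [GrBimod.comp_apply, GrBimod.comp_apply, GrBimod.comp_apply, mS_qel, dL_qel, map_neg,
      map_sum]
    simp only [mS_qel, mul_single_zgen d hv]

/-- The idempotents given by the first `s` vertices cut out subcomplexes of the cone. -/
theorem mS_initS_d (hv : v.IsAcyclic) (n s : ℕ) :
    mS v d (initS F r s) (n + 1) ≫ (coneAug v d).d (n + 1) n ≫ mS v d (initS F r s) n =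
      mS v d (initS F r s) (n + 1) ≫ (coneAug v d).d (n + 1) n := by
  rw [cone_d, Preadditive.add_comp, Preadditive.comp_add, Preadditive.comp_add, mS_initS_dL d hv]
  congr 1
  rcases n with _ | n
  · exact congrArg (mS v d (initS F r s) 1 ≫ ·) Limits.zero_comp
  · rw [dR_mS, ← Category.assoc, mS_comp, initS_mul_self]

end Cone

end Zigzag

/-! ### The maps relating two consecutive subcomplexes of the cone -/

namespace KoszulContraction

open Zigzag

variable {F : Type u} [Field F] {L : Type u} [Ring L] [Algebra F L] {𝒜 : ℕ → Submodule F L}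
  [GradedAlgebra 𝒜] [FiniteDimensional F (𝒜 1)] {r : ℕ} {v : VertexIdem (zgr 𝒜) r}

variable (κ : KoszulContraction v)

/-- The contracting homotopy on maps with values in degree `1`, extended by zero. -/
def opOne (n : ℕ) : (𝒜 n →ₗ[F] QDual v) →ₗ[F] (𝒜 (n + 1) →ₗ[F] QDual v) :=
  κ.h n 0 ∘ₗ degHom v n 1

theorem opOne_precS (n : ℕ) (s : Fin r → F) (φ : 𝒜 n →ₗ[F] QDual v) :
    κ.opOne n (HigherZigzag.precS v n s φ) = HigherZigzag.precS v (n + 1) s (κ.opOne n φ) := by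
  rw [opOne, LinearMap.comp_apply, degHom_precS, κ.precS]; rfl

theorem opOne_of_mem {n : ℕ} {φ : 𝒜 n →ₗ[F] QDual v} (hφ : φ ∈ homS v n 1) :
    κ.opOne n φ = κ.h n 0 φ := by
  rw [opOne, LinearMap.comp_apply, degHom_of_mem v hφ]

theorem opOne_of_mem_ne {n j : ℕ} (hj : j ≠ 1) {φ : 𝒜 n →ₗ[F] QDual v} (hφ : φ ∈ homS v n j) :
    κ.opOne n φ = 0 := by
  rw [opOne, LinearMap.comp_apply, degHom_of_mem_ne v hj hφ, map_zero]

theorem opOne_mem (n j : ℕ) (φ) (hφ : φ ∈ homS v n (j + 1)) : κ.opOne n φ ∈ homS v (n + 1) j := by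
  rcases j with _ | j
  · rw [opOne_of_mem κ hφ]
    exact κ.mem n 0 φ hφ
  · rw [opOne_of_mem_ne κ (by omega) hφ]
    exact zero_mem _

/-- The contracting homotopy on maps with values in degrees at least `2`, extended by zero. -/
def opTwo (n : ℕ) : (𝒜 n →ₗ[F] QDual v) →ₗ[F] (𝒜 (n + 1) →ₗ[F] QDual v) :=
  ∑ p ∈ Finset.range r, κ.h n (p + 1) ∘ₗ degHom v n (p + 2)

theorem opTwo_apply (n : ℕ) (φ : 𝒜 n →ₗ[F] QDual v) :
    κ.opTwo n φ = ∑ p ∈ Finset.range r, κ.h n (p + 1) (degHom v n (p + 2) φ) := by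
  rw [opTwo, LinearMap.sum_apply]; rfl

theorem opTwo_precS (n : ℕ) (s : Fin r → F) (φ : 𝒜 n →ₗ[F] QDual v) :
    κ.opTwo n (HigherZigzag.precS v n s φ) = HigherZigzag.precS v (n + 1) s (κ.opTwo n φ) := by
  rw [opTwo_apply, opTwo_apply, map_sum]
  exact Finset.sum_congr rfl fun p _ => by rw [degHom_precS, κ.precS]

theorem opTwo_of_lt {n j : ℕ} (hj : j < 2) {φ : 𝒜 n →ₗ[F] QDual v} (hφ : φ ∈ homS v n j) :
    κ.opTwo n φ = 0 := by
  rw [opTwo_apply]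
  exact Finset.sum_eq_zero fun p _ => by rw [degHom_of_mem_ne v (by omega) hφ, map_zero]

theorem opTwo_of_mem (hv : v.IsAcyclic) {n j : ℕ} {φ : 𝒜 n →ₗ[F] QDual v}
    (hφ : φ ∈ homS v n (j + 2)) : κ.opTwo n φ = κ.h n (j + 1) φ := by
  by_cases hj : j < r
  · rw [opTwo_apply, Finset.sum_eq_single j, degHom_of_mem v hφ]
    · exact fun p _ hp => by rw [degHom_of_mem_ne v (by omega) hφ, map_zero]
    · exact fun h => absurd (Finset.mem_range.2 hj) h
  · have h0 : φ = 0 := LinearMap.ext fun m => hv.eq_zero_of_mem (by omega) (hφ.2 m)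
    rw [h0, map_zero, map_zero]

theorem opTwo_mem (hv : v.IsAcyclic) (n j : ℕ) (φ) (hφ : φ ∈ homS v n (j + 1)) :
    κ.opTwo n φ ∈ homS v (n + 1) j := by
  rcases j with _ | j
  · rw [opTwo_of_lt κ (by omega) hφ]
    exact zero_mem _
  · rw [opTwo_of_mem κ hv hφ]
    exact κ.mem n (j + 1) φ hφ

end KoszulContraction

namespace Zigzag

open GrBimod Twist

section TriComp

variable {F : Type u} [Field F] {A X M I : Type u} [AddCommGroup A] [Module F A] [AddCommGroup X]
  [Module F X] [AddCommGroup M] [Module F M] [AddCommGroup I] [Module F I]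

/-- The trilinear map `(a, x, b) ↦ B (a, T (x, b))`. -/
def triComp {A' : Type u} [AddCommGroup A'] [Module F A'] (B : A →ₗ[F] M →ₗ[F] I)
    (T : X →ₗ[F] A' →ₗ[F] M) : A →ₗ[F] X →ₗ[F] A' →ₗ[F] I :=
  LinearMap.mk₂ F (fun a x => B a ∘ₗ T x)
    (fun _ _ _ => by ext; simp) (fun _ _ _ => by ext; simp)
    (fun _ _ _ => by ext; simp) (fun _ _ _ => by ext; simp)

end TriComp

section Maps

variable {F : Type u} [Field F] {L : Type u} [Ring L] [Algebra F L] {𝒜 : ℕ → Submodule F L}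
  [GradedAlgebra 𝒜] {r : ℕ} (v : VertexIdem (zgr 𝒜) r) (d : ℕ)
  [hfin : ∀ n, FiniteDimensional F (𝒜 n)] (i : Fin r)

theorem single_mul_sA (s : Fin r → F) :
    sA v d (Pi.single i 1) * sA v d s = s i • sA v d (Pi.single i 1) := by
  rw [← map_mul, mul_comm, mul_single_eq, map_smul]

theorem sA_mul_single (s : Fin r → F) :
    sA v d s * sA v d (Pi.single i 1) = s i • sA v d (Pi.single i 1) := by
  rw [← map_mul, mul_single_eq, map_smul]

theorem brk_mul_single {n : ℕ} (a : Zigzag v d) (m : ((coneAug v d).X n).carrier) :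
    brk (vertices v d) i ((coneAug v d).X n) (a * sA v d (Pi.single i 1)) m =
      brk (vertices v d) i ((coneAug v d).X n) a m := by
  rw [← vertices_e, brk_mul_e]

theorem brk_L_single {n : ℕ} (a : Zigzag v d) (m : ((coneAug v d).X n).carrier) :
    brk (vertices v d) i ((coneAug v d).X n) a (((coneAug v d).X n).L (sA v d (Pi.single i 1)) m) =
      brk (vertices v d) i ((coneAug v d).X n) a m := by
  rw [← vertices_e, brk_L_e]

/-- The trilinear map defining `theta`. -/
def thetaTri (n : ℕ) : Zigzag v d →ₗ[F] Module.Dual F (𝒜 n) →ₗ[F] Zigzag v d →ₗ[F]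
    (ind (vertices v d) i ((coneAug v d).X n)).carrier :=
  triComp (brk (vertices v d) i ((coneAug v d).X n))
    ((qel v d n (sA v d (Pi.single i 1))).compr₂ (Hom.toLin (dL v d n)))

theorem brk_mul_sA {n : ℕ} (a : Zigzag v d) (s : Fin r → F) (m : ((coneAug v d).X n).carrier) :
    brk (vertices v d) i ((coneAug v d).X n) (a * sA v d s) m =
      s i • brk (vertices v d) i ((coneAug v d).X n) a m := by
  have h : a * sA v d s * sA v d (Pi.single i 1) = s i • (a * sA v d (Pi.single i 1)) := by
    rw [mul_assoc, sA_mul_single, mul_smul_comm]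
  rw [← brk_mul_single, h, ← brk_mul_single v d i a]
  exact LinearMap.map_smul₂ _ _ _ _

theorem qel_single_rS (n : ℕ) (s : Fin r → F) (x : Module.Dual F (𝒜 n)) (b : Zigzag v d) :
    qel v d n (sA v d (Pi.single i 1)) (x ∘ₗ rS v n s) b =
      s i • qel v d n (sA v d (Pi.single i 1)) x b := by
  rw [← qel_left, single_mul_sA, LinearMap.map_smul₂]
  rfl

/-- The map `a ⊗ x ⊗ b ↦ a e_i ⊗ ∂ (e_i ⊗ x ⊗ b)` from a term of the cone to the next term, tensored
with `A e_i ⊗ e_i A`, where `∂` is the left part of the differential. -/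
def theta (n : ℕ) : (coneAug v d).X (n + 1) ⟶ ind (vertices v d) i ((coneAug v d).X n) :=
  qhom v d n (P := ind (vertices v d) i ((coneAug v d).X n)) (thetaTri v d i n)
    (fun a s x b => (brk_mul_sA v d i a s _).trans
      ((map_smul (brk (vertices v d) i ((coneAug v d).X n) a) _ _).symm.trans
        (congrArg (brk (vertices v d) i ((coneAug v d).X n) a)
          ((map_smul (Hom.toLin (dL v d n)) _ _).symm.trans
            (congrArg (Hom.toLin (dL v d n)) (qel_single_rS v d i n s x b).symm)))))
    (fun a s x b => congrArg (fun y => brk (vertices v d) i ((coneAug v d).X n) a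
      (Hom.toLin (dL v d n) y)) (qel_right v d n _ s x b))
    (fun c a x b => (brk_L ((coneAug v d).X n) c a _).symm)
    (fun c a x b => by
      refine Eq.trans ?_ (brk_R ((coneAug v d).X n) c a _).symm
      refine congrArg (brk (vertices v d) i ((coneAug v d).X n) a) ?_
      exact (congrArg (Hom.toLin (dL v d n)) (qel_R v d c _ x b).symm).trans
        (Hom.map_R (dL v d n) c _))
    (fun k l a ha x b hb => by
      have h := brk_mem (v := vertices v d) (i := i) ((coneAug v d).X n) ha
        (Hom.map_mem (dL v d n) _ _ (qel_mem v d n x (sA_mem v d (Pi.single i 1)) hb))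
      rw [zero_add, ← add_assoc] at h
      exact h)

theorem theta_qel (n : ℕ) (a : Zigzag v d) (x : Module.Dual F (𝒜 n)) (b : Zigzag v d) :
    Hom.toLin (theta v d i n) (qel v d n a x b) = brk (vertices v d) i ((coneAug v d).X n) a
      (Hom.toLin (dL v d n) (qel v d n (sA v d (Pi.single i 1)) x b)) :=
  qhom_qtri v d n (P := ind (vertices v d) i ((coneAug v d).X n)) _ _ _ _ _ _ a x b

/-- The image of a map `Λ_n → Λ^!` in the term of degree `n + 1` of the cone. -/
def tel (n : ℕ) : (𝒜 n →ₗ[F] QDual v) →ₗ[F] Zigzag v d →ₗ[F] ((coneAug v d).X (n + 1)).carrier :=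
  tau v d n

theorem qel_ι (n : ℕ) (c : QDual v) (x : Module.Dual F (𝒜 n)) (b : Zigzag v d) :
    qel v d n (ι v d c) x b = tel v d n (avgS v n (x.smulRight c)) b :=
  (tau_smulRight v d n x c b).symm.trans (tau_avgS v d n _ b).symm

theorem tel_lmulS (n : ℕ) (s : Fin r → F) (φ : 𝒜 n →ₗ[F] QDual v) (b : Zigzag v d) :
    ((coneAug v d).X (n + 1)).L (sA v d s) (tel v d n φ b) = tel v d n (lmulS v n s φ) b :=
  (tau_lmulS v d n s φ b).symm

theorem dL_tel (n : ℕ) (φ : 𝒜 (n + 1) →ₗ[F] QDual v) (b : Zigzag v d) :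
    Hom.toLin (dL v d (n + 1)) (tel v d (n + 1) φ b) = -tel v d n (dK v n φ) b :=
  congrArg Neg.neg (qdL_tau v d n φ b)

theorem dR_tel (n : ℕ) (φ : 𝒜 (n + 1) →ₗ[F] QDual v) (b : Zigzag v d) :
    Hom.toLin (dR v d (n + 1)) (tel v d (n + 1) φ b) = (-1 : ℤ) ^ n • ∑ γ, tel v d n
      (φ ∘ₗ lmul n (basisV (zgr 𝒜) γ)) (zgen v d γ * b) :=
  (zsmul_toLin ((-1 : ℤ) ^ n) (qdR v d n) _).trans
    (congrArg (fun t => (-1 : ℤ) ^ n • t) (qdR_tau v d n φ b))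

variable {v d} in
/-- The right linear map between terms of the cone of consecutive positive degrees which is induced
by an operator on maps from `Λ` to `Λ^!`. -/
def extE {n : ℕ} (K : (𝒜 n →ₗ[F] QDual v) →ₗ[F] (𝒜 (n + 1) →ₗ[F] QDual v))
    (hK : ∀ s φ, K (precS v n s φ) = precS v (n + 1) s (K φ)) :
    ((coneAug v d).X (n + 1)).carrier →ₗ[F] ((coneAug v d).X (n + 2)).carrier := qext v d K hK

variable {v d} in
theorem extE_tel {n : ℕ} (K : (𝒜 n →ₗ[F] QDual v) →ₗ[F] (𝒜 (n + 1) →ₗ[F] QDual v))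
    (hK : ∀ s φ, K (precS v n s φ) = precS v (n + 1) s (K φ)) {j : ℕ} {φ : 𝒜 n →ₗ[F] QDual v}
    (hφ : φ ∈ homS v n j) (b : Zigzag v d) :
    extE K hK (tel v d n φ b) = tel v d (n + 1) (K φ) b :=
  (qext_tau v d K hK φ b).trans (by rw [avgS_of_mem v hφ]; rfl)

variable {v d} in
theorem extE_R {n : ℕ} (K : (𝒜 n →ₗ[F] QDual v) →ₗ[F] (𝒜 (n + 1) →ₗ[F] QDual v)) (hK)
    (c : (Zigzag v d)ᵐᵒᵖ) (t : ((coneAug v d).X (n + 1)).carrier) :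
    extE K hK (((coneAug v d).X (n + 1)).R c t) = ((coneAug v d).X (n + 2)).R c (extE K hK t) :=
  qext_R v d K hK c t

variable {v d} in
theorem extE_mem {n : ℕ} (K : (𝒜 n →ₗ[F] QDual v) →ₗ[F] (𝒜 (n + 1) →ₗ[F] QDual v)) (hK)
    (h0 : ∀ φ ∈ homS v n 0, K φ = 0) (h1 : ∀ j, ∀ φ ∈ homS v n (j + 1), K φ ∈ homS v (n + 1) j)
    (N : ℤ) (t : ((coneAug v d).X (n + 1)).carrier) (ht : t ∈ ((coneAug v d).X (n + 1)).gr N) :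
    extE K hK t ∈ ((coneAug v d).X (n + 2)).gr N :=
  qext_mem v d K hK h0 h1 ht

end Maps

end Zigzag

/-! ### Relations between the structure maps -/

namespace Zigzag

open GrBimod Twist

section ZSMul

variable {F : Type u} [Field F] {M N I : Type u} [AddCommGroup M] [Module F M] [AddCommGroup N]
  [Module F N] [AddCommGroup I] [Module F I]

theorem map_zsmul_sum {ι : Type} [Fintype ι] (f : M →ₗ[F] N) (k : ℤ) (y : ι → M) :
    f (k • ∑ j, y j) = k • ∑ j, f (y j) := by
  rw [map_zsmul, map_sum]

theorem map_map_zsmul_sum {ι : Type} [Fintype ι] (f : M →ₗ[F] N) (g : N →ₗ[F] I) (k : ℤ)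
    (y : ι → M) : g (f (k • ∑ j, y j)) = k • ∑ j, g (f (y j)) :=
  map_zsmul_sum (g ∘ₗ f) k y

end ZSMul

section Steps

variable {F : Type u} [Field F] {L : Type u} [Ring L] [Algebra F L] {𝒜 : ℕ → Submodule F L}
  [GradedAlgebra 𝒜] {r : ℕ} (v : VertexIdem (zgr 𝒜) r) (d : ℕ)
  [hfin : ∀ n, FiniteDimensional F (𝒜 n)] (i : Fin r)

-- The terms of the cone unfold to large tensor products, which unification must not explore.
attribute [local irreducible] brk indMap ev theta qel dL dR mS tel extE

theorem brk_initS {n : ℕ} (a : Zigzag v d) (m : ((coneAug v d).X n).carrier) :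
    brk (vertices v d) i ((coneAug v d).X n) (a * sA v d (initS F r i)) m = 0 := by
  rw [brk_mul_sA, initS, if_neg (lt_irrefl _), zero_smul]

theorem mS_theta (n : ℕ) : mS v d (initS F r i) (n + 1) ≫ theta v d i n = 0 := by
  refine qel_hom_ext v d fun a x b => ?_
  rw [GrBimod.comp_apply, mS_qel, theta_qel, brk_initS]
  rfl

theorem theta_ev (n : ℕ) : theta v d i n ≫ ev (vertices v d) i ((coneAug v d).X n) =
    mS v d (Pi.single i 1) (n + 1) ≫ dL v d n := by
  refine qel_hom_ext v d fun a x b => ?_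
  have h : a * (vertices v d).e i * sA v d (Pi.single i 1) = a * sA v d (Pi.single i 1) := by
    rw [vertices_e, mul_assoc, ← map_mul (sA v d), single_mul_single]
  rw [GrBimod.comp_apply, GrBimod.comp_apply, mS_qel, theta_qel, ev_brk, ← Hom.map_L, qel_L, h]

theorem mS_succ (n : ℕ) : mS v d (initS F r (i + 1)) (n + 1) =
    mS v d (initS F r i) (n + 1) + mS v d (Pi.single i 1) (n + 1) := by
  rw [initS_succ, mS_add]

theorem mS_single_dR_mS (n : ℕ) : mS v d (Pi.single i 1) (n + 1) ≫ dR v d n ≫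
    mS v d (initS F r i) n = 0 := by
  rcases n with _ | n
  · have h : dR v d 0 = 0 := dR_zero v d
    rw [h, Limits.zero_comp, Limits.comp_zero]
  · rw [dR_mS, ← Category.assoc, mS_comp, single_mul_initS, mS_zero, Limits.zero_comp]

/-- The map from the subcomplex of the first `i + 1` vertices to the twist of the subcomplex of the
first `i` vertices is compatible with the differentials. -/
theorem theta_chain (n : ℕ) : mS v d (initS F r (i + 1)) (n + 1) ≫
    (mS v d (initS F r i) (n + 1) ≫ (coneAug v d).d (n + 1) n +
      theta v d i n ≫ ev (vertices v d) i ((coneAug v d).X n)) ≫ mS v d (initS F r i) n =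
    mS v d (initS F r (i + 1)) (n + 1) ≫ (coneAug v d).d (n + 1) n ≫ mS v d (initS F r i) n := by
  have h1 : mS v d (initS F r (i + 1)) (n + 1) ≫ mS v d (initS F r i) (n + 1) =
      mS v d (initS F r i) (n + 1) := by rw [mS_comp, mul_comm, initS_mul_succ]
  have h2 : mS v d (initS F r (i + 1)) (n + 1) ≫ mS v d (Pi.single i 1) (n + 1) =
      mS v d (Pi.single i 1) (n + 1) := by rw [mS_comp, mul_comm, single_mul_initS_succ]
  rw [theta_ev, Preadditive.add_comp, Preadditive.comp_add, Category.assoc, Category.assoc,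
    ← Category.assoc, h1, ← Category.assoc (mS v d (initS F r (i + 1)) (n + 1)), h2, mS_succ,
    Preadditive.add_comp]
  congr 1
  rw [cone_d, Preadditive.add_comp, Preadditive.comp_add, mS_single_dR_mS, add_zero]

variable {v}

theorem indMap_brk_dL (hv : v.IsAcyclic) (n : ℕ) (a : Zigzag v d) (x : Module.Dual F (𝒜 n))
    (b : Zigzag v d) : Hom.toLin (indMap (vertices v d) i (mS v d (initS F r i) n))
      (brk (vertices v d) i ((coneAug v d).X n) a
        (Hom.toLin (dL v d n) (qel v d n (sA v d (Pi.single i 1)) x b))) =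
      brk (vertices v d) i ((coneAug v d).X n) a
        (Hom.toLin (dL v d n) (qel v d n (sA v d (Pi.single i 1)) x b)) := by
  have h := LinearMap.congr_fun (congrArg Hom.toLin (mS_single_dL d hv n i)) (qel v d n 1 x b)
  rw [GrBimod.comp_apply, GrBimod.comp_apply, GrBimod.comp_apply, mS_qel, one_mul] at h
  rw [indMap_brk, h]

theorem theta_indMap (hv : v.IsAcyclic) (n : ℕ) :
    theta v d i n ≫ indMap (vertices v d) i (mS v d (initS F r i) n) = theta v d i n := by
  refine qel_hom_ext v d fun a x b => ?_
  rw [GrBimod.comp_apply, theta_qel, indMap_brk_dL d i hv]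

theorem mS_dL_theta (hv : v.IsAcyclic) (n : ℕ) :
    mS v d (initS F r (i + 1)) (n + 2) ≫ dL v d (n + 1) ≫ theta v d i n = 0 := by
  refine qel_hom_ext v d fun a x b => ?_
  rw [GrBimod.comp_apply, GrBimod.comp_apply, mS_qel, dL_qel, map_neg, map_sum]
  refine neg_eq_zero.2 (Finset.sum_eq_zero fun γ _ => ?_)
  rw [theta_qel, ← brk_mul_single, initS_zgen_single d hv, LinearMap.map_zero₂]

theorem theta_indMap_dL_d (n : ℕ) :
    theta v d i (n + 1) ≫ indMap (vertices v d) i ((coneAug v d).d (n + 1) n) =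
      -(dR v d (n + 1) ≫ theta v d i n) := by
  refine qel_hom_ext v d fun a x b => ?_
  have h1 : Hom.toLin ((coneAug v d).d (n + 1) n) (Hom.toLin (dL v d (n + 1))
      (qel v d (n + 1) (sA v d (Pi.single i 1)) x b)) = -Hom.toLin (dL v d n)
        (Hom.toLin (dR v d (n + 1)) (qel v d (n + 1) (sA v d (Pi.single i 1)) x b)) :=
    LinearMap.congr_fun (congrArg Hom.toLin (dL_d v d n))
      (qel v d (n + 1) (sA v d (Pi.single i 1)) x b)
  have h2 : ∀ c, Hom.toLin (theta v d i n) (Hom.toLin (dR v d (n + 1)) (qel v d (n + 1) c x b)) =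
      brk (vertices v d) i ((coneAug v d).X n) c (Hom.toLin (dL v d n)
        (Hom.toLin (dR v d (n + 1)) (qel v d (n + 1) (sA v d (Pi.single i 1)) x b))) := fun c => by
    rw [dR_qel, dR_qel]
    refine (map_zsmul_sum (Hom.toLin (theta v d i n)) _ _).trans ?_
    refine Eq.trans ?_ (map_map_zsmul_sum (Hom.toLin (dL v d n))
      (brk (vertices v d) i ((coneAug v d).X n) c) _ _).symm
    exact congrArg (fun t => (-1 : ℤ) ^ n • t)
      (Finset.sum_congr rfl fun γ _ => theta_qel v d i n c _ _)
  rw [GrBimod.comp_apply, theta_qel, indMap_brk, h1]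
  exact (map_neg (brk (vertices v d) i ((coneAug v d).X n) a) _).trans
    (congrArg Neg.neg (h2 a).symm)

theorem theta_d (hv : v.IsAcyclic) (n : ℕ) : mS v d (initS F r (i + 1)) (n + 2) ≫
    theta v d i (n + 1) ≫ indMap (vertices v d) i (mS v d (initS F r i) (n + 1) ≫
      (coneAug v d).d (n + 1) n ≫ mS v d (initS F r i) n) =
    -(mS v d (initS F r (i + 1)) (n + 2) ≫ (coneAug v d).d (n + 2) (n + 1) ≫ theta v d i n ≫
      indMap (vertices v d) i (mS v d (initS F r i) n)) := by
  rw [mS_initS_d d hv, theta_indMap d i hv, ← indMap_comp, ← Category.assoc (theta v d i (n + 1)),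
    theta_indMap d i hv, theta_indMap_dL_d, cone_d v d (n + 1), Preadditive.add_comp,
    Preadditive.comp_add, mS_dL_theta d i hv, zero_add, Preadditive.comp_neg]

variable (κ : KoszulContraction v) (x₀ : Module.Dual F (𝒜 0))

/-- The map `m ↦ e_i ⊗ x₀ ⊗ m`. -/
def lamZero : ((coneAug v d).X 0).carrier →ₗ[F] ((coneAug v d).X 1).carrier :=
  show Zigzag v d →ₗ[F] ((coneAug v d).X 1).carrier from qel v d 0 (sA v d (Pi.single i 1)) x₀

theorem lamZero_R (c : (Zigzag v d)ᵐᵒᵖ) (m : ((coneAug v d).X 0).carrier) :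
    lamZero d i x₀ (((coneAug v d).X 0).R c m) = ((coneAug v d).X 1).R c (lamZero d i x₀ m) :=
  (qel_R v d c _ x₀ m).symm

theorem lamZero_mem (n : ℤ) (m : ((coneAug v d).X 0).carrier)
    (hm : m ∈ ((coneAug v d).X 0).gr n) : lamZero d i x₀ m ∈ ((coneAug v d).X 1).gr n := by
  have h := qel_mem v d 0 x₀ (sA_mem v d (Pi.single i 1)) (j := n) hm
  have e : 0 + ((0 : ℕ) : ℤ) + n = n := by simp
  exact e ▸ h

theorem neg_extE_R (n : ℕ) (c : (Zigzag v d)ᵐᵒᵖ) (m : ((coneAug v d).X (n + 1)).carrier) :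
    (-extE (d := d) (κ.opOne n) (κ.opOne_precS n)) (((coneAug v d).X (n + 1)).R c m) =
      ((coneAug v d).X (n + 2)).R c ((-extE (κ.opOne n) (κ.opOne_precS n)) m) :=
  (congrArg Neg.neg (extE_R (κ.opOne n) (κ.opOne_precS n) c m)).trans
    (map_neg (((coneAug v d).X (n + 2)).R c) _).symm

theorem neg_extE_mem (n : ℕ) (N : ℤ) (m : ((coneAug v d).X (n + 1)).carrier)
    (hm : m ∈ ((coneAug v d).X (n + 1)).gr N) :
    (-extE (κ.opOne n) (κ.opOne_precS n)) m ∈ ((coneAug v d).X (n + 2)).gr N :=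
  neg_mem (extE_mem (κ.opOne n) (κ.opOne_precS n)
    (fun φ hφ => κ.opOne_of_mem_ne (by omega) hφ) (κ.opOne_mem n) N m hm)

/-- The maps which split the maps `theta` on the subcomplexes: these are induced by the inverse of
the left differential on `e_i ⊗ Λ_n^* ⊗ A`, where `x₀` is the coordinate of the vertex `i`. -/
def lam : ∀ n, ind (vertices v d) i ((coneAug v d).X n) ⟶ (coneAug v d).X (n + 1)
  | 0 => indLift (M := (coneAug v d).X 0) (N := (coneAug v d).X 1) (lamZero d i x₀)
      (lamZero_R d i x₀) (lamZero_mem d i x₀)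
  | n + 1 => indLift (M := (coneAug v d).X (n + 1)) (N := (coneAug v d).X (n + 2))
      (-extE (κ.opOne n) (κ.opOne_precS n)) (neg_extE_R d κ n) (neg_extE_mem d κ n)

theorem nul_R (n : ℕ) (c : (Zigzag v d)ᵐᵒᵖ) (m : ((coneAug v d).X (n + 1)).carrier) :
    (brk (vertices v d) i ((coneAug v d).X (n + 2)) 1 ∘ₗ extE (κ.opTwo n) (κ.opTwo_precS n))
      (((coneAug v d).X (n + 1)).R c m) =
    (ind (vertices v d) i ((coneAug v d).X (n + 2))).R c
      ((brk (vertices v d) i ((coneAug v d).X (n + 2)) 1 ∘ₗ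
        extE (κ.opTwo n) (κ.opTwo_precS n)) m) := by
  rw [LinearMap.comp_apply, LinearMap.comp_apply, extE_R, brk_R]

theorem nul_mem (hv : v.IsAcyclic) (n : ℕ) (N : ℤ) (m : ((coneAug v d).X (n + 1)).carrier)
    (hm : m ∈ ((coneAug v d).X (n + 1)).gr N) :
    (brk (vertices v d) i ((coneAug v d).X (n + 2)) 1 ∘ₗ extE (κ.opTwo n) (κ.opTwo_precS n)) m ∈
      (ind (vertices v d) i ((coneAug v d).X (n + 2))).gr N := by
  have h := extE_mem (κ.opTwo n) (κ.opTwo_precS n)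
    (fun φ hφ => κ.opTwo_of_lt (by omega) hφ) (κ.opTwo_mem hv n) N m hm
  have h2 := brk_mem (v := vertices v d) (i := i) ((coneAug v d).X (n + 2))
    (SetLike.GradedOne.one_mem (A := gr v d)) h
  rw [zero_add] at h2
  exact h2

/-- The contracting homotopy on the part of `A e_i ⊗ e_i Q` where the left factor of `Q` has degree
at least `2`. -/
def nul (hv : v.IsAcyclic) : ∀ n, ind (vertices v d) i ((coneAug v d).X n) ⟶
    ind (vertices v d) i ((coneAug v d).X (n + 1))
  | 0 => 0
  | n + 1 => indLift (M := (coneAug v d).X (n + 1))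
      (N := ind (vertices v d) i ((coneAug v d).X (n + 2)))
      (brk (vertices v d) i ((coneAug v d).X (n + 2)) 1 ∘ₗ extE (κ.opTwo n) (κ.opTwo_precS n))
      (nul_R d i κ n) (nul_mem d i κ hv n)

theorem nul_brk (hv : v.IsAcyclic) (n : ℕ) (a : Zigzag v d)
    (m : ((coneAug v d).X (n + 1)).carrier) :
    Hom.toLin (nul d i κ hv (n + 1)) (brk (vertices v d) i ((coneAug v d).X (n + 1)) a m) =
      brk (vertices v d) i ((coneAug v d).X (n + 2)) a (extE (κ.opTwo n) (κ.opTwo_precS n)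
        (((coneAug v d).X (n + 1)).L (sA v d (Pi.single i 1)) m)) := by
  refine (indLift_brk (v := vertices v d) (i := i) (M := (coneAug v d).X (n + 1))
      (N := ind (vertices v d) i ((coneAug v d).X (n + 2))) _ (nul_R d i κ n)
      (nul_mem d i κ hv n) a m).trans ?_
  rw [LinearMap.comp_apply, brk_L, mul_one, brk_mul_e, vertices_e]

theorem smulRight_mem (n : ℕ) (x : Module.Dual F (𝒜 n)) (s : Fin r → F) :
    avgS v n (x.smulRight (QDual.ofS v s)) ∈ homS v n 0 :=
  avgS_mem v fun m => Submodule.smul_mem _ (x m) (QDual.ofS_mem v s)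

theorem single_qel (n : ℕ) (x : Module.Dual F (𝒜 n)) (b : Zigzag v d) :
    qel v d n (sA v d (Pi.single i 1)) x b =
      tel v d n (avgS v n (x.smulRight (QDual.ofS v (Pi.single i 1)))) b :=
  qel_ι v d n _ x b

theorem L_single_dL (n : ℕ) (x : Module.Dual F (𝒜 n)) (b : Zigzag v d) :
    ((coneAug v d).X n).L (sA v d (Pi.single i 1))
      (Hom.toLin (dL v d n) (qel v d n (sA v d (Pi.single i 1)) x b)) =
      Hom.toLin (dL v d n) (qel v d n (sA v d (Pi.single i 1)) x b) := by
  rw [← Hom.map_L, qel_L, ← map_mul (sA v d), single_mul_single]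

theorem nul_theta (hv : v.IsAcyclic) (n : ℕ) : theta v d i n ≫ nul d i κ hv n = 0 := by
  rcases n with _ | n
  · exact Limits.comp_zero
  · refine qel_hom_ext v d fun a x b => ?_
    have h := dK_mem v (smulRight_mem (v := v) (n + 1) x (Pi.single i 1))
    have h2 : extE (κ.opTwo n) (κ.opTwo_precS n) (Hom.toLin (dL v d (n + 1))
        (qel v d (n + 1) (sA v d (Pi.single i 1)) x b)) = 0 := by
      rw [single_qel, dL_tel, LinearMap.map_neg, extE_tel _ _ h, κ.opTwo_of_lt (by omega) h,
        LinearMap.map_zero₂, neg_zero]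
    rw [GrBimod.comp_apply, theta_qel, nul_brk, L_single_dL, h2, LinearMap.map_zero]
    rfl

theorem lam_brk_zero (a m : Zigzag v d) :
    Hom.toLin (lam d i κ x₀ 0) (brk (vertices v d) i ((coneAug v d).X 0) a m) =
      qel v d 0 (a * sA v d (Pi.single i 1)) x₀ (sA v d (Pi.single i 1) * m) := by
  refine (indLift_brk (v := vertices v d) (i := i) (M := (coneAug v d).X 0)
      (N := (coneAug v d).X 1) _ (lamZero_R d i x₀) (lamZero_mem d i x₀) a m).trans ?_
  have h : a * (vertices v d).e i * sA v d (Pi.single i 1) = a * sA v d (Pi.single i 1) := by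
    rw [vertices_e, mul_assoc, ← map_mul (sA v d), single_mul_single]
  refine (qel_L v d _ _ _ _).trans ?_
  rw [h]
  exact congrArg (fun y => qel v d 0 (a * sA v d (Pi.single i 1)) x₀ (y * m)) (vertices_e v d i)

theorem lam_brk_succ (n : ℕ) (a : Zigzag v d) (m : ((coneAug v d).X (n + 1)).carrier) :
    Hom.toLin (lam d i κ x₀ (n + 1)) (brk (vertices v d) i ((coneAug v d).X (n + 1)) a m) =
      -((coneAug v d).X (n + 2)).L (a * sA v d (Pi.single i 1)) (extE (κ.opOne n)
        (κ.opOne_precS n) (((coneAug v d).X (n + 1)).L (sA v d (Pi.single i 1)) m)) := by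
  refine (indLift_brk (v := vertices v d) (i := i) (M := (coneAug v d).X (n + 1))
      (N := (coneAug v d).X (n + 2)) _ (neg_extE_R d κ n) (neg_extE_mem d κ n) a m).trans ?_
  rw [vertices_e]
  exact map_neg (((coneAug v d).X (n + 2)).L (a * sA v d (Pi.single i 1))) _

theorem mul_single_mul_single (a : Zigzag v d) :
    a * sA v d (Pi.single i 1) * sA v d (Pi.single i 1) = a * sA v d (Pi.single i 1) := by
  rw [mul_assoc, ← map_mul (sA v d), single_mul_single]

theorem dL_qel_zero (x : Module.Dual F (𝒜 0)) (b : Zigzag v d) :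
    Hom.toLin (dL v d 0) (qel v d 0 (sA v d (Pi.single i 1)) x b) =
      (x (eN v i) • (sA v d (Pi.single i 1) * b) : Zigzag v d) := by
  refine (dL_zero_qel v d _ x b).trans ?_
  have h : ∀ k, x (eN v k) • (sA v d (Pi.single i 1) * sA v d (Pi.single k 1) * b) =
      if k = i then x (eN v i) • (sA v d (Pi.single i 1) * b) else 0 := fun k => by
    rw [single_mul_sA]
    split_ifs with hk
    · rw [hk, Pi.single_eq_same, one_smul]
    · rw [Pi.single_eq_of_ne (Ne.symm hk), zero_smul, zero_mul, smul_zero]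
  exact (Finset.sum_congr rfl fun k _ => h k).trans
    ((Finset.sum_ite_eq' Finset.univ i _).trans (if_pos (Finset.mem_univ i)))

variable {x₀}

theorem comp_rS_single (hS : ∀ m : 𝒜 0, ∃ s, v.hom s = m)
    (hx₀ : ∀ s (m : 𝒜 0), v.hom s = m → x₀ m = s i) (x : Module.Dual F (𝒜 0)) :
    x ∘ₗ rS v 0 (Pi.single i 1) = x (eN v i) • (x₀ ∘ₗ lS v 0 (Pi.single i 1)) := by
  ext m
  obtain ⟨s, hs⟩ := hS m
  have h1 : rS v 0 (Pi.single i 1) m = s i • eN v i := Subtype.ext (by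
    rw [coe_rS, ← hs, ← map_mul, mul_single_eq, map_smul, v.hom_single]; rfl)
  have h2 : x₀ (lS v 0 (Pi.single i 1) m) = s i := by
    rw [hx₀ (Pi.single i 1 * s) _ (by rw [coe_lS, ← hs, map_mul]), Pi.mul_apply, Pi.single_eq_same,
      one_mul]
  rw [LinearMap.comp_apply, h1, LinearMap.smul_apply, LinearMap.comp_apply, h2, map_smul,
    smul_eq_mul, smul_eq_mul, mul_comm]

/-- On the part of the cone at the vertex `i`, the maps `lam` split the maps `theta`. -/
theorem lam_theta (hS : ∀ m : 𝒜 0, ∃ s, v.hom s = m)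
    (hx₀ : ∀ s (m : 𝒜 0), v.hom s = m → x₀ m = s i) (n : ℕ) :
    theta v d i n ≫ lam d i κ x₀ n = mS v d (Pi.single i 1) (n + 1) := by
  rcases n with _ | n
  · refine qel_hom_ext v d fun a x b => ?_
    have h1 : qel v d 0 (a * sA v d (Pi.single i 1)) x b = x (eN v i) •
        qel v d 0 (a * sA v d (Pi.single i 1)) x₀ (sA v d (Pi.single i 1) * b) := by
      have e := qel_left v d 0 (a * sA v d (Pi.single i 1)) (Pi.single i 1) x b
      rw [mul_single_mul_single, comp_rS_single i hS hx₀, LinearMap.map_smul,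
        LinearMap.smul_apply, qel_right] at e
      exact e
    have h2 : sA v d (Pi.single i 1) * (x (eN v i) • (sA v d (Pi.single i 1) * b)) =
        x (eN v i) • (sA v d (Pi.single i 1) * b) := by
      rw [mul_smul_comm, ← mul_assoc, ← map_mul (sA v d), single_mul_single]
    refine Eq.trans ?_ ((mS_qel v d 0 (Pi.single i 1) a x b).trans h1).symm
    rw [GrBimod.comp_apply, theta_qel]
    refine (congrArg (fun y => Hom.toLin (lam d i κ x₀ 0) (brk (vertices v d) i
      ((coneAug v d).X 0) a y)) (dL_qel_zero d i x b)).trans ?_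
    refine (lam_brk_zero d i κ x₀ a (x (eN v i) • (sA v d (Pi.single i 1) * b))).trans ?_
    exact (congrArg (qel v d 0 (a * sA v d (Pi.single i 1)) x₀) h2).trans
      (LinearMap.map_smul (qel v d 0 (a * sA v d (Pi.single i 1)) x₀) _ _)
  · refine qel_hom_ext v d fun a x b => ?_
    have h := smulRight_mem (v := v) (n + 1) x (Pi.single i 1)
    have h1 : extE (κ.opOne n) (κ.opOne_precS n) (Hom.toLin (dL v d (n + 1))
        (qel v d (n + 1) (sA v d (Pi.single i 1)) x b)) =
        -qel v d (n + 1) (sA v d (Pi.single i 1)) x b := by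
      have h2 : κ.opOne n (dK v n (avgS v (n + 1)
          (x.smulRight (QDual.ofS v (Pi.single i 1))))) =
          avgS v (n + 1) (x.smulRight (QDual.ofS v (Pi.single i 1))) := by
        rw [κ.opOne_of_mem (dK_mem v h), κ.h_dK n _ h]
      rw [single_qel, dL_tel]
      refine (LinearMap.map_neg (extE (κ.opOne n) (κ.opOne_precS n)) _).trans ?_
      refine congrArg Neg.neg ((extE_tel _ _ (dK_mem v h) b).trans ?_)
      exact congrArg (fun φ => tel v d (n + 1) φ b) h2
    refine Eq.trans ?_ (mS_qel v d (n + 1) (Pi.single i 1) a x b).symm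
    refine (GrBimod.comp_apply (theta v d i (n + 1)) (lam d i κ x₀ (n + 1)) _).trans ?_
    refine (congrArg (Hom.toLin (lam d i κ x₀ (n + 1))) (theta_qel v d i (n + 1) a x b)).trans ?_
    refine (lam_brk_succ d i κ x₀ n a _).trans ?_
    refine (congrArg (fun y => -((coneAug v d).X (n + 2)).L (a * sA v d (Pi.single i 1))
      (extE (κ.opOne n) (κ.opOne_precS n) y)) (L_single_dL d i (n + 1) x b)).trans ?_
    refine (congrArg (fun y => -((coneAug v d).X (n + 2)).L (a * sA v d (Pi.single i 1)) y)
      h1).trans ?_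
    refine (congrArg Neg.neg (LinearMap.map_neg
      (((coneAug v d).X (n + 2)).L (a * sA v d (Pi.single i 1))) _)).trans ?_
    refine (neg_neg _).trans ?_
    refine (qel_L v d (n := n + 1) _ _ x b).trans ?_
    exact congrArg (fun y => qel v d (n + 1) y x b) (mul_single_mul_single d i a)

theorem theta_zero_surjective (hx₀ : ∀ s (m : 𝒜 0), v.hom s = m → x₀ m = s i)
    (z : (ind (vertices v d) i ((coneAug v d).X 0)).carrier) :
    ∃ t, Hom.toLin (theta v d i 0) (Hom.toLin (mS v d (initS F r (i + 1)) 1) t) = z := by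
  refine ind_induction ((coneAug v d).X 0) (p := fun z => ∃ t, Hom.toLin (theta v d i 0)
    (Hom.toLin (mS v d (initS F r (i + 1)) 1) t) = z) (fun (a : Zigzag v d) (m : Zigzag v d) => ?_)
    ⟨0, by rw [LinearMap.map_zero, LinearMap.map_zero]⟩ (fun x y hx hy => ?_) z
  · refine ⟨qel v d 0 (a * sA v d (Pi.single i 1)) x₀ m, ?_⟩
    have h1 : a * sA v d (Pi.single i 1) * sA v d (initS F r (i + 1)) =
        a * sA v d (Pi.single i 1) := by
      rw [mul_assoc, ← map_mul (sA v d), single_mul_initS_succ]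
    have h2 : x₀ (eN v i) = 1 := by
      rw [hx₀ (Pi.single i 1) _ (v.hom_single i), Pi.single_eq_same]
    rw [mS_qel, h1, theta_qel, brk_mul_single, dL_qel_zero, h2, one_smul]
    exact brk_L_single v d i (n := 0) a m
  · obtain ⟨t, ht⟩ := hx
    obtain ⟨t', ht'⟩ := hy
    exact ⟨t + t', by rw [LinearMap.map_add, LinearMap.map_add, ht, ht']⟩

end Steps

end Zigzag

/-! ### The filtration by path length -/

namespace Zigzag

open GrBimod Twist

section Filtration

variable {F : Type u} [Field F] {L : Type u} [Ring L] [Algebra F L] {𝒜 : ℕ → Submodule F L}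
  [GradedAlgebra 𝒜] {r : ℕ} {v : VertexIdem (zgr 𝒜) r} (d : ℕ)
  [hfin : ∀ n, FiniteDimensional F (𝒜 n)] (i : Fin r)

theorem lmulS_avgS (n : ℕ) (s : Fin r → F) (φ : 𝒜 n →ₗ[F] QDual v) :
    lmulS v n s (avgS v n φ) = avgS v n (lmulS v n s φ) := by
  ext m
  rw [lmulS_apply, avgS_apply, avgS_apply, Finset.mul_sum]
  simp only [lmulS_apply, mul_assoc]

/-- A left `e_i`-invariant map to `Λ^!` of degree `0` comes from a functional. -/
theorem exists_smulRight_eq {n : ℕ} {ψ : 𝒜 n →ₗ[F] QDual v} (hψ : ψ ∈ homS v n 0)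
    (hi : lmulS v n (Pi.single i 1) ψ = ψ) :
    ∃ x : Module.Dual F (𝒜 n), avgS v n (x.smulRight (QDual.ofS v (Pi.single i 1))) = ψ := by
  have h1 : ∀ m, ∃ c : F, ψ m = c • QDual.ofS v (Pi.single i 1) := fun m => by
    have h := hψ.2 m
    rw [QDual.natGr, pow_zero, mul_one] at h
    obtain ⟨s, hs⟩ := h
    refine ⟨s i, ?_⟩
    rw [← hi, lmulS_apply, ← hs]
    refine (map_mul (QDual.ofS v) _ _).symm.trans ?_
    rw [mul_comm, mul_single_eq, map_smul]
  have h2 : ∃ f : Module.Dual F (QDual v), ∀ c : F,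
      f (c • QDual.ofS v (Pi.single i 1)) • QDual.ofS v (Pi.single i 1) =
        c • QDual.ofS v (Pi.single i 1) := by
    by_cases h0 : QDual.ofS v (Pi.single i 1) = 0
    · exact ⟨0, fun c => by rw [h0, smul_zero, smul_zero]⟩
    · obtain ⟨f, hf⟩ := LinearMap.exists_leftInverse_of_injective
        (LinearMap.toSpanSingleton F (QDual v) (QDual.ofS v (Pi.single i 1)))
        (LinearMap.ker_toSpanSingleton F h0)
      refine ⟨f, fun c => ?_⟩
      have h := LinearMap.congr_fun hf c
      rw [LinearMap.comp_apply, LinearMap.toSpanSingleton_apply, LinearMap.id_apply] at h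
      rw [h]
  obtain ⟨f, hf⟩ := h2
  refine ⟨f ∘ₗ ψ, ?_⟩
  have h3 : (f ∘ₗ ψ).smulRight (QDual.ofS v (Pi.single i 1)) = ψ := by
    ext m
    obtain ⟨c, hc⟩ := h1 m
    rw [LinearMap.smulRight_apply, LinearMap.comp_apply, hc, hf]
  rw [h3, avgS_of_mem v hψ]

theorem mul_ofS_initS (hv : v.IsAcyclic) {j : ℕ} {c : QDual v} (hc : c ∈ QDual.natGr v (j + 1))
    (hi : QDual.ofS v (Pi.single i 1) * c = c) : c * QDual.ofS v (initS F r i) = c := by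
  have h : QDual.ofS v (Pi.single i 1) * c * QDual.ofS v (1 - initS F r i) = 0 := by
    refine ofS_mul_mul_ofS_eq_zero _ fun k l hk hl => hv.ofS_mul_mul_ofS (j + 1) ?_ hc
    obtain rfl : k = i := by
      by_contra hne
      exact hk (Pi.single_eq_of_ne hne 1)
    simp only [initS, Pi.sub_apply, Pi.one_apply] at hl
    split_ifs at hl with h
    · exact absurd (sub_self (1 : F)) hl
    · omega
  rw [hi, map_sub, map_one, mul_sub, mul_one, sub_eq_zero] at h
  exact h.symm

theorem comp_lmul_mem {n j : ℕ} {φ : 𝒜 (n + 1) →ₗ[F] QDual v} (hφ : φ ∈ homS v (n + 1) j)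
    (γ : zgr 𝒜 1) : φ ∘ₗ lmul n γ ∈ homS v n j := by
  refine ⟨fun s m => ?_, fun m => hφ.2 _⟩
  rw [LinearMap.comp_apply, LinearMap.comp_apply, ← hφ.1]
  exact congrArg φ (Subtype.ext (by rw [coe_rS, coe_lmul, coe_lmul, coe_rS, mul_assoc]))

attribute [local irreducible] brk indMap ev theta qel dL dR mS tel extE

variable (v)

/-- The span of the elements `a ⊗ c ⊗ x ⊗ b` with `c` in `e_i Λ^!` of degree between `1` and `l`. -/
def lowDeg (n l : ℕ) : Submodule F (ind (vertices v d) i ((coneAug v d).X (n + 1))).carrier :=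
  Submodule.span F {z | ∃ j φ a b, j < l ∧ φ ∈ homS v n (j + 1) ∧
    lmulS v n (Pi.single i 1) φ = φ ∧
      z = brk (vertices v d) i ((coneAug v d).X (n + 1)) a (tel v d n φ b)}

variable {v}

theorem brk_tel_mem_lowDeg {n l j : ℕ} (hj : j < l) {φ : 𝒜 n →ₗ[F] QDual v}
    (hφ : φ ∈ homS v n (j + 1)) (hi : lmulS v n (Pi.single i 1) φ = φ) (a b : Zigzag v d) :
    brk (vertices v d) i ((coneAug v d).X (n + 1)) a (tel v d n φ b) ∈ lowDeg v d i n l :=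
  Submodule.subset_span ⟨j, φ, a, b, hj, hφ, hi, rfl⟩

theorem lowDeg_le {n l : ℕ}
    {U : Submodule F (ind (vertices v d) i ((coneAug v d).X (n + 1))).carrier}
    (h : ∀ j < l, ∀ φ ∈ homS v n (j + 1), lmulS v n (Pi.single i 1) φ = φ → ∀ a b,
      brk (vertices v d) i ((coneAug v d).X (n + 1)) a (tel v d n φ b) ∈ U) :
    lowDeg v d i n l ≤ U := by
  refine Submodule.span_le.2 ?_
  rintro z ⟨j, φ, a, b, hj, hφ, hi, rfl⟩
  exact h j hj φ hφ hi a b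

theorem lowDeg_zero (n : ℕ) : lowDeg v d i n 0 = ⊥ :=
  le_bot_iff.1 (lowDeg_le d i fun j hj => absurd hj (Nat.not_lt_zero j))

theorem mS_tel (hv : v.IsAcyclic) {n j : ℕ} {φ : 𝒜 n →ₗ[F] QDual v} (hφ : φ ∈ homS v n (j + 1))
    (hi : lmulS v n (Pi.single i 1) φ = φ) (b : Zigzag v d) :
    Hom.toLin (mS v d (initS F r i) (n + 1)) (tel v d n φ b) = tel v d n φ b := by
  have h : ∀ m, ι v d (φ m) * sA v d (initS F r i) = ι v d (φ m) := fun m => by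
    rw [sA_apply, ← map_mul, mul_ofS_initS i hv (hφ.2 m)]
    exact LinearMap.congr_fun hi m
  have e : tel v d n φ b = ∑ μ, qel v d n (ι v d (φ (Module.finBasis F (𝒜 n) μ)))
      ((Module.finBasis F (𝒜 n)).coord μ) b := by
    unfold tel qel
    exact tau_apply v d n φ b
  rw [e]
  refine (map_sum (Hom.toLin (mS v d (initS F r i) (n + 1))) _ _).trans ?_
  exact Finset.sum_congr rfl fun μ _ => (mS_qel v d n _ _ _ b).trans
    (congrArg (fun y => qel v d n y ((Module.finBasis F (𝒜 n)).coord μ) b) (h _))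

theorem indMap_lowDeg (hv : v.IsAcyclic) (n l : ℕ)
    (z : (ind (vertices v d) i ((coneAug v d).X (n + 1))).carrier) (hz : z ∈ lowDeg v d i n l) :
    Hom.toLin (indMap (vertices v d) i (mS v d (initS F r i) (n + 1))) z = z := by
  have h : lowDeg v d i n l ≤ LinearMap.eqLocus
      (Hom.toLin (indMap (vertices v d) i (mS v d (initS F r i) (n + 1)))) LinearMap.id := by
    refine lowDeg_le d i fun j _ φ hφ hi a b => ?_
    refine (indMap_brk (mS v d (initS F r i) (n + 1)) a _).trans ?_
    rw [mS_tel d i hv hφ hi]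
    rfl
  exact h hz

variable (κ : KoszulContraction v)

theorem opTwo_lmulS (hv : v.IsAcyclic) {n j : ℕ} {φ : 𝒜 n →ₗ[F] QDual v} (hφ : φ ∈ homS v n j)
    (hi : lmulS v n (Pi.single i 1) φ = φ) :
    lmulS v (n + 1) (Pi.single i 1) (κ.opTwo n φ) = κ.opTwo n φ := by
  rcases Nat.lt_or_ge j 2 with hj | hj
  · rw [κ.opTwo_of_lt hj hφ]
    ext m
    rw [lmulS_apply, LinearMap.zero_apply, mul_zero]
  · obtain ⟨j, rfl⟩ := Nat.exists_eq_add_of_le' hj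
    rw [κ.opTwo_of_mem hv hφ, ← κ.lmulS, hi]

theorem nul_brk_tel (hv : v.IsAcyclic) {n j : ℕ} {φ : 𝒜 n →ₗ[F] QDual v} (hφ : φ ∈ homS v n j)
    (hi : lmulS v n (Pi.single i 1) φ = φ) (a b : Zigzag v d) :
    Hom.toLin (nul d i κ hv (n + 1)) (brk (vertices v d) i ((coneAug v d).X (n + 1)) a
      (tel v d n φ b)) = brk (vertices v d) i ((coneAug v d).X (n + 2)) a
        (tel v d (n + 1) (κ.opTwo n φ) b) := by
  refine (nul_brk d i κ hv n a _).trans ?_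
  refine congrArg (brk (vertices v d) i ((coneAug v d).X (n + 2)) a) ?_
  refine (congrArg (extE (κ.opTwo n) (κ.opTwo_precS n)) ((tel_lmulS v d n _ φ b).trans
    (congrArg (fun y => tel v d n y b) hi))).trans ?_
  exact extE_tel _ _ hφ b

theorem nul_lowDeg (hv : v.IsAcyclic) (n l : ℕ)
    (z : (ind (vertices v d) i ((coneAug v d).X (n + 1))).carrier) (hz : z ∈ lowDeg v d i n l) :
    Hom.toLin (nul d i κ hv (n + 1)) z ∈ lowDeg v d i (n + 1) l := by
  have h : lowDeg v d i n l ≤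
      (lowDeg v d i (n + 1) l).comap (Hom.toLin (nul d i κ hv (n + 1))) := by
    refine lowDeg_le d i fun j hj φ hφ hi a b => ?_
    refine Submodule.mem_comap.2 ?_
    rw [nul_brk_tel d i κ hv hφ hi]
    rcases j with _ | j
    · rw [κ.opTwo_of_lt (by omega) hφ, LinearMap.map_zero₂, LinearMap.map_zero]
      exact zero_mem _
    · exact brk_tel_mem_lowDeg d i (by omega) (κ.opTwo_mem hv n (j + 1) φ hφ)
        (opTwo_lmulS i κ hv hφ hi) a b
  exact h hz

/-- The Koszul differential of an element of degree `0` in `Λ^!` lies in the image of `theta`. -/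
theorem brk_tel_dK {n : ℕ} {ψ : 𝒜 (n + 1) →ₗ[F] QDual v} (hψ : ψ ∈ homS v (n + 1) 0)
    (hi : lmulS v (n + 1) (Pi.single i 1) ψ = ψ) (a b : Zigzag v d) :
    ∃ t, Hom.toLin (theta v d i (n + 1)) (Hom.toLin (mS v d (initS F r (i + 1)) (n + 2)) t) =
      brk (vertices v d) i ((coneAug v d).X (n + 1)) a (tel v d n (dK v n ψ) b) := by
  obtain ⟨x, hx⟩ := exists_smulRight_eq i hψ hi
  refine ⟨-qel v d (n + 1) (a * sA v d (Pi.single i 1)) x b, ?_⟩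
  have h1 : a * sA v d (Pi.single i 1) * sA v d (initS F r (i + 1)) =
      a * sA v d (Pi.single i 1) := by
    rw [mul_assoc, ← map_mul (sA v d), single_mul_initS_succ]
  have h2 : Hom.toLin (dL v d (n + 1)) (qel v d (n + 1) (sA v d (Pi.single i 1)) x b) =
      -tel v d n (dK v n ψ) b := by
    rw [single_qel, dL_tel, hx]
  have h3 : Hom.toLin (theta v d i (n + 1)) (Hom.toLin (mS v d (initS F r (i + 1)) (n + 2))
      (qel v d (n + 1) (a * sA v d (Pi.single i 1)) x b)) =
      -brk (vertices v d) i ((coneAug v d).X (n + 1)) a (tel v d n (dK v n ψ) b) := by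
    rw [mS_qel, h1, theta_qel, brk_mul_single, h2]
    exact LinearMap.map_neg (brk (vertices v d) i ((coneAug v d).X (n + 1)) a) _
  refine (LinearMap.map_neg (Hom.toLin (theta v d i (n + 1)) ∘ₗ
    Hom.toLin (mS v d (initS F r (i + 1)) (n + 2))) _).trans ?_
  exact (congrArg Neg.neg h3).trans (neg_neg _)

theorem lmulS_comp_lmul {n : ℕ} {φ : 𝒜 (n + 1) →ₗ[F] QDual v}
    (hi : lmulS v (n + 1) (Pi.single i 1) φ = φ) (γ : zgr 𝒜 1) :
    lmulS v n (Pi.single i 1) (φ ∘ₗ lmul n γ) = φ ∘ₗ lmul n γ :=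
  LinearMap.ext fun m => LinearMap.congr_fun hi (lmul n γ m)

/-- The value of the differential, up to terms coming from its right part. -/
theorem indMap_d_brk_tel (n : ℕ) (φ : 𝒜 (n + 1) →ₗ[F] QDual v) (a b : Zigzag v d) :
    Hom.toLin (indMap (vertices v d) i ((coneAug v d).d (n + 2) (n + 1)))
      (brk (vertices v d) i ((coneAug v d).X (n + 2)) a (tel v d (n + 1) φ b)) =
    -brk (vertices v d) i ((coneAug v d).X (n + 1)) a (tel v d n (dK v n φ) b) +
      (-1 : ℤ) ^ n • ∑ γ, brk (vertices v d) i ((coneAug v d).X (n + 1)) a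
        (tel v d n (φ ∘ₗ lmul n (basisV (zgr 𝒜) γ)) (zgen v d γ * b)) := by
  refine (indMap_brk ((coneAug v d).d (n + 2) (n + 1)) a _).trans ?_
  have h : Hom.toLin ((coneAug v d).d (n + 2) (n + 1)) (tel v d (n + 1) φ b) =
      -tel v d n (dK v n φ) b + (-1 : ℤ) ^ n • ∑ γ, tel v d n
        (φ ∘ₗ lmul n (basisV (zgr 𝒜) γ)) (zgen v d γ * b) := by
    rw [cone_d v d (n + 1), ← dL_tel, ← dR_tel]
    rfl
  refine (congrArg (brk (vertices v d) i ((coneAug v d).X (n + 1)) a) h).trans ?_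
  refine (LinearMap.map_add (brk (vertices v d) i ((coneAug v d).X (n + 1)) a) _ _).trans ?_
  exact congrArg₂ (· + ·) (LinearMap.map_neg (brk (vertices v d) i ((coneAug v d).X (n + 1)) a) _)
    (map_zsmul_sum (brk (vertices v d) i ((coneAug v d).X (n + 1)) a) _ _)

theorem h_lmulS {n j : ℕ} {φ : 𝒜 n →ₗ[F] QDual v} (hi : lmulS v n (Pi.single i 1) φ = φ) :
    lmulS v (n + 1) (Pi.single i 1) (κ.h n j φ) = κ.h n j φ := by
  rw [← κ.lmulS, hi]

theorem zsmul_sum_brk_tel_mem {n l j : ℕ} (hj : j < l)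
    {φ : Fin (Module.finrank F (zgr 𝒜 1)) → (𝒜 n →ₗ[F] QDual v)}
    (hφ : ∀ γ, φ γ ∈ homS v n (j + 1)) (hi : ∀ γ, lmulS v n (Pi.single i 1) (φ γ) = φ γ) (k : ℤ)
    (a : Zigzag v d) (b : Fin (Module.finrank F (zgr 𝒜 1)) → Zigzag v d) :
    k • ∑ γ, brk (vertices v d) i ((coneAug v d).X (n + 1)) a (tel v d n (φ γ) (b γ)) ∈
      lowDeg v d i n l :=
  zsmul_mem (sum_mem fun γ _ => brk_tel_mem_lowDeg d i hj (hφ γ) (hi γ) a (b γ)) k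

/-- One half of the contraction identity: `z + N (d z)`, for `N` the homotopy operator, is the
Koszul differential of the contraction of `z`, up to terms of smaller degree. -/
theorem add_nul_d (hv : v.IsAcyclic) {l j : ℕ} (hj : j < l + 1) : ∀ (n : ℕ)
    {φ : 𝒜 n →ₗ[F] QDual v} (_ : φ ∈ homS v n (j + 1)) (_ : lmulS v n (Pi.single i 1) φ = φ)
    (a b : Zigzag v d), ∃ g ∈ lowDeg v d i n l,
      brk (vertices v d) i ((coneAug v d).X (n + 1)) a (tel v d n φ b) +
        Hom.toLin (nul d i κ hv n) (Hom.toLin (indMap (vertices v d) i ((coneAug v d).d (n + 1) n))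
          (brk (vertices v d) i ((coneAug v d).X (n + 1)) a (tel v d n φ b))) =
      brk (vertices v d) i ((coneAug v d).X (n + 1)) a (tel v d n (dK v n (κ.h n j φ)) b) + g
  | 0, φ, hφ, hi, a, b => ⟨0, zero_mem _, by rw [κ.dK_zero j φ hφ]; rfl⟩
  | n + 1, φ, hφ, hi, a, b => by
    have hdi : lmulS v n (Pi.single i 1) (dK v n φ) = dK v n φ := by rw [← dK_lmulS, hi]
    have h1 : Hom.toLin (nul d i κ hv (n + 1))
        (Hom.toLin (indMap (vertices v d) i ((coneAug v d).d (n + 2) (n + 1)))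
          (brk (vertices v d) i ((coneAug v d).X (n + 2)) a (tel v d (n + 1) φ b))) =
        -brk (vertices v d) i ((coneAug v d).X (n + 2)) a
          (tel v d (n + 1) (κ.opTwo n (dK v n φ)) b) +
        (-1 : ℤ) ^ n • ∑ γ, brk (vertices v d) i ((coneAug v d).X (n + 2)) a
          (tel v d (n + 1) (κ.opTwo n (φ ∘ₗ lmul n (basisV (zgr 𝒜) γ))) (zgen v d γ * b)) := by
      refine (congrArg (Hom.toLin (nul d i κ hv (n + 1)))
        (indMap_d_brk_tel d i n φ a b)).trans ?_
      refine (LinearMap.map_add (Hom.toLin (nul d i κ hv (n + 1))) _ _).trans ?_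
      refine congrArg₂ (· + ·)
        ((LinearMap.map_neg (Hom.toLin (nul d i κ hv (n + 1))) _).trans
          (congrArg Neg.neg (nul_brk_tel d i κ hv (dK_mem v hφ) hdi a b)))
        ((map_zsmul_sum (Hom.toLin (nul d i κ hv (n + 1))) _ _).trans
          (congrArg (fun y => (-1 : ℤ) ^ n • y) (Finset.sum_congr rfl fun γ _ => ?_)))
      exact nul_brk_tel d i κ hv (comp_lmul_mem hφ _) (lmulS_comp_lmul i hi _) a _
    have h2 : tel v d (n + 1) φ b = tel v d (n + 1) (dK v (n + 1) (κ.h (n + 1) j φ)) b +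
        tel v d (n + 1) (κ.opTwo n (dK v n φ)) b := by
      rw [κ.opTwo_of_mem hv (dK_mem v hφ), ← LinearMap.map_add₂, κ.dK_succ n j φ hφ]
    have h3 := LinearMap.map_add (brk (vertices v d) i ((coneAug v d).X (n + 2)) a)
      (tel v d (n + 1) (dK v (n + 1) (κ.h (n + 1) j φ)) b)
      (tel v d (n + 1) (κ.opTwo n (dK v n φ)) b)
    refine ⟨(-1 : ℤ) ^ n • ∑ γ, brk (vertices v d) i ((coneAug v d).X (n + 2)) a
      (tel v d (n + 1) (κ.opTwo n (φ ∘ₗ lmul n (basisV (zgr 𝒜) γ))) (zgen v d γ * b)), ?_, ?_⟩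
    · rcases j with _ | j
      · refine zsmul_mem (sum_mem fun γ _ => ?_) _
        rw [κ.opTwo_of_lt (by omega) (comp_lmul_mem hφ _), LinearMap.map_zero₂, LinearMap.map_zero]
        exact zero_mem _
      · exact zsmul_sum_brk_tel_mem d i (by omega)
          (fun γ => κ.opTwo_mem hv n (j + 1) _ (comp_lmul_mem hφ _))
          (fun γ => opTwo_lmulS i κ hv (comp_lmul_mem hφ _) (lmulS_comp_lmul i hi _)) _ a _
    · rw [h1]
      refine (add_assoc _ _ _).symm.trans ?_
      refine congrArg (· + _) ?_
      refine (congrArg (· + _) ((congrArg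
        (brk (vertices v d) i ((coneAug v d).X (n + 2)) a) h2).trans h3)).trans ?_
      exact add_neg_cancel_right _ _

/-- The other half of the contraction identity: `d (N z)`, for `N` the homotopy operator, cancels
the Koszul differential of the contraction of `z`, up to terms of smaller degree and, if `z` has
degree `1`, for which `N z = 0`, up to the image of `theta`. -/
theorem d_nul_add (hv : v.IsAcyclic) {l j : ℕ} (hj : j < l + 1) {n : ℕ}
    {φ : 𝒜 n →ₗ[F] QDual v} (hφ : φ ∈ homS v n (j + 1)) (hi : lmulS v n (Pi.single i 1) φ = φ)
    (a b : Zigzag v d) : ∃ g ∈ lowDeg v d i n l, ∃ t,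
      Hom.toLin (indMap (vertices v d) i ((coneAug v d).d (n + 2) (n + 1)))
        (Hom.toLin (nul d i κ hv (n + 1)) (brk (vertices v d) i ((coneAug v d).X (n + 1)) a
          (tel v d n φ b))) +
        brk (vertices v d) i ((coneAug v d).X (n + 1)) a (tel v d n (dK v n (κ.h n j φ)) b) =
      g + Hom.toLin (theta v d i (n + 1))
        (Hom.toLin (mS v d (initS F r (i + 1)) (n + 2)) t) := by
  rw [nul_brk_tel d i κ hv hφ hi]
  rcases j with _ | j
  · obtain ⟨t, ht⟩ := brk_tel_dK d i (κ.mem n 0 φ hφ) (h_lmulS i κ hi) a b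
    refine ⟨0, zero_mem _, t, ?_⟩
    rw [ht, κ.opTwo_of_lt (by omega) hφ, LinearMap.map_zero₂, LinearMap.map_zero]
    exact congrArg (· + _) (LinearMap.map_zero _)
  · rw [κ.opTwo_of_mem hv hφ]
    refine ⟨_, zsmul_sum_brk_tel_mem d i (j := j) (by omega)
      (fun γ => comp_lmul_mem (κ.mem n (j + 1) φ hφ) (basisV (zgr 𝒜) γ))
      (fun γ => lmulS_comp_lmul i (h_lmulS i κ hi) _) ((-1) ^ n) a
      (fun γ => zgen v d γ * b), 0, ?_⟩
    refine (congrArg (· + _) (indMap_d_brk_tel d i n _ a b)).trans ?_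
    refine (neg_add_cancel_comm _ _).trans ?_
    refine ((congrArg (_ + ·) ?_).trans (add_zero _)).symm
    exact LinearMap.map_zero (Hom.toLin (theta v d i (n + 1)) ∘ₗ
      Hom.toLin (mS v d (initS F r (i + 1)) (n + 2)))

/-- Up to elements of smaller degree and elements in the image of `theta`, the map `nul` is a
contracting homotopy. -/
theorem lowDeg_succ (hv : v.IsAcyclic) (n l : ℕ)
    (z : (ind (vertices v d) i ((coneAug v d).X (n + 1))).carrier)
    (hz : z ∈ lowDeg v d i n (l + 1)) : ∃ g ∈ lowDeg v d i n l, ∃ t,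
      z + Hom.toLin (indMap (vertices v d) i ((coneAug v d).d (n + 2) (n + 1)))
        (Hom.toLin (nul d i κ hv (n + 1)) z) +
        Hom.toLin (nul d i κ hv n)
          (Hom.toLin (indMap (vertices v d) i ((coneAug v d).d (n + 1) n)) z) =
      g + Hom.toLin (theta v d i (n + 1))
        (Hom.toLin (mS v d (initS F r (i + 1)) (n + 2)) t) := by
  have h : lowDeg v d i n (l + 1) ≤ (lowDeg v d i n l ⊔ LinearMap.range
      (Hom.toLin (theta v d i (n + 1)) ∘ₗ Hom.toLin (mS v d (initS F r (i + 1)) (n + 2)))).comap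
      (LinearMap.id + Hom.toLin (indMap (vertices v d) i ((coneAug v d).d (n + 2) (n + 1))) ∘ₗ
        Hom.toLin (nul d i κ hv (n + 1)) + Hom.toLin (nul d i κ hv n) ∘ₗ
          Hom.toLin (indMap (vertices v d) i ((coneAug v d).d (n + 1) n))) := by
    refine lowDeg_le d i fun j hj φ hφ hi a b => ?_
    obtain ⟨g, hg, e⟩ := add_nul_d d i κ hv hj n hφ hi a b
    obtain ⟨g', hg', t, e'⟩ := d_nul_add d i κ hv hj hφ hi a b
    refine Submodule.mem_comap.2 (Submodule.mem_sup.2 ⟨g + g', add_mem hg hg', _, ⟨t, rfl⟩, ?_⟩)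
    refine Eq.trans ?_ (((add_right_comm _ _ _).trans (congrArg (· + _) e)).trans
      ((add_right_comm _ _ _).trans ((congrArg (· + g)
        ((add_comm _ _).trans e')).trans (add_comm _ g)))).symm
    exact add_assoc _ _ _
  obtain ⟨g, hg, y, ⟨t, ht⟩, e⟩ := Submodule.mem_sup.1 (Submodule.mem_comap.1 (h hz))
  exact ⟨g, hg, t, e.symm.trans (congrArg (g + ·) ht.symm)⟩

theorem brk_qel_ι_mem_lowDeg {n j : ℕ} (hj : j < r) {c : QDual v}
    (hc : c ∈ QDual.natGr v (j + 1)) (hi : QDual.ofS v (Pi.single i 1) * c = c) (a : Zigzag v d)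
    (x : Module.Dual F (𝒜 n)) (b : Zigzag v d) :
    brk (vertices v d) i ((coneAug v d).X (n + 1)) a (qel v d n (ι v d c) x b) ∈
      lowDeg v d i n r := by
  rw [qel_ι]
  refine brk_tel_mem_lowDeg d i hj (avgS_mem v fun m => Submodule.smul_mem _ _ hc) ?_ a b
  rw [lmulS_avgS]
  congr 1
  ext m
  rw [lmulS_apply, LinearMap.smulRight_apply, mul_smul_comm, hi]

/-- The part `e_i Λ^! f` of `Λ^!`, with `f` the sum of the idempotents before `e_i`, is contained in
positive degrees. -/
theorem single_mul_mul_initS_mem (hv : v.IsAcyclic)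
    {U : Submodule F (QDual v)} (hU : ∀ j < r, ∀ c ∈ QDual.natGr v (j + 1),
      QDual.ofS v (Pi.single i 1) * c = c → c ∈ U) (c : QDual v) :
    QDual.ofS v (Pi.single i 1) * c * QDual.ofS v (initS F r i) ∈ U := by
  refine homogeneous_induction (DirectSum.Decomposition.isInternal (QDual.gr v))
    (P := fun c => QDual.ofS v (Pi.single i 1) * c * QDual.ofS v (initS F r i) ∈ U)
    (fun k c hc => ?_) ?_ (fun c c' h h' => ?_) c
  · rcases k with j | j
    · change c ∈ QDual.natGr v j at hc
      have hc' : QDual.ofS v (Pi.single i 1) * c * QDual.ofS v (initS F r i) ∈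
          QDual.natGr v j := natGr_mul_ofS v (natGr_ofS_mul v hc _) _
      rcases j with _ | j
      · rw [QDual.natGr, pow_zero, mul_one] at hc
        obtain ⟨s, rfl⟩ := hc
        have h0 : QDual.ofS v (Pi.single i 1) * QDual.ofS v s * QDual.ofS v (initS F r i) = 0 := by
          rw [← map_mul, ← map_mul, mul_right_comm, single_mul_initS, zero_mul, map_zero]
        exact h0 ▸ zero_mem U
      · rcases Nat.lt_or_ge j r with hj | hj
        · refine hU j hj _ hc' ?_
          rw [← mul_assoc, ← mul_assoc, ← map_mul, single_mul_single]
        · rw [hv.eq_zero_of_mem (by omega) hc']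
          exact zero_mem _
    · rw [(Submodule.mem_bot F).1 hc, mul_zero, zero_mul]
      exact zero_mem _
  · rw [mul_zero, zero_mul]
    exact zero_mem _
  · rw [mul_add, add_mul]
    exact add_mem h h'

/-- The filtration exhausts `A e_i ⊗ e_i C_i`, as `Λ^!` vanishes in degrees at least `r`. -/
theorem indMap_mem_lowDeg (hv : v.IsAcyclic) (n : ℕ)
    (z : (ind (vertices v d) i ((coneAug v d).X (n + 1))).carrier) :
    Hom.toLin (indMap (vertices v d) i (mS v d (initS F r i) (n + 1))) z ∈ lowDeg v d i n r := by
  have h1 : ∀ (c : QDual v) (a : Zigzag v d) (x : Module.Dual F (𝒜 n)) (b : Zigzag v d),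
      brk (vertices v d) i ((coneAug v d).X (n + 1)) a (qel v d n (ι v d
        (QDual.ofS v (Pi.single i 1) * c * QDual.ofS v (initS F r i))) x b) ∈ lowDeg v d i n r :=
    fun c a x b => single_mul_mul_initS_mem i hv
      (U := (lowDeg v d i n r).comap (brk (vertices v d) i ((coneAug v d).X (n + 1)) a ∘ₗ
        (((qel v d n).flip x).flip b) ∘ₗ (ι v d).toLinearMap))
      (fun j hj c hc hi => brk_qel_ι_mem_lowDeg d i hj hc hi a x b) c
  refine ind_induction ((coneAug v d).X (n + 1))
    (p := fun z => Hom.toLin (indMap (vertices v d) i (mS v d (initS F r i) (n + 1))) z ∈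
      lowDeg v d i n r) (fun a m => ?_) ?_ (fun x y hx hy => ?_) z
  · rw [indMap_brk]
    refine qel_induction v d (n := n) (p := fun m => brk (vertices v d) i
      ((coneAug v d).X (n + 1)) a (Hom.toLin (mS v d (initS F r i) (n + 1)) m) ∈ lowDeg v d i n r)
      (fun a' x b => ?_) ?_ (fun m m' hm hm' => ?_) m
    · rw [mS_qel, ← brk_L_single, qel_L, ← mul_assoc, single_mul_initS_eq_inl d hv]
      exact h1 (pr v d a') a x b
    · rw [LinearMap.map_zero, LinearMap.map_zero]
      exact zero_mem _
    · rw [LinearMap.map_add, LinearMap.map_add]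
      exact add_mem hm hm'
  · rw [LinearMap.map_zero]
    exact zero_mem _
  · rw [LinearMap.map_add]
    exact add_mem hx hy

end Filtration

end Zigzag

/-! ### The subcomplexes of the cone -/

namespace GrBimod

section ImageComplexIso

variable {F : Type u} [Field F] {A B : Type u} [Ring A] [Algebra F A] [Ring B] [Algebra F B]
  {𝒜 : ℤ → Submodule F A} {ℬ : ℤ → Submodule F B}

theorem nonempty_homotopyEquiv_imageComplex_of_eq_id (C : ChainComplex (GrBimod 𝒜 ℬ) ℕ)
    (π : ∀ n, C.X n ⟶ C.X n) (hπ) (hd) (h : ∀ n, π n = 𝟙 (C.X n)) :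
    Nonempty (HomotopyEquiv (imageComplex C π hπ hd) C) := by
  refine ⟨HomotopyEquiv.ofIso (HomologicalComplex.Hom.isoOfComponents (fun n =>
    { hom := incl (π n)
      inv := proj (π n)
      hom_inv_id := incl_proj (hπ n)
      inv_hom_id := h n }) ?_)⟩
  rintro _ n rfl
  change incl (π (n + 1)) ≫ C.d (n + 1) n = (imageComplex C π hπ hd).d (n + 1) n ≫ incl (π n)
  refine Eq.trans ?_ (congrArg (fun f : image (π (n + 1)) ⟶ image (π n) => f ≫ incl (π n))
    (imageComplex_d C π hπ hd n)).symm
  rw [Category.assoc, Category.assoc, proj_incl, h n, Category.comp_id]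

theorem nonempty_homotopyEquiv_imageComplex_of_eq_zero (C : ChainComplex (GrBimod 𝒜 ℬ) ℕ)
    (π : ∀ n, C.X n ⟶ C.X n) (hπ) (hd) (h0 : π 0 = 𝟙 (C.X 0)) (h : ∀ n, π (n + 1) = 0) :
    Nonempty (HomotopyEquiv (imageComplex C π hπ hd) (single (C.X 0))) := by
  have hz : ∀ n, 𝟙 (image (π (n + 1))) = 0 := fun n => by
    rw [← incl_proj (hπ (n + 1)), ← incl_comp (hπ (n + 1)), h n, Limits.comp_zero,
      Limits.zero_comp]
  let f : ∀ n, image (π n) ≅ singleX (C.X 0) n := fun n => match n with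
    | 0 =>
      { hom := incl (π 0)
        inv := proj (π 0)
        hom_inv_id := incl_proj (hπ 0)
        inv_hom_id := h0 }
    | n + 1 =>
      { hom := 0
        inv := 0
        hom_inv_id := Limits.zero_comp.trans (hz n).symm
        inv_hom_id := rfl }
  refine ⟨HomotopyEquiv.ofIso (HomologicalComplex.Hom.isoOfComponents f ?_)⟩
  rintro _ n rfl
  have hzero : ∀ {P : GrBimod 𝒜 ℬ} (g : image (π (n + 1)) ⟶ P), g = 0 := fun g => by
    rw [← Category.id_comp g, hz, Limits.zero_comp]
  exact (hzero _).trans (hzero _).symm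

end ImageComplexIso

end GrBimod

theorem foldl_induction {α : Type*} {p : ℕ → α → Prop} : ∀ {r : ℕ} (f : α → Fin r → α) (x : α),
    p 0 x → (∀ (i : Fin r) y, p i y → p (i + 1) (f y i)) → p r (Fin.foldl r f x)
  | 0, f, x, h0, _ => by rwa [Fin.foldl_zero]
  | r + 1, f, x, h0, hs => by
    rw [Fin.foldl_succ_last]
    exact hs (Fin.last r) _ (foldl_induction _ x h0 fun i y hy => hs i.castSucc y hy)

section DegreeZero

variable {F : Type u} [Field F] {L : Type u} [Ring L] [Algebra F L] {𝒜 : ℕ → Submodule F L}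
  [GradedAlgebra 𝒜] {r : ℕ} (v : VertexIdem (zgr 𝒜) r)

/-- The inclusion of `S` in the degree zero part. -/
def homZero : (Fin r → F) →ₗ[F] 𝒜 0 :=
  v.hom.toLinearMap.codRestrict (𝒜 0) (VertexIdem.hom_mem_nat v)

variable {v}

theorem homZero_surjective (hS : ∀ m : 𝒜 0, ∃ s, v.hom s = m) : Function.Surjective (homZero v) :=
  fun m => (hS m).imp fun _ hs => Subtype.ext hs

/-- The coordinate of a vertex on `Λ_0 = S`. -/
theorem exists_coord (hS : ∀ m : 𝒜 0, ∃ s, v.hom s = m) (hinj : Function.Injective v.hom)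
    (i : Fin r) : ∃ x₀ : Module.Dual F (𝒜 0), ∀ s (m : 𝒜 0), v.hom s = m → x₀ m = s i := by
  let e := LinearEquiv.ofBijective (homZero v)
    ⟨fun _ _ h => hinj (congrArg Subtype.val h), homZero_surjective hS⟩
  refine ⟨LinearMap.proj i ∘ₗ e.symm.toLinearMap, fun s m hm => ?_⟩
  have h : m = e s := Subtype.ext hm.symm
  rw [h, LinearMap.comp_apply, LinearEquiv.coe_coe, LinearEquiv.symm_apply_apply]
  rfl

theorem IsKoszul.finiteDimensional [FiniteDimensional F (𝒜 1)] (hK : IsKoszul 𝒜)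
    (hS : ∀ m : 𝒜 0, ∃ s, v.hom s = m) : ∀ n, FiniteDimensional F (𝒜 n)
  | 0 => Module.Finite.of_surjective (homZero v) (homZero_surjective hS)
  | 1 => inferInstance
  | n + 2 => by
    rw [← hK.generated (n + 2) (by omega)]
    exact Module.Finite.iff_fg.2 ((Module.Finite.iff_fg.1 inferInstance : (𝒜 1).FG).pow (n + 2))

end DegreeZero

namespace Zigzag

open GrBimod Twist

section InitComplex

variable {F : Type u} [Field F] {L : Type u} [Ring L] [Algebra F L] {𝒜 : ℕ → Submodule F L}
  [GradedAlgebra 𝒜] {r : ℕ} {v : VertexIdem (zgr 𝒜) r} (d : ℕ)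
  [hfin : ∀ n, FiniteDimensional F (𝒜 n)]

attribute [local irreducible] brk indMap ev theta qel dL dR mS tel extE lam nul

theorem mS_idem (s n : ℕ) : mS v d (initS F r s) n ≫ mS v d (initS F r s) n =
    mS v d (initS F r s) n := by
  rw [mS_comp, initS_mul_self]

/-- The subcomplex of the cone with terms `A f ⊗_S Λ_n^* ⊗_S A`, where `f` is the sum of the first
`s` vertices, and `A` in degree `0`. -/
def initComplex (hv : v.IsAcyclic) (s : ℕ) : ChainComplex (GrBimod (gr v d) (gr v d)) ℕ :=
  imageComplex (coneAug v d) (mS v d (initS F r s)) (mS_idem d s) fun n => mS_initS_d d hv n s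

theorem mS_init_zero (s : Fin r → F) : mS v d s 0 = 𝟙 ((coneAug v d).X 0) := by
  unfold mS
  rfl

theorem nonempty_initComplex_zero (hv : v.IsAcyclic) :
    Nonempty (HomotopyEquiv (initComplex d hv 0) (single (regular (gr v d)))) := by
  have h : initS F r 0 = 0 := by
    ext k
    exact if_neg (Nat.not_lt_zero _)
  exact nonempty_homotopyEquiv_imageComplex_of_eq_zero (coneAug v d) _ _ _ (mS_init_zero d _)
    fun n => by rw [h, mS_zero]

theorem nonempty_initComplex_last (hv : v.IsAcyclic) :
    Nonempty (HomotopyEquiv (initComplex d hv r) (coneAug v d)) := by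
  have h : initS F r r = 1 := by
    ext k
    exact if_pos k.2
  exact nonempty_homotopyEquiv_imageComplex_of_eq_id (coneAug v d) _ _ _
    fun n => by rw [h, mS_one]

theorem init_inv (hv : v.IsAcyclic) (κ : KoszulContraction v) {i : Fin r}
    {x₀ : Module.Dual F (𝒜 0)} (hS : ∀ m : 𝒜 0, ∃ s, v.hom s = m)
    (hx₀ : ∀ s (m : 𝒜 0), v.hom s = m → x₀ m = s i) (n : ℕ) :
    mS v d (initS F r (i + 1)) (n + 1) ≫ (mS v d (initS F r i) (n + 1) +
      theta v d i n ≫ indMap (vertices v d) i (mS v d (initS F r i) n) ≫ lam d i κ x₀ n) ≫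
        mS v d (initS F r (i + 1)) (n + 1) = mS v d (initS F r (i + 1)) (n + 1) := by
  have h : theta v d i n ≫ indMap (vertices v d) i (mS v d (initS F r i) n) ≫ lam d i κ x₀ n =
      mS v d (Pi.single i 1) (n + 1) := by
    rw [← Category.assoc, theta_indMap d i hv, lam_theta d i κ hS hx₀]
  rw [h, ← mS_succ, mS_idem, mS_idem]

theorem theta_nul (hv : v.IsAcyclic) (κ : KoszulContraction v) (i : Fin r) (n : ℕ) :
    mS v d (initS F r (i + 1)) (n + 1) ≫ theta v d i n ≫
      indMap (vertices v d) i (mS v d (initS F r i) n) ≫ nul d i κ hv n ≫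
        indMap (vertices v d) i (mS v d (initS F r i) (n + 1)) = 0 := by
  rw [← Category.assoc (theta v d i n), theta_indMap d i hv, ← Category.assoc (theta v d i n),
    nul_theta, Limits.zero_comp, Limits.comp_zero]

/-- Adding a vertex to the subcomplex amounts to tensoring with the twist at this vertex. -/
theorem nonempty_initComplex_succ (hv : v.IsAcyclic) (κ : KoszulContraction v) (i : Fin r)
    (hS : ∀ m : 𝒜 0, ∃ s, v.hom s = m) (hinj : Function.Injective v.hom) :
    Nonempty (HomotopyEquiv (initComplex d hv (i + 1)) (tw (vertices v d) i
      (initComplex d hv i))) := by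
  obtain ⟨x₀, hx₀⟩ := exists_coord hS hinj i
  have hid : indMap (vertices v d) i (mS v d (initS F r i) 0) = 𝟙 _ := by
    rw [mS_init_zero]
    exact ind_hom_ext fun a m => indMap_brk (𝟙 ((coneAug v d).X 0)) a m
  exact nonempty_homotopyEquiv_image (vertices v d) i (coneAug v d) (mS v d (initS F r i))
    (mS v d (initS F r (i + 1))) _ _ _ _
    (fun n => by rw [mS_comp, initS_mul_succ]) (theta v d i) (lam d i κ x₀) (nul d i κ hv)
    (mS_theta v d i) (theta_chain v d i) (theta_d d i hv)
    ((mS_init_zero d _).trans (mS_init_zero d _).symm)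
    (init_inv d hv κ hS hx₀) (theta_nul d hv κ i)
    (fun z => by
      rw [hid]
      exact theta_zero_surjective d i hx₀ z)
    (lowDeg v d i) r (lowDeg_zero d i) (indMap_mem_lowDeg d i hv) (indMap_lowDeg d i hv)
    (fun n l z hz => indMap_lowDeg d i hv (n + 1) l _ (nul_lowDeg d i κ hv n l z hz))
    (lowDeg_succ d i κ hv)

end InitComplex

end Zigzag

end HigherZigzag

end

theorem proposition4p28 {F : Type u} [Field F] {Λ : Type u} [Ring Λ] [Algebra F Λ]
    (𝒜 : ℕ → Submodule F Λ) [GradedAlgebra 𝒜] [FiniteDimensional F (𝒜 1)]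
    (hK : IsKoszul 𝒜) {r : ℕ} (v : VertexIdem (zgr 𝒜) r) (hv : v.IsAcyclic)
    (d : ℕ) (hd : GldimLE Λ d) :
    Nonempty (HomotopyEquiv (twistProduct (Zigzag.vertices v d)) (Zigzag.coneAug v d)) := by
  have hS : ∀ m : 𝒜 0, ∃ s, v.hom s = (m : Λ) := fun m => hv.exists_hom_eq hK.semisimple m.2
  have := hK.finiteDimensional hS
  obtain ⟨R⟩ := hK.resolution
  obtain ⟨κ⟩ := R.nonempty_koszulContraction v (fun x hx => hS ⟨x, hx⟩) hv.hom_injective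
  obtain ⟨e⟩ : Nonempty (HomotopyEquiv (twistProduct (Zigzag.vertices v d))
      (Zigzag.initComplex d hv r)) := by
    refine foldl_induction (p := fun s Y => Nonempty (HomotopyEquiv Y (Zigzag.initComplex d hv s)))
      _ _ ?_ fun i Y hY => ?_
    · obtain ⟨e⟩ := Zigzag.nonempty_initComplex_zero d hv
      exact ⟨e.symm⟩
    · obtain ⟨e⟩ := hY
      obtain ⟨e'⟩ := Zigzag.nonempty_initComplex_succ d hv κ i hS hv.hom_injective
      exact ⟨(GrBimod.tensorComplexHomotopyEquiv (twist (Zigzag.vertices v d) i) e).trans e'.symm⟩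
  obtain ⟨e'⟩ := Zigzag.nonempty_initComplex_last d hv
  exact ⟨e.trans e'⟩
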